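/- Let $m>3$ and let $V_0\in C^\infty(\mathbb R^3;\mathbb R)$ satisfy $V_0(x)=|x|^{-m}v_0(x/|x|)$ for $|x|>1$. Let $(-\Delta)^{1/2}$ be the operator on $L^2(\mathbb R^3)$ with domain $H^1(\mathbb R^3)$, let $R_0(z)=((-\Delta)^{1/2}-z)^{-1}$, and for $\lambda>0$ let $R_0^+(\lambda)g=\lim_{\mu\to0+}R_0(\lambda+i\mu)g$, the limit being taken in $H^{1,-s}(\mathbb R^3)=\{u\in\mathscr S'(\mathbb R^3):\langle x\rangle^{-s}\langle D\rangle u\in L^2(\mathbb R^3)\}$ for every $s>1/2$. Write $\hat V_0(\xi)=\int_{\mathbb R^3}e^{-ix\cdot\xi}V_0(x)\,dx$ and $$f_0(\lambda,\theta,w)=(2\pi)^{-1}\lambda\,\hat V_0(\lambda(\theta-w)),\qquad \lambda>0,\ \theta,w\in\mathbb S^2 .$$ (a) For all $\lambda>0$ and $w\in\mathbb S^2$, the distribution $w_0=R_0^+(\lambda)(V_0e^{i\lambda x\cdot w})$ exists, is unique, and $$w_0(x)=|x|^{-1}e^{i\lambda|x|}f_0(\lambda,x/|x|,w)+h(x)\quad\text{with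 } h\in L^2(\mathbb R^3).$$ (b) $f_0$ is smooth on $\{(\lambda,\theta,w)\in(0,\infty)\times\mathbb S^2\times\mathbb S^2:\theta\ne w\}$. (c) For all $\lambda>0$ and $\theta\in\mathbb S^2$, the function $w\mapsto f_0(\lambda,\theta,w)$ belongs to $H^\kappa(\mathbb S^2)$ for every real $\kappa<m-2$. (d) Let $\lambda>0$, $\theta\in\mathbb S^2$. If the X-ray transform $XV_0(x,\theta)=\int_{\mathbb R}V_0(x+t\theta)\,dt$ is not identically zero on $\{x\in\mathbb R^3: x\cdot\theta=0,\ |x|>1\}$, then $w\mapsto f_0(\lambda,\theta,w)$ does not belong to $H^{m-2}(\mathbb S^2)$. -/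

import Mathlib

open MeasureTheory Filter Topology
open scoped SchwartzMap FourierTransform Manifold ContDiff

noncomputable section

/-- Euclidean space `ℝ³`. -/
abbrev E3 := EuclideanSpace ℝ (Fin 3)

/-- The plane `ℝ²`, model space of the charts of the sphere. -/
abbrev E2 := EuclideanSpace ℝ (Fin 2)

/-- The unit sphere `𝕊² ⊂ ℝ³`. -/
abbrev S2 := Metric.sphere (0 : E3) 1

/-- The Hilbert space `L²(ℝ³; ℂ)`. -/
abbrev L2R3 := Lp ℂ 2 (volume : Measure E3)

/-- The tempered distribution `T` is (integration against) the function `F`. -/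
def IsRepresentedBy {n : ℕ} (T : 𝓢'(EuclideanSpace ℝ (Fin n), ℂ))
    (F : EuclideanSpace ℝ (Fin n) → ℂ) : Prop :=
  ∀ φ : 𝓢(EuclideanSpace ℝ (Fin n), ℂ),
    Integrable (fun x => φ x * F x) ∧ T φ = ∫ x, φ x * F x

/-! ### The free Hamiltonian and its outgoing resolvent -/

/-- `v = H₀ u` for `H₀ = (-Δ)^{1/2}` as an operator on `L²(ℝ³)` with domain `H¹(ℝ³)`: multiplication
by `|ξ|` on the Fourier side. Mathlib's Fourier transform has the phase `e^{-2πi x·ξ}`, so that the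
symbol is `2π|ξ|`. The domain is `{u ∈ L² : |ξ| û ∈ L²}` because `v` is required to be in `L²`. -/
def IsHalfLaplacian (u v : L2R3) : Prop :=
  ∀ᵐ ξ : E3, (𝓕 v : L2R3) ξ = ((2 * Real.pi * ‖ξ‖ : ℝ) : ℂ) * (𝓕 u : L2R3) ξ

/-- `u = R₀(z) g = (H₀ - z)⁻¹ g`, that is, `H₀ u = g + z u`. -/
def IsFreeResolvent (z : ℂ) (g u : L2R3) : Prop :=
  IsHalfLaplacian u (g + z • u)

/-- The symbol of `⟨D⟩^k = (1 - Δ)^{k/2}` in Mathlib's normalization of the Fourier transform. -/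
def japaneseSymbol (k : ℝ) (ξ : E3) : ℂ :=
  (((1 + ‖(2 * Real.pi) • ξ‖ ^ 2) ^ (k / 2) : ℝ) : ℂ)

/-- The weight `⟨x⟩^s = (1 + |x|²)^{s/2}`. -/
def japaneseWeight (s : ℝ) (x : E3) : ℂ :=
  (((1 + ‖x‖ ^ 2) ^ (s / 2) : ℝ) : ℂ)

theorem japaneseWeight_hasTemperateGrowth (s : ℝ) :
    (japaneseWeight s).HasTemperateGrowth := by
  unfold japaneseWeight
  fun_prop

theorem japaneseSymbol_hasTemperateGrowth (k : ℝ) :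
    (japaneseSymbol k).HasTemperateGrowth := by
  have h : japaneseSymbol k =
      japaneseWeight k ∘ ((2 * Real.pi) • ContinuousLinearMap.id ℝ E3) := by
    funext ξ
    simp [japaneseSymbol, japaneseWeight]
  rw [h]
  exact (japaneseWeight_hasTemperateGrowth k).comp
    (ContinuousLinearMap.hasTemperateGrowth _)

/-- `⟨x⟩^s ⟨D⟩^k T = h` with `h ∈ L²(ℝ³)`; thus `T` is in the weighted Sobolev space `H^{k,s}(ℝ³)`
and its norm there is `‖h‖`. -/
def IsWeightedSobolevRep (k s : ℝ) (T : 𝓢'(E3, ℂ)) (h : L2R3) : Prop :=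
  TemperedDistribution.smulLeftCLM ℂ (japaneseWeight s)
    (TemperedDistribution.fourierMultiplierCLM ℂ (japaneseSymbol k) T) =
      Lp.toTemperedDistribution h

/-- `w = R₀⁺(λ) g`: the function `g` is in `L²(ℝ³)`, and `R₀(λ + iμ) g → w` in `H^{1,-s}(ℝ³)`
as `μ → 0+`, for every `s > 1/2`. -/
def IsOutgoingResolvent (lam : ℝ) (g : E3 → ℂ) (w : 𝓢'(E3, ℂ)) : Prop :=
  ∃ G : L2R3, G =ᵐ[volume] g ∧
    ∃ u : ℝ → L2R3,
      (∀ μ : ℝ, 0 < μ → IsFreeResolvent ((lam : ℂ) + (μ : ℂ) * Complex.I) G (u μ)) ∧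
      ∀ s : ℝ, 1 / 2 < s →
        ∃ h : ℝ → L2R3,
          (∀ μ : ℝ, 0 < μ →
            IsWeightedSobolevRep 1 (-s) (Lp.toTemperedDistribution (u μ) - w) (h μ)) ∧
          Tendsto (fun μ => ‖h μ‖) (𝓝[>] 0) (𝓝 0)

/-! ### The leading amplitude and the X-ray transform -/

/-- The plane wave `Φ₀(x; w, λ) = e^{iλ x·w}`. -/
def planeWave (lam : ℝ) (w x : E3) : ℂ :=
  Complex.exp (Complex.I * ((lam * inner ℝ x w : ℝ) : ℂ))

/-- `V̂(ξ) = ∫ e^{-i x·ξ} V(x) dx`. -/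
def potentialFourier (V : E3 → ℝ) (ξ : E3) : ℂ :=
  ∫ x : E3, Complex.exp (-Complex.I * ((inner ℝ x ξ : ℝ) : ℂ)) * (V x : ℂ)

/-- `f₀(λ, θ, w) = (2π)⁻¹ λ V̂(λ(θ - w))`. -/
def leadingAmplitude (V : E3 → ℝ) (lam : ℝ) (θ w : E3) : ℂ :=
  ((lam / (2 * Real.pi) : ℝ) : ℂ) * potentialFourier V (lam • (θ - w))

/-- The X-ray transform `X V(x, θ) = ∫ V(x + tθ) dt`. -/
def xrayTransform (V : E3 → ℝ) (x θ : E3) : ℝ :=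
  ∫ t : ℝ, V (x + t • θ)

/-! ### Sobolev spaces on the sphere -/

/-- The function `f` on `𝕊²` belongs to `H^κ(𝕊²)`: in every smooth chart and for every smooth cutoff
compactly supported in the range of the chart, the localized function, extended by zero to `ℝ²`,
is in `H^κ(ℝ²)`. -/
def MemSobolevSphere (κ : ℝ) (f : S2 → ℂ) : Prop :=
  ∀ e ∈ IsManifold.maximalAtlas (𝓡 2) ∞ S2,
    ∀ χ : E2 → ℂ, ContDiff ℝ ∞ χ → HasCompactSupport χ → tsupport χ ⊆ e.target →
      ∃ T : 𝓢'(E2, ℂ), IsRepresentedBy T (fun y => χ y * f (e.symm y)) ∧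
        TemperedDistribution.MemSobolev κ 2 T

end

/-!
# Outgoing waves and the leading amplitude of potentials homogeneous at infinity

Write `q = 2^{3-m} < 1`. Everything about the amplitude rests on a dyadic decomposition of the
potential, `V = W + ∑ⱼ 2^{-jm} U(2^{-j} ·)` with `W`, `U` smooth and compactly supported
(`exists_dyadic_decomposition`). On the Fourier side it reads `V̂ = Ŵ + ∑ⱼ qʲ Û(2ʲ ·)`.

*Smoothness off the diagonal.* Away from the origin the dilates `Û(2ʲ ·)` have derivatives bounded
uniformly in `j`, so that `V̂` is smooth there (`contDiffAt_fourier_of_dyadic`).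

*Sobolev regularity.* In a chart of the sphere, `w ↦ Û(2ʲ λ(θ - w))` is a profile concentrated at
scale `2^{-j}` around one point of a two-dimensional manifold. Its norm in `H^κ` is of order
`(2ʲ)^{κ-1}`, and the dyadic series converges when `3 - m + κ - 1 < 0`, that is, for `κ < m - 2`
(`exists_memSobolev_of_dyadic`, `memSobolevSphere_leadingAmplitude`).

*Failure at the endpoint.* Near `w = θ`, test the amplitude against functions of scale `1/t` with
frequencies of size `t`. By the change of variables `x ↦ t x` and the homogeneity of `V`, `t^{m-1}`
times the pairing converges to an integral of the X-ray transform of `V` in the direction `θ` against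
an arbitrary bump function on the plane orthogonal to `θ`, supported in `|x| > 1`
(`tendsto_integral_dilated_potential`, `integral_mul_comp_adjoint`). For an element of `H^{m-2}` the
same quantity tends to zero, because only the high frequencies of the element are seen
(`tendsto_pairing_of_memSobolev`).

*Limiting absorption.* By `1/(ρ - z) = 2z/(ρ² - z²) + 1/(ρ + z)` the resolvent of `(-Δ)^{1/2}` is the
convolution with the Helmholtz kernel `(z/2π) e^{iz|x|}/|x|` plus a multiplier that is regular at
`z = λ`. For `z → λ` the kernels converge boundedly by `|x|⁻¹`, and dominated convergence gives
convergence in the weighted spaces. Derivatives cost nothing since `(⟨D⟩ - ⟨λ⟩) R₀(z)` is a multiplier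
bounded by `1` (`isOutgoingResolvent_outgoingWave`, `IsOutgoingResolvent.unique`).

*Asymptotics.* It remains to compare `e^{iλ|x|}/|x| * g`, where `g = V e^{iλ x·w}`, with its far field
(`memLp_waveRemainder`). By the dyadic decomposition it is enough to show that for wave packets
`U(y/Y) e^{iλ y·w}` the difference has `L²` norm `O(Y³)`, since the `j`-th term has the coefficient
`(q/8)ʲ`. In the ball of radius of order `Y²` the wave and its far field are estimated separately, by
Plancherel's theorem for the truncated kernel: the transform of the packet lives at distance `1/Y`
from `λw`, hence on a cap of area `Y⁻²` of the sphere (`exists_lintegral_ball_kernelConv_le`). Outside,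
the radial equation `k'' + 2iλk' = -s⁻¹ e^{-iλs} Λ(e^{iλ|x-y|}/|x-y|)`, with `Λ` the spherical
Laplacian, expresses the difference by an outgoing wave with source `Λg`, since `Λ` is
symmetric and commutes with rotation invariant kernels. As `Λg` is again a sum of wave packets, with
coefficients `O(Y²)`, Hardy's inequality concludes (`enorm_waveRemainder_le`,
`exists_lintegral_waveRemainder_wavePacket_le`).
-/

noncomputable section

/-! ### Dyadic decomposition of a homogeneous potential -/

/-- Homogeneity of degree `-m` outside the unit ball. -/
theorem potential_smul_eq {m : ℝ} {V v : E3 → ℝ}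
    (hhom : ∀ x : E3, 1 < ‖x‖ → V x = ‖x‖ ^ (-m) * v (‖x‖⁻¹ • x))
    {x : E3} (hx : 1 < ‖x‖) {t : ℝ} (ht : 1 ≤ t) : V (t • x) = t ^ (-m) * V x := by
  have ht0 : 0 < t := by linarith
  have hx0 : 0 < ‖x‖ := by linarith
  have hn : ‖t • x‖ = t * ‖x‖ := by rw [norm_smul, Real.norm_of_nonneg ht0.le]
  rw [hhom x hx, hhom (t • x) (by rw [hn]; nlinarith), hn,
    Real.mul_rpow ht0.le hx0.le, smul_smul]
  have : (t * ‖x‖)⁻¹ * t = ‖x‖⁻¹ := by field_simp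
  rw [this, mul_assoc]

theorem exists_potential_bound {m : ℝ} (hm : 0 < m) {V v : E3 → ℝ} (hV : Continuous V)
    (hhom : ∀ x : E3, 1 < ‖x‖ → V x = ‖x‖ ^ (-m) * v (‖x‖⁻¹ • x)) :
    ∃ C : ℝ, 0 ≤ C ∧ ∀ x, |V x| ≤ C * (1 + ‖x‖) ^ (-m) := by
  obtain ⟨M, hM⟩ := (isCompact_closedBall (0 : E3) 2).exists_bound_of_continuousOn hV.continuousOn
  have hM0 : 0 ≤ M := (norm_nonneg _).trans (hM 0 (by simp))
  refine ⟨M * 4 ^ m, by positivity, fun x => ?_⟩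
  have hx0 := norm_nonneg x
  rcases le_or_gt ‖x‖ 2 with hx | hx
  · have h1 : |V x| ≤ M := by simpa using hM x (by simpa using hx)
    have h2 : (4 : ℝ) ^ (-m) ≤ (1 + ‖x‖) ^ (-m) :=
      Real.rpow_le_rpow_of_nonpos (by positivity) (by linarith) (by linarith)
    have h3 : (4 : ℝ) ^ m * 4 ^ (-m) = 1 := by
      rw [← Real.rpow_add (by norm_num)]; simp
    calc |V x| ≤ M * (4 ^ m * 4 ^ (-m)) := by rw [h3, mul_one]; exact h1
      _ ≤ M * (4 ^ m * (1 + ‖x‖) ^ (-m)) := by gcongr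
      _ = _ := by ring
  · set y : E3 := (2 / ‖x‖) • x with hy
    have hyn : ‖y‖ = 2 := by
      rw [hy, norm_smul, Real.norm_of_nonneg (by positivity)]; field_simp
    have hxy : x = (‖x‖ / 2) • y := by
      rw [hy, smul_smul]
      have : ‖x‖ / 2 * (2 / ‖x‖) = 1 := by field_simp
      rw [this, one_smul]
    have h1 : |V y| ≤ M := by simpa using hM y (by simp [hyn])
    have h2 : V x = (‖x‖ / 2) ^ (-m) * V y := by
      conv_lhs => rw [hxy]
      exact potential_smul_eq hhom (by rw [hyn]; norm_num) (by linarith)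
    have h3 : (‖x‖ / 2) ^ (-m) ≤ 4 ^ m * (1 + ‖x‖) ^ (-m) := by
      have e : (‖x‖ / 2) ^ (-m) = 4 ^ m * (2 * ‖x‖) ^ (-m) := by
        rw [show ‖x‖ / 2 = (4 : ℝ)⁻¹ * (2 * ‖x‖) by ring, Real.mul_rpow (by norm_num) (by positivity),
          Real.inv_rpow (by norm_num), Real.rpow_neg (by norm_num), inv_inv]
      rw [e]
      exact mul_le_mul_of_nonneg_left (Real.rpow_le_rpow_of_nonpos (by positivity) (by linarith)
        (by linarith)) (by positivity)
    rw [h2, abs_mul, abs_of_nonneg (by positivity)]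
    calc _ ≤ (4 ^ m * (1 + ‖x‖) ^ (-m)) * M := by gcongr
      _ = _ := by ring

theorem integrable_potential {m : ℝ} (hm : 3 < m) {V v : E3 → ℝ} (hV : Continuous V)
    (hhom : ∀ x : E3, 1 < ‖x‖ → V x = ‖x‖ ^ (-m) * v (‖x‖⁻¹ • x)) :
    Integrable V := by
  obtain ⟨C, -, hC⟩ := exists_potential_bound (by linarith) hV hhom
  have h := (integrable_one_add_norm (E := E3) (μ := volume) (r := m) (by simpa using hm)).const_mul C
  exact h.mono' hV.aestronglyMeasurable (.of_forall fun x => by simpa using hC x)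

/-- The ratio `2^{3-m}` by which the `L¹` norms of the dyadic pieces of the potential decay. -/
def dyadicRatio (m : ℝ) : ℝ := (2 : ℝ) ^ (3 - m)

theorem dyadicRatio_pos (m : ℝ) : 0 < dyadicRatio m := by unfold dyadicRatio; positivity

theorem dyadicRatio_lt_one {m : ℝ} (hm : 3 < m) : dyadicRatio m < 1 :=
  Real.rpow_lt_one_of_one_lt_of_neg (by norm_num) (by linarith)

theorem dyadicRatio_div_eight_pow (m : ℝ) (j : ℕ) :
    (dyadicRatio m / 8) ^ j = ((2 : ℝ) ^ j) ^ (-m) := by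
  have h : dyadicRatio m / 8 = (2 : ℝ) ^ (-m) := by
    unfold dyadicRatio
    rw [Real.rpow_sub (by norm_num), Real.rpow_neg (by norm_num)]
    norm_num
    ring
  rw [h, ← Real.rpow_natCast, ← Real.rpow_natCast, ← Real.rpow_mul (by norm_num),
    ← Real.rpow_mul (by norm_num), mul_comm]

/-- A smooth potential which is homogeneous of degree `-m` outside the unit ball is the sum of a
test function and of the rescalings `2^{-jm} U(2^{-j}x)` of a single test function `U`. -/
theorem exists_dyadic_decomposition {m : ℝ} {V v : E3 → ℝ} (hV : ContDiff ℝ ∞ V)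
    (hhom : ∀ x : E3, 1 < ‖x‖ → V x = ‖x‖ ^ (-m) * v (‖x‖⁻¹ • x)) :
    ∃ W U : 𝓢(E3, ℂ), HasCompactSupport W ∧ HasCompactSupport U ∧ ∀ x, HasSum
      (fun j : ℕ => (((dyadicRatio m / 8) ^ j : ℝ) : ℂ) * U (((2 : ℝ) ^ j)⁻¹ • x))
      ((V x : ℂ) - W x) := by
  -- The sum telescopes: with a bump `χ` equal to `1` on the ball of radius `2`, the pieces are `V
  -- (χ(2⁻¹ x) - χ(x))` and its dilates, and `W = V χ`. The annulus where `U` lives lies in `|x| ≥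
  -- 2`, where `V` is homogeneous.
  let χ : ContDiffBump (0 : E3) := ⟨2, 3, by norm_num, by norm_num⟩
  have hVc : ContDiff ℝ ∞ (fun x => (V x : ℂ)) := Complex.ofRealCLM.contDiff.comp hV
  have hχs : ContDiff ℝ ∞ (fun x => (χ x : ℂ)) := Complex.ofRealCLM.contDiff.comp χ.contDiff
  have hχ1 : ∀ x : E3, ‖x‖ ≤ 2 → χ x = 1 := fun x hx =>
    χ.one_of_mem_closedBall (by simpa [χ] using hx)
  have hχ0 : ∀ x : E3, 3 ≤ ‖x‖ → χ x = 0 := fun x hx =>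
    χ.zero_of_le_dist (by simpa [χ] using hx)
  have hWc : HasCompactSupport (fun x => (V x : ℂ) * (χ x : ℂ)) :=
    HasCompactSupport.intro (isCompact_closedBall (0 : E3) 3) fun x hx => by
      rw [hχ0 x (by simpa using (not_le.1 (by simpa using hx)).le)]; simp
  have hUc : HasCompactSupport
      (fun x => (V x : ℂ) * ((χ ((2 : ℝ)⁻¹ • x) : ℂ) - (χ x : ℂ))) :=
    HasCompactSupport.intro (isCompact_closedBall (0 : E3) 6) fun x hx => by
      have h6 : 6 < ‖x‖ := by simpa using hx
      rw [hχ0 x (by linarith), hχ0 ((2 : ℝ)⁻¹ • x)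
        (by rw [norm_smul]; norm_num; linarith)]; simp
  have hWs : ContDiff ℝ ∞ (fun x => (V x : ℂ) * (χ x : ℂ)) := hVc.mul hχs
  have hUs : ContDiff ℝ ∞ (fun x => (V x : ℂ) * ((χ ((2 : ℝ)⁻¹ • x) : ℂ) - (χ x : ℂ))) :=
    hVc.mul ((hχs.comp (contDiff_id.const_smul _)).sub hχs)
  refine ⟨hWc.toSchwartzMap hWs, hUc.toSchwartzMap hUs, hWc, hUc, fun x => ?_⟩
  have hterm : ∀ j : ℕ, (((dyadicRatio m / 8) ^ j : ℝ) : ℂ) *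
      ((V (((2 : ℝ) ^ j)⁻¹ • x) : ℂ) * ((χ ((2 : ℝ)⁻¹ • ((2 : ℝ) ^ j)⁻¹ • x) : ℂ)
        - (χ (((2 : ℝ) ^ j)⁻¹ • x) : ℂ))) =
      (V x : ℂ) * (χ (((2 : ℝ) ^ (j + 1))⁻¹ • x) : ℂ)
        - (V x : ℂ) * (χ (((2 : ℝ) ^ j)⁻¹ • x) : ℂ) := by
    intro j
    have e : (2 : ℝ)⁻¹ • ((2 : ℝ) ^ j)⁻¹ • x = ((2 : ℝ) ^ (j + 1))⁻¹ • x := by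
      rw [smul_smul, pow_succ, mul_inv, mul_comm]
    rw [e]
    set y := ((2 : ℝ) ^ j)⁻¹ • x with hy
    have hxy : x = (2 : ℝ) ^ j • y := by rw [hy, smul_inv_smul₀ (by positivity)]
    rcases le_or_gt ‖y‖ 2 with h | h
    · have h' : ‖((2 : ℝ) ^ (j + 1))⁻¹ • x‖ ≤ 2 := by
        rw [← e, norm_smul]; norm_num; linarith [norm_nonneg y]
      rw [hχ1 y h, hχ1 _ h']; simp
    · have : V x = (dyadicRatio m / 8) ^ j * V y := by
        conv_lhs => rw [hxy]
        rw [potential_smul_eq hhom (by linarith) (one_le_pow₀ (by norm_num)),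
          dyadicRatio_div_eight_pow]
      rw [this]; push_cast; ring
  -- For a fixed `x` the series is a finite sum.
  obtain ⟨J, hJ⟩ := pow_unbounded_of_one_lt ‖x‖ (by norm_num : (1 : ℝ) < 2)
  have hbig : ∀ j, J ≤ j → χ (((2 : ℝ) ^ j)⁻¹ • x) = 1 := by
    intro j hj
    apply hχ1
    rw [norm_smul, norm_inv, Real.norm_of_nonneg (by positivity), inv_mul_le_iff₀ (by positivity)]
    have : (2 : ℝ) ^ J ≤ 2 ^ j := pow_le_pow_right₀ (by norm_num) hj
    nlinarith [norm_nonneg x]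
  have hs := hasSum_sum_of_ne_finset_zero (L := SummationFilter.unconditional ℕ)
    (s := Finset.range J)
    (f := fun j : ℕ => (V x : ℂ) * (χ (((2 : ℝ) ^ (j + 1))⁻¹ • x) : ℂ)
        - (V x : ℂ) * (χ (((2 : ℝ) ^ j)⁻¹ • x) : ℂ)) (fun j hj => by
      have hj' : J ≤ j := by simpa using hj
      rw [hbig j hj', hbig (j + 1) (by omega)]; simp)
  rw [Finset.sum_range_sub (fun j : ℕ => (V x : ℂ) * (χ (((2 : ℝ) ^ j)⁻¹ • x) : ℂ)),
    hbig J le_rfl] at hs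
  convert hs using 1
  · funext j; exact hterm j
  · simp

theorem fourier_comp_inv_smul {n : ℕ} (f : EuclideanSpace ℝ (Fin n) → ℂ) {a : ℝ} (ha : 0 < a)
    (ξ : EuclideanSpace ℝ (Fin n)) :
    𝓕 (fun x => f (a⁻¹ • x)) ξ = (a : ℂ) ^ n * 𝓕 f (a • ξ) := by
  rw [Real.fourier_eq, Real.fourier_eq]
  have h := Measure.integral_comp_inv_smul (volume : Measure (EuclideanSpace ℝ (Fin n)))
    (fun x => Real.fourierChar (-inner ℝ x (a • ξ)) • f x) a
  have e : ∀ x : EuclideanSpace ℝ (Fin n), inner ℝ (a⁻¹ • x) (a • ξ) = inner ℝ x ξ := by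
    intro x
    rw [real_inner_smul_left, real_inner_smul_right, inv_mul_cancel_left₀ ha.ne']
  simp only [e] at h
  rw [h]
  simp [abs_of_pos ha]

theorem integral_norm_comp_inv_smul {n : ℕ} (f : EuclideanSpace ℝ (Fin n) → ℂ) {a : ℝ}
    (ha : 0 < a) : ∫ x, ‖f (a⁻¹ • x)‖ = a ^ n * ∫ x, ‖f x‖ := by
  rw [Measure.integral_comp_inv_smul volume (fun x => ‖f x‖)]
  simp [abs_of_pos ha]

/-- Termwise integration of a dyadic decomposition against a bounded function. -/
theorem hasSum_integral_dyadic {m : ℝ} (hm : 3 < m) {F : E3 → ℂ} {U : 𝓢(E3, ℂ)}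
    (hF : ∀ x, HasSum
      (fun j : ℕ => (((dyadicRatio m / 8) ^ j : ℝ) : ℂ) * U (((2 : ℝ) ^ j)⁻¹ • x)) (F x))
    {b : E3 → ℂ} (hb : AEStronglyMeasurable b) {B : ℝ} (hB : ∀ x, ‖b x‖ ≤ B) :
    HasSum (fun j : ℕ => (((dyadicRatio m / 8) ^ j : ℝ) : ℂ) *
      ∫ x, b x * U (((2 : ℝ) ^ j)⁻¹ • x)) (∫ x, b x * F x) := by
  have hq := dyadicRatio_pos m
  have hint : ∀ j : ℕ, Integrable (fun x : E3 => U (((2 : ℝ) ^ j)⁻¹ • x)) := fun j =>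
    U.integrable.comp_smul (by positivity)
  have hint2 : ∀ j : ℕ, Integrable (fun x : E3 =>
      b x * ((((dyadicRatio m / 8) ^ j : ℝ) : ℂ) * U (((2 : ℝ) ^ j)⁻¹ • x))) := fun j =>
    ((hint j).const_mul _).bdd_mul hb (.of_forall hB)
  have hnorm : ∀ j : ℕ, ∫ x : E3, ‖b x * ((((dyadicRatio m / 8) ^ j : ℝ) : ℂ) *
      U (((2 : ℝ) ^ j)⁻¹ • x))‖ ≤ (B * ∫ x, ‖U x‖) * dyadicRatio m ^ j := by
    intro j
    calc _ ≤ ∫ x : E3, B * (((dyadicRatio m / 8) ^ j) * ‖U (((2 : ℝ) ^ j)⁻¹ • x)‖) := by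
          refine integral_mono (hint2 j).norm (((hint j).norm.const_mul _).const_mul _) fun x => ?_
          simp only [norm_mul, Complex.norm_real, Real.norm_of_nonneg (by positivity :
            0 ≤ (dyadicRatio m / 8) ^ j)]
          gcongr
          exact hB x
      _ = _ := by
          rw [integral_const_mul, integral_const_mul, integral_norm_comp_inv_smul _ (by positivity)]
          have : (dyadicRatio m / 8) ^ j * ((2 : ℝ) ^ j) ^ 3 = dyadicRatio m ^ j := by
            rw [div_pow, ← pow_mul, mul_comm j 3, pow_mul]; norm_num
          rw [← this]; ring
  have h := hasSum_integral_of_summable_integral_norm hint2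
    (Summable.of_nonneg_of_le (fun j => integral_nonneg fun x => norm_nonneg _) hnorm
      ((summable_geometric_of_lt_one hq.le (dyadicRatio_lt_one hm)).mul_left _))
  have e1 : (fun j : ℕ => (((dyadicRatio m / 8) ^ j : ℝ) : ℂ) *
      ∫ x, b x * U (((2 : ℝ) ^ j)⁻¹ • x)) = fun j : ℕ => ∫ x : E3,
      b x * ((((dyadicRatio m / 8) ^ j : ℝ) : ℂ) * U (((2 : ℝ) ^ j)⁻¹ • x)) := by
    funext j
    rw [← integral_const_mul]
    congr 1; funext x; ring
  have e2 : ∀ x : E3, b x * F x = ∑' j : ℕ,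
      b x * ((((dyadicRatio m / 8) ^ j : ℝ) : ℂ) * U (((2 : ℝ) ^ j)⁻¹ • x)) := fun x => by
    rw [tsum_mul_left, (hF x).tsum_eq]
  rw [e1]
  simp only [e2]
  exact h

/-- The dyadic series on the Fourier side. The factor `8^j` from the change of variables turns the
coefficients `2^{-jm}` into `2^{j(3-m)}`. -/
theorem hasSum_fourier_dyadic {m : ℝ} (hm : 3 < m) {F : E3 → ℂ} {U : 𝓢(E3, ℂ)}
    (hF : ∀ x, HasSum
      (fun j : ℕ => (((dyadicRatio m / 8) ^ j : ℝ) : ℂ) * U (((2 : ℝ) ^ j)⁻¹ • x)) (F x))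
    (ξ : E3) :
    HasSum (fun j : ℕ => ((dyadicRatio m ^ j : ℝ) : ℂ) * 𝓕 U ((2 : ℝ) ^ j • ξ)) (𝓕 F ξ) := by
  have h := hasSum_integral_dyadic hm hF
    (b := fun x => Complex.exp (((-2 * Real.pi * inner ℝ x ξ : ℝ) : ℂ) * Complex.I))
    (by fun_prop) (B := 1) (fun x => by rw [Complex.norm_exp_ofReal_mul_I])
  rw [Real.fourier_eq']
  simp only [smul_eq_mul]
  have e : (fun j : ℕ => ((dyadicRatio m ^ j : ℝ) : ℂ) * 𝓕 U ((2 : ℝ) ^ j • ξ)) =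
      fun j : ℕ => (((dyadicRatio m / 8) ^ j : ℝ) : ℂ) *
      ∫ x, Complex.exp (((-2 * Real.pi * inner ℝ x ξ : ℝ) : ℂ) * Complex.I) *
        U (((2 : ℝ) ^ j)⁻¹ • x) := by
    funext j
    have := fourier_comp_inv_smul U (a := 2 ^ j) (by positivity) ξ
    rw [Real.fourier_eq'] at this
    simp only [smul_eq_mul] at this
    rw [this, SchwartzMap.fourier_coe, ← mul_assoc]
    congr 1
    push_cast
    rw [div_pow, ← pow_mul, mul_comm j 3, pow_mul]; norm_num
  rw [e]
  exact h

theorem potentialFourier_eq_fourier (V : E3 → ℝ) (ξ : E3) :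
    potentialFourier V ξ = 𝓕 (fun x => (V x : ℂ)) ((2 * Real.pi)⁻¹ • ξ) := by
  rw [potentialFourier, Real.fourier_eq']
  congr 1; funext x
  rw [smul_eq_mul, real_inner_smul_right]
  congr 2
  push_cast
  field_simp

/-! ### Smoothness of the amplitude off the diagonal -/

theorem norm_iteratedFDeriv_comp_smul_le {n : ℕ} (K : 𝓢(EuclideanSpace ℝ (Fin n), ℂ)) (a : ℝ)
    (i : ℕ) (x : EuclideanSpace ℝ (Fin n)) :
    ‖iteratedFDeriv ℝ i (fun y => K (a • y)) x‖ ≤ |a| ^ i * ‖iteratedFDeriv ℝ i K (a • x)‖ := by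
  have h := iteratedFDeriv_comp_const_smul (𝕜 := ℝ) (f := K) (i := i) a
    ((K.smooth ⊤).of_le (by exact_mod_cast le_top))
  rw [h]
  simp [norm_smul]

/-- A smooth function with bounded derivatives that vanishes near the origin and equals `1` outside
the ball of radius `2c`. -/
theorem exists_cutoff_away {c : ℝ} (hc : 0 < c) : ∃ χ : E3 → ℂ, ContDiff ℝ ∞ χ ∧
    (∀ x, ‖x‖ < c → χ x = 0) ∧ (∀ x, 2 * c < ‖x‖ → χ x = 1) ∧
    ∀ i : ℕ, ∃ M : ℝ, 0 ≤ M ∧ ∀ x, ‖iteratedFDeriv ℝ i χ x‖ ≤ M := by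
  obtain ⟨β, hin, hout⟩ : ∃ β : ContDiffBump (0 : E3), β.rIn = c ∧ β.rOut = 2 * c :=
    ⟨⟨c, 2 * c, hc, by linarith⟩, rfl, rfl⟩
  have hβs : ContDiff ℝ ∞ (fun x => (β x : ℂ)) := Complex.ofRealCLM.contDiff.comp β.contDiff
  have hβc : HasCompactSupport (fun x => (β x : ℂ)) := 
    β.hasCompactSupport.comp_left (g := fun r : ℝ => (r : ℂ)) (by simp)
  refine ⟨fun x => 1 - (β x : ℂ), contDiff_const.sub hβs, fun x hx => ?_, fun x hx => ?_,
    fun i => ?_⟩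
  · simp only
    rw [β.one_of_mem_closedBall (by simpa [hin] using hx.le)]; simp
  · simp only
    rw [β.zero_of_le_dist (by simpa [hout] using hx.le)]; simp
  · obtain ⟨M, hM0, hM⟩ := (hβc.toSchwartzMap hβs).decay 0 i
    refine ⟨1 + M, by positivity, fun x => ?_⟩
    have hM' : ‖iteratedFDeriv ℝ i (fun x => (β x : ℂ)) x‖ ≤ M := by
      have := hM x
      rw [pow_zero, one_mul] at this
      exact this
    have hs : iteratedFDeriv ℝ i (fun x => 1 - (β x : ℂ)) x =
        iteratedFDeriv ℝ i (fun _ : E3 => (1 : ℂ)) x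
        - iteratedFDeriv ℝ i (fun x => (β x : ℂ)) x :=
      fun_iteratedFDeriv_sub_apply (f := fun _ : E3 => (1 : ℂ)) contDiff_const.contDiffAt
        (hβs.of_le (by exact_mod_cast le_top)).contDiffAt
    rw [hs]
    refine (norm_sub_le _ _).trans (add_le_add ?_ hM')
    rcases i with _ | i
    · simp
    · rw [iteratedFDeriv_const_of_ne (by simp)]; simp

/-- Away from the origin, the derivatives of the dilates of a Schwartz function are bounded
uniformly in the dilation: the factor `a^i` is absorbed by the decay at `a x`. -/
theorem exists_bound_iteratedFDeriv_comp_smul {c : ℝ} (hc : 0 < c) (K : 𝓢(E3, ℂ)) (i : ℕ) :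
    ∃ D : ℝ, 0 ≤ D ∧ ∀ (a : ℝ) (x : E3), 0 < a → c ≤ ‖x‖ →
      ‖iteratedFDeriv ℝ i (fun y => K (a • y)) x‖ ≤ D := by
  obtain ⟨D, hD0, hD⟩ := K.decay i i
  refine ⟨c⁻¹ ^ i * D, by positivity, fun a x ha hx => ?_⟩
  refine (norm_iteratedFDeriv_comp_smul_le K _ i x).trans ?_
  have h1 := hD (a • x)
  rw [norm_smul, Real.norm_of_nonneg ha.le, mul_pow] at h1
  rw [abs_of_pos ha, inv_pow, inv_mul_eq_div, le_div_iff₀ (by positivity)]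
  have h2 : c ^ i ≤ ‖x‖ ^ i := pow_le_pow_left₀ (by positivity) hx i
  have h3 : 0 ≤ a ^ i * ‖iteratedFDeriv ℝ i K (a • x)‖ := by positivity
  nlinarith

theorem contDiff_tsum_cutoff_dyadic {q : ℝ} (hq : 0 < q) (hq1 : q < 1) {c : ℝ} (hc : 0 < c)
    (K : 𝓢(E3, ℂ)) {χ : E3 → ℂ} (hχs : ContDiff ℝ ∞ χ) (hχ0 : ∀ x, ‖x‖ < c → χ x = 0)
    (hχb : ∀ i : ℕ, ∃ M : ℝ, 0 ≤ M ∧ ∀ x, ‖iteratedFDeriv ℝ i χ x‖ ≤ M) :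
    ContDiff ℝ ∞ (fun η : E3 => ∑' j : ℕ, (q ^ j : ℝ) • (χ η * K ((2 : ℝ) ^ j • η))) := by
  choose M hM0 hM using hχb
  choose D hD0 hD using exists_bound_iteratedFDeriv_comp_smul hc K
  have hKs : ∀ j : ℕ, ContDiff ℝ ∞ (fun y : E3 => K ((2 : ℝ) ^ j • y)) := fun j =>
    (K.smooth ⊤).comp (contDiff_id.const_smul _)
  have hf : ∀ j : ℕ, ContDiff ℝ ∞ (fun η : E3 => χ η * K ((2 : ℝ) ^ j • η)) := fun j =>
    hχs.mul (hKs j)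
  have hb : ∀ (k j : ℕ) (x : E3), ‖iteratedFDeriv ℝ k (fun η : E3 => χ η * K ((2 : ℝ) ^ j • η)) x‖ ≤
      ∑ i ∈ Finset.range (k + 1), (k.choose i) * M i * D (k - i) := by
    intro k j x
    rcases lt_or_ge ‖x‖ c with hx | hx
    · have hev : (fun η : E3 => χ η * K ((2 : ℝ) ^ j • η)) =ᶠ[𝓝 x] fun _ => 0 := by
        filter_upwards [(isOpen_lt continuous_norm continuous_const).mem_nhds hx] with y hy
        rw [hχ0 y hy, zero_mul]
      rw [(hev.iteratedFDeriv ℝ k).eq_of_nhds]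
      have : iteratedFDeriv ℝ k (fun _ : E3 => (0 : ℂ)) x = 0 := by
        simp [show (fun _ : E3 => (0 : ℂ)) = 0 from rfl]
      rw [this, norm_zero]
      exact Finset.sum_nonneg fun i _ => by have := hM0 i; have := hD0 (k - i); positivity
    · refine (norm_iteratedFDeriv_mul_le (n := k) (N := k) (hχs.of_le (by exact_mod_cast le_top))
        ((hKs j).of_le (by exact_mod_cast le_top)) x le_rfl).trans ?_
      refine Finset.sum_le_sum fun i _ => ?_
      have := hM0 i
      gcongr
      · exact hM i x
      · exact hD (k - i) _ x (by positivity) hx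
  refine contDiff_tsum (N := ⊤) (v := fun k j => q ^ j *
    ∑ i ∈ Finset.range (k + 1), (k.choose i) * M i * D (k - i)) (fun j => ?_) (fun k _ => ?_)
    (fun k j x _ => ?_)
  · exact (hf j).const_smul (q ^ j)
  · exact (summable_geometric_of_lt_one hq.le hq1).mul_right _
  · have hsm : ContDiff ℝ k (fun η : E3 => χ η * K ((2 : ℝ) ^ j • η)) :=
      (hf j).of_le (by exact_mod_cast le_top)
    rw [iteratedFDeriv_const_smul_apply' (a := q ^ j) hsm.contDiffAt, norm_smul,
      Real.norm_of_nonneg (by positivity)]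
    exact mul_le_mul_of_nonneg_left (hb k j x) (by positivity)

/-- The Fourier transform of the potential is smooth away from the origin: near `η₀ ≠ 0` the terms
of its dyadic series and all their derivatives decay geometrically. -/
theorem contDiffAt_fourier_of_dyadic {m : ℝ} (hm : 3 < m) {W U : 𝓢(E3, ℂ)} {F : E3 → ℂ}
    (hF : ∀ x, HasSum
      (fun j : ℕ => (((dyadicRatio m / 8) ^ j : ℝ) : ℂ) * U (((2 : ℝ) ^ j)⁻¹ • x)) (F x - W x))
    (hFi : Integrable F) {η₀ : E3} (hη : η₀ ≠ 0) : ContDiffAt ℝ ∞ (𝓕 F) η₀ := by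
  have hη0 : 0 < ‖η₀‖ := norm_pos_iff.2 hη
  obtain ⟨χ, hχs, hχ0, hχ1, hχb⟩ := exists_cutoff_away (c := ‖η₀‖ / 4) (by linarith)
  have hsum := contDiff_tsum_cutoff_dyadic (dyadicRatio_pos m) (dyadicRatio_lt_one hm)
    (c := ‖η₀‖ / 4) (by linarith) (𝓕 U) hχs hχ0 hχb
  have hWs : ContDiff ℝ ∞ (𝓕 W : 𝓢(E3, ℂ)) := (𝓕 W).smooth ⊤
  refine ((hWs.add hsum).contDiffAt (x := η₀)).congr_of_eventuallyEq ?_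
  have hopen : IsOpen {x : E3 | ‖η₀‖ / 2 < ‖x‖} := isOpen_lt continuous_const continuous_norm
  filter_upwards [hopen.mem_nhds (show ‖η₀‖ / 2 < ‖η₀‖ by linarith)] with η hη'
  have h1 := (hasSum_fourier_dyadic hm hF η).tsum_eq
  have h2 : 𝓕 (fun x => F x - W x) η = 𝓕 F η - 𝓕 W η := by
    rw [Real.fourier_eq', SchwartzMap.fourier_coe, Real.fourier_eq', Real.fourier_eq',
      ← integral_sub]
    · simp [mul_sub]
    · exact hFi.bdd_mul (by fun_prop) (c := 1) (.of_forall fun x => by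
        rw [Complex.norm_exp_ofReal_mul_I])
    · exact W.integrable.bdd_mul (by fun_prop) (c := 1) (.of_forall fun x => by
        rw [Complex.norm_exp_ofReal_mul_I])
  rw [h2] at h1
  simp only [hχ1 η (by linarith [show ‖η₀‖ / 2 < ‖η‖ from hη']), one_mul, Complex.real_smul]
  rw [h1]
  ring

theorem contMDiffOn_leadingAmplitude {V : E3 → ℝ}
    (hV : ∀ η : E3, η ≠ 0 → ContDiffAt ℝ ∞ (𝓕 (fun x => (V x : ℂ))) η) :
    ContMDiffOn (𝓘(ℝ, ℝ).prod ((𝓡 2).prod (𝓡 2))) 𝓘(ℝ, ℂ) ∞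
      (fun p : ℝ × S2 × S2 => leadingAmplitude V p.1 p.2.1 p.2.2)
      {p : ℝ × S2 × S2 | 0 < p.1 ∧ p.2.1 ≠ p.2.2} := by
  rintro ⟨lam, θ, w⟩ ⟨hl, hne⟩
  apply ContMDiffAt.contMDiffWithinAt
  simp only at hl hne
  have hne' : (θ : E3) - w ≠ 0 := sub_ne_zero.2 fun h => hne (Subtype.ext h)
  have : Fact (Module.finrank ℝ E3 = 2 + 1) := ⟨by simp⟩
  have hcoe : ContMDiff (𝓡 2) 𝓘(ℝ, E3) ∞ (fun x : S2 => (x : E3)) := contMDiff_coe_sphere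
  have hmap : ContMDiff (𝓘(ℝ, ℝ).prod ((𝓡 2).prod (𝓡 2))) 𝓘(ℝ, ℝ × E3 × E3) ∞
      (fun p : ℝ × S2 × S2 => (p.1, (p.2.1 : E3), (p.2.2 : E3))) := by
    refine ContMDiff.prodMk_space contMDiff_fst ?_
    exact ContMDiff.prodMk_space (hcoe.comp (contMDiff_fst.comp contMDiff_snd))
      (hcoe.comp (contMDiff_snd.comp contMDiff_snd))
  have hfun : ContDiffAt ℝ ∞ (fun q : ℝ × E3 × E3 => ((q.1 / (2 * Real.pi) : ℝ) : ℂ) *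
      𝓕 (fun x => (V x : ℂ)) ((2 * Real.pi)⁻¹ • q.1 • (q.2.1 - q.2.2))) (lam, (θ : E3), (w : E3)) := by
    refine ContDiffAt.mul ?_ ?_
    · exact (Complex.ofRealCLM.contDiff.comp (contDiff_fst.div_const _)).contDiffAt
    · refine ContDiffAt.comp (g := 𝓕 (fun x => (V x : ℂ))) (lam, (θ : E3), (w : E3)) (hV _ ?_) ?_
      · simp only [ne_eq, smul_eq_zero, inv_eq_zero, not_or]
        exact ⟨by positivity, hl.ne', hne'⟩
      · fun_prop
  have h := ContMDiffAt.comp (lam, θ, w) hfun.contMDiffAt hmap.contMDiffAt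
  refine h.congr_of_eventuallyEq (.of_forall fun p => ?_)
  simp only [leadingAmplitude, potentialFourier_eq_fourier, Function.comp]

/-! ### Fourier transforms of square integrable functions -/

/-- The Fourier transform is symmetric for the bilinear pairing. -/
theorem integral_fourier_mul_eq {n : ℕ} {φ f : EuclideanSpace ℝ (Fin n) → ℂ} (hφ : Integrable φ)
    (hf : Integrable f) : ∫ x, 𝓕 φ x * f x = ∫ x, φ x * 𝓕 f x := by
  have h := VectorFourier.integral_fourierIntegral_smul_eq_flip (μ := volume) (ν := volume)
    (L := innerₗ (EuclideanSpace ℝ (Fin n))) Real.continuous_fourierChar continuous_inner hφ hf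
  rw [flip_innerₗ] at h
  exact h

theorem continuous_fourier_of_integrable {n : ℕ} {f : EuclideanSpace ℝ (Fin n) → ℂ}
    (hf : Integrable f) : Continuous (𝓕 f) :=
  VectorFourier.fourierIntegral_continuous Real.continuous_fourierChar continuous_inner hf

/-- The Fourier transform on `L²` extends the one defined by the Fourier integral. -/
theorem fourier_toLp_ae_eq {n : ℕ} {f : EuclideanSpace ℝ (Fin n) → ℂ} (hf : Integrable f)
    (hf2 : MemLp f 2) :
    ((𝓕 (hf2.toLp f) : Lp ℂ 2 (volume : Measure (EuclideanSpace ℝ (Fin n)))) :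
      EuclideanSpace ℝ (Fin n) → ℂ) =ᵐ[volume] 𝓕 f := by
  -- Both sides are compared as distributions, on real-valued test functions.
  refine ae_eq_of_integral_contDiff_smul_eq ?_ ?_ fun g hg hgc => ?_
  · exact (Lp.memLp _).locallyIntegrable (by norm_num)
  · exact (continuous_fourier_of_integrable hf).locallyIntegrable
  have hg₁ : HasCompactSupport (fun x => (g x : ℂ)) :=
    hgc.comp_left (g := fun r : ℝ => (r : ℂ)) (by simp)
  have hg₂ : ContDiff ℝ ∞ (fun x => (g x : ℂ)) := Complex.ofRealCLM.contDiff.comp hg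
  have h := congrArg (fun T : 𝓢'(EuclideanSpace ℝ (Fin n), ℂ) => T (hg₁.toSchwartzMap hg₂))
    (Lp.fourier_toTemperedDistribution_eq (hf2.toLp f))
  simp only [TemperedDistribution.fourier_apply, Lp.toTemperedDistribution_apply] at h
  have e1 : ∫ x, g x • ((𝓕 (hf2.toLp f) : Lp ℂ 2 (volume : Measure (EuclideanSpace ℝ (Fin n)))) :
      EuclideanSpace ℝ (Fin n) → ℂ) x = ∫ x, (hg₁.toSchwartzMap hg₂) x •
      ((𝓕 (hf2.toLp f) : Lp ℂ 2 (volume : Measure (EuclideanSpace ℝ (Fin n)))) :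
      EuclideanSpace ℝ (Fin n) → ℂ) x := by
    congr 1
  rw [e1, ← h]
  have e2 : ∫ x, (𝓕 (hg₁.toSchwartzMap hg₂)) x • (hf2.toLp f) x =
      ∫ x, 𝓕 (fun x => (g x : ℂ)) x * f x := by
    refine integral_congr_ae ?_
    filter_upwards [hf2.coeFn_toLp] with x hx
    rw [hx, SchwartzMap.fourier_coe, smul_eq_mul]
    rfl
  rw [e2, integral_fourier_mul_eq (φ := fun x => (g x : ℂ)) (hg₁.toSchwartzMap hg₂).integrable hf]
  simp

theorem eLpNorm_fourier_eq {n : ℕ} {f : EuclideanSpace ℝ (Fin n) → ℂ} (hf : Integrable f)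
    (hf2 : MemLp f 2) : eLpNorm (𝓕 f) 2 volume = eLpNorm f 2 volume := by
  have h := Lp.norm_fourier_eq (hf2.toLp f)
  rw [← eLpNorm_congr_ae (fourier_toLp_ae_eq hf hf2), ← eLpNorm_congr_ae hf2.coeFn_toLp]
  rw [Lp.norm_def, Lp.norm_def, ENNReal.toReal_eq_toReal_iff' (Lp.eLpNorm_ne_top _)
    (Lp.eLpNorm_ne_top _)] at h
  exact h

/-- A pointwise convergent series of functions whose `Lᵖ` norms are summable is in `Lᵖ`. -/
theorem memLp_of_hasSum {α : Type*} [MeasurableSpace α] {μ : Measure α} {p : ENNReal} (hp : 1 ≤ p)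
    {f : ℕ → α → ℂ} {g : α → ℂ} (hf : ∀ j, AEStronglyMeasurable (f j) μ)
    (hg : ∀ᵐ x ∂μ, HasSum (fun j => f j x) (g x)) {a : ℕ → ℝ} (ha0 : ∀ j, 0 ≤ a j)
    (ha : Summable a) (hfa : ∀ j, eLpNorm (f j) p μ ≤ ENNReal.ofReal (a j)) : MemLp g p μ := by
  have hmeas : ∀ N, AEStronglyMeasurable (fun x => ∑ j ∈ Finset.range N, f j x) μ := fun N =>
    Finset.aestronglyMeasurable_fun_sum _ fun j _ => hf j
  have hlim : ∀ᵐ x ∂μ, Tendsto (fun N => ∑ j ∈ Finset.range N, f j x) atTop (𝓝 (g x)) := by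
    filter_upwards [hg] with x hx using hx.tendsto_sum_nat
  refine ⟨aestronglyMeasurable_of_tendsto_ae atTop hmeas hlim, ?_⟩
  have hb : ∀ N, eLpNorm (fun x => ∑ j ∈ Finset.range N, f j x) p μ ≤
      ENNReal.ofReal (∑' j, a j) := by
    intro N
    have e : (fun x => ∑ j ∈ Finset.range N, f j x) = ∑ j ∈ Finset.range N, f j := by
      funext x; simp
    rw [e]
    refine (eLpNorm_sum_le (fun j _ => hf j) hp).trans ?_
    refine (Finset.sum_le_sum fun j _ => hfa j).trans ?_
    rw [← ENNReal.ofReal_sum_of_nonneg fun j _ => ha0 j]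
    exact ENNReal.ofReal_le_ofReal (ha.sum_le_tsum _ fun j _ => ha0 j)
  refine (Lp.eLpNorm_lim_le_liminf_eLpNorm hmeas g hlim).trans_lt ?_
  refine lt_of_le_of_lt ?_ (ENNReal.ofReal_lt_top (r := ∑' j, a j))
  exact (liminf_le_liminf (.of_forall hb)).trans (by simp)

/-- The symbol `(1 + |k|²)^{κ/2}` of the Bessel potential of order `κ`. -/
def besselSymbol (n : ℕ) (κ : ℝ) (k : EuclideanSpace ℝ (Fin n)) : ℂ :=
  (((1 + ‖k‖ ^ 2) ^ (κ / 2) : ℝ) : ℂ)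

theorem besselSymbol_hasTemperateGrowth (n : ℕ) (κ : ℝ) :
    (besselSymbol n κ).HasTemperateGrowth := by
  unfold besselSymbol
  fun_prop

/-- A function in `L¹ ∩ L²` with weighted square integrable Fourier transform is in `H^κ`. -/
theorem exists_memSobolev_of_fourier {n : ℕ} {κ : ℝ} {F : EuclideanSpace ℝ (Fin n) → ℂ}
    (hF : Integrable F) (hF2 : MemLp F 2) (h : MemLp (fun k => besselSymbol n κ k * 𝓕 F k) 2) :
    ∃ T : 𝓢'(EuclideanSpace ℝ (Fin n), ℂ), IsRepresentedBy T F ∧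
      TemperedDistribution.MemSobolev κ 2 T := by
  refine ⟨Lp.toTemperedDistribution (hF2.toLp F), fun φ => ⟨?_, ?_⟩, ?_⟩
  · exact (φ.memLp 2).integrable_mul hF2
  · rw [Lp.toTemperedDistribution_apply]
    refine integral_congr_ae ?_
    filter_upwards [hF2.coeFn_toLp] with x hx
    rw [hx, smul_eq_mul]
  · rw [TemperedDistribution.memSobolev_iff_exists_smulLeftCLM_fourier]
    refine ⟨h.toLp _, ?_⟩
    ext φ
    rw [TemperedDistribution.smulLeftCLM_apply_apply, Lp.fourier_toTemperedDistribution_eq,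
      Lp.toTemperedDistribution_apply, Lp.toTemperedDistribution_apply]
    refine integral_congr_ae ?_
    filter_upwards [h.coeFn_toLp, fourier_toLp_ae_eq hF hF2] with k h1 h2
    rw [h1, h2]
    change (SchwartzMap.smulLeftCLM ℂ (besselSymbol n κ) φ) k • _ = _
    rw [SchwartzMap.smulLeftCLM_apply_apply (besselSymbol_hasTemperateGrowth n κ)]
    simp only [smul_eq_mul]
    ring

/-! ### Sobolev norms of concentrating profiles on the plane -/

theorem schwartz_pointwise_bound {n : ℕ} (Φ : 𝓢(EuclideanSpace ℝ (Fin n), ℂ)) (k : ℕ) :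
    ∃ D : ℝ, 0 ≤ D ∧ ∀ x, ‖Φ x‖ ≤ D * ((1 + ‖x‖) ^ k)⁻¹ := by
  refine ⟨2 ^ k * ((Finset.Iic (k, 0)).sup fun m => SchwartzMap.seminorm ℝ m.1 m.2) Φ,
    by positivity, fun x => ?_⟩
  have h := SchwartzMap.one_add_le_sup_seminorm_apply (𝕜 := ℝ) (m := (k, 0)) le_rfl le_rfl Φ x
  rw [norm_iteratedFDeriv_zero] at h
  rw [← div_eq_mul_inv, le_div_iff₀ (by positivity), mul_comm]
  exact h

theorem eLpNorm_comp_smul_sub {f : E2 → ℝ} (hf : Measurable f) {a : ℝ} (ha : 0 < a) (y₀ : E2) :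
    eLpNorm (fun y => f (a • (y - y₀))) 2 volume = ENNReal.ofReal a⁻¹ * eLpNorm f 2 volume := by
  have h1 : eLpNorm (fun y => f (a • (y - y₀))) 2 volume =
      eLpNorm (fun y => f (a • y)) 2 volume :=
    eLpNorm_comp_measurePreserving (g := fun y => f (a • y)) (f := fun y => y - y₀)
      (hf.comp (measurable_const_smul a)).aestronglyMeasurable
      (measurePreserving_sub_right volume y₀)
  have h2 : eLpNorm (fun y => f (a • y)) 2 volume =
      eLpNorm f 2 (Measure.map (fun y : E2 => a • y) volume) :=
    (eLpNorm_map_measure hf.aestronglyMeasurable (by fun_prop)).symm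
  rw [h1, h2, Measure.map_addHaar_smul volume ha.ne',
    eLpNorm_smul_measure_of_ne_zero (by simp; positivity)]
  rw [smul_eq_mul]
  congr 1
  rw [ENNReal.ofReal_rpow_of_nonneg (by positivity) (by positivity)]
  congr 1
  rw [finrank_euclideanSpace_fin, abs_of_pos (by positivity), ← inv_pow]
  simp only [one_div, ENNReal.toReal_inv, ENNReal.toReal_ofNat]
  rw [show (2 : ℝ)⁻¹ = 1 / 2 by norm_num, ← Real.sqrt_eq_rpow, Real.sqrt_sq (by positivity)]

/-- The function `y ↦ P(y) Φ(t γ(y))`, which lives at the scale `t⁻¹` near the zero of `γ`. -/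
def concentratingProfile (P : E2 → ℂ) (γ : E2 → E3) (Φ : 𝓢(E3, ℂ)) (t : ℝ) : E2 → ℂ :=
  fun y => P y * Φ (t • γ y)

theorem concentratingProfile_contDiff {P : E2 → ℂ} {γ : E2 → E3} (hP : ContDiff ℝ ∞ P)
    (hγ : ContDiff ℝ ∞ γ) (Φ : 𝓢(E3, ℂ)) (t : ℝ) :
    ContDiff ℝ ∞ (concentratingProfile P γ Φ t) :=
  hP.mul ((Φ.smooth ⊤).comp (hγ.const_smul t))

theorem concentratingProfile_hasCompactSupport {P : E2 → ℂ} (hP : HasCompactSupport P)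
    (γ : E2 → E3) (Φ : 𝓢(E3, ℂ)) (t : ℝ) :
    HasCompactSupport (concentratingProfile P γ Φ t) :=
  hP.mul_right

/-- The profile is of size one on a disc of radius `1/t`, because `|γ(y)| ≥ c |y - y₀|`, so that
its norm in `L²(ℝ²)` is of order `1/t`. -/
theorem eLpNorm_concentratingProfile_le {P : E2 → ℂ} (hP : Continuous P)
    (hPc : HasCompactSupport P) {γ : E2 → E3} {y₀ : E2} {c : ℝ} (hc : 0 < c)
    (hγ : ∀ y ∈ tsupport P, c * ‖y - y₀‖ ≤ ‖γ y‖) (Φ : 𝓢(E3, ℂ)) :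
    ∃ C : ℝ, 0 ≤ C ∧ ∀ t : ℝ, 1 ≤ t →
      eLpNorm (concentratingProfile P γ Φ t) 2 volume ≤ ENNReal.ofReal (C * t⁻¹) := by
  obtain ⟨M, hM⟩ := hP.bounded_above_of_compact_support hPc
  have hM0 : 0 ≤ M := (norm_nonneg _).trans (hM 0)
  obtain ⟨D, hD0, hD⟩ := schwartz_pointwise_bound Φ 2
  set b : E2 → ℝ := fun z => ((1 + ‖z‖) ^ 2)⁻¹ with hb
  have hbc : Continuous b := by
    refine Continuous.inv₀ (by fun_prop) fun z => by positivity
  have hb2 : MemLp b 2 := by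
    rw [memLp_two_iff_integrable_sq hbc.aestronglyMeasurable]
    have h := integrable_one_add_norm (E := E2) (μ := volume) (r := 4) (by simp; norm_num)
    refine h.congr (.of_forall fun z => ?_)
    simp only [hb]
    rw [Real.rpow_neg (by positivity), inv_pow, ← pow_mul]
    norm_cast
  refine ⟨(M * D) * c⁻¹ * (eLpNorm b 2 volume).toReal, by positivity, fun t ht => ?_⟩
  have ht0 : 0 < t := by linarith
  have hpt : ∀ y, ‖concentratingProfile P γ Φ t y‖ ≤ (M * D) * ‖b ((t * c) • (y - y₀))‖ := by
    intro y
    by_cases hy : y ∈ tsupport P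
    · have h1 : ‖(t * c) • (y - y₀)‖ ≤ ‖t • γ y‖ := by
        rw [norm_smul, norm_smul, Real.norm_of_nonneg (by positivity),
          Real.norm_of_nonneg ht0.le, mul_assoc]
        exact mul_le_mul_of_nonneg_left (hγ y hy) ht0.le
      have h2 : ((1 + ‖t • γ y‖) ^ 2)⁻¹ ≤ ((1 + ‖(t * c) • (y - y₀)‖) ^ 2)⁻¹ := by gcongr
      rw [concentratingProfile, norm_mul, Real.norm_of_nonneg (by positivity : 0 ≤ b _), mul_assoc]
      refine mul_le_mul (hM y) ((hD _).trans ?_) (norm_nonneg _) hM0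
      exact mul_le_mul_of_nonneg_left h2 hD0
    · rw [concentratingProfile, image_eq_zero_of_notMem_tsupport hy, zero_mul, norm_zero]
      positivity
  refine (eLpNorm_le_mul_eLpNorm_of_ae_le_mul (.of_forall hpt) 2).trans ?_
  rw [eLpNorm_comp_smul_sub hbc.measurable (by positivity)]
  have hfin : eLpNorm b 2 volume = ENNReal.ofReal (eLpNorm b 2 volume).toReal :=
    (ENNReal.ofReal_toReal hb2.2.ne).symm
  rw [hfin, ← ENNReal.ofReal_mul (by positivity), ← ENNReal.ofReal_mul (by positivity)]
  refine ENNReal.ofReal_le_ofReal (le_of_eq ?_)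
  rw [mul_inv, ENNReal.toReal_ofReal (by positivity)]
  ring

/-- The directional derivative of a concentrating profile is a combination of such profiles; each
derivative costs at most a factor `t`. -/
theorem fderiv_concentratingProfile {P : E2 → ℂ} {γ : E2 → E3} (hP : ContDiff ℝ ∞ P)
    (hγ : ContDiff ℝ ∞ γ) (Φ : 𝓢(E3, ℂ)) (t : ℝ) (v y : E2) :
    fderiv ℝ (concentratingProfile P γ Φ t) y v =
      concentratingProfile (fun y => fderiv ℝ P y v) γ Φ t y +
      ∑ i : Fin 3, (t : ℂ) * concentratingProfile (fun y => P y * ((fderiv ℝ γ y v i : ℝ) : ℂ)) γ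
        (LineDeriv.lineDerivOp (EuclideanSpace.single i (1 : ℝ)) Φ) t y := by
  have hPd : HasFDerivAt P (fderiv ℝ P y) y :=
    (hP.differentiable (by simp) y).hasFDerivAt
  have hγd : HasFDerivAt γ (fderiv ℝ γ y) y :=
    (hγ.differentiable (by simp) y).hasFDerivAt
  have hc : HasFDerivAt (fun y => Φ (t • γ y)) ((fderiv ℝ Φ (t • γ y)).comp (t • fderiv ℝ γ y)) y :=
    (Φ.hasFDerivAt _).comp y (hγd.const_smul t)
  have h : HasFDerivAt (concentratingProfile P γ Φ t)
      (P y • ((fderiv ℝ Φ (t • γ y)).comp (t • fderiv ℝ γ y)) + Φ (t • γ y) • fderiv ℝ P y) y :=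
    hPd.mul hc
  rw [h.fderiv]
  have hsum : fderiv ℝ γ y v = ∑ i : Fin 3, (fderiv ℝ γ y v i) • EuclideanSpace.single i (1 : ℝ) := by
    conv_lhs => rw [← (EuclideanSpace.basisFun (Fin 3) ℝ).sum_repr (fderiv ℝ γ y v)]
    simp
  simp only [add_apply, smul_apply,
    ContinuousLinearMap.comp_apply, concentratingProfile, SchwartzMap.lineDerivOp_apply_eq_fderiv,
    smul_eq_mul]
  conv_lhs => rw [hsum]
  simp only [map_smul, map_sum, Complex.real_smul, Finset.mul_sum]
  rw [add_comm, mul_comm]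
  congr 1
  refine Finset.sum_congr rfl fun i _ => ?_
  ring

/-- The `L²` norms of the derivatives of order `N` of a concentrating profile, on the Fourier side,
are of order `t^{N-1}`. By induction on `N` for all amplitudes and profiles at once, since a
derivative of a profile is a combination of profiles. -/
theorem eLpNorm_inner_pow_mul_fourier_le {γ : E2 → E3} (hγs : ContDiff ℝ ∞ γ) {y₀ : E2} {c : ℝ}
    (hc : 0 < c) (v : E2) (N : ℕ) : ∀ (P : E2 → ℂ) (_ : ContDiff ℝ ∞ P) (_ : HasCompactSupport P)
    (_ : ∀ y ∈ tsupport P, c * ‖y - y₀‖ ≤ ‖γ y‖) (Φ : 𝓢(E3, ℂ)),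
    ∃ C : ℝ, 0 ≤ C ∧ ∀ t : ℝ, 1 ≤ t →
      eLpNorm (fun k => ((inner ℝ k v : ℝ) : ℂ) ^ N * 𝓕 (concentratingProfile P γ Φ t) k) 2 volume ≤
        ENNReal.ofReal (C * t ^ N * t⁻¹) := by
  induction N with
  | zero =>
    intro P hP hPc hγ Φ
    obtain ⟨C, hC0, hC⟩ := eLpNorm_concentratingProfile_le hP.continuous hPc hc hγ Φ
    refine ⟨C, hC0, fun t ht => ?_⟩
    simp only [pow_zero, one_mul, mul_one]
    have hs := concentratingProfile_contDiff hP hγs Φ t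
    have hcs := concentratingProfile_hasCompactSupport hPc γ Φ t
    have := hC t ht
    have h2 := eLpNorm_fourier_eq (f := concentratingProfile P γ Φ t)
      (hcs.toSchwartzMap hs).integrable ((hcs.toSchwartzMap hs).memLp 2 volume)
    exact h2.le.trans this
  | succ N ih =>
    intro P hP hPc hγ Φ
    have hP1 : ContDiff ℝ ∞ (fun y => fderiv ℝ P y v) :=
      (hP.fderiv_right (m := ∞) (by simp)).clm_apply contDiff_const
    have hP1c : HasCompactSupport (fun y => fderiv ℝ P y v) := hPc.fderiv_apply (𝕜 := ℝ) v
    have hP1t : tsupport (fun y => fderiv ℝ P y v) ⊆ tsupport P :=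
      tsupport_fderiv_apply_subset ℝ v
    have hg : ∀ i : Fin 3, ContDiff ℝ ∞ (fun y => ((fderiv ℝ γ y v i : ℝ) : ℂ)) := fun i => by
      have h1 : ContDiff ℝ ∞ (fun y => fderiv ℝ γ y v) :=
        (hγs.fderiv_right (m := ∞) (by simp)).clm_apply contDiff_const
      exact Complex.ofRealCLM.contDiff.comp ((contDiff_euclidean.1 h1) i)
    have hP2 : ∀ i : Fin 3, ContDiff ℝ ∞ (fun y => P y * ((fderiv ℝ γ y v i : ℝ) : ℂ)) := fun i =>
      hP.mul (hg i)
    obtain ⟨C1, hC10, hC1⟩ := ih _ hP1 hP1c (fun y hy => hγ y (hP1t hy)) Φ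
    have h2 := fun i : Fin 3 => ih _ (hP2 i) hPc.mul_right
      (fun y hy => hγ y (tsupport_mul_subset_left hy))
      (LineDeriv.lineDerivOp (EuclideanSpace.single i (1 : ℝ)) Φ)
    choose C2 hC20 hC2 using h2
    refine ⟨C1 + ∑ i, C2 i, add_nonneg hC10 (Finset.sum_nonneg fun i _ => hC20 i),
      fun t ht => ?_⟩
    have ht0 : 0 < t := by linarith
    -- The profiles as Schwartz functions, for which the Fourier transform of a derivative is
    -- known.
    set f0 := (concentratingProfile_hasCompactSupport hPc γ Φ t).toSchwartzMap
      (concentratingProfile_contDiff hP hγs Φ t) with hf0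
    set f1 := (concentratingProfile_hasCompactSupport hP1c γ Φ t).toSchwartzMap
      (concentratingProfile_contDiff hP1 hγs Φ t) with hf1
    set f2 := fun i : Fin 3 => (concentratingProfile_hasCompactSupport
      (P := fun y => P y * ((fderiv ℝ γ y v i : ℝ) : ℂ)) hPc.mul_right γ
      (LineDeriv.lineDerivOp (EuclideanSpace.single i (1 : ℝ)) Φ) t).toSchwartzMap
      (concentratingProfile_contDiff (hP2 i) hγs _ t) with hf2
    have hd : LineDeriv.lineDerivOp v f0 = f1 + ∑ i, (t : ℂ) • f2 i := by
      ext y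
      rw [SchwartzMap.lineDerivOp_apply_eq_fderiv, add_apply, sum_apply]
      exact fderiv_concentratingProfile hP hγs Φ t v y
    have hF : ∀ k, ((inner ℝ k v : ℝ) : ℂ) ^ (N + 1) * 𝓕 f0 k =
        (2 * Real.pi * Complex.I)⁻¹ * ((((inner ℝ k v : ℝ) : ℂ) ^ N * 𝓕 f1 k) +
          ∑ i, (t : ℂ) * (((inner ℝ k v : ℝ) : ℂ) ^ N * 𝓕 (f2 i) k)) := by
      intro k
      have h := congrArg (fun f : 𝓢(E2, ℂ) => f k) (SchwartzMap.fourier_lineDerivOp_eq f0 v)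
      have hgr : (inner ℝ · v : E2 → ℝ).HasTemperateGrowth :=
        ((innerSL ℝ).flip v).hasTemperateGrowth
      simp only [smul_apply, SchwartzMap.smulLeftCLM_apply_apply hgr, hd] at h
      have hlin : 𝓕 (f1 + ∑ i, (t : ℂ) • f2 i) = 𝓕 f1 + ∑ i, (t : ℂ) • 𝓕 (f2 i) := by
        simp only [← FourierTransform.fourierCLM_apply (R := ℂ), map_add, map_sum, map_smul]
      rw [hlin] at h
      simp only [add_apply, sum_apply, smul_apply,
        smul_eq_mul, Complex.real_smul] at h
      have hpi : (2 * Real.pi * Complex.I : ℂ) ≠ 0 := by simp [Real.pi_ne_zero]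
      have e : (((inner ℝ k v : ℝ) : ℂ) ^ N * 𝓕 f1 k) +
          ∑ i, (t : ℂ) * (((inner ℝ k v : ℝ) : ℂ) ^ N * 𝓕 (f2 i) k) =
          ((inner ℝ k v : ℝ) : ℂ) ^ N * (𝓕 f1 k + ∑ i, (t : ℂ) * 𝓕 (f2 i) k) := by
        rw [mul_add, Finset.mul_sum]
        congr 1
        exact Finset.sum_congr rfl fun i _ => by ring
      rw [e, h]
      rw [pow_succ]
      field_simp
    have hm1 : AEStronglyMeasurable (fun k => ((inner ℝ k v : ℝ) : ℂ) ^ N * 𝓕 f1 k) volume := by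
      have : Continuous (𝓕 f1 : 𝓢(E2, ℂ)) := (𝓕 f1).continuous
      fun_prop
    have hm2 : ∀ i, AEStronglyMeasurable
        (fun k => (t : ℂ) * (((inner ℝ k v : ℝ) : ℂ) ^ N * 𝓕 (f2 i) k)) volume := fun i => by
      have : Continuous (𝓕 (f2 i) : 𝓢(E2, ℂ)) := (𝓕 (f2 i)).continuous
      fun_prop
    have hb1 : eLpNorm (fun k => ((inner ℝ k v : ℝ) : ℂ) ^ N * 𝓕 f1 k) 2 volume ≤
        ENNReal.ofReal (C1 * t ^ N * t⁻¹) := hC1 t ht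
    have hb2 : ∀ i, eLpNorm (fun k => (t : ℂ) * (((inner ℝ k v : ℝ) : ℂ) ^ N * 𝓕 (f2 i) k)) 2 volume
        ≤ ENNReal.ofReal (t * (C2 i * t ^ N * t⁻¹)) := fun i => by
      have h := eLpNorm_const_smul (t : ℂ) (fun k => ((inner ℝ k v : ℝ) : ℂ) ^ N * 𝓕 (f2 i) k) 2
        (volume : Measure E2)
      have e : (fun k => (t : ℂ) * (((inner ℝ k v : ℝ) : ℂ) ^ N * 𝓕 (f2 i) k)) =
        (t : ℂ) • (fun k => ((inner ℝ k v : ℝ) : ℂ) ^ N * 𝓕 (f2 i) k) := rfl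
      have e' : ‖(t : ℂ)‖ₑ = ENNReal.ofReal t := by
        rw [← ofReal_norm, Complex.norm_real, Real.norm_of_nonneg ht0.le]
      rw [e, h, ENNReal.ofReal_mul ht0.le, e']
      exact mul_le_mul_right (hC2 i t ht) _
    have hfun : (fun k => ((inner ℝ k v : ℝ) : ℂ) ^ (N + 1) *
        𝓕 (concentratingProfile P γ Φ t) k) = (2 * Real.pi * Complex.I : ℂ)⁻¹ •
        ((fun k => ((inner ℝ k v : ℝ) : ℂ) ^ N * 𝓕 f1 k) +
          ∑ i, fun k => (t : ℂ) * (((inner ℝ k v : ℝ) : ℂ) ^ N * 𝓕 (f2 i) k)) := by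
      funext k
      simp only [Pi.smul_apply, Pi.add_apply, Finset.sum_apply, smul_eq_mul]
      exact hF k
    have hpi1 : ‖(2 * Real.pi * Complex.I : ℂ)⁻¹‖ₑ ≤ 1 := by
      rw [← ofReal_norm]
      refine ENNReal.ofReal_le_one.2 ?_
      rw [norm_inv]
      refine inv_le_one_of_one_le₀ ?_
      simp only [Complex.norm_mul, Complex.norm_ofNat, Complex.norm_real, Complex.norm_I, mul_one]
      rw [Real.norm_of_nonneg Real.pi_pos.le]
      linarith [Real.pi_gt_three]
    rw [hfun, eLpNorm_const_smul]
    refine (mul_le_of_le_one_left (by simp) hpi1).trans ?_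
    refine (eLpNorm_add_le hm1 (Finset.aestronglyMeasurable_sum _ fun i _ => hm2 i)
      (by norm_num)).trans ?_
    refine (add_le_add hb1 ((eLpNorm_sum_le (fun i _ => hm2 i) (by norm_num)).trans
      (Finset.sum_le_sum fun i _ => hb2 i))).trans ?_
    rw [← ENNReal.ofReal_sum_of_nonneg fun i _ => by have := hC20 i; positivity,
      ← ENNReal.ofReal_add (by positivity)
        (Finset.sum_nonneg fun i _ => by have := hC20 i; positivity)]
    refine ENNReal.ofReal_le_ofReal ?_
    have hpow : t ^ N ≤ t ^ (N + 1) := pow_le_pow_right₀ ht (Nat.le_succ N)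
    calc C1 * t ^ N * t⁻¹ + ∑ i, t * (C2 i * t ^ N * t⁻¹)
        = C1 * t ^ N * t⁻¹ + (∑ i, C2 i) * t ^ (N + 1) * t⁻¹ := by
          rw [Finset.sum_mul, Finset.sum_mul]
          congr 1
          exact Finset.sum_congr rfl fun i _ => by ring
      _ ≤ C1 * t ^ (N + 1) * t⁻¹ + (∑ i, C2 i) * t ^ (N + 1) * t⁻¹ := by gcongr
      _ = _ := by ring

/-! ### Dyadic superpositions in Sobolev spaces -/

theorem one_add_add_pow_le {a b : ℝ} (ha : 0 ≤ a) (hb : 0 ≤ b) (N : ℕ) :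
    (1 + a + b) ^ N ≤ 3 ^ N * (1 + a ^ N + b ^ N) := by
  set M := max 1 (max a b) with hM
  have h1 : 1 ≤ M := le_max_left _ _
  have h2 : a ≤ M := (le_max_left _ _).trans (le_max_right _ _)
  have h3 : b ≤ M := (le_max_right _ _).trans (le_max_right _ _)
  have hMN : M ^ N ≤ 1 + a ^ N + b ^ N := by
    have ha' : 0 ≤ a ^ N := by positivity
    have hb' : 0 ≤ b ^ N := by positivity
    rcases max_choice 1 (max a b) with h | h
    · rw [hM, h, one_pow]; linarith
    · rcases max_choice a b with h' | h'
      · rw [hM, h, h']; linarith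
      · rw [hM, h, h']; linarith
  calc (1 + a + b) ^ N ≤ (3 * M) ^ N := pow_le_pow_left₀ (by positivity) (by linarith) N
    _ = 3 ^ N * M ^ N := mul_pow _ _ _
    _ ≤ _ := by gcongr

/-- For `|k|` measured in units of `t`, the symbol of order `κ` is at most `t^κ` times a polynomial
of degree `N ≥ κ`. -/
theorem norm_besselSymbol_le {κ : ℝ} (hκ : 0 ≤ κ) {N : ℕ} (hN : κ ≤ N) {t : ℝ} (ht : 1 ≤ t)
    (k : E2) : ‖besselSymbol 2 κ k‖ ≤
      t ^ κ * (2 * 3 ^ N) * (1 + (t ^ N)⁻¹ * |k 0| ^ N + (t ^ N)⁻¹ * |k 1| ^ N) := by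
  have ht0 : 0 < t := by linarith
  set r := √(1 + ‖k‖ ^ 2) with hr
  have hr0 : 0 ≤ r := Real.sqrt_nonneg _
  have hn : ‖besselSymbol 2 κ k‖ = r ^ κ := by
    rw [besselSymbol, Complex.norm_real, Real.norm_of_nonneg (by positivity), hr,
      Real.sqrt_eq_rpow, ← Real.rpow_mul (by positivity)]
    congr 1; ring
  have hrk : r ≤ 1 + |k 0| + |k 1| := by
    rw [hr]
    refine Real.sqrt_le_iff.2 ⟨by positivity, ?_⟩
    rw [EuclideanSpace.norm_sq_eq, Fin.sum_univ_two, Real.norm_eq_abs, Real.norm_eq_abs]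
    nlinarith [abs_nonneg (k 0), abs_nonneg (k 1), mul_nonneg (abs_nonneg (k 0)) (abs_nonneg (k 1))]
  -- With `s = r/t`, `s^κ` is at most `1` or at most `s^N`.
  have hs : (r / t) ^ κ ≤ 1 + (r / t) ^ N := by
    rcases le_or_gt (r / t) 1 with h | h
    · have := Real.rpow_le_one (by positivity) h hκ
      have h2 : 0 ≤ (r / t) ^ N := by positivity
      linarith
    · have := Real.rpow_le_rpow_of_exponent_le h.le hN
      rw [Real.rpow_natCast] at this
      linarith
  have hsN : (r / t) ^ N ≤ 3 ^ N * (1 + (t ^ N)⁻¹ * |k 0| ^ N + (t ^ N)⁻¹ * |k 1| ^ N) := by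
    rw [div_pow, div_le_iff₀ (by positivity)]
    have h1 := (pow_le_pow_left₀ hr0 hrk N).trans
      (one_add_add_pow_le (abs_nonneg (k 0)) (abs_nonneg (k 1)) N)
    have h2 : 1 ≤ t ^ N := one_le_pow₀ ht
    have e : 3 ^ N * (1 + (t ^ N)⁻¹ * |k 0| ^ N + (t ^ N)⁻¹ * |k 1| ^ N) * t ^ N =
        3 ^ N * (t ^ N + |k 0| ^ N + |k 1| ^ N) := by field_simp
    rw [e]
    refine h1.trans ?_
    gcongr
  have h3 : (1 : ℝ) ≤ 3 ^ N := one_le_pow₀ (by norm_num)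
  have hS : 1 ≤ 1 + (t ^ N)⁻¹ * |k 0| ^ N + (t ^ N)⁻¹ * |k 1| ^ N := by
    have : 0 ≤ (t ^ N)⁻¹ * |k 0| ^ N + (t ^ N)⁻¹ * |k 1| ^ N := by positivity
    linarith
  have hrt : r ^ κ = t ^ κ * (r / t) ^ κ := by
    rw [← Real.mul_rpow ht0.le (by positivity), mul_div_cancel₀ _ ht0.ne']
  rw [hn, hrt, mul_assoc]
  refine mul_le_mul_of_nonneg_left ?_ (by positivity)
  refine hs.trans ?_
  nlinarith

/-- The `H^κ` norm of a profile concentrated at scale `1/t` is of order `t^{κ-1}`. -/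
theorem eLpNorm_besselSymbol_mul_fourier_le {κ : ℝ} (hκ : 0 ≤ κ) {P : E2 → ℂ}
    (hP : ContDiff ℝ ∞ P) (hPc : HasCompactSupport P) {γ : E2 → E3} (hγs : ContDiff ℝ ∞ γ)
    {y₀ : E2} {c : ℝ} (hc : 0 < c) (hγ : ∀ y ∈ tsupport P, c * ‖y - y₀‖ ≤ ‖γ y‖)
    (Φ : 𝓢(E3, ℂ)) : ∃ C : ℝ, 0 ≤ C ∧ ∀ t : ℝ, 1 ≤ t →
      eLpNorm (fun k => besselSymbol 2 κ k * 𝓕 (concentratingProfile P γ Φ t) k) 2 volume ≤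
        ENNReal.ofReal (C * t ^ κ * t⁻¹) := by
  obtain ⟨N, hN⟩ := exists_nat_ge κ
  obtain ⟨C0, hC00, hC0⟩ := eLpNorm_inner_pow_mul_fourier_le hγs hc 0 0 P hP hPc hγ Φ
  obtain ⟨C1, hC10, hC1⟩ := eLpNorm_inner_pow_mul_fourier_le hγs hc
    (EuclideanSpace.single 0 (1 : ℝ)) N P hP hPc hγ Φ
  obtain ⟨C2, hC20, hC2⟩ := eLpNorm_inner_pow_mul_fourier_le hγs hc
    (EuclideanSpace.single 1 (1 : ℝ)) N P hP hPc hγ Φ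
  refine ⟨2 * 3 ^ N * (C0 + C1 + C2), by positivity, fun t ht => ?_⟩
  have ht0 : 0 < t := by linarith
  have hfc : Continuous (𝓕 (concentratingProfile P γ Φ t)) :=
    continuous_fourier_of_integrable (((concentratingProfile_hasCompactSupport hPc γ Φ t).toSchwartzMap
      (concentratingProfile_contDiff hP hγs Φ t)).integrable)
  set f := 𝓕 (concentratingProfile P γ Φ t) with hf
  set g0 : E2 → ℂ := fun k => ((inner ℝ k (0 : E2) : ℝ) : ℂ) ^ 0 * f k with hg0
  set g1 : E2 → ℂ := fun k => ((inner ℝ k (EuclideanSpace.single 0 (1 : ℝ)) : ℝ) : ℂ) ^ N * f k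
    with hg1
  set g2 : E2 → ℂ := fun k => ((inner ℝ k (EuclideanSpace.single 1 (1 : ℝ)) : ℝ) : ℂ) ^ N * f k
    with hg2
  have hpt : ∀ k, ‖besselSymbol 2 κ k * f k‖ ≤ t ^ κ * (2 * 3 ^ N) *
      ‖(‖g0 k‖ + (t ^ N)⁻¹ * ‖g1 k‖ + (t ^ N)⁻¹ * ‖g2 k‖)‖ := by
    intro k
    rw [Real.norm_of_nonneg (by positivity), norm_mul]
    refine (mul_le_mul_of_nonneg_right (norm_besselSymbol_le hκ hN ht k)
      (norm_nonneg (f k))).trans (le_of_eq ?_)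
    simp only [hg0, hg1, hg2, norm_mul, norm_pow, Complex.norm_real, pow_zero, one_mul,
      EuclideanSpace.inner_single_right, Real.norm_eq_abs, conj_trivial]
    ring
  have m0 : AEStronglyMeasurable (fun k => ‖g0 k‖) volume := by
    have : Continuous fun k => ‖g0 k‖ := by simp only [hg0]; fun_prop
    exact this.aestronglyMeasurable
  have m1 : AEStronglyMeasurable (fun k => (t ^ N)⁻¹ * ‖g1 k‖) volume := by
    have : Continuous fun k => (t ^ N)⁻¹ * ‖g1 k‖ := by simp only [hg1]; fun_prop
    exact this.aestronglyMeasurable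
  have m2 : AEStronglyMeasurable (fun k => (t ^ N)⁻¹ * ‖g2 k‖) volume := by
    have : Continuous fun k => (t ^ N)⁻¹ * ‖g2 k‖ := by simp only [hg2]; fun_prop
    exact this.aestronglyMeasurable
  have b0 : eLpNorm (fun k => ‖g0 k‖) 2 volume ≤ ENNReal.ofReal (C0 * t⁻¹) := by
    rw [eLpNorm_norm]; simpa only [hg0, pow_zero, mul_one] using hC0 t ht
  have bi : ∀ (g : E2 → ℂ) (C : ℝ), eLpNorm g 2 volume ≤ ENNReal.ofReal (C * t ^ N * t⁻¹) →
      eLpNorm (fun k => (t ^ N)⁻¹ * ‖g k‖) 2 volume ≤ ENNReal.ofReal (C * t⁻¹) := by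
    intro g C h
    have e : (fun k => (t ^ N)⁻¹ * ‖g k‖) = ((t ^ N)⁻¹ : ℝ) • fun k => ‖g k‖ := rfl
    rw [e, eLpNorm_const_smul, eLpNorm_norm, ← ofReal_norm,
      Real.norm_of_nonneg (by positivity)]
    refine (mul_le_mul_right h _).trans (le_of_eq ?_)
    rw [← ENNReal.ofReal_mul (by positivity)]
    congr 1
    field_simp
  refine (eLpNorm_le_mul_eLpNorm_of_ae_le_mul (.of_forall hpt) 2).trans ?_
  have hsum : eLpNorm (fun k => ‖g0 k‖ + (t ^ N)⁻¹ * ‖g1 k‖ + (t ^ N)⁻¹ * ‖g2 k‖) 2 volume ≤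
      ENNReal.ofReal ((C0 + C1 + C2) * t⁻¹) := by
    refine (eLpNorm_add_le (m0.add m1) m2 (by norm_num)).trans ?_
    refine (add_le_add (eLpNorm_add_le m0 m1 (by norm_num)) le_rfl).trans ?_
    refine (add_le_add (add_le_add b0 (bi g1 C1 (hC1 t ht))) (bi g2 C2 (hC2 t ht))).trans ?_
    rw [← ENNReal.ofReal_add (by positivity) (by positivity),
      ← ENNReal.ofReal_add (by positivity) (by positivity)]
    exact ENNReal.ofReal_le_ofReal (le_of_eq (by ring))
  refine (mul_le_mul_right hsum _).trans ?_
  rw [← ENNReal.ofReal_mul (by positivity)]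
  exact ENNReal.ofReal_le_ofReal (le_of_eq (by ring))

/-- A dyadic superposition of concentrating profiles with ratio `q` belongs to `H^κ(ℝ²)` as soon as
the series of the `H^κ` norms, of ratio `q 2^{κ-1}`, converges. -/
theorem exists_memSobolev_of_dyadic {q κ : ℝ} (hq0 : 0 < q) (hq1 : q < 1) (hκ : 0 ≤ κ)
    (hqκ : q * 2 ^ (κ - 1) < 1) {P : E2 → ℂ}
    (hP : ContDiff ℝ ∞ P) (hPc : HasCompactSupport P) {γ : E2 → E3} (hγs : ContDiff ℝ ∞ γ)
    {y₀ : E2} {c : ℝ} (hc : 0 < c) (hγ : ∀ y ∈ tsupport P, c * ‖y - y₀‖ ≤ ‖γ y‖)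
    (A Φ : 𝓢(E3, ℂ)) {F : E2 → ℂ}
    (hF : ∀ y, HasSum (fun j : ℕ => ((q ^ j : ℝ) : ℂ) * concentratingProfile P γ Φ (2 ^ j) y)
      (F y - concentratingProfile P γ A 1 y)) :
    ∃ T : 𝓢'(E2, ℂ), IsRepresentedBy T F ∧ TemperedDistribution.MemSobolev κ 2 T := by
  have hsch : ∀ (Ψ : 𝓢(E3, ℂ)) (t : ℝ), ∃ f : 𝓢(E2, ℂ), ⇑f = concentratingProfile P γ Ψ t :=
    fun Ψ t => ⟨(concentratingProfile_hasCompactSupport hPc γ Ψ t).toSchwartzMap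
      (concentratingProfile_contDiff hP hγs Ψ t), rfl⟩
  obtain ⟨fA, hfA⟩ := hsch A 1
  choose f hf using fun j : ℕ => hsch Φ (2 ^ j)
  obtain ⟨B, hB0, hB⟩ := schwartz_pointwise_bound Φ 0
  have hB' : ∀ x, ‖Φ x‖ ≤ B := fun x => by simpa using hB x
  have hPm : AEStronglyMeasurable P volume := hP.continuous.aestronglyMeasurable
  have hterm : ∀ p : ENNReal, ∀ j : ℕ,
      eLpNorm (fun y => ((q ^ j : ℝ) : ℂ) * f j y) p volume ≤
      ENNReal.ofReal (q ^ j * (B * (eLpNorm P p volume).toReal)) := by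
    intro p j
    have hPp : MemLp P p := hP.continuous.memLp_of_hasCompactSupport hPc
    have hpt : ∀ y, ‖((q ^ j : ℝ) : ℂ) * f j y‖ ≤ (q ^ j * B) * ‖P y‖ := by
      intro y
      rw [hf, concentratingProfile, norm_mul, norm_mul, Complex.norm_real,
        Real.norm_of_nonneg (by positivity), mul_assoc]
      rw [mul_comm ‖P y‖]
      gcongr
      exact hB' _
    refine (eLpNorm_le_mul_eLpNorm_of_ae_le_mul (.of_forall hpt) p).trans ?_
    have e : q ^ j * (B * (eLpNorm P p volume).toReal) =
        (q ^ j * B) * (eLpNorm P p volume).toReal := by ring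
    rw [e, ENNReal.ofReal_mul (by positivity : 0 ≤ q ^ j * B), ENNReal.ofReal_toReal hPp.2.ne]
  have hgeo := summable_geometric_of_lt_one hq0.le hq1
  -- `F ∈ L¹ ∩ L²`, because `q < 1` and the profiles are bounded by a multiple of `|P|`.
  have hFp : ∀ p : ENNReal, 1 ≤ p → MemLp F p := by
    intro p hp
    have h1 : MemLp (fun y => F y - fA y) p := by
      refine memLp_of_hasSum hp (f := fun j y => ((q ^ j : ℝ) : ℂ) * f j y) (fun j => ?_) (.of_forall fun y => ?_)
        (a := fun j => q ^ j * (B * (eLpNorm P p volume).toReal)) (fun j => by positivity)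
        (hgeo.mul_right _) (hterm p)
      · exact ((f j).continuous.const_smul ((q ^ j : ℝ) : ℂ)).aestronglyMeasurable
      · simpa only [hf, hfA] using hF y
    have h2 := h1.add (fA.memLp p volume)
    have e : (fun y => F y - fA y) + ⇑fA = F := by funext y; simp
    rwa [e] at h2
  have hF1 : Integrable F := memLp_one_iff_integrable.1 (hFp 1 le_rfl)
  have hF2 := hFp 2 (by norm_num)
  refine exists_memSobolev_of_fourier hF1 hF2 ?_
  obtain ⟨C, hC0, hC⟩ := eLpNorm_besselSymbol_mul_fourier_le hκ hP hPc hγs hc hγ Φ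
  obtain ⟨CA, hCA0, hCA⟩ := eLpNorm_besselSymbol_mul_fourier_le hκ hP hPc hγs hc hγ A
  have hbc : Continuous (besselSymbol 2 κ) :=
    (besselSymbol_hasTemperateGrowth 2 κ).1.continuous
  have hA : MemLp (fun k => besselSymbol 2 κ k * 𝓕 (concentratingProfile P γ A 1) k) 2 := by
    refine ⟨?_, (hCA 1 le_rfl).trans_lt ENNReal.ofReal_lt_top⟩
    have h1 : Continuous (𝓕 (concentratingProfile P γ A 1)) := by
      rw [← hfA]; exact continuous_fourier_of_integrable fA.integrable
    exact (hbc.mul h1).aestronglyMeasurable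
  -- The Fourier transform may be taken term by term.
  have hser : ∀ k, HasSum (fun j : ℕ => ((q ^ j : ℝ) : ℂ) * 𝓕 (concentratingProfile P γ Φ (2 ^ j)) k)
      (𝓕 F k - 𝓕 (concentratingProfile P γ A 1) k) := by
    intro k
    set ε : E2 → ℂ := fun y => Complex.exp (((-2 * Real.pi * inner ℝ y k : ℝ) : ℂ) * Complex.I)
    have hε : ∀ y, ‖ε y‖ ≤ 1 := fun y => (Complex.norm_exp_ofReal_mul_I _).le
    have hεc : Continuous ε := by fun_prop
    have hint : ∀ j, Integrable (fun y => ε y * (((q ^ j : ℝ) : ℂ) * f j y)) := fun j =>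
      ((f j).integrable.const_mul _).bdd_mul hεc.aestronglyMeasurable (.of_forall hε)
    have hP1 : Integrable P := hP.continuous.integrable_of_hasCompactSupport hPc
    have hnorm : ∀ j, ∫ y, ‖ε y * (((q ^ j : ℝ) : ℂ) * f j y)‖ ≤ q ^ j * (B * ∫ y, ‖P y‖) := by
      intro j
      rw [← integral_const_mul, ← integral_const_mul]
      refine integral_mono (hint j).norm ((hP1.norm.const_mul _).const_mul _) fun y => ?_
      simp only
      rw [norm_mul, hf, concentratingProfile, norm_mul, norm_mul, Complex.norm_real,
        Real.norm_of_nonneg (by positivity : 0 ≤ q ^ j)]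
      calc ‖ε y‖ * (q ^ j * (‖P y‖ * ‖Φ _‖)) ≤ 1 * (q ^ j * (‖P y‖ * B)) := by
            gcongr
            · exact hε y
            · exact hB' _
        _ = _ := by ring
    have h := hasSum_integral_of_summable_integral_norm hint
      (Summable.of_nonneg_of_le (fun j => integral_nonneg fun y => norm_nonneg _) hnorm
        (hgeo.mul_right _))
    have e1 : (fun j : ℕ => ((q ^ j : ℝ) : ℂ) * 𝓕 (concentratingProfile P γ Φ (2 ^ j)) k) =
        fun j : ℕ => ∫ y, ε y * (((q ^ j : ℝ) : ℂ) * f j y) := by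
      funext j
      rw [Real.fourier_eq', ← integral_const_mul, hf]
      congr 1; funext y
      simp only [ε, smul_eq_mul]; ring
    have e2 : 𝓕 F k - 𝓕 (concentratingProfile P γ A 1) k =
        ∫ y, ∑' j : ℕ, ε y * (((q ^ j : ℝ) : ℂ) * f j y) := by
      rw [Real.fourier_eq', Real.fourier_eq', ← integral_sub]
      · congr 1; funext y
        rw [tsum_mul_left]
        have := (hF y).tsum_eq
        simp only [← hf] at this
        rw [this]
        simp only [ε, smul_eq_mul]; ring
      · exact hF1.bdd_mul hεc.aestronglyMeasurable (.of_forall hε)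
      · rw [← hfA]
        exact fA.integrable.bdd_mul hεc.aestronglyMeasurable (.of_forall hε)
    rw [e1, e2]
    exact h
  -- The `H^κ` norm of the `j`-th term is at most a multiple of `q^j (2^j)^{κ-1}`.
  have hD : MemLp (fun k => besselSymbol 2 κ k * (𝓕 F k - 𝓕 (concentratingProfile P γ A 1) k)) 2 := by
    refine memLp_of_hasSum (by norm_num) (f := fun j k => ((q ^ j : ℝ) : ℂ) *
        (besselSymbol 2 κ k * 𝓕 (concentratingProfile P γ Φ (2 ^ j)) k))
      (fun j => ?_) (.of_forall fun k => ?_)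
      (a := fun j => C * (q * 2 ^ (κ - 1)) ^ j) (fun j => by positivity)
      ((summable_geometric_of_lt_one (by positivity) hqκ).mul_left _) fun j => ?_
    · have h1 : Continuous (𝓕 (concentratingProfile P γ Φ (2 ^ j))) := by
        rw [← hf]; exact continuous_fourier_of_integrable (f j).integrable
      exact (continuous_const.mul (hbc.mul h1)).aestronglyMeasurable
    · have := (hser k).mul_left (besselSymbol 2 κ k)
      have e : (fun j : ℕ => besselSymbol 2 κ k * (((q ^ j : ℝ) : ℂ) *
          𝓕 (concentratingProfile P γ Φ (2 ^ j)) k)) = fun j : ℕ => ((q ^ j : ℝ) : ℂ) *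
          (besselSymbol 2 κ k * 𝓕 (concentratingProfile P γ Φ (2 ^ j)) k) := by
        funext j; ring
      rw [e] at this
      exact this
    · have h := eLpNorm_const_smul ((q ^ j : ℝ) : ℂ)
        (fun k => besselSymbol 2 κ k * 𝓕 (concentratingProfile P γ Φ (2 ^ j)) k) 2
        (volume : Measure E2)
      refine h.le.trans ?_
      refine (mul_le_mul_right (hC (2 ^ j) (one_le_pow₀ (by norm_num))) _).trans ?_
      rw [← ofReal_norm, Complex.norm_real, Real.norm_of_nonneg (by positivity),
        ← ENNReal.ofReal_mul (by positivity)]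
      refine ENNReal.ofReal_le_ofReal (le_of_eq ?_)
      have e : ((2 : ℝ) ^ j) ^ κ * ((2 : ℝ) ^ j)⁻¹ = (2 ^ (κ - 1)) ^ j := by
        rw [← Real.rpow_natCast, ← Real.rpow_natCast, ← Real.rpow_mul (by norm_num),
          ← Real.rpow_mul (by norm_num), ← Real.rpow_neg (by norm_num),
          ← Real.rpow_add (by norm_num)]
        congr 1; ring
      rw [mul_pow, ← e]; ring
  have := hD.add hA
  convert this using 1
  funext k
  simp only [Pi.add_apply]
  ring

/-! ### Sobolev regularity of the amplitude -/

/-- The radial projection `x ↦ x/|x|` onto the sphere, with an arbitrary value at the origin. -/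
def radialProjection (x : E3) : S2 :=
  if hx : x = 0 then ⟨EuclideanSpace.single 0 1, by simp⟩
  else ⟨‖x‖⁻¹ • x, by simp [norm_smul, hx]⟩

theorem radialProjection_coe_of_ne_zero {x : E3} (hx : x ≠ 0) :
    (radialProjection x : E3) = ‖x‖⁻¹ • x := by
  simp [radialProjection, hx]

theorem radialProjection_coe (w : S2) : radialProjection w = w := by
  have h1 : ‖(w : E3)‖ = 1 := by simp
  have h : (w : E3) ≠ 0 := by intro h; simp [h] at h1
  apply Subtype.ext
  rw [radialProjection_coe_of_ne_zero h, h1]; simp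

theorem contMDiffAt_radialProjection {x : E3} (hx : x ≠ 0) :
    ContMDiffAt 𝓘(ℝ, E3) (𝓡 2) ∞ radialProjection x := by
  have : Fact (Module.finrank ℝ E3 = 2 + 1) := ⟨by simp⟩
  let U : TopologicalSpace.Opens E3 := ⟨{0}ᶜ, isOpen_compl_singleton⟩
  have hU : ∀ y : U, (y : E3) ≠ 0 := fun y => y.2
  have h1 : ContMDiff 𝓘(ℝ, E3) 𝓘(ℝ, E3) ∞ (fun y : U => ‖(y : E3)‖⁻¹ • (y : E3)) := by
    intro y
    have h2 : ContMDiffAt 𝓘(ℝ, E3) 𝓘(ℝ, E3) ∞ (fun y : E3 => ‖y‖⁻¹ • y) (y : E3) := by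
      rw [contMDiffAt_iff_contDiffAt]
      exact ((contDiffAt_norm ℝ (hU y)).inv (norm_ne_zero_iff.2 (hU y))).smul contDiffAt_id
    exact contMDiffAt_subtype_iff.2 h2
  have h3 := h1.codRestrict_sphere (n := 2) (fun y => by
    simp [norm_smul, hU y])
  have h4 := h3 ⟨x, hx⟩
  have e : Set.codRestrict (fun y : U => ‖(y : E3)‖⁻¹ • (y : E3)) (Metric.sphere (0 : E3) 1)
      (fun y => by simp [norm_smul, hU y]) = fun y : U => radialProjection y := by
    funext y
    apply Subtype.ext
    rw [radialProjection_coe_of_ne_zero (hU y)]; rfl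
  rw [e] at h4
  exact (contMDiffAt_subtype_iff (U := U) (x := ⟨x, hx⟩)).1 h4

/-- A chart of the sphere is Lipschitz for the chordal distance on compact sets. -/
theorem exists_norm_sub_le_of_chart {e : OpenPartialHomeomorph S2 E2}
    (he : e ∈ IsManifold.maximalAtlas (𝓡 2) ∞ S2) {K : Set E2} (hK : IsCompact K)
    (hKe : K ⊆ e.target) : ∃ L : ℝ, 0 < L ∧ ∀ y ∈ K, ∀ y' ∈ K,
      ‖y - y'‖ ≤ L * ‖(e.symm y : E3) - e.symm y'‖ := by
  have : Fact (Module.finrank ℝ E3 = 2 + 1) := ⟨by simp⟩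
  -- The inverse of `e.symm` on the sphere extends to `x ↦ e(x/|x|)`, which is smooth near the
  -- compact set `K'` and thus Lipschitz on it.
  set K' : Set E3 := (fun y => (e.symm y : E3)) '' K with hK'
  have hK'c : IsCompact K' := hK.image_of_continuousOn
    (continuous_subtype_val.comp_continuousOn (e.continuousOn_symm.mono hKe))
  have hlip : LocallyLipschitzOn K' (fun x => e (radialProjection x)) := by
    rintro _ ⟨y, hy, rfl⟩
    have h0 : (e.symm y : E3) ≠ 0 := by
      intro h
      have h1 : ‖(e.symm y : E3)‖ = 1 := by simp
      simp [h] at h1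
    have hc : ContMDiffAt 𝓘(ℝ, E3) (𝓡 2) ∞ (fun x => e (radialProjection x)) (e.symm y : E3) := by
      refine ContMDiffAt.comp (I' := 𝓡 2) (g := e) _ ?_ (contMDiffAt_radialProjection h0)
      rw [radialProjection_coe]
      exact contMDiffAt_of_mem_maximalAtlas he (e.map_target (hKe hy))
    have hc' : ContDiffAt ℝ 1 (fun x => e (radialProjection x)) (e.symm y : E3) :=
      (contMDiffAt_iff_contDiffAt.1 hc).of_le (by norm_cast)
    obtain ⟨C, t, ht, hCt⟩ := hc'.exists_lipschitzOnWith
    exact ⟨C, t, mem_nhdsWithin_of_mem_nhds ht, hCt⟩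
  obtain ⟨L, hL⟩ := hlip.exists_lipschitzOnWith_of_compact hK'c
  refine ⟨L + 1, by positivity, fun y hy y' hy' => ?_⟩
  have h := hL.dist_le_mul _ ⟨y, hy, rfl⟩ _ ⟨y', hy', rfl⟩
  simp only [radialProjection_coe] at h
  rw [e.right_inv (hKe hy), e.right_inv (hKe hy'), dist_eq_norm, dist_eq_norm] at h
  refine h.trans ?_
  gcongr
  simp

/-- A map that is smooth on an open set agrees near a compact subset with a globally smooth one. -/
theorem exists_contDiff_eqOn_of_isCompact {f : E2 → E3} {s K : Set E2} (hs : IsOpen s)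
    (hf : ContDiffOn ℝ ∞ f s) (hK : IsCompact K) (hKs : K ⊆ s) :
    ∃ g : E2 → E3, ContDiff ℝ ∞ g ∧ ∀ y ∈ K, g y = f y := by
  obtain ⟨K', hK'c, hKK', hK's⟩ := exists_compact_between hK hs hKs
  obtain ⟨φ, hφ1, hφ0, -⟩ := exists_contMDiffMap_one_nhds_of_subset_interior (n := ⊤)
    (𝓘(ℝ, E2)) hK.isClosed hKK'
  refine ⟨fun y => φ y • f y, ?_, fun y hy => ?_⟩
  · rw [contDiff_iff_contDiffAt]
    intro y
    by_cases hy : y ∈ K'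
    · exact (φ.contMDiff.contDiff.contDiffAt).smul (hf.contDiffAt (hs.mem_nhds (hK's hy)))
    · have : (fun y => φ y • f y) =ᶠ[𝓝 y] fun _ => 0 := by
        filter_upwards [hK'c.isClosed.isOpen_compl.mem_nhds hy] with z hz
        rw [hφ0 z hz, zero_smul]
      exact contDiffAt_const.congr_of_eventuallyEq this
  · simp [hφ1.self_of_nhdsSet y hy]

theorem contDiffOn_chart_symm_coe {e : OpenPartialHomeomorph S2 E2}
    (he : e ∈ IsManifold.maximalAtlas (𝓡 2) ∞ S2) :
    ContDiffOn ℝ ∞ (fun y => (e.symm y : E3)) e.target := by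
  have : Fact (Module.finrank ℝ E3 = 2 + 1) := ⟨by simp⟩
  rw [← contMDiffOn_iff_contDiffOn]
  exact (contMDiff_coe_sphere (m := ∞) (n := 2) (E := E3)).comp_contMDiffOn
    (contMDiffOn_symm_of_mem_maximalAtlas he)

/-- In a chart, `w ↦ V̂(λ(θ - w))` is a dyadic superposition of profiles concentrating at the zero
of `γ(y) = (λ/2π)(θ - w(y))`. As the dyadic ratio is `2^{3-m}`, the sum is in `H^κ` for `3 - m + κ
- 1 < 0`. -/
theorem memSobolevSphere_leadingAmplitude {m : ℝ} (hm : 3 < m) {V v : E3 → ℝ}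
    (hV : ContDiff ℝ ∞ V)
    (hhom : ∀ x : E3, 1 < ‖x‖ → V x = ‖x‖ ^ (-m) * v (‖x‖⁻¹ • x)) {lam : ℝ} (hlam : 0 < lam)
    (θ : S2) {κ : ℝ} (hκ : κ < m - 2) :
    MemSobolevSphere κ (fun w : S2 => leadingAmplitude V lam θ w) := by
  intro e he χ hχ hχc hχt
  set c0 : ℝ := lam / (2 * Real.pi) with hc0
  have hc0p : 0 < c0 := by positivity
  have hγ0 : ContDiffOn ℝ ∞ (fun y => c0 • ((θ : E3) - e.symm y)) e.target :=
    (contDiffOn_const.sub (contDiffOn_chart_symm_coe he)).const_smul c0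
  obtain ⟨γ, hγs, hγeq⟩ := exists_contDiff_eqOn_of_isCompact e.open_target hγ0 hχc hχt
  obtain ⟨L, hL0, hL⟩ := exists_norm_sub_le_of_chart he hχc hχt
  -- The zero `θ` of the phase need not lie in the chart. The minimizer `y₀` of `|γ|` replaces it:
  -- `|γ(y) - γ(y₀)| ≤ |γ(y)| + |γ(y₀)| ≤ 2 |γ(y)|`.
  have hy0 : ∃ y₀ : E2, ∀ y ∈ tsupport χ, c0 / (2 * L) * ‖y - y₀‖ ≤ ‖γ y‖ := by
    rcases (tsupport χ).eq_empty_or_nonempty with h | h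
    · exact ⟨0, by simp [h]⟩
    · obtain ⟨y₀, hy₀, hmin⟩ := hχc.exists_isMinOn h (f := fun y => ‖γ y‖)
        hγs.continuous.norm.continuousOn
      refine ⟨y₀, fun y hy => ?_⟩
      have h1 : ‖γ y₀‖ ≤ ‖γ y‖ := hmin hy
      have h2 : c0 * ‖(e.symm y : E3) - e.symm y₀‖ ≤ 2 * ‖γ y‖ := by
        have e1 : c0 • ((e.symm y : E3) - e.symm y₀) = γ y₀ - γ y := by
          rw [hγeq y hy, hγeq y₀ hy₀]; module
        have e2 := norm_sub_le (γ y₀) (γ y)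
        rw [← e1, norm_smul, Real.norm_of_nonneg hc0p.le] at e2
        linarith
      have h3 := hL y hy y₀ hy₀
      rw [div_mul_eq_mul_div, div_le_iff₀ (by positivity)]
      nlinarith
  obtain ⟨y₀, hy₀⟩ := hy0
  obtain ⟨W, U, -, -, hWU⟩ := exists_dyadic_decomposition (m := m) hV hhom
  -- The estimates need `κ ≥ 0`; the other spaces are larger than `L²`.
  set κ' := max κ 0 with hκ'
  have hκ'm : κ' < m - 2 := max_lt hκ (by linarith)
  have hq : dyadicRatio m * 2 ^ (κ' - 1) < 1 := by
    rw [dyadicRatio, ← Real.rpow_add (by norm_num)]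
    exact Real.rpow_lt_one_of_one_lt_of_neg (by norm_num) (by linarith)
  set P : E2 → ℂ := fun y => (c0 : ℂ) * χ y with hP
  have hPs : ContDiff ℝ ∞ P := contDiff_const.mul hχ
  have hPt : tsupport P ⊆ tsupport χ := closure_mono (by
    intro y hy hχy; exact hy (by simp [hP, hχy]))
  have hPc : HasCompactSupport P := hχc.mul_left
  obtain ⟨T, hT, hTκ⟩ := exists_memSobolev_of_dyadic (q := dyadicRatio m) (κ := κ')
    (dyadicRatio_pos m) (dyadicRatio_lt_one hm) (le_max_right _ _) hq hPs hPc hγs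
    (y₀ := y₀) (c := c0 / (2 * L)) (by positivity) (fun y hy => hy₀ y (hPt hy)) (𝓕 W) (𝓕 U)
    (F := fun y => χ y * leadingAmplitude V lam θ (e.symm y)) (fun y => by
      by_cases hy : y ∈ tsupport χ
      · have hVint := integrable_potential hm hV.continuous hhom
        have h := hasSum_fourier_dyadic hm hWU (γ y)
        have h2 : 𝓕 (fun x => (V x : ℂ) - W x) (γ y) = 𝓕 (fun x => (V x : ℂ)) (γ y) - 𝓕 W (γ y) := by
          rw [SchwartzMap.fourier_coe, Real.fourier_eq, Real.fourier_eq, Real.fourier_eq,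
            ← integral_sub]
          · simp only [smul_sub]
          · exact (Real.fourierIntegral_convergent_iff _).2 hVint.ofReal
          · exact (Real.fourierIntegral_convergent_iff _).2 W.integrable
        rw [h2] at h
        have h3 := h.mul_left (P y)
        have e1 : (fun j : ℕ => P y * (((dyadicRatio m ^ j : ℝ) : ℂ) * 𝓕 U ((2 : ℝ) ^ j • γ y))) =
            fun j : ℕ => ((dyadicRatio m ^ j : ℝ) : ℂ) *
              concentratingProfile P γ (𝓕 U) (2 ^ j) y := by
          funext j; rw [concentratingProfile]; ring
        have e2 : P y * (𝓕 (fun x => (V x : ℂ)) (γ y) - 𝓕 W (γ y)) =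
            χ y * leadingAmplitude V lam θ (e.symm y) - concentratingProfile P γ (𝓕 W) 1 y := by
          rw [concentratingProfile, leadingAmplitude, potentialFourier_eq_fourier, one_smul,
            smul_smul, hγeq y hy]
          have : (2 * Real.pi)⁻¹ * lam = c0 := by rw [hc0]; ring
          rw [this]; simp only [hP]; ring
        rw [e1, e2] at h3
        exact h3
      · have h0 : χ y = 0 := image_eq_zero_of_notMem_tsupport hy
        have h1 : P y = 0 := by simp [hP, h0]
        simp only [concentratingProfile, h0, h1, zero_mul, mul_zero, sub_zero]
        exact hasSum_zero)
  exact ⟨T, hT, hTκ.mono (le_max_left _ _)⟩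

theorem contDiffAt_fourier_potential {m : ℝ} (hm : 3 < m) {V v : E3 → ℝ} (hV : ContDiff ℝ ∞ V)
    (hhom : ∀ x : E3, 1 < ‖x‖ → V x = ‖x‖ ^ (-m) * v (‖x‖⁻¹ • x)) {η : E3} (hη : η ≠ 0) :
    ContDiffAt ℝ ∞ (𝓕 (fun x => (V x : ℂ))) η := by
  obtain ⟨W, U, -, hU, hWU⟩ := exists_dyadic_decomposition (m := m) hV hhom
  exact contDiffAt_fourier_of_dyadic hm hWU (integrable_potential hm hV.continuous hhom).ofReal hη

/-! ### Slices of space, stereographic charts and oscillatory integrals -/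

/-- If a linear isometry `ι` embeds the plane as the orthogonal complement of the unit vector `θ`,
then `(y, s) ↦ ι y + s θ` preserves the Lebesgue measure. -/
theorem exists_slice_measurePreserving (ι : E2 →ₗᵢ[ℝ] E3) {θ : E3} (hθ : ‖θ‖ = 1)
    (hι : ∀ y, inner ℝ (ι y) θ = 0) :
    ∃ e : E2 × ℝ ≃ᵐ E3, MeasurePreserving e volume volume ∧ ∀ p, e p = ι p.1 + p.2 • θ := by
  let L0 : WithLp 2 (E2 × ℝ) →ₗ[ℝ] E3 :=
    { toFun := fun p => ι p.fst + p.snd • θ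
      map_add' := fun p q => by
        simp only [WithLp.add_fst, WithLp.add_snd, map_add]; module
      map_smul' := fun c p => by
        simp only [WithLp.smul_fst, WithLp.smul_snd, map_smul, RingHom.id_apply, smul_eq_mul]
        module }
  let L : WithLp 2 (E2 × ℝ) →ₗᵢ[ℝ] E3 := ⟨L0, fun p => by
    have h1 : ‖ι p.fst + p.snd • θ‖ ^ 2 = ‖p‖ ^ 2 := by
      rw [WithLp.prod_norm_sq_eq_of_L2, norm_add_sq_real, inner_smul_right, hι, norm_smul, hθ,
        ι.norm_map]
      ring
    exact (pow_left_inj₀ (norm_nonneg _) (norm_nonneg _) two_ne_zero).1 h1⟩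
  have hfr : Module.finrank ℝ (WithLp 2 (E2 × ℝ)) = Module.finrank ℝ E3 := by
    rw [(WithLp.linearEquiv 2 ℝ (E2 × ℝ)).finrank_eq]
    simp
  let Le := L.toLinearIsometryEquiv hfr
  refine ⟨(MeasurableEquiv.toLp 2 (E2 × ℝ)).trans Le.toMeasurableEquiv, ?_, fun p => rfl⟩
  exact Le.measurePreserving.comp (WithLp.volume_preserving_toLp (U := E2) (V := ℝ))

theorem exists_isometry_orthogonal (θ : S2) :
    ∃ ι : E2 →ₗᵢ[ℝ] E3, ∀ y, inner ℝ (ι y) (θ : E3) = 0 := by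
  have : Fact (Module.finrank ℝ E3 = 2 + 1) := ⟨by simp⟩
  refine ⟨(Submodule.subtypeₗᵢ (ℝ ∙ (θ : E3))ᗮ).comp
    (OrthonormalBasis.fromOrthogonalSpanSingleton 2
      (ne_zero_of_mem_unit_sphere θ)).repr.symm.toLinearIsometry, fun y => ?_⟩
  have := (((OrthonormalBasis.fromOrthogonalSpanSingleton 2
      (ne_zero_of_mem_unit_sphere θ)).repr.symm y).2)
  rw [Submodule.mem_orthogonal_singleton_iff_inner_left] at this
  exact this

/-- The chart of the sphere by stereographic projection from `-θ`, which is centred at `θ`. -/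
theorem exists_stereographic_chart (θ : S2) :
    ∃ e ∈ IsManifold.maximalAtlas (𝓡 2) ∞ S2, e.target = Set.univ ∧
      ∃ ι : E2 →ₗᵢ[ℝ] E3, (∀ y, inner ℝ (ι y) (θ : E3) = 0) ∧
        ∀ y, (θ : E3) - e.symm y = (‖y‖ ^ 2 + 4)⁻¹ • ((2 * ‖y‖ ^ 2) • (θ : E3) - (4 : ℝ) • ι y) := by
  have : Fact (Module.finrank ℝ E3 = 2 + 1) := ⟨by simp⟩
  refine ⟨stereographic' 2 (-θ), ?_, by simp, (Submodule.subtypeₗᵢ (ℝ ∙ ((-θ : S2) : E3))ᗮ).comp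
    (OrthonormalBasis.fromOrthogonalSpanSingleton 2
      (ne_zero_of_mem_unit_sphere (-θ))).repr.symm.toLinearIsometry, fun y => ?_, fun y => ?_⟩
  · apply IsManifold.subset_maximalAtlas
    have h : chartAt E2 θ = stereographic' 2 (-θ) := rfl
    rw [← h]
    exact chart_mem_atlas E2 θ
  · have := (((OrthonormalBasis.fromOrthogonalSpanSingleton 2
      (ne_zero_of_mem_unit_sphere (-θ))).repr.symm y).2)
    rw [Submodule.mem_orthogonal_singleton_iff_inner_left] at this
    have h2 : inner ℝ (((OrthonormalBasis.fromOrthogonalSpanSingleton 2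
      (ne_zero_of_mem_unit_sphere (-θ))).repr.symm y : E3)) (-(θ : E3)) = 0 := this
    rw [inner_neg_right, neg_eq_zero] at h2
    exact h2
  · rw [stereographic'_symm_apply]
    dsimp only
    set z : E3 := (((OrthonormalBasis.fromOrthogonalSpanSingleton 2
      (ne_zero_of_mem_unit_sphere (-θ))).repr.symm y : E3)) with hz
    have hzn : ‖z‖ = ‖y‖ := by
      rw [hz, ← Submodule.coe_norm, LinearIsometryEquiv.norm_map]
    rw [hzn]
    have hv : ((-θ : S2) : E3) = -(θ : E3) := rfl
    change (θ : E3) - _ = (‖y‖ ^ 2 + 4)⁻¹ • ((2 * ‖y‖ ^ 2) • (θ : E3) - (4 : ℝ) • z)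
    simp only [hv]
    have h4 : ‖y‖ ^ 2 + 4 ≠ 0 := by positivity
    have e1 : (θ : E3) = (‖y‖ ^ 2 + 4)⁻¹ • ((‖y‖ ^ 2 + 4) • (θ : E3)) := by
      rw [smul_smul, inv_mul_cancel₀ h4, one_smul]
    nth_rewrite 1 [e1]
    module

/-- Repeated derivatives of a Fourier transform are Fourier transforms. -/
theorem exists_fourier_eq_iterate_lineDeriv (β : 𝓢(E2, ℂ)) (v : E2) (N : ℕ) :
    ∃ b : 𝓢(E2, ℂ), (∀ k, b k = (-(2 * Real.pi * Complex.I)) ^ N *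
      ((inner ℝ k v : ℝ) : ℂ) ^ N * β k) ∧
      𝓕 b = (LineDeriv.lineDerivOp v)^[N] (𝓕 β) := by
  induction N with
  | zero => exact ⟨β, fun k => by simp, rfl⟩
  | succ N ih =>
    obtain ⟨b, hb, hbF⟩ := ih
    refine ⟨-(2 * Real.pi * Complex.I) • SchwartzMap.smulLeftCLM ℂ
      (fun k => inner ℝ k v) b, fun k => ?_, ?_⟩
    · have hg : (fun k : E2 => inner ℝ k v).HasTemperateGrowth :=
        ((innerSL ℝ).flip v).hasTemperateGrowth
      rw [smul_apply, SchwartzMap.smulLeftCLM_apply_apply hg, hb, smul_eq_mul, Complex.real_smul]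
      ring
    · rw [Function.iterate_succ_apply', ← hbF, SchwartzMap.lineDerivOp_fourier_eq]

/-- Each integration by parts in an oscillatory integral with phase `x · γ(ε z) / ε` gains a factor
`ε + |x|`. -/
theorem norm_integral_rescaled_phase_le {γ : E2 → E3} (hγ : ContDiff ℝ ∞ γ) (v : E2)
    (ψ : 𝓢(E2, ℂ)) (N : ℕ) : ∀ (P : E2 → ℂ) (_ : ContDiff ℝ ∞ P) (_ : HasCompactSupport P),
    ∃ C : ℝ, 0 ≤ C ∧ ∀ ε : ℝ, 0 < ε → ∀ x : E3,
      ‖∫ z : E2, P (ε • z) * Complex.exp (-Complex.I * ((inner ℝ x (ε⁻¹ • γ (ε • z)) : ℝ) : ℂ)) *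
        ((LineDeriv.lineDerivOp v)^[N] ψ : 𝓢(E2, ℂ)) z‖ ≤ C * (ε + ‖x‖) ^ N := by
  induction N with
  | zero =>
    intro P hP hPc
    obtain ⟨M, hM⟩ := hP.continuous.bounded_above_of_compact_support hPc
    have hM0 : 0 ≤ M := (norm_nonneg _).trans (hM 0)
    refine ⟨M * ∫ z, ‖ψ z‖, by positivity, fun ε hε x => ?_⟩
    rw [pow_zero, mul_one, ← integral_const_mul]
    refine norm_integral_le_of_norm_le (ψ.integrable.norm.const_mul M) (.of_forall fun z => ?_)
    rw [norm_mul, norm_mul, Function.iterate_zero, id]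
    have h1 : ‖Complex.exp (-Complex.I * ((inner ℝ x (ε⁻¹ • γ (ε • z)) : ℝ) : ℂ))‖ = 1 := by
      rw [Complex.norm_exp]; simp
    rw [h1, mul_one]
    gcongr
    exact hM _
  | succ N ih =>
    intro P hP hPc
    have hPv : ContDiff ℝ ∞ (fun y => fderiv ℝ P y v) := (hP.fderiv_right (m := ∞) (by simp)).clm_apply contDiff_const
    have hγv : ContDiff ℝ ∞ (fun y => fderiv ℝ γ y v) := (hγ.fderiv_right (m := ∞) (by simp)).clm_apply contDiff_const
    have hPvc : HasCompactSupport (fun y => fderiv ℝ P y v) := hPc.fderiv_apply (𝕜 := ℝ) v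
    have hγi : ∀ i : Fin 3, ContDiff ℝ ∞ (fun y => P y * ((fderiv ℝ γ y v i : ℝ) : ℂ)) := fun i =>
      hP.mul (Complex.ofRealCLM.contDiff.comp ((contDiff_euclidean.1 hγv) i))
    obtain ⟨C0, hC00, hC0⟩ := ih _ hPv hPvc
    choose C hC0' hC using fun i : Fin 3 => ih _ (hγi i) hPc.mul_right
    refine ⟨C0 + ∑ i, C i, add_nonneg hC00 (Finset.sum_nonneg fun i _ => hC0' i), fun ε hε x => ?_⟩
    set E : E2 → ℂ := fun z => Complex.exp (-Complex.I * ((inner ℝ x (ε⁻¹ • γ (ε • z)) : ℝ) : ℂ))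
      with hE
    have hγε : ContDiff ℝ ∞ fun z => γ (ε • z) := hγ.comp (contDiff_const_smul ε)
    have hEs : ContDiff ℝ ∞ E := by
      refine ContDiff.cexp (contDiff_const.mul (Complex.ofRealCLM.contDiff.comp ?_))
      exact contDiff_const.inner ℝ (hγε.const_smul ε⁻¹)
    have hPε : ContDiff ℝ ∞ fun z => P (ε • z) := hP.comp (contDiff_const_smul ε)
    have hPεc : HasCompactSupport fun z => P (ε • z) := hPc.comp_smul hε.ne'
    -- Integration by parts in the direction `v`. The derivative of the amplitude gains `ε`, that
    -- of the phase gains `x`, for the scalings of `γ` by `1/ε` and of `z` by `ε` cancel.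
    let f : 𝓢(E2, ℂ) := (hPεc.mul_right (f' := E)).toSchwartzMap (hPε.mul hEs)
    have hf : ∀ z, f z = P (ε • z) * E z := fun z => rfl
    have hder : ∀ z, (LineDeriv.lineDerivOp v f : 𝓢(E2, ℂ)) z = (ε : ℂ) * (fderiv ℝ P (ε • z) v * E z) +
        ∑ i, (-Complex.I * (x i : ℂ)) * (P (ε • z) * ((fderiv ℝ γ (ε • z) v i : ℝ) : ℂ) * E z) := by
      intro z
      rw [SchwartzMap.lineDerivOp_apply_eq_fderiv]
      have hs : HasFDerivAt (fun z : E2 => ε • z) (ε • ContinuousLinearMap.id ℝ E2) z :=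
        (hasFDerivAt_id z).const_smul ε
      have hPd : HasFDerivAt (fun z => P (ε • z)) _ z :=
        (hP.differentiable (by simp) (ε • z)).hasFDerivAt.comp z hs
      have hγd : HasFDerivAt (fun z => γ (ε • z)) _ z :=
        (hγ.differentiable (by simp) (ε • z)).hasFDerivAt.comp z hs
      have hid : HasFDerivAt (fun z => inner ℝ x (ε⁻¹ • γ (ε • z))) _ z :=
        (innerSL ℝ x).hasFDerivAt.comp z (hγd.const_smul ε⁻¹)
      have hEd : HasFDerivAt E _ z :=
        ((Complex.ofRealCLM.hasFDerivAt.comp z hid).const_mul (-Complex.I)).cexp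
      have hfd : HasFDerivAt f _ z := hPd.mul hEd
      rw [hfd.fderiv]
      have e1 : inner ℝ x (fderiv ℝ γ (ε • z) v) = ∑ i, x i * fderiv ℝ γ (ε • z) v i := by
        rw [PiLp.inner_apply]; simp [mul_comm]
      simp only [add_apply, smul_apply, ContinuousLinearMap.comp_apply, smul_eq_mul,
        ContinuousLinearMap.id_apply, map_smul, innerSL_apply_apply, Complex.ofRealCLM_apply,
        Complex.real_smul, smul_smul, inv_mul_cancel₀ hε.ne', one_smul]
      rw [e1]
      change P (ε • z) * (E z * -Complex.I) * _ + _ = _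
      push_cast
      rw [Finset.mul_sum, add_comm]
      congr 1
      · ring
      · exact Finset.sum_congr rfl fun i _ => by ring
    rw [Function.iterate_succ_apply']
    have hibp := SchwartzMap.integral_mul_lineDerivOp_right_eq_neg_left (μ := volume) f
      ((LineDeriv.lineDerivOp v)^[N] ψ) v
    simp only [hf] at hibp
    rw [hibp, norm_neg]
    set g : 𝓢(E2, ℂ) := (LineDeriv.lineDerivOp v)^[N] ψ with hg
    have hbi : ∀ (Q : E2 → ℂ), ContDiff ℝ ∞ Q → HasCompactSupport Q →
        Integrable fun z => Q (ε • z) * E z * g z := fun Q hQ hQc =>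
      (((hQ.continuous.comp (continuous_const_smul ε)).mul hEs.continuous).mul
        g.continuous).integrable_of_hasCompactSupport ((hQc.comp_smul hε.ne').mul_right.mul_right)
    have e2 : ∀ z, (LineDeriv.lineDerivOp v f : 𝓢(E2, ℂ)) z * g z =
        (ε : ℂ) * (fderiv ℝ P (ε • z) v * E z * g z) + ∑ i, (-Complex.I * (x i : ℂ)) *
          ((P (ε • z) * ((fderiv ℝ γ (ε • z) v i : ℝ) : ℂ)) * E z * g z) := by
      intro z
      rw [hder, add_mul, Finset.sum_mul]
      congr 1
      · ring
      · exact Finset.sum_congr rfl fun i _ => by ring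
    simp only [e2]
    rw [integral_add ((hbi _ hPv hPvc).const_mul _)
      (integrable_finsetSum _ fun i _ => (hbi _ (hγi i) hPc.mul_right).const_mul _),
      integral_finsetSum _ fun i _ => (hbi _ (hγi i) hPc.mul_right).const_mul _, integral_const_mul]
    simp only [integral_const_mul]
    refine (norm_add_le _ _).trans ?_
    rw [add_mul, Finset.sum_mul]
    refine add_le_add ?_ ((norm_sum_le _ _).trans (Finset.sum_le_sum fun i _ => ?_))
    · rw [norm_mul, Complex.norm_real, Real.norm_of_nonneg hε.le]
      calc ε * _ ≤ (ε + ‖x‖) * (C0 * (ε + ‖x‖) ^ N) :=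
            mul_le_mul (by linarith [norm_nonneg x]) (hC0 ε hε x) (norm_nonneg _) (by positivity)
        _ = _ := by ring
    · rw [norm_mul, norm_mul, norm_neg, Complex.norm_I, one_mul, Complex.norm_real]
      calc ‖x i‖ * _ ≤ (ε + ‖x‖) * (C i * (ε + ‖x‖) ^ N) :=
            mul_le_mul (by linarith [PiLp.norm_apply_le x i]) (hC i ε hε x) (norm_nonneg _)
              (by positivity)
        _ = _ := by ring

/-! ### High frequency components of Sobolev distributions -/

theorem sq_integral_norm_mul_le {α : Type*} [MeasurableSpace α] {μ : Measure α} {f g : α → ℂ}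
    (hf : MemLp f 2 μ) (hg : MemLp g 2 μ) :
    (∫ x, ‖f x‖ * ‖g x‖ ∂μ) ^ 2 ≤ (∫ x, ‖f x‖ ^ 2 ∂μ) * ∫ x, ‖g x‖ ^ 2 ∂μ := by
  have h := integral_mul_le_Lp_mul_Lq_of_nonneg (μ := μ) Real.HolderConjugate.two_two
    (f := fun x => ‖f x‖) (g := fun x => ‖g x‖) (.of_forall fun x => norm_nonneg _)
    (.of_forall fun x => norm_nonneg _) (by simpa using hf.norm) (by simpa using hg.norm)
  have hF : 0 ≤ ∫ x, ‖f x‖ ^ 2 ∂μ := integral_nonneg fun x => by positivity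
  have hG : 0 ≤ ∫ x, ‖g x‖ ^ 2 ∂μ := integral_nonneg fun x => by positivity
  simp only [Real.rpow_two] at h
  rw [← Real.sqrt_eq_rpow, ← Real.sqrt_eq_rpow] at h
  calc _ ≤ (√(∫ x, ‖f x‖ ^ 2 ∂μ) * √(∫ x, ‖g x‖ ^ 2 ∂μ)) ^ 2 :=
        pow_le_pow_left₀ (integral_nonneg fun x => by positivity) h 2
    _ = _ := by rw [mul_pow, Real.sq_sqrt hF, Real.sq_sqrt hG]

/-- The high frequency components of a distribution in `H^κ(ℝ²)` decay faster than the scaling of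
the norm of `H^κ` alone would give. -/
theorem tendsto_pairing_of_memSobolev {κ : ℝ} (hκ : 0 ≤ κ) {T : 𝓢'(E2, ℂ)}
    (hT : TemperedDistribution.MemSobolev κ 2 T) (b : 𝓢(E2, ℂ)) {c : ℝ} (hc : 0 < c)
    (hb : ∀ k, ‖k‖ < c → b k = 0) (bt : ℝ → 𝓢(E2, ℂ))
    (hbt : ∀ t : ℝ, 0 < t → ∀ k, bt t k = (((t ^ 2)⁻¹ : ℝ) : ℂ) * b (t⁻¹ • k)) :
    Tendsto (fun t : ℝ => ((t ^ (κ + 1) : ℝ) : ℂ) * T (𝓕 (bt t))) atTop (𝓝 0) := by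
  rw [TemperedDistribution.memSobolev_iff_exists_smulLeftCLM_fourier] at hT
  obtain ⟨h, hh⟩ := hT
  -- On the Fourier side `T` is `⟨k⟩^{-κ} h(k)` with `h ∈ L²`.
  have hT' : ∀ f : 𝓢(E2, ℂ), T (𝓕 f) = ∫ k, besselSymbol 2 (-κ) k * f k * h k := by
    intro f
    have e1 : f = SchwartzMap.smulLeftCLM ℂ (besselSymbol 2 κ)
        (SchwartzMap.smulLeftCLM ℂ (besselSymbol 2 (-κ)) f) := by
      ext k
      rw [SchwartzMap.smulLeftCLM_apply_apply (besselSymbol_hasTemperateGrowth 2 κ),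
        SchwartzMap.smulLeftCLM_apply_apply (besselSymbol_hasTemperateGrowth 2 (-κ))]
      simp only [smul_eq_mul, besselSymbol, ← mul_assoc, ← Complex.ofReal_mul]
      rw [← Real.rpow_add (by positivity)]
      have : κ / 2 + -κ / 2 = 0 := by ring
      rw [this]; simp
    have e2 : T (𝓕 f) = (TemperedDistribution.smulLeftCLM ℂ (besselSymbol 2 κ) (𝓕 T))
        (SchwartzMap.smulLeftCLM ℂ (besselSymbol 2 (-κ)) f) := by
      rw [TemperedDistribution.smulLeftCLM_apply_apply, ← e1]; rfl
    rw [e2]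
    have hh' : TemperedDistribution.smulLeftCLM ℂ (besselSymbol 2 κ) (𝓕 T) =
      Lp.toTemperedDistribution h := hh
    rw [hh', Lp.toTemperedDistribution_apply]
    refine integral_congr_ae (.of_forall fun k => ?_)
    simp only [SchwartzMap.smulLeftCLM_apply_apply (besselSymbol_hasTemperateGrowth 2 (-κ)),
      smul_eq_mul]
  have hh2 : MemLp h 2 := Lp.memLp h
  -- The test function of scale `t` only sees frequencies `|k| ≥ c t`, where the mass of `h` tends
  -- to zero.
  set I : ℝ → ℝ := fun t => ∫ k, ‖Set.indicator {k : E2 | c * t ≤ ‖k‖} h k‖ ^ 2 with hI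
  have hmeas : ∀ t, MeasurableSet {k : E2 | c * t ≤ ‖k‖} := fun t =>
    measurableSet_le measurable_const measurable_norm
  have hIlim : Tendsto I atTop (𝓝 0) := by
    have h0 : (0 : ℝ) = ∫ _ : E2, (0 : ℝ) := by simp
    rw [h0]
    refine tendsto_integral_filter_of_dominated_convergence (fun k => ‖h k‖ ^ 2)
      (.of_forall fun t => ?_) (.of_forall fun t => .of_forall fun k => ?_) ?_
      (.of_forall fun k => ?_)
    · exact ((hh2.1.indicator (hmeas t)).norm.pow 2)
    · rw [Real.norm_of_nonneg (by positivity)]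
      gcongr
      exact norm_indicator_le_norm_self _ _
    · exact hh2.norm.integrable_sq
    · refine tendsto_const_nhds.congr' ?_
      filter_upwards [eventually_gt_atTop (‖k‖ / c)] with t ht
      rw [div_lt_iff₀ hc] at ht
      rw [Set.indicator_of_notMem]
      · simp
      · simp only [Set.mem_ofPred_eq, not_le]; linarith
  -- Cauchy-Schwarz, with `⟨k⟩^{-κ} ≤ (c t)^{-κ}` on these frequencies.
  have hbound : ∀ t : ℝ, 1 ≤ t → ‖((t ^ (κ + 1) : ℝ) : ℂ) * T (𝓕 (bt t))‖ ≤
      c ^ (-κ) * √((∫ k, ‖b k‖ ^ 2) * I t) := by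
    intro t ht
    have ht0 : 0 < t := by linarith
    rw [hT', norm_mul, Complex.norm_real, Real.norm_of_nonneg (by positivity)]
    have hbi : MemLp (bt t) 2 := (bt t).memLp 2
    have hgi : MemLp (Set.indicator {k : E2 | c * t ≤ ‖k‖} h) 2 := hh2.indicator (hmeas t)
    have h1 : ‖∫ k, besselSymbol 2 (-κ) k * bt t k * h k‖ ≤ (c * t) ^ (-κ) *
        ∫ k, ‖bt t k‖ * ‖Set.indicator {k : E2 | c * t ≤ ‖k‖} h k‖ := by
      rw [← integral_const_mul]
      refine norm_integral_le_of_norm_le ((hbi.norm.integrable_mul hgi.norm).const_mul _)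
        (.of_forall fun k => ?_)
      by_cases hk : c * t ≤ ‖k‖
      · rw [Set.indicator_of_mem (by exact hk), norm_mul, norm_mul, mul_assoc]
        gcongr
        rw [besselSymbol, Complex.norm_real, Real.norm_of_nonneg (by positivity), neg_div,
          Real.rpow_neg (by positivity), Real.rpow_neg (by positivity)]
        refine inv_anti₀ (by positivity) ?_
        have e : κ = 2 * (κ / 2) := by ring
        nth_rewrite 1 [e]
        rw [Real.rpow_mul (by positivity), Real.rpow_two]
        refine Real.rpow_le_rpow (by positivity) ?_ (by positivity)
        have := pow_le_pow_left₀ (by positivity) hk 2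
        linarith
      · have h0 : bt t k = 0 := by
          rw [hbt t ht0, hb, mul_zero]
          rw [norm_smul, Real.norm_of_nonneg (by positivity), inv_mul_lt_iff₀ ht0]
          linarith [not_le.1 hk]
        rw [h0]; simp
    have h2 := Real.le_sqrt_of_sq_le (sq_integral_norm_mul_le hbi hgi)
    have h3 : ∫ k, ‖bt t k‖ ^ 2 = (t ^ 2)⁻¹ * ∫ k, ‖b k‖ ^ 2 := by
      have e : (fun k => ‖bt t k‖ ^ 2) = fun k => ((t ^ 2)⁻¹) ^ 2 * ‖b (t⁻¹ • k)‖ ^ 2 := by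
        funext k
        rw [hbt t ht0, norm_mul, Complex.norm_real, Real.norm_of_nonneg (by positivity), mul_pow]
      rw [e, integral_const_mul, Measure.integral_comp_inv_smul volume (fun k => ‖b k‖ ^ 2) t]
      simp only [finrank_euclideanSpace, Fintype.card_fin, smul_eq_mul, abs_of_pos (pow_pos ht0 2)]
      field_simp
    have hB : 0 ≤ ∫ k, ‖b k‖ ^ 2 := integral_nonneg fun x => by positivity
    rw [h3, mul_assoc, Real.sqrt_mul (by positivity), Real.sqrt_inv, Real.sqrt_sq ht0.le] at h2
    calc t ^ (κ + 1) * ‖∫ k, besselSymbol 2 (-κ) k * bt t k * h k‖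
        ≤ t ^ (κ + 1) * ((c * t) ^ (-κ) * (t⁻¹ * √((∫ k, ‖b k‖ ^ 2) * I t))) := by
          gcongr
          exact h1.trans (by gcongr)
      _ = c ^ (-κ) * √((∫ k, ‖b k‖ ^ 2) * I t) := by
          rw [Real.mul_rpow hc.le ht0.le, Real.rpow_neg ht0.le, Real.rpow_add ht0, Real.rpow_one]
          have : t ^ κ ≠ 0 := (Real.rpow_pos_of_pos ht0 κ).ne'
          field_simp
  have hlim : Tendsto (fun t => c ^ (-κ) * √((∫ k, ‖b k‖ ^ 2) * I t)) atTop (𝓝 0) := by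
    have := ((hIlim.const_mul (∫ k, ‖b k‖ ^ 2)).sqrt).const_mul (c ^ (-κ))
    simpa using this
  exact squeeze_zero_norm' ((eventually_ge_atTop 1).mono fun t ht => hbound t ht) hlim

/-! ### Dilated potentials -/

/-- The oscillatory integral `∫ χ(εz) e^{-i x·γ(εz)/ε} ψ(z) dz`. -/
def rescaledPhaseIntegral (γ : E2 → E3) (χ ψ : E2 → ℂ) (ε : ℝ) (x : E3) : ℂ :=
  ∫ z : E2, χ (ε • z) * Complex.exp (-Complex.I * ((inner ℝ x (ε⁻¹ • γ (ε • z)) : ℝ) : ℂ)) * ψ z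

theorem norm_exp_neg_I_mul (a : ℝ) : ‖Complex.exp (-Complex.I * (a : ℂ))‖ = 1 := by
  rw [Complex.norm_exp]; simp

/-- Pairing a localized amplitude with a test function of scale `1/t` is pairing the dilated
potential with an oscillatory integral, by the change of variables `x ↦ t x`. -/
theorem integral_comp_mul_potentialFourier {V : E3 → ℝ} (hVi : Integrable V)
    {γ : E2 → E3} (hγ : Continuous γ) {χ : E2 → ℂ} (hχ : Continuous χ) (hχc : HasCompactSupport χ)
    (ψ : 𝓢(E2, ℂ)) (m : ℝ) {t : ℝ} (ht : 0 < t) :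
    ((t ^ (m - 1) : ℝ) : ℂ) * ∫ y, ψ (t • y) * (χ y * potentialFourier V (γ y)) =
      ∫ x, ((t ^ m * V (t • x) : ℝ) : ℂ) * rescaledPhaseIntegral γ χ ψ t⁻¹ x := by
  have e1 : ∫ y, ψ (t • y) * (χ y * potentialFourier V (γ y)) =
      ((t⁻¹ ^ 2 : ℝ) : ℂ) * ∫ z, ψ z * (χ (t⁻¹ • z) * potentialFourier V (γ (t⁻¹ • z))) := by
    have := Measure.integral_comp_smul_of_nonneg (μ := (volume : Measure E2))
      (fun z => ψ z * (χ (t⁻¹ • z) * potentialFourier V (γ (t⁻¹ • z)))) t (hR := ht.le)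
    simp only [smul_smul, inv_mul_cancel₀ ht.ne', one_smul, finrank_euclideanSpace,
      Fintype.card_fin] at this
    rw [this, Complex.real_smul, inv_pow]
  have e2 : ∀ ξ : E3, potentialFourier V ξ = ((t ^ 3 : ℝ) : ℂ) *
      ∫ x : E3, Complex.exp (-Complex.I * ((inner ℝ x (t • ξ) : ℝ) : ℂ)) * (V (t • x) : ℂ) := by
    intro ξ
    have := Measure.integral_comp_smul_of_nonneg (μ := (volume : Measure E3))
      (fun x : E3 => Complex.exp (-Complex.I * ((inner ℝ x ξ : ℝ) : ℂ)) * (V x : ℂ)) t (hR := ht.le)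
    simp only [finrank_euclideanSpace, Fintype.card_fin, inner_smul_left, conj_trivial] at this
    simp only [inner_smul_right]
    rw [this, potentialFourier, Complex.real_smul, ← mul_assoc, ← Complex.ofReal_mul,
      mul_inv_cancel₀ (by positivity), Complex.ofReal_one, one_mul]
  have hVt : Integrable (fun x : E3 => (V (t • x) : ℂ)) := (hVi.comp_smul ht.ne').ofReal
  have hψχ : Integrable (fun z => χ (t⁻¹ • z) * ψ z) :=
    ((hχ.comp (continuous_const_smul t⁻¹)).mul ψ.continuous).integrable_of_hasCompactSupport
      ((hχc.comp_smul (inv_ne_zero ht.ne')).mul_right)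
  have hswap : ∫ z, (∫ x : E3, (χ (t⁻¹ • z) * ψ z) * (Complex.exp (-Complex.I *
        ((inner ℝ x (t • γ (t⁻¹ • z)) : ℝ) : ℂ)) * (V (t • x) : ℂ))) =
      ∫ x : E3, ∫ z, (χ (t⁻¹ • z) * ψ z) * (Complex.exp (-Complex.I *
        ((inner ℝ x (t • γ (t⁻¹ • z)) : ℝ) : ℂ)) * (V (t • x) : ℂ)) := by
    refine integral_integral_swap ?_
    have hp := hψχ.mul_prod hVt
    have hc : Continuous fun p : E2 × E3 => Complex.exp (-Complex.I *
        ((inner ℝ p.2 (t • γ (t⁻¹ • p.1)) : ℝ) : ℂ)) := by fun_prop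
    have := hp.bdd_mul (c := 1) hc.aestronglyMeasurable
      (.of_forall fun p => (norm_exp_neg_I_mul _).le)
    refine this.congr (.of_forall fun p => ?_)
    simp only [Function.uncurry]
    ring
  have e3 : ∫ z, ψ z * (χ (t⁻¹ • z) * potentialFourier V (γ (t⁻¹ • z))) = ((t ^ 3 : ℝ) : ℂ) *
      ∫ z, (∫ x : E3, (χ (t⁻¹ • z) * ψ z) * (Complex.exp (-Complex.I *
        ((inner ℝ x (t • γ (t⁻¹ • z)) : ℝ) : ℂ)) * (V (t • x) : ℂ))) := by
    rw [← integral_const_mul]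
    congr 1; funext z
    rw [e2, integral_const_mul]; ring
  rw [e1, e3, hswap, ← mul_assoc, ← mul_assoc, ← integral_const_mul]
  congr 1; funext x
  rw [rescaledPhaseIntegral, inv_inv, ← integral_const_mul, ← integral_const_mul]
  congr 1; funext z
  have e4 : ((t ^ (m - 1) : ℝ) : ℂ) * ((t⁻¹ ^ 2 : ℝ) : ℂ) * ((t ^ 3 : ℝ) : ℂ) = ((t ^ m : ℝ) : ℂ) := by
    rw [← Complex.ofReal_mul, ← Complex.ofReal_mul, Real.rpow_sub ht, Real.rpow_one]
    congr 1; field_simp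
  rw [e4]; push_cast; ring

/-- The dilates of a potential that is homogeneous at infinity converge to the homogeneous
potential, also after pairing with an oscillatory integral that vanishes to high order at the
origin. -/
theorem tendsto_integral_dilated_potential {m : ℝ} (hm : 3 < m) {V v : E3 → ℝ} (hV : Continuous V)
    (hhom : ∀ x : E3, 1 < ‖x‖ → V x = ‖x‖ ^ (-m) * v (‖x‖⁻¹ • x))
    {B : ℝ → E3 → ℂ} {B' : E3 → ℂ} (hBm : ∀ t, 1 ≤ t → Continuous (B t)) {N : ℕ} (hN : m ≤ N) {C : ℝ} (hC : 0 ≤ C)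
    (hB0 : ∀ t, 1 ≤ t → ∀ x, ‖B t x‖ ≤ C) (hBN : ∀ t, 1 ≤ t → ∀ x, ‖B t x‖ ≤ C * (t⁻¹ + ‖x‖) ^ N)
    (hBlim : ∀ x, Tendsto (fun t => B t x) atTop (𝓝 (B' x)))
    (hB' : ∀ x, ‖x‖ ≤ 1 → B' x = 0) :
    Tendsto (fun t : ℝ => ∫ x, ((t ^ m * V (t • x) : ℝ) : ℂ) * B t x) atTop
      (𝓝 (∫ x, (V x : ℂ) * B' x)) := by
  obtain ⟨CV, hCV0, hCV⟩ := exists_potential_bound (by linarith) hV hhom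
  have hVt : ∀ t : ℝ, 1 ≤ t → ∀ x : E3, |t ^ m * V (t • x)| ≤ CV * (t⁻¹ + ‖x‖) ^ (-m) := by
    intro t ht x
    have ht0 : 0 < t := by linarith
    rw [abs_mul, abs_of_pos (by positivity)]
    calc t ^ m * |V (t • x)| ≤ t ^ m * (CV * (1 + ‖t • x‖) ^ (-m)) := by gcongr; exact hCV _
      _ = CV * (t⁻¹ + ‖x‖) ^ (-m) := by
        have : t⁻¹ + ‖x‖ = t⁻¹ * (1 + ‖t • x‖) := by
          rw [norm_smul, Real.norm_of_nonneg ht0.le]; field_simp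
        rw [this, Real.mul_rpow (by positivity) (by positivity), Real.inv_rpow ht0.le,
          Real.rpow_neg ht0.le, inv_inv]; ring
  refine tendsto_integral_filter_of_dominated_convergence
    (fun x => (CV * C * 2 ^ (N : ℝ) * 2 ^ m) * (1 + ‖x‖) ^ (-m)) ?_ ?_ ?_ ?_
  · filter_upwards [eventually_ge_atTop 1] with t ht
    have : Continuous fun x => ((t ^ m * V (t • x) : ℝ) : ℂ) * B t x := by
      have := hBm t ht
      fun_prop
    exact this.aestronglyMeasurable
  · filter_upwards [eventually_ge_atTop 1] with t ht
    refine .of_forall fun x => ?_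
    have ht0 : 0 < t := by linarith
    have hti : t⁻¹ ≤ 1 := inv_le_one_of_one_le₀ ht
    rw [norm_mul, Complex.norm_real, Real.norm_eq_abs]
    have hp : 0 < t⁻¹ + ‖x‖ := by positivity
    have h2m : (1 : ℝ) ≤ 2 ^ (N : ℝ) := Real.one_le_rpow (by norm_num) (by positivity)
    have key : (2 : ℝ) ^ m * (1 + ‖x‖) ^ (-m) = ((1 + ‖x‖) / 2) ^ (-m) := by
      rw [Real.div_rpow (by positivity) (by norm_num), Real.rpow_neg (by norm_num : (0:ℝ) ≤ 2)]
      field_simp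
    -- Outside the unit ball the decay of the potential suffices; inside, the vanishing of `B t`
    -- to order `N ≥ m` compensates the singularity `|x|^{-m}` of the homogeneous limit.
    rcases le_or_gt 1 ‖x‖ with hx | hx
    · calc |t ^ m * V (t • x)| * ‖B t x‖ ≤ CV * (t⁻¹ + ‖x‖) ^ (-m) * C := by
            gcongr
            · exact hVt t ht x
            · exact hB0 t ht x
        _ ≤ CV * ((1 + ‖x‖) / 2) ^ (-m) * C := by
            gcongr CV * ?_ * C
            refine Real.rpow_le_rpow_of_nonpos (by positivity) ?_ (by linarith)
            have : 0 < t⁻¹ := by positivity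
            linarith
        _ ≤ CV * ((1 + ‖x‖) / 2) ^ (-m) * C * 2 ^ (N : ℝ) :=
            le_mul_of_one_le_right (by positivity) h2m
        _ = _ := by rw [← key]; ring
    · calc |t ^ m * V (t • x)| * ‖B t x‖
          ≤ CV * (t⁻¹ + ‖x‖) ^ (-m) * (C * (t⁻¹ + ‖x‖) ^ N) := by
            gcongr
            · exact hVt t ht x
            · exact hBN t ht x
        _ = CV * C * (t⁻¹ + ‖x‖) ^ ((N : ℝ) - m) := by
            rw [sub_eq_add_neg, Real.rpow_add hp, Real.rpow_natCast]; ring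
        _ ≤ CV * C * 2 ^ (N : ℝ) := by
            gcongr
            calc (t⁻¹ + ‖x‖) ^ ((N : ℝ) - m) ≤ 2 ^ ((N : ℝ) - m) :=
                  Real.rpow_le_rpow hp.le (by linarith) (by linarith)
              _ ≤ 2 ^ (N : ℝ) := Real.rpow_le_rpow_of_exponent_le (by norm_num) (by linarith)
        _ = CV * C * 2 ^ (N : ℝ) * 1 := by ring
        _ ≤ CV * C * 2 ^ (N : ℝ) * (2 ^ m * (1 + ‖x‖) ^ (-m)) := by
            gcongr
            rw [key]
            exact Real.one_le_rpow_of_pos_of_le_one_of_nonpos (by positivity) (by linarith)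
              (by linarith)
        _ = _ := by ring
  · exact (integrable_one_add_norm (E := E3) (μ := volume) (r := m) (by simpa using hm)).const_mul _
  · have hae : ∀ᵐ x : E3, x ≠ 0 := by
      simp [ae_iff, measure_singleton]
    filter_upwards [hae] with x hx
    have hx0 : 0 < ‖x‖ := norm_pos_iff.2 hx
    have h1 : Tendsto (fun t : ℝ => ((t ^ m * V (t • x) : ℝ) : ℂ)) atTop
        (𝓝 ((‖x‖ ^ (-m) * v (‖x‖⁻¹ • x) : ℝ) : ℂ)) := by
      refine tendsto_const_nhds.congr' ?_
      filter_upwards [eventually_gt_atTop ‖x‖⁻¹, eventually_gt_atTop 0] with t ht ht0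
      have hn : ‖t • x‖ = t * ‖x‖ := by rw [norm_smul, Real.norm_of_nonneg ht0.le]
      have h1 : 1 < t * ‖x‖ := by rwa [inv_lt_iff_one_lt_mul₀ hx0] at ht
      rw [hhom (t • x) (by rwa [hn]), hn, smul_smul, Real.mul_rpow ht0.le hx0.le,
        Real.rpow_neg ht0.le]
      have : (t * ‖x‖)⁻¹ * t = ‖x‖⁻¹ := by field_simp
      rw [this]
      congr 1
      have := (Real.rpow_pos_of_pos ht0 m).ne'
      field_simp
    have h2 := h1.mul (hBlim x)
    -- `V` is homogeneous only outside the unit ball, where the limit `B'` lives.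
    rcases le_or_gt ‖x‖ 1 with h | h
    · rw [hB' x h, mul_zero] at h2
      rw [hB' x h, mul_zero]; exact h2
    · rw [hhom x h]; exact h2

/-! ### The X-ray transform and the failure of regularity -/

theorem norm_add_smul_of_orthogonal (ι : E2 →ₗᵢ[ℝ] E3) {θ : E3} (hθ : ‖θ‖ = 1)
    (hι : ∀ y, inner ℝ (ι y) θ = 0) (y : E2) (s : ℝ) :
    ‖ι y + s • θ‖ ^ 2 = ‖y‖ ^ 2 + s ^ 2 := by
  rw [norm_add_sq_real, inner_smul_right, hι, norm_smul, hθ, ι.norm_map]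
  simp

theorem continuous_xrayTransform {m : ℝ} (hm : 3 < m) {V v : E3 → ℝ} (hV : Continuous V)
    (hhom : ∀ x : E3, 1 < ‖x‖ → V x = ‖x‖ ^ (-m) * v (‖x‖⁻¹ • x))
    (ι : E2 →ₗᵢ[ℝ] E3) {θ : E3} (hθ : ‖θ‖ = 1) (hι : ∀ y, inner ℝ (ι y) θ = 0) :
    Continuous fun y => xrayTransform V (ι y) θ := by
  obtain ⟨C, hC0, hC⟩ := exists_potential_bound (by linarith) hV hhom
  refine continuous_of_dominated (F := fun (y : E2) (s : ℝ) => V (ι y + s • θ))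
    (bound := fun s => C * (1 + ‖s‖) ^ (-m))
    (fun y => ?_) (fun y => .of_forall fun s => ?_) ?_ (.of_forall fun s => ?_)
  · have : Continuous fun s : ℝ => V (ι y + s • θ) := by fun_prop
    exact this.aestronglyMeasurable
  · refine (hC _).trans ?_
    gcongr C * ?_
    refine Real.rpow_le_rpow_of_nonpos (by positivity) ?_ (by linarith)
    gcongr
    refine (pow_le_pow_iff_left₀ (norm_nonneg _) (norm_nonneg _) two_ne_zero).1 ?_
    rw [norm_add_smul_of_orthogonal ι hθ hι, Real.norm_eq_abs, sq_abs]
    nlinarith [norm_nonneg y]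
  · exact (integrable_one_add_norm (E := ℝ) (μ := volume) (r := m) (by simp; linarith)).const_mul C
  · have := ι.continuous
    fun_prop

/-- Against functions of the component orthogonal to `θ`, a potential acts through its X-ray
transform. -/
theorem integral_mul_comp_adjoint {V : E3 → ℝ} (hVi : Integrable V)
    (ι : E2 →ₗᵢ[ℝ] E3) {θ : E3} (hθ : ‖θ‖ = 1) (hι : ∀ y, inner ℝ (ι y) θ = 0)
    {B : E3 → ℂ} {b : E2 → ℂ} (hb : Continuous b) {M : ℝ} (hM : ∀ y, ‖b y‖ ≤ M)
    (hB : ∀ y (s : ℝ), B (ι y + s • θ) = b y) :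
    ∫ x, (V x : ℂ) * B x = ∫ y, (xrayTransform V (ι y) θ : ℂ) * b y := by
  obtain ⟨e, he, hep⟩ := exists_slice_measurePreserving ι hθ hι
  have hVe : Integrable (fun p => V (e p)) (volume : Measure (E2 × ℝ)) :=
    (he.integrable_comp_emb e.measurableEmbedding).2 hVi
  rw [← he.integral_comp e.measurableEmbedding]
  simp only [hep, hB]
  have h1 : Integrable (fun p : E2 × ℝ => (V (ι p.1 + p.2 • θ) : ℂ) * b p.1)
      (volume.prod volume) := by
    have := (hVe.ofReal (𝕜 := ℂ)).mul_bdd (c := M) (hb.comp continuous_fst).aestronglyMeasurable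
      (.of_forall fun p : E2 × ℝ => hM p.1)
    simp only [hep] at this
    exact this
  rw [Measure.volume_eq_prod, integral_prod _ h1]
  congr 1; funext y
  change ∫ s : ℝ, (V (ι y + s • θ) : ℂ) * b y = _
  rw [integral_mul_const, xrayTransform, integral_complex_ofReal]

/-- Blowing up at a zero of `γ` linearizes the phase. -/
theorem tendsto_rescaledPhaseIntegral {γ : E2 → E3} {χ : E2 → ℂ} (hχc : Continuous χ)
    (hχ1 : ∀ y, ‖χ y‖ ≤ 1) (hχ0 : χ 0 = 1) (hγ : Continuous γ) (ψ : 𝓢(E2, ℂ)) {l : E2 → E3}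
    (hγl : ∀ z, Tendsto (fun t : ℝ => t⁻¹⁻¹ • γ (t⁻¹ • z)) atTop (𝓝 (-l z))) (x : E3) :
    Tendsto (fun t : ℝ => rescaledPhaseIntegral γ χ ψ t⁻¹ x) atTop
      (𝓝 (∫ z, Complex.exp (Complex.I * ((inner ℝ x (l z) : ℝ) : ℂ)) * ψ z)) := by
  refine tendsto_integral_filter_of_dominated_convergence (fun z => ‖ψ z‖)
    (.of_forall fun t => ?_) (.of_forall fun t => .of_forall fun z => ?_)
    ψ.integrable.norm (.of_forall fun z => ?_)
  · have : Continuous fun z : E2 => χ (t⁻¹ • z) * Complex.exp (-Complex.I *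
      ((inner ℝ x (t⁻¹⁻¹ • γ (t⁻¹ • z)) : ℝ) : ℂ)) * ψ z := by
      have := ψ.continuous
      fun_prop
    exact this.aestronglyMeasurable
  · rw [norm_mul, norm_mul, norm_exp_neg_I_mul, mul_one]
    exact mul_le_of_le_one_left (norm_nonneg _) (hχ1 _)
  · have hε : Tendsto (fun t : ℝ => t⁻¹) atTop (𝓝 0) := tendsto_inv_atTop_zero
    have h1 : Tendsto (fun t : ℝ => χ (t⁻¹ • z)) atTop (𝓝 1) := by
      rw [← hχ0, ← zero_smul ℝ z]
      exact (hχc.tendsto _).comp (hε.smul_const z)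
    have h3 : Tendsto (fun t : ℝ => inner ℝ x (t⁻¹⁻¹ • γ (t⁻¹ • z))) atTop
        (𝓝 (inner ℝ x (-l z))) := tendsto_const_nhds.inner (hγl z)
    have h4 := (h1.mul (((Complex.continuous_ofReal.tendsto _).comp h3).const_mul
      (-Complex.I)).cexp).mul_const (ψ z)
    have e3 : (1 : ℂ) * Complex.exp (-Complex.I * ((inner ℝ x (-l z) : ℝ) : ℂ)) * ψ z =
        Complex.exp (Complex.I * ((inner ℝ x (l z) : ℝ) : ℂ)) * ψ z := by
      rw [one_mul, inner_neg_right]; push_cast; rw [neg_mul_neg]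
    rw [e3] at h4
    exact h4

/-- Suppose that the amplitude is in `H^{m-2}`. Testing it near `w = θ` against functions of scale
`1/t` with frequencies in an annulus of size `t` gives `o(t^{-(m-1)})`. But `t^{m-1}` times this
pairing converges to the integral of the X-ray transform of `V` against the frequency profile, and
this profile can be chosen so that the integral does not vanish. -/
theorem not_memSobolevSphere_leadingAmplitude {m : ℝ} (hm : 3 < m) {V v : E3 → ℝ}
    (hV : ContDiff ℝ ∞ V)
    (hhom : ∀ x : E3, 1 < ‖x‖ → V x = ‖x‖ ^ (-m) * v (‖x‖⁻¹ • x)) {lam : ℝ} (hlam : 0 < lam)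
    (θ : S2) (hx : ∃ x : E3, inner ℝ x (θ : E3) = 0 ∧ 1 < ‖x‖ ∧ xrayTransform V x θ ≠ 0) :
    ¬ MemSobolevSphere (m - 2) (fun w : S2 => leadingAmplitude V lam θ w) := by
  intro hmem
  obtain ⟨x₀, hx₀θ, hx₀1, hx₀X⟩ := hx
  have hθ : ‖(θ : E3)‖ = 1 := by simp
  obtain ⟨e, he, het, ι, hι, hιe⟩ := exists_stereographic_chart θ
  obtain ⟨y₀, hy₀⟩ : ∃ y₀, ι y₀ = x₀ := by
    obtain ⟨E, -, hE⟩ := exists_slice_measurePreserving ι hθ hι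
    obtain ⟨⟨y, s⟩, hp⟩ := E.surjective x₀
    rw [hE] at hp
    refine ⟨y, ?_⟩
    have h1 : inner ℝ (ι y + s • (θ : E3)) (θ : E3) = 0 := by rw [hp]; exact hx₀θ
    rw [inner_add_left, hι, inner_smul_left, real_inner_self_eq_norm_sq, hθ] at h1
    have h2 : s = 0 := by simpa using h1
    rw [← hp, h2]; simp
  have hVi := integrable_potential hm hV.continuous hhom
  have hXc := continuous_xrayTransform hm hV.continuous hhom ι hθ hι
  set X : E2 → ℝ := fun y => xrayTransform V (ι y) θ with hX
  have hX0 : X y₀ ≠ 0 := by rw [hX]; simp only [hy₀]; exact hx₀X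
  have hy₀1 : 1 < ‖y₀‖ := by rw [← ι.norm_map, hy₀]; exact hx₀1
  set c : ℝ := lam / (2 * Real.pi) with hc
  have hc0 : 0 < c := by positivity
  -- near `y₀` the X-ray transform has constant sign
  have hev : ∀ᶠ k in 𝓝 (c • y₀), 1 < ‖c⁻¹ • k‖ ∧ 0 < inner ℝ k y₀ ∧ 0 < X (c⁻¹ • k) * X y₀ := by
    have hcc : c⁻¹ • c • y₀ = y₀ := by rw [smul_smul, inv_mul_cancel₀ hc0.ne', one_smul]
    refine (ContinuousAt.eventually_lt (f := fun _ => (1 : ℝ)) (by fun_prop) (by fun_prop) ?_).and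
      ((ContinuousAt.eventually_lt (f := fun _ => (0 : ℝ)) (by fun_prop) (by fun_prop) ?_).and
      (ContinuousAt.eventually_lt (f := fun _ => (0 : ℝ)) (by fun_prop) (by fun_prop) ?_))
    · rwa [hcc]
    · rw [inner_smul_left, real_inner_self_eq_norm_sq]; simp only [conj_trivial]; positivity
    · rw [hcc]; exact mul_self_pos.2 hX0
  obtain ⟨δ, hδ0, hδ⟩ := Metric.eventually_nhds_iff_ball.1 hev
  let β : ContDiffBump (c • y₀) := ⟨δ / 2, δ, by linarith, by linarith⟩
  have hβs : ∀ k, β k ≠ 0 → 1 < ‖c⁻¹ • k‖ ∧ 0 < inner ℝ k y₀ ∧ 0 < X (c⁻¹ • k) * X y₀ := by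
    intro k hk
    apply hδ
    have : k ∈ Function.support β := hk
    rwa [β.support_eq] at this
  let βS : 𝓢(E2, ℂ) := HasCompactSupport.toSchwartzMap (f := fun k => (β k : ℂ))
    (β.hasCompactSupport.comp_left (g := fun r : ℝ => (r : ℂ)) (by simp))
    (Complex.ofRealCLM.contDiff.comp β.contDiff)
  have hβS : ∀ k, βS k = (β k : ℂ) := fun k => rfl
  -- The factor `⟨k, y₀⟩^N` makes the test function an `N`-th derivative, so that the oscillatory
  -- integral vanishes to order `N` at the origin; it is positive on the support of `β`.
  obtain ⟨N, hN⟩ := exists_nat_ge m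
  obtain ⟨b, hb, hbF⟩ := exists_fourier_eq_iterate_lineDeriv βS y₀ N
  let χ0 : ContDiffBump (0 : E2) := ⟨1, 2, by norm_num, by norm_num⟩
  set χ : E2 → ℂ := fun y => (χ0 y : ℂ) with hχ
  have hχs : ContDiff ℝ ∞ χ := Complex.ofRealCLM.contDiff.comp χ0.contDiff
  have hχc : HasCompactSupport χ :=
    χ0.hasCompactSupport.comp_left (g := fun r : ℝ => (r : ℂ)) (by simp)
  -- The phase `λ(θ - w(y))` in the stereographic chart; its derivative at the origin is `-λ ι`.
  set γ : E2 → E3 := fun y => lam • (‖y‖ ^ 2 + 4)⁻¹ • ((2 * ‖y‖ ^ 2) • (θ : E3) - (4 : ℝ) • ι y) with hγ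
  have hγs : ContDiff ℝ ∞ γ := by
    have h1 : ContDiff ℝ ∞ fun y : E2 => ‖y‖ ^ 2 := contDiff_norm_sq ℝ
    have h2 : ContDiff ℝ ∞ fun y : E2 => ι y := ι.contDiff
    refine ContDiff.const_smul lam (ContDiff.smul ((h1.add contDiff_const).inv fun y => by positivity)
      (ContDiff.sub ((contDiff_const.mul h1).smul contDiff_const) (h2.const_smul 4)))
  have hγe : ∀ y, γ y = lam • ((θ : E3) - e.symm y) := fun y => by rw [hιe]
  obtain ⟨T, hT, hTκ⟩ := hmem e he χ hχs hχc (by rw [het]; exact Set.subset_univ _)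
  -- the dilated test functions
  have hbt : ∀ t : ℝ, ∃ f : 𝓢(E2, ℂ), 0 < t → ∀ k, f k = (((t ^ 2)⁻¹ : ℝ) : ℂ) * b (t⁻¹ • k) := by
    intro t
    rcases le_or_gt t 0 with h | h
    · exact ⟨0, fun h' => absurd h (not_le.2 h')⟩
    · refine ⟨(((t ^ 2)⁻¹ : ℝ) : ℂ) • SchwartzMap.compCLMOfContinuousLinearEquiv ℂ
        (ContinuousLinearEquiv.smulLeft (Units.mk0 t⁻¹ (inv_ne_zero h.ne'))) b, fun _ k => ?_⟩
      rfl
  choose bt hbt using hbt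
  have hcsupp_one : ∀ y, ‖y‖ ≤ 1 → b (c • y) = 0 := by
    intro y hy
    by_contra hne
    have : β (c • y) ≠ 0 := fun h => hne (by rw [hb, hβS, h]; simp)
    have := (hβs _ this).1
    rw [smul_smul, inv_mul_cancel₀ hc0.ne', one_smul] at this
    linarith
  have hcsupp : ∀ k, ‖k‖ < c → b k = 0 := by
    intro k hk
    by_contra hne
    have : β k ≠ 0 := fun h => hne (by rw [hb, hβS, h]; simp)
    have := (hβs k this).1
    rw [norm_smul, Real.norm_of_nonneg (by positivity), ← div_eq_inv_mul, one_lt_div hc0] at this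
    linarith
  have hlim0 := tendsto_pairing_of_memSobolev (κ := m - 2) (by linarith) hTκ b hc0 hcsupp bt hbt
  have hFbt : ∀ t : ℝ, 0 < t → ∀ y, 𝓕 (bt t) y = 𝓕 b (t • y) := by
    intro t ht y
    rw [SchwartzMap.fourier_coe, SchwartzMap.fourier_coe, Real.fourier_eq', Real.fourier_eq']
    have h := Measure.integral_comp_inv_smul_of_nonneg (μ := (volume : Measure E2))
      (fun k : E2 => Complex.exp (((-2 * Real.pi * inner ℝ k (t • y) : ℝ) : ℂ) * Complex.I) • b k)
      (R := t) ht.le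
    simp only [finrank_euclideanSpace, Fintype.card_fin] at h
    rw [← inv_smul_eq_iff₀ (by positivity : t ^ 2 ≠ 0), ← integral_smul] at h
    rw [← h]
    congr 1; funext k
    rw [hbt t ht, inner_smul_left, inner_smul_right, conj_trivial, ← mul_assoc t⁻¹,
      inv_mul_cancel₀ ht.ne', one_mul, Complex.real_smul, smul_eq_mul, smul_eq_mul]
    ring
  set ψ : 𝓢(E2, ℂ) := 𝓕 b with hψ
  have hpair : ∀ t : ℝ, 0 < t → ((t ^ (m - 2 + 1) : ℝ) : ℂ) * T (𝓕 (bt t)) =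
      (c : ℂ) * ∫ x, ((t ^ m * V (t • x) : ℝ) : ℂ) * rescaledPhaseIntegral γ χ ψ t⁻¹ x := by
    intro t ht
    rw [← integral_comp_mul_potentialFourier hVi hγs.continuous hχs.continuous hχc
      ψ m ht, (hT _).2]
    have e1 : m - 2 + 1 = m - 1 := by ring
    rw [e1, mul_left_comm]
    congr 1
    rw [← integral_const_mul]
    congr 1; funext y
    simp only [hFbt t ht, leadingAmplitude, hγe]
    ring
  -- the limit of the rescaled pairing
  set B' : E3 → ℂ := fun x => ∫ z, Complex.exp (Complex.I * ((inner ℝ x (lam • ι z) : ℝ) : ℂ)) * ψ z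
    with hB'
  have hB'eq : ∀ y (s : ℝ), B' (ι y + s • (θ : E3)) = b (c • y) := by
    intro y s
    have h1 : (𝓕⁻ ψ : 𝓢(E2, ℂ)) (c • y) = b (c • y) := by rw [hψ, FourierTransform.fourierInv_fourier_eq]
    rw [← h1, SchwartzMap.fourierInv_coe, Real.fourierInv_eq']
    simp only [hB']
    congr 1; funext z
    rw [smul_eq_mul]
    congr 2
    rw [inner_smul_right, inner_add_left, ι.inner_map_map, inner_smul_left, inner_smul_right,
      real_inner_comm (ι z) (θ : E3), hι, real_inner_comm z y, hc]
    push_cast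
    have : (Real.pi : ℂ) ≠ 0 := by exact_mod_cast Real.pi_ne_zero
    simp only [mul_zero, add_zero]
    field_simp
  have hlim1 : Tendsto (fun t : ℝ => ∫ x, ((t ^ m * V (t • x) : ℝ) : ℂ) *
      rescaledPhaseIntegral γ χ ψ t⁻¹ x) atTop (𝓝 (∫ x, (V x : ℂ) * B' x)) := by
    obtain ⟨C1, hC10, hC1⟩ := norm_integral_rescaled_phase_le hγs y₀ (𝓕 βS) N χ hχs hχc
    obtain ⟨C2, hC20, hC2⟩ := norm_integral_rescaled_phase_le hγs y₀ ψ 0 χ hχs hχc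
    rw [← hbF] at hC1
    have hχ1 : ∀ y, ‖χ y‖ ≤ 1 := fun y => by
      rw [hχ, Complex.norm_real, Real.norm_of_nonneg (χ0.nonneg' y)]
      exact χ0.le_one
    have hχz : χ 0 = 1 := by
      rw [hχ]; dsimp only
      rw [χ0.one_of_mem_closedBall (by simp [χ0])]; simp
    have hγlim : ∀ z, Tendsto (fun t : ℝ => t⁻¹⁻¹ • γ (t⁻¹ • z)) atTop (𝓝 (-(lam • ι z))) := by
      intro z
      have hε : Tendsto (fun t : ℝ => t⁻¹) atTop (𝓝 0) := tendsto_inv_atTop_zero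
      have e1 : Tendsto (fun t : ℝ => lam • ((t⁻¹ ^ 2 * ‖z‖ ^ 2 + 4)⁻¹ •
          ((2 * t⁻¹ * ‖z‖ ^ 2) • (θ : E3) - (4 : ℝ) • ι z))) atTop
          (𝓝 (lam • (((0 : ℝ) ^ 2 * ‖z‖ ^ 2 + 4)⁻¹ •
          ((2 * 0 * ‖z‖ ^ 2) • (θ : E3) - (4 : ℝ) • ι z)))) :=
        (((((hε.pow 2).mul_const _).add_const _).inv₀ (by norm_num)).smul
          ((((hε.const_mul 2).mul_const _).smul_const _).sub_const _)).const_smul lam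
      have e2 : lam • (((0 : ℝ) ^ 2 * ‖z‖ ^ 2 + 4)⁻¹ •
          ((2 * 0 * ‖z‖ ^ 2) • (θ : E3) - (4 : ℝ) • ι z)) = -(lam • ι z) := by
        simp [smul_smul]
      rw [e2] at e1
      refine e1.congr' ?_
      filter_upwards [eventually_gt_atTop 0] with t ht
      simp only [hγ]
      rw [map_smul, norm_smul, Real.norm_of_nonneg (by positivity : 0 ≤ t⁻¹), inv_inv, mul_pow,
        smul_comm t lam, smul_comm t]
      congr 2
      rw [smul_sub, smul_smul, smul_comm t (4 : ℝ), smul_smul t t⁻¹, mul_inv_cancel₀ ht.ne', one_smul]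
      congr 2
      field_simp
    refine tendsto_integral_dilated_potential hm hV.continuous hhom (C := C1 + C2) (N := N)
      (fun t ht => ?_) hN (by positivity) (fun t ht x => ?_) (fun t ht x => ?_) (fun x => ?_)
      (fun x hx => ?_)
    · refine continuous_of_dominated (bound := fun z => ‖ψ z‖) (fun x => ?_)
        (fun x => .of_forall fun z => ?_) ψ.integrable.norm (.of_forall fun z => ?_)
      · have h1 := hχs.continuous
        have h2 := hγs.continuous
        have : Continuous fun z : E2 => χ (t⁻¹ • z) * Complex.exp (-Complex.I *
          ((inner ℝ x (t⁻¹⁻¹ • γ (t⁻¹ • z)) : ℝ) : ℂ)) * ψ z := by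
          have := ψ.continuous
          fun_prop
        exact this.aestronglyMeasurable
      · rw [norm_mul, norm_mul, norm_exp_neg_I_mul, mul_one]
        exact mul_le_of_le_one_left (norm_nonneg _) (hχ1 _)
      · fun_prop
    · have := hC2 t⁻¹ (by positivity) x
      rw [pow_zero, mul_one] at this
      refine le_trans this ?_
      linarith
    · refine le_trans (hC1 t⁻¹ (by positivity) x) ?_
      gcongr
      linarith
    · exact tendsto_rescaledPhaseIntegral hχs.continuous hχ1 hχz hγs.continuous ψ hγlim x
    · obtain ⟨E, -, hE⟩ := exists_slice_measurePreserving ι hθ hι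
      obtain ⟨⟨y, s⟩, rfl⟩ := E.surjective x
      rw [hE] at hx ⊢
      simp only at hx ⊢
      rw [hB'eq]
      have h1 := norm_add_smul_of_orthogonal ι hθ hι y s
      apply hcsupp_one
      nlinarith [norm_nonneg y, norm_nonneg (ι y + s • (θ : E3))]
  -- The same pairing computed in two ways.
  have hzero : ∫ x, (V x : ℂ) * B' x = 0 := by
    have h1 : Tendsto (fun t : ℝ => ((t ^ (m - 2 + 1) : ℝ) : ℂ) * T (𝓕 (bt t))) atTop
        (𝓝 ((c : ℂ) * ∫ x, (V x : ℂ) * B' x)) :=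
      (hlim1.const_mul (c : ℂ)).congr' (by
        filter_upwards [eventually_gt_atTop 0] with t ht using (hpair t ht).symm)
    have h2 := tendsto_nhds_unique h1 hlim0
    exact (mul_eq_zero.1 h2).resolve_left (by exact_mod_cast hc0.ne')
  obtain ⟨M, -, hM⟩ := schwartz_pointwise_bound b 0
  rw [integral_mul_comp_adjoint hVi ι hθ hι (b := fun y => b (c • y))
    (b.continuous.comp (continuous_const_smul c)) (M := M) (fun y => by simpa using hM (c • y))
    hB'eq] at hzero
  -- The integrand is, up to a constant, nonnegative and not identically zero.
  set g : E2 → ℝ := fun y => (inner ℝ (c • y) y₀) ^ N * β (c • y) * (X y * X y₀) with hg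
  have hgc : Continuous g := by
    have := β.continuous
    fun_prop
  have hβc : HasCompactSupport fun y => β (c • y) := β.hasCompactSupport.comp_smul hc0.ne'
  have hcy : ∀ y : E2, c⁻¹ • c • y = y := fun y => by
    rw [smul_smul, inv_mul_cancel₀ hc0.ne', one_smul]
  have hgpos : 0 < ∫ y, g y := by
    refine hgc.integral_pos_of_hasCompactSupport_nonneg_nonzero (x := y₀) ?_ ?_ ?_
    · exact (hβc.mul_left (f := fun y => (inner ℝ (c • y) y₀) ^ N)).mul_right
    · intro y
      by_cases h : β (c • y) = 0
      · simp [hg, h]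
      · obtain ⟨-, h2, h3⟩ := hβs _ h
        rw [hcy] at h3
        have := β.nonneg' (c • y)
        exact mul_nonneg (mul_nonneg (pow_nonneg h2.le _) this) h3.le
    · have h1 : β (c • y₀) = 1 := β.one_of_mem_closedBall (by simp [β]; linarith)
      obtain ⟨-, h2, h3⟩ := hβs (c • y₀) (by rw [h1]; norm_num)
      rw [hcy] at h3
      simp only [hg, h1]
      positivity
  have hgeq : (∫ y, (xrayTransform V (ι y) θ : ℂ) * b (c • y)) * (X y₀ : ℂ) =
      (-(2 * Real.pi * Complex.I)) ^ N * ((∫ y, g y : ℝ) : ℂ) := by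
    rw [← integral_complex_ofReal, ← integral_const_mul, ← integral_mul_const]
    congr 1; funext y
    rw [hb, hβS]
    simp only [hg, hX]
    push_cast
    ring
  rw [hzero, zero_mul] at hgeq
  have h3 : (-(2 * (Real.pi : ℂ) * Complex.I)) ^ N ≠ 0 := by
    simp [Real.pi_ne_zero]
  exact (mul_ne_zero h3 (by exact_mod_cast hgpos.ne')) hgeq.symm

/-! ### Polar coordinates and spherical caps -/

/-- The surface measure of the unit sphere. -/
abbrev sphereMeasure : Measure S2 := (volume : Measure E3).toSphere

theorem lintegral_polar {f : E3 → ENNReal} (hf : Measurable f) :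
    ∫⁻ x, f x = ∫⁻ σ : S2, ∫⁻ r in Set.Ioi (0 : ℝ),
      ENNReal.ofReal (r ^ 2) * f (r • (σ : E3)) ∂volume ∂sphereMeasure := by
  have hmp := (volume : Measure E3).measurePreserving_homeomorphUnitSphereProd
  have hf' : Measurable fun p : S2 × Set.Ioi (0 : ℝ) => f (p.2.1 • (p.1 : E3)) := by
    refine hf.comp ?_
    have : Continuous fun p : S2 × Set.Ioi (0 : ℝ) => p.2.1 • (p.1 : E3) := by fun_prop
    exact this.measurable
  calc ∫⁻ x, f x = ∫⁻ x in ({(0 : E3)}ᶜ : Set E3), f x := by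
        rw [restrict_compl_singleton]
    _ = ∫⁻ x : ({(0 : E3)}ᶜ : Set E3), f (x : E3) ∂(volume.comap Subtype.val) := by
        rw [lintegral_subtype_comap (measurableSet_singleton _).compl]
    _ = ∫⁻ p, f (p.2.1 • (p.1 : E3)) ∂(sphereMeasure.prod (Measure.volumeIoiPow
          (Module.finrank ℝ E3 - 1))) := by
        rw [← hmp.lintegral_comp hf']
        refine lintegral_congr fun x => ?_
        have hx : ‖(x : E3)‖ ≠ 0 := norm_ne_zero_iff.2 x.2
        rw [homeomorphUnitSphereProd_apply_snd_coe, homeomorphUnitSphereProd_apply_fst_coe]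
        rw [smul_smul, mul_inv_cancel₀ hx, one_smul]
    _ = ∫⁻ σ : S2, ∫⁻ r : Set.Ioi (0 : ℝ), f (r.1 • (σ : E3)) ∂(Measure.volumeIoiPow
          (Module.finrank ℝ E3 - 1)) ∂sphereMeasure := lintegral_prod _ hf'.aemeasurable
    _ = _ := by
        refine lintegral_congr fun σ => ?_
        have h1 : Measurable fun r : Set.Ioi (0 : ℝ) => f (r.1 • (σ : E3)) :=
          hf'.comp (measurable_const.prodMk measurable_id)
        rw [Measure.volumeIoiPow, lintegral_withDensity_eq_lintegral_mul _ (by fun_prop) h1]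
        simp only [Pi.mul_apply, finrank_euclideanSpace, Fintype.card_fin, Nat.add_one_sub_one]
        rw [lintegral_subtype_comap measurableSet_Ioi
          (fun r : ℝ => ENNReal.ofReal (r ^ 2) * f (r • (σ : E3)))]

theorem lintegral_Ioo_sq : ∫⁻ r in Set.Ioo (0 : ℝ) 1, ENNReal.ofReal (r ^ 2) = ENNReal.ofReal (1 / 3) := by
  rw [restrict_Ioo_eq_restrict_Ioc, ← ofReal_integral_eq_lintegral_ofReal
    (by
      have := (intervalIntegral.intervalIntegrable_pow 2 (μ := volume) (a := 0) (b := 1)).1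
      exact this)
    (.of_forall fun r => by positivity), ← intervalIntegral.integral_of_le (by norm_num),
    integral_pow]
  norm_num

/-- Integrals over the sphere as integrals over the unit ball of homogeneous functions. -/
theorem lintegral_sphere_eq_ball {H : E3 → ENNReal} (hH : Measurable H) :
    ∫⁻ σ : S2, H σ ∂sphereMeasure =
      3 * ∫⁻ x in Metric.ball (0 : E3) 1, H (‖x‖⁻¹ • x) := by
  have hm : Measurable fun x : E3 => H (‖x‖⁻¹ • x) := hH.comp (by fun_prop)
  rw [← lintegral_indicator measurableSet_ball, lintegral_polar (hm.indicator measurableSet_ball)]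
  have h : ∀ σ : S2, ∫⁻ r in Set.Ioi (0 : ℝ), ENNReal.ofReal (r ^ 2) *
      (Metric.ball (0 : E3) 1).indicator (fun x => H (‖x‖⁻¹ • x)) (r • (σ : E3)) =
      ENNReal.ofReal (1 / 3) * H σ := by
    intro σ
    rw [← lintegral_Ioo_sq, ← lintegral_mul_const _ (by fun_prop),
      ← lintegral_indicator measurableSet_Ioi, ← lintegral_indicator measurableSet_Ioo]
    refine lintegral_congr fun r => ?_
    by_cases hr : 0 < r
    · have hn : ‖r • (σ : E3)‖ = r := by rw [norm_smul, Real.norm_of_nonneg hr.le]; simp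
      rw [Set.indicator_of_mem (by exact hr)]
      by_cases hr1 : r < 1
      · rw [Set.indicator_of_mem (by simpa [hn] using hr1), Set.indicator_of_mem (Set.mem_Ioo.2 ⟨hr, hr1⟩), hn,
          smul_smul, inv_mul_cancel₀ hr.ne', one_smul]
      · rw [Set.indicator_of_notMem (by simpa [hn] using hr1),
          Set.indicator_of_notMem (fun h => hr1 h.2), mul_zero]
    · rw [Set.indicator_of_notMem (by exact hr), Set.indicator_of_notMem (fun h => hr h.1)]
  simp only [h]
  rw [lintegral_const_mul (f := fun σ : S2 => H σ) _ (hH.comp measurable_subtype_coe), ← mul_assoc]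
  have : (3 : ENNReal) * ENNReal.ofReal (1 / 3) = 1 := by
    rw [← ENNReal.ofReal_ofNat, ← ENNReal.ofReal_mul (by norm_num)]; norm_num
  rw [this, one_mul]

theorem lintegral_plane_dilate {Y : ℝ} (hY : 0 < Y) :
    ∫⁻ η : E2, ENNReal.ofReal (((1 + (Y * ‖η‖) ^ 2) ^ 2)⁻¹) =
      ENNReal.ofReal ((Y ^ 2)⁻¹ * ∫ η : E2, ((1 + ‖η‖ ^ 2) ^ 2)⁻¹) := by
  have hint : Integrable fun η : E2 => ((1 + ‖η‖ ^ 2) ^ 2)⁻¹ := by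
    have := integrable_rpow_neg_one_add_norm_sq (E := E2) (μ := volume) (r := 4) (by simp; norm_num)
    refine this.congr (.of_forall fun η => ?_)
    simp only
    rw [show (-4 / 2 : ℝ) = -((2 : ℕ) : ℝ) by norm_num, Real.rpow_neg (by positivity),
      Real.rpow_natCast]
  have e : ∀ η : E2, ((1 + (Y * ‖η‖) ^ 2) ^ 2)⁻¹ = (fun η : E2 => ((1 + ‖η‖ ^ 2) ^ 2)⁻¹) (Y • η) := by
    intro η
    simp only [norm_smul, Real.norm_of_nonneg hY.le]
  simp only [e]
  rw [← ofReal_integral_eq_lintegral_ofReal (hint.comp_smul hY.ne')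
    (.of_forall fun η => by positivity), Measure.integral_comp_smul_of_nonneg (volume : Measure E2)
    (fun η : E2 => ((1 + ‖η‖ ^ 2) ^ 2)⁻¹) Y (hR := hY.le)]
  simp

/-- The mass that `(1 + Y² |σ - w|²)⁻²` has on the sphere is that of a cap of radius `1/Y`. -/
theorem exists_lintegral_cap_le : ∃ C : ℝ, 0 ≤ C ∧ ∀ (w : S2) (Y : ℝ), 0 < Y →
    ∫⁻ σ : S2, ENNReal.ofReal (((1 + (Y * ‖(σ : E3) - w‖) ^ 2) ^ 2)⁻¹) ∂sphereMeasure ≤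
      ENNReal.ofReal (C * (Y ^ 2)⁻¹) := by
  set J : ℝ := ∫ η : E2, ((1 + ‖η‖ ^ 2) ^ 2)⁻¹ with hJ
  have hJ0 : 0 ≤ J := integral_nonneg fun η => by positivity
  refine ⟨6 * J, by positivity, fun w Y hY => ?_⟩
  obtain ⟨ι, hι⟩ := exists_isometry_orthogonal w
  have hw : ‖(w : E3)‖ = 1 := by simp
  obtain ⟨e, he, hep⟩ := exists_slice_measurePreserving ι hw hι
  rw [lintegral_sphere_eq_ball (H := fun x => ENNReal.ofReal (((1 + (Y * ‖x - w‖) ^ 2) ^ 2)⁻¹))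
    (by fun_prop), ← lintegral_indicator measurableSet_ball, ← he.lintegral_comp_emb e.measurableEmbedding]
  -- In the slices `x = ι y + s w` of the ball, `|y| ≤ |x/|x| - w|`: the component of `x/|x| - w`
  -- orthogonal to `w` is `ι y/|x|`. The integrand is thus bounded by a function of `y` alone.
  have hb : ∀ p : E2 × ℝ, (Metric.ball (0 : E3) 1).indicator (fun x => ENNReal.ofReal
      (((1 + (Y * ‖‖x‖⁻¹ • x - (w : E3)‖) ^ 2) ^ 2)⁻¹)) (e p) ≤
      ENNReal.ofReal (((1 + (Y * ‖p.1‖) ^ 2) ^ 2)⁻¹) *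
        (Set.Icc (-1 : ℝ) 1).indicator (fun _ => 1) p.2 := by
    rintro ⟨y, s⟩
    by_cases hx : e (y, s) ∈ Metric.ball (0 : E3) 1
    · rw [Set.indicator_of_mem hx]
      rw [mem_ball_zero_iff, hep] at hx
      rw [hep]
      simp only at hx ⊢
      have h1 := norm_add_smul_of_orthogonal ι hw hι y s
      set x : E3 := ι y + s • (w : E3) with hxd
      have hs : s ∈ Set.Icc (-1 : ℝ) 1 := by
        rw [Set.mem_Icc, ← abs_le, ← sq_le_one_iff_abs_le_one]
        nlinarith [sq_nonneg ‖y‖, norm_nonneg x]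
      rw [Set.indicator_of_mem hs, mul_one]
      have hy : ‖y‖ ≤ ‖‖x‖⁻¹ • x - (w : E3)‖ := by
        rcases eq_or_ne x 0 with h0 | h0
        · have : ‖y‖ ^ 2 = 0 := by rw [h0] at h1; simp at h1; nlinarith [sq_nonneg s, sq_nonneg ‖y‖]
          rw [pow_eq_zero_iff two_ne_zero] at this
          rw [this]; positivity
        · have hx0 : 0 < ‖x‖ := norm_pos_iff.2 h0
          have h2 : ‖x - ‖x‖ • (w : E3)‖ ^ 2 = ‖y‖ ^ 2 + (s - ‖x‖) ^ 2 := by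
            rw [← norm_add_smul_of_orthogonal ι hw hι y (s - ‖x‖)]
            congr 2; rw [hxd]; module
          have h3 : ‖x - ‖x‖ • (w : E3)‖ = ‖x‖ * ‖‖x‖⁻¹ • x - (w : E3)‖ := by
            rw [← Real.norm_of_nonneg hx0.le, ← norm_smul, Real.norm_of_nonneg hx0.le, smul_sub,
              smul_smul, mul_inv_cancel₀ hx0.ne', one_smul]
          have h4 : ‖y‖ ≤ ‖x - ‖x‖ • (w : E3)‖ := by
            refine (pow_le_pow_iff_left₀ (norm_nonneg _) (norm_nonneg _) two_ne_zero).1 ?_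
            rw [h2]; nlinarith [sq_nonneg (s - ‖x‖)]
          rw [h3] at h4
          exact h4.trans (mul_le_of_le_one_left (norm_nonneg _) hx.le)
      gcongr
    · rw [Set.indicator_of_notMem hx]; exact zero_le
  refine (mul_le_mul_right (lintegral_mono hb) 3).trans ?_
  rw [Measure.volume_eq_prod, lintegral_prod_mul
    (f := fun η : E2 => ENNReal.ofReal (((1 + (Y * ‖η‖) ^ 2) ^ 2)⁻¹))
    (g := (Set.Icc (-1 : ℝ) 1).indicator (fun _ => 1)) (by fun_prop)
    ((measurable_const.indicator measurableSet_Icc).aemeasurable), lintegral_plane_dilate hY,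
    lintegral_indicator measurableSet_Icc]
  simp only [lintegral_const, MeasurableSet.univ, Measure.restrict_apply, Set.univ_inter, one_mul,
    Real.volume_Icc]
  rw [← ENNReal.ofReal_mul (by positivity), ← ENNReal.ofReal_ofNat,
    ← ENNReal.ofReal_mul (by norm_num)]
  exact ENNReal.ofReal_le_ofReal (le_of_eq (by ring))

/-! ### Fourier transforms of radial functions -/

theorem exists_eq_norm_smul (ξ : E3) : ∃ θ : S2, ξ = ‖ξ‖ • (θ : E3) := by
  rcases eq_or_ne ξ 0 with h | h
  · exact ⟨radialProjection 0, by simp [h]⟩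
  · refine ⟨radialProjection ξ, ?_⟩
    rw [radialProjection_coe_of_ne_zero h, smul_smul, mul_inv_cancel₀ (norm_ne_zero_iff.2 h),
      one_smul]

theorem integral_plane_radial (F : ℝ → ℂ) :
    ∫ y : E2, F ‖y‖ = 2 * Real.pi * ∫ r in Set.Ioi (0 : ℝ), (r : ℂ) * F r := by
  have h := integral_fun_norm_addHaar (volume : Measure E2) F
  simp only [finrank_euclideanSpace, Fintype.card_fin, Nat.add_one_sub_one, pow_one,
    Complex.real_smul, nsmul_eq_mul] at h
  rw [h]
  have : (volume : Measure E2).real (Metric.ball 0 1) = Real.pi := by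
    rw [Measure.real, EuclideanSpace.volume_ball_fin_two]; simp [Real.pi_pos.le]
  rw [this]; push_cast; ring

/-- The Fourier transform of a radial function `Q'(|x|)/|x|` of three variables is a one-dimensional
Fourier transform. -/
theorem fourier_radial {Q κ : ℝ → ℂ} (hQ : ∀ r, HasDerivAt Q (κ r) r)
    (hQ0 : Tendsto Q atTop (𝓝 0))
    (hi : Integrable fun x : E3 => κ ‖x‖ / (‖x‖ : ℂ)) (ξ : E3) :
    𝓕 (fun x : E3 => κ ‖x‖ / (‖x‖ : ℂ)) ξ =
      -(2 * Real.pi) * ∫ t : ℝ, Complex.exp (-Complex.I * ((2 * Real.pi * ‖ξ‖ * t : ℝ) : ℂ)) * Q |t| := by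
  obtain ⟨θ, hθ⟩ := exists_eq_norm_smul ξ
  obtain ⟨ι, hι⟩ := exists_isometry_orthogonal θ
  have hθ1 : ‖(θ : E3)‖ = 1 := by simp
  obtain ⟨e, he, hep⟩ := exists_slice_measurePreserving ι hθ1 hι
  have hn : ∀ (y : E2) (t : ℝ), ‖ι y + t • (θ : E3)‖ = √(‖y‖ ^ 2 + t ^ 2) := fun y t => by
    rw [← norm_add_smul_of_orthogonal ι hθ1 hι, Real.sqrt_sq (norm_nonneg _)]
  set F : ℝ → ℝ → ℂ := fun t r => κ (√(r ^ 2 + t ^ 2)) / ((√(r ^ 2 + t ^ 2) : ℝ) : ℂ) with hF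
  have hFi : Integrable (fun p : E2 × ℝ => F p.2 ‖p.1‖) (volume.prod volume) := by
    have h := (he.integrable_comp_emb e.measurableEmbedding).2 hi
    refine h.congr (.of_forall fun p => ?_)
    simp only [Function.comp_apply, hep, hn, hF]
  have hae : ∀ᵐ t : ℝ, Integrable (fun y : E2 => F t ‖y‖) := hFi.prod_left_ae
  -- In polar coordinates on the plane at height `t`, the integrand is the derivative in `r` of
  -- `Q(√(r² + t²))`.
  have hinner : ∀ᵐ t : ℝ, ∫ y : E2, F t ‖y‖ = -(2 * Real.pi) * Q |t| := by
    have h0 : ∀ᵐ t : ℝ, t ≠ 0 := by simp [ae_iff, measure_singleton]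
    filter_upwards [hae, h0] with t ht ht0
    rw [integral_plane_radial]
    rw [integrable_fun_norm_addHaar (volume : Measure E2)] at ht
    simp only [finrank_euclideanSpace, Fintype.card_fin, Nat.add_one_sub_one, pow_one,
      Complex.real_smul] at ht
    have ht2 : 0 < t ^ 2 := by positivity
    have hd : ∀ r : ℝ, HasDerivAt (fun r : ℝ => Q (√(r ^ 2 + t ^ 2))) ((r : ℂ) * F t r) r := by
      intro r
      have h1 : HasDerivAt (fun r : ℝ => r ^ 2 + t ^ 2) (2 * r) r := by
        simpa using (hasDerivAt_pow 2 r).add_const (t ^ 2)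
      have h2 := h1.sqrt (by positivity)
      have h3 := (hQ _).scomp r h2
      have h4 : √(r ^ 2 + t ^ 2) ≠ 0 := by positivity
      have h5 : (2 * r / (2 * √(r ^ 2 + t ^ 2))) • κ √(r ^ 2 + t ^ 2) = (r : ℂ) * F t r := by
        rw [hF, Complex.real_smul]
        push_cast
        field_simp
      rw [h5] at h3
      exact h3
    have hlim : Tendsto (fun r : ℝ => Q (√(r ^ 2 + t ^ 2))) atTop (𝓝 0) := by
      refine hQ0.comp (Real.tendsto_sqrt_atTop.comp (tendsto_atTop_add_const_right _ _ ?_))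
      exact tendsto_pow_atTop two_ne_zero
    rw [integral_Ioi_of_hasDerivAt_of_tendsto (hd 0).continuousAt.continuousWithinAt
      (fun r _ => hd r) ht hlim]
    simp only [ne_eq, OfNat.ofNat_ne_zero, not_false_eq_true, zero_pow, zero_add, Real.sqrt_sq_eq_abs]
    ring
  have hex : Integrable (fun p : E2 × ℝ => Complex.exp (-Complex.I * ((2 * Real.pi * ‖ξ‖ * p.2 : ℝ) : ℂ)) *
      F p.2 ‖p.1‖) (volume.prod volume) := by
    refine hFi.bdd_mul (c := 1) ?_ (.of_forall fun p => (norm_exp_neg_I_mul _).le)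
    have : Continuous fun p : E2 × ℝ => Complex.exp (-Complex.I * ((2 * Real.pi * ‖ξ‖ * p.2 : ℝ) : ℂ)) := by
      fun_prop
    exact this.aestronglyMeasurable
  rw [Real.fourier_eq', ← he.integral_comp e.measurableEmbedding]
  have e1 : (fun p : E2 × ℝ => Complex.exp (((-2 * Real.pi * inner ℝ (e p) ξ : ℝ) : ℂ) * Complex.I) •
      (κ ‖e p‖ / (‖e p‖ : ℂ))) = fun p => Complex.exp (-Complex.I * ((2 * Real.pi * ‖ξ‖ * p.2 : ℝ) : ℂ)) *
      F p.2 ‖p.1‖ := by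
    funext p
    have h1 : inner ℝ (e p) ξ = ‖ξ‖ * p.2 := by
      rw [hep]
      nth_rewrite 1 [hθ]
      rw [inner_smul_right, inner_add_left, hι, inner_smul_left, real_inner_self_eq_norm_sq, hθ1]
      simp
    rw [h1, hep, hn, smul_eq_mul]
    congr 2
    push_cast; ring
  rw [e1, Measure.volume_eq_prod, integral_prod_symm _ hex, ← integral_const_mul]
  refine integral_congr_ae ?_
  filter_upwards [hinner] with t ht
  rw [integral_const_mul, ht]
  ring

/-! ### Spherical waves and their truncations -/

/-- The spherical wave `e^{iz|x|}/|x|`, which is `4π` times the outgoing fundamental solution of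
`-Δ - z²`. -/
def sphericalKernel (z : ℂ) (x : E3) : ℂ :=
  Complex.exp (Complex.I * z * (‖x‖ : ℂ)) / (‖x‖ : ℂ)

theorem measurable_sphericalKernel (z : ℂ) : Measurable (sphericalKernel z) := by
  unfold sphericalKernel
  fun_prop

theorem norm_sphericalKernel (z : ℂ) (x : E3) :
    ‖sphericalKernel z x‖ = Real.exp (-z.im * ‖x‖) / ‖x‖ := by
  rw [sphericalKernel, norm_div, Complex.norm_exp, Complex.norm_real, norm_norm]
  simp

theorem integrable_sphericalKernel {z : ℂ} (hz : 0 < z.im) : Integrable (sphericalKernel z) := by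
  have h := (integrable_fun_norm_addHaar (volume : Measure E3)
    (f := fun r : ℝ => Real.exp (-z.im * r) / r)).2 ?_
  · exact h.mono' (measurable_sphericalKernel z).aestronglyMeasurable
      (.of_forall fun x => (norm_sphericalKernel z x).le)
  · have h1 := integrableOn_rpow_mul_exp_neg_mul_rpow (p := 1) (s := 1) (by norm_num) (by norm_num) hz
    refine h1.congr_fun (fun r hr => ?_) measurableSet_Ioi
    have : r ≠ 0 := (Set.mem_Ioi.1 hr).ne'
    simp only [finrank_euclideanSpace, Fintype.card_fin, Nat.add_one_sub_one, Real.rpow_one, smul_eq_mul]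
    field_simp

theorem integral_eq_integral_Ioi_add_comp_neg {f : ℝ → ℂ} (hf : Integrable f) :
    ∫ t, f t = ∫ t in Set.Ioi (0 : ℝ), (f t + f (-t)) := by
  have h1 : ∫ t in Set.Ioi (0 : ℝ), f (-t) = ∫ t in Set.Iic (0 : ℝ), f t := by
    rw [integral_comp_neg_Ioi, neg_zero]
  rw [integral_add hf.integrableOn (hf.comp_neg).integrableOn, h1, add_comm,
    intervalIntegral.integral_Iic_add_Ioi hf.integrableOn hf.integrableOn]

theorem integrable_comp_abs {f : ℝ → ℂ} (hf : IntegrableOn f (Set.Ioi 0)) :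
    Integrable fun t => f |t| := by
  have hg : Integrable ((Set.Ioi (0 : ℝ)).indicator f) :=
    (integrable_indicator_iff measurableSet_Ioi).2 hf
  refine (hg.add hg.comp_neg).congr ?_
  have h0 : ∀ᵐ t : ℝ, t ≠ 0 := by simp [ae_iff, measure_singleton]
  filter_upwards [h0] with t ht
  simp only [Pi.add_apply]
  rcases lt_or_gt_of_ne ht with h | h
  · rw [Set.indicator_of_notMem (by simp [h.le]), Set.indicator_of_mem (by simpa using h),
      abs_of_neg h, zero_add]
  · rw [Set.indicator_of_mem (by simpa using h), Set.indicator_of_notMem (by simp [h.le]),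
      abs_of_pos h, add_zero]

/-- The outgoing wave `e^{iz|x|}/|x|` is `4π` times a fundamental solution of `-Δ - z²`. -/
theorem fourier_sphericalKernel {z : ℂ} (hz : 0 < z.im) (ξ : E3) :
    𝓕 (sphericalKernel z) ξ =
      4 * Real.pi / (((2 * Real.pi * ‖ξ‖ : ℝ) : ℂ) ^ 2 - z ^ 2) := by
  have hz0 : z ≠ 0 := by rintro rfl; simp at hz
  have hI : Complex.I * z ≠ 0 := mul_ne_zero Complex.I_ne_zero hz0
  have hre : (Complex.I * z).re < 0 := by simpa using hz
  set Q : ℝ → ℂ := fun r => Complex.exp (Complex.I * z * (r : ℂ)) / (Complex.I * z) with hQ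
  have hQd : ∀ r : ℝ, HasDerivAt Q (Complex.exp (Complex.I * z * (r : ℂ))) r := by
    intro r
    have h1 : HasDerivAt (fun r : ℝ => Complex.I * z * (r : ℂ)) (Complex.I * z) r := by
      simpa using (Complex.ofRealCLM.hasDerivAt (x := r)).const_mul (Complex.I * z)
    have h2 := h1.cexp.div_const (Complex.I * z)
    rwa [mul_div_assoc, div_self hI, mul_one] at h2
  have hnQ : ∀ r : ℝ, ‖Complex.exp (Complex.I * z * (r : ℂ))‖ = Real.exp (-z.im * r) := by
    intro r; rw [Complex.norm_exp]; simp
  have hQ0 : Tendsto Q atTop (𝓝 0) := by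
    have h1 : Tendsto (fun r : ℝ => Complex.exp (Complex.I * z * (r : ℂ))) atTop (𝓝 0) := by
      rw [tendsto_zero_iff_norm_tendsto_zero]
      simp only [hnQ]
      refine Real.tendsto_exp_atBot.comp ?_
      exact tendsto_id.const_mul_atTop_of_neg (by linarith)
    simpa using h1.div_const (Complex.I * z)
  have h := fourier_radial hQd hQ0 (integrable_sphericalKernel hz) ξ
  rw [show sphericalKernel z = fun x : E3 => Complex.exp (Complex.I * z * (‖x‖ : ℂ)) / (‖x‖ : ℂ)
    from rfl, h]
  set ρ : ℝ := 2 * Real.pi * ‖ξ‖ with hρ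
  have hρe : ∀ t : ℝ, 2 * Real.pi * ‖ξ‖ * t = ρ * t := fun t => rfl
  have hm : (Complex.I * (z - ρ)).re < 0 := by simpa using hz
  have hp : (Complex.I * (z + ρ)).re < 0 := by simpa using hz
  have hint0 : Integrable fun t : ℝ => Q |t| := by
    exact integrable_comp_abs ((integrableOn_exp_mul_complex_Ioi hre 0).div_const _)
  have hint : Integrable fun t : ℝ =>
      Complex.exp (-Complex.I * ((2 * Real.pi * ‖ξ‖ * t : ℝ) : ℂ)) * Q |t| := by
    refine hint0.bdd_mul (c := 1) ?_ (.of_forall fun t => (norm_exp_neg_I_mul _).le)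
    have : Continuous fun t : ℝ => Complex.exp (-Complex.I * ((2 * Real.pi * ‖ξ‖ * t : ℝ) : ℂ)) := by
      fun_prop
    exact this.aestronglyMeasurable
  rw [integral_eq_integral_Ioi_add_comp_neg hint]
  have e1 : ∀ t ∈ Set.Ioi (0 : ℝ), Complex.exp (-Complex.I * ((2 * Real.pi * ‖ξ‖ * t : ℝ) : ℂ)) * Q |t| +
      Complex.exp (-Complex.I * ((2 * Real.pi * ‖ξ‖ * -t : ℝ) : ℂ)) * Q |-t| =
      (Complex.exp (Complex.I * (z - ρ) * t) + Complex.exp (Complex.I * (z + ρ) * t)) / (Complex.I * z) := by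
    intro t ht
    rw [abs_neg, abs_of_pos (Set.mem_Ioi.1 ht), hρe, hρe, hQ]
    simp only
    rw [mul_div_assoc', mul_div_assoc', ← Complex.exp_add, ← Complex.exp_add, ← add_div]
    congr 3
    · simp only [hρ]; push_cast; ring
    · simp only [hρ]; push_cast; ring
  rw [setIntegral_congr_fun measurableSet_Ioi e1, integral_div, integral_add
    (integrableOn_exp_mul_complex_Ioi hm 0) (integrableOn_exp_mul_complex_Ioi hp 0),
    integral_exp_mul_complex_Ioi hm, integral_exp_mul_complex_Ioi hp]
  have h1 : z - ρ ≠ 0 := by intro h0; rw [h0] at hm; simp at hm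
  have h2 : z + ρ ≠ 0 := by intro h0; rw [h0] at hp; simp at hp
  have h3 : (ρ : ℂ) ^ 2 - z ^ 2 ≠ 0 := by
    have : (ρ : ℂ) ^ 2 - z ^ 2 = -((z - ρ) * (z + ρ)) := by ring
    rw [this]; exact neg_ne_zero.2 (mul_ne_zero h1 h2)
  simp only [Complex.ofReal_zero, mul_zero, Complex.exp_zero]
  have hI2 := Complex.I_sq
  rw [div_add_div _ _ (mul_ne_zero Complex.I_ne_zero h1) (mul_ne_zero Complex.I_ne_zero h2), div_div,
    mul_div_assoc', div_eq_div_iff (by simp [h1, h2, hz0]) h3]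
  linear_combination (4 * Real.pi * Complex.I * z * ((ρ : ℂ) ^ 2 - z ^ 2)) * hI2


/-- A smooth even cutoff on the line, equal to one on `[-1, 1]` and supported in `[-2, 2]`. -/
def lineCutoff : ContDiffBump (0 : ℝ) := ⟨1, 2, by norm_num, by norm_num⟩

theorem lineCutoff_of_le {r : ℝ} (hr : |r| ≤ 1) : lineCutoff r = 1 :=
  lineCutoff.one_of_mem_closedBall (by simpa [lineCutoff] using hr)

theorem lineCutoff_of_ge {r : ℝ} (hr : 2 ≤ |r|) : lineCutoff r = 0 :=
  lineCutoff.zero_of_le_dist (by simpa [lineCutoff, Real.dist_eq] using hr)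

theorem exists_deriv_lineCutoff_le : ∃ M : ℝ, 0 ≤ M ∧ ∀ r, |deriv lineCutoff r| ≤ M := by
  have h1 : Continuous (deriv lineCutoff) := lineCutoff.contDiff.continuous_deriv (n := 1) le_rfl
  obtain ⟨M, hM⟩ := h1.bounded_above_of_compact_support lineCutoff.hasCompactSupport.deriv
  exact ⟨M, (norm_nonneg _).trans (hM 0), hM⟩

/-- The spherical wave `e^{iλ|x|}/|x|`, cut off at distances of order `R`. -/
def truncatedKernel (lam R : ℝ) (x : E3) : ℂ :=
  Complex.exp (Complex.I * (lam : ℂ) * (‖x‖ : ℂ)) * ((lineCutoff (‖x‖ / R) : ℝ) : ℂ) / (‖x‖ : ℂ)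

theorem measurable_truncatedKernel (lam R : ℝ) : Measurable (truncatedKernel lam R) := by
  have := lineCutoff.continuous.measurable
  unfold truncatedKernel
  fun_prop

theorem truncatedKernel_eq (lam : ℝ) {R : ℝ} (hR : 0 < R) {x : E3} (hx : ‖x‖ ≤ R) :
    truncatedKernel lam R x = sphericalKernel lam x := by
  rw [truncatedKernel, sphericalKernel, lineCutoff_of_le]
  · simp
  · rwa [abs_of_nonneg (by positivity), div_le_one hR]

theorem norm_truncatedKernel_le (lam : ℝ) {R : ℝ} (hR : 0 < R) (x : E3) :
    ‖truncatedKernel lam R x‖ ≤ (Set.Iio (2 * R)).indicator (fun r : ℝ => r⁻¹) ‖x‖ := by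
  have h1 : ‖truncatedKernel lam R x‖ = lineCutoff (‖x‖ / R) / ‖x‖ := by
    rw [truncatedKernel, norm_div, norm_mul, Complex.norm_exp, Complex.norm_real, Complex.norm_real,
      norm_norm, Real.norm_of_nonneg (lineCutoff.nonneg' _)]
    simp
  rw [h1]
  by_cases hx : ‖x‖ < 2 * R
  · rw [Set.indicator_of_mem (by exact hx), div_eq_mul_inv]
    exact mul_le_of_le_one_left (by positivity) lineCutoff.le_one
  · rw [Set.indicator_of_notMem (by exact hx), lineCutoff_of_ge, zero_div]
    rw [abs_of_nonneg (by positivity), le_div_iff₀ hR]; exact not_lt.1 hx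

theorem integrable_indicator_inv_norm_pow {k : ℕ} (hk : k ≤ 2) (R : ℝ) :
    Integrable fun x : E3 => (Set.Iio R).indicator (fun r : ℝ => (r ^ k)⁻¹) ‖x‖ := by
  rw [integrable_fun_norm_addHaar (volume : Measure E3)
    (f := (Set.Iio R).indicator (fun r : ℝ => (r ^ k)⁻¹))]
  have h1 : IntegrableOn (fun r : ℝ => r ^ (2 - k)) (Set.Ioo 0 R) := by
    have : IntegrableOn (fun r : ℝ => r ^ (2 - k)) (Set.Icc 0 R) :=
      (continuous_pow _).continuousOn.integrableOn_Icc
    exact this.mono_set Set.Ioo_subset_Icc_self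
  have h2 : Integrable ((Set.Ioo 0 R).indicator (fun r : ℝ => r ^ (2 - k))) :=
    (integrable_indicator_iff measurableSet_Ioo).2 h1
  refine (h2.integrableOn (s := Set.Ioi 0)).congr_fun (fun r hr => ?_) measurableSet_Ioi
  have hr0 : 0 < r := hr
  simp only [finrank_euclideanSpace, Fintype.card_fin, Nat.add_one_sub_one, smul_eq_mul]
  by_cases h : r < R
  · rw [Set.indicator_of_mem (Set.mem_Ioo.2 ⟨hr0, h⟩), Set.indicator_of_mem (by exact h),
      ← div_eq_mul_inv, eq_div_iff (by positivity), ← pow_add, Nat.sub_add_cancel hk]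
  · rw [Set.indicator_of_notMem (fun h' => h h'.2), Set.indicator_of_notMem (by exact h), mul_zero]

theorem integrable_truncatedKernel (lam : ℝ) {R : ℝ} (hR : 0 < R) :
    Integrable (truncatedKernel lam R) := by
  have := integrable_indicator_inv_norm_pow (k := 1) (by norm_num) (2 * R)
  simp only [pow_one] at this
  exact this.mono' (measurable_truncatedKernel lam R).aestronglyMeasurable
    (.of_forall fun x => norm_truncatedKernel_le lam hR x)

/-- The Fourier transform of a spherical wave of frequency `λ` cut off at distance `R` is
concentrated near the sphere of radius `λ`, at distance of order `1/R`. -/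
theorem exists_norm_fourier_truncatedKernel_le : ∃ C : ℝ, 0 ≤ C ∧ ∀ lam : ℝ, 0 < lam → ∀ R : ℝ,
    0 < R → ∀ ξ : E3, (2 * Real.pi * ‖ξ‖ * ‖𝓕 (truncatedKernel lam R) ξ‖) ^ 2 ≤
      C * R ^ 2 * (1 + (R * (2 * Real.pi * ‖ξ‖ - lam)) ^ 2)⁻¹ := by
  obtain ⟨M, hM0, hM⟩ := exists_deriv_lineCutoff_le
  refine ⟨(8 * Real.pi) ^ 2 + (4 * Real.pi * (1 + 2 * M)) ^ 2, by positivity,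
    fun lam hlam R hR ξ => ?_⟩
  set ρ : ℝ := 2 * Real.pi * ‖ξ‖ with hρ
  have hρ0 : 0 ≤ ρ := by positivity
  set κ : ℝ → ℂ := fun r => Complex.exp (Complex.I * (lam : ℂ) * (r : ℂ)) *
    ((lineCutoff (r / R) : ℝ) : ℂ) with hκ
  have hκc : Continuous κ := by
    have := lineCutoff.continuous
    simp only [hκ]; fun_prop
  set Q : ℝ → ℂ := fun r => ∫ s in (2 * R)..r, κ s with hQ
  have hQd : ∀ r, HasDerivAt Q (κ r) r := fun r =>
    intervalIntegral.integral_hasDerivAt_right (hκc.intervalIntegrable _ _)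
      (hκc.stronglyMeasurableAtFilter _ _) hκc.continuousAt
  have hκ0 : ∀ r, 2 * R ≤ r → κ r = 0 := by
    intro r hr
    simp only [hκ]
    rw [lineCutoff_of_ge]
    · simp
    · rw [abs_of_nonneg (div_nonneg (by linarith) hR.le), le_div_iff₀ hR]; exact hr
  have hQ0 : ∀ r, 2 * R ≤ r → Q r = 0 := by
    intro r hr
    simp only [hQ]
    rw [intervalIntegral.integral_congr (g := fun _ => 0)]
    · simp
    · intro s hs
      rw [Set.uIcc_of_le hr] at hs
      exact hκ0 s hs.1
  have hQc : Continuous Q := continuous_iff_continuousAt.2 fun r => (hQd r).continuousAt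
  have hQlim : Tendsto Q atTop (𝓝 0) := by
    refine tendsto_const_nhds.congr' ?_
    filter_upwards [eventually_ge_atTop (2 * R)] with r hr using (hQ0 r hr).symm
  have h := fourier_radial hQd hQlim (integrable_truncatedKernel lam hR) ξ
  have hQi : Integrable fun t : ℝ => Q |t| := by
    refine Continuous.integrable_of_hasCompactSupport (by fun_prop) ?_
    refine HasCompactSupport.intro (isCompact_Icc (a := -(2 * R)) (b := 2 * R)) fun t ht => ?_
    apply hQ0
    rw [Set.mem_Icc, ← abs_le, not_le] at ht
    exact ht.le
  have hei : Integrable fun t : ℝ => Complex.exp (-Complex.I * ((ρ * t : ℝ) : ℂ)) * Q |t| := by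
    refine hQi.bdd_mul (c := 1) ?_ (.of_forall fun t => (norm_exp_neg_I_mul _).le)
    have : Continuous fun t : ℝ => Complex.exp (-Complex.I * ((ρ * t : ℝ) : ℂ)) := by fun_prop
    exact this.aestronglyMeasurable
  have h1 : ∫ t : ℝ, Complex.exp (-Complex.I * ((ρ * t : ℝ) : ℂ)) * Q |t| =
      ∫ t in (0 : ℝ)..(2 * R), 2 * Complex.cos ((ρ * t : ℝ) : ℂ) * Q t := by
    rw [integral_eq_integral_Ioi_add_comp_neg hei, intervalIntegral.integral_of_le (by linarith)]
    have e1 : ∀ t ∈ Set.Ioi (0 : ℝ), Complex.exp (-Complex.I * ((ρ * t : ℝ) : ℂ)) * Q |t| +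
        Complex.exp (-Complex.I * ((ρ * -t : ℝ) : ℂ)) * Q |-t| =
        2 * Complex.cos ((ρ * t : ℝ) : ℂ) * Q t := by
      intro t ht
      rw [abs_neg, abs_of_pos (Set.mem_Ioi.1 ht), Complex.two_cos]
      have e2 : -Complex.I * ((ρ * t : ℝ) : ℂ) = -((ρ * t : ℝ) : ℂ) * Complex.I := by ring
      have e3 : -Complex.I * ((ρ * -t : ℝ) : ℂ) = ((ρ * t : ℝ) : ℂ) * Complex.I := by
        push_cast; ring
      rw [e2, e3]; ring
    rw [setIntegral_congr_fun measurableSet_Ioi e1]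
    refine setIntegral_eq_of_subset_of_forall_sdiff_eq_zero measurableSet_Ioi
      Set.Ioc_subset_Ioi_self fun t ht => ?_
    rw [hQ0 t, mul_zero]
    by_contra h0
    exact ht.2 ⟨ht.1, (not_le.1 h0).le⟩
  -- Integration by parts: the factor `ρ` makes of the cosine transform of the primitive `Q` the
  -- sine transform `S` of `κ`.
  have h2 : (ρ : ℂ) * ∫ t in (0 : ℝ)..(2 * R), 2 * Complex.cos ((ρ * t : ℝ) : ℂ) * Q t =
      -2 * ∫ t in (0 : ℝ)..(2 * R), Complex.sin ((ρ * t : ℝ) : ℂ) * κ t := by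
    have hsd : ∀ t : ℝ, HasDerivAt (fun t : ℝ => 2 * Complex.sin ((ρ * t : ℝ) : ℂ))
        (2 * Complex.cos ((ρ * t : ℝ) : ℂ) * (ρ : ℂ)) t := by
      intro t
      have h1 : HasDerivAt (fun t : ℝ => ((ρ * t : ℝ) : ℂ)) (ρ : ℂ) t := by
        have := ((hasDerivAt_id t).const_mul ρ).ofReal_comp
        simpa using this
      have h2 := ((Complex.hasDerivAt_sin ((ρ * t : ℝ) : ℂ)).comp t h1).const_mul 2
      rwa [← mul_assoc] at h2
    have e := intervalIntegral.integral_mul_deriv_eq_deriv_mul (a := 0) (b := 2 * R)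
      (fun t _ => hsd t) (fun t _ => hQd t)
      (Continuous.intervalIntegrable (by fun_prop) _ _) (hκc.intervalIntegrable _ _)
    rw [hQ0 _ le_rfl] at e
    simp only [mul_zero, Complex.ofReal_zero, Complex.sin_zero, zero_mul, sub_zero, zero_sub] at e
    rw [← intervalIntegral.integral_const_mul, ← intervalIntegral.integral_const_mul]
    have e2 : ∫ t in (0 : ℝ)..(2 * R), -2 * (Complex.sin ((ρ * t : ℝ) : ℂ) * κ t) =
        -∫ t in (0 : ℝ)..(2 * R), 2 * Complex.sin ((ρ * t : ℝ) : ℂ) * κ t := by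
      rw [← intervalIntegral.integral_neg]
      exact intervalIntegral.integral_congr fun t _ => by ring
    rw [e2, e, neg_neg]
    exact intervalIntegral.integral_congr fun t _ => by ring
  set S : ℂ := ∫ t in (0 : ℝ)..(2 * R), Complex.sin ((ρ * t : ℝ) : ℂ) * κ t with hS
  have h3 : ρ * ‖𝓕 (truncatedKernel lam R) ξ‖ = 4 * Real.pi * ‖S‖ := by
    have e1 : 𝓕 (truncatedKernel lam R) ξ = -(2 * Real.pi) *
        ∫ t in (0 : ℝ)..(2 * R), 2 * Complex.cos ((ρ * t : ℝ) : ℂ) * Q t := by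
      rw [← h1]; exact h
    have e2 : (ρ : ℂ) * 𝓕 (truncatedKernel lam R) ξ = 4 * Real.pi * S := by
      rw [e1]; linear_combination (-(2 * Real.pi) : ℂ) * h2
    have e3 := congrArg norm e2
    rw [norm_mul, norm_mul, norm_mul, Complex.norm_real, Complex.norm_real,
      Real.norm_of_nonneg hρ0, Real.norm_of_nonneg Real.pi_pos.le] at e3
    simpa using e3
  -- The trivial bound, by the length of the interval of integration.
  have hS1 : ‖S‖ ≤ 2 * R := by
    have e1 := intervalIntegral.norm_integral_le_of_norm_le_const (a := 0) (b := 2 * R) (C := 1)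
      (f := fun t : ℝ => Complex.sin ((ρ * t : ℝ) : ℂ) * κ t) fun t _ => by
        rw [norm_mul, ← Complex.ofReal_sin, Complex.norm_real, hκ]
        simp only
        rw [norm_mul, Complex.norm_exp, Complex.norm_real, Real.norm_of_nonneg lineCutoff.nonneg]
        simpa using mul_le_one₀ (Real.abs_sin_le_one (ρ * t)) lineCutoff.nonneg lineCutoff.le_one
    rwa [sub_zero, one_mul, abs_of_pos (by linarith)] at e1
  have hexp : ∀ a : ℝ, |a| * ‖∫ t in (0 : ℝ)..(2 * R), Complex.exp (Complex.I * ((a * t : ℝ) : ℂ)) *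
      ((lineCutoff (t / R) : ℝ) : ℂ)‖ ≤ 1 + 2 * M := by
    intro a
    have hed : ∀ t : ℝ, HasDerivAt (fun t : ℝ => Complex.exp (Complex.I * ((a * t : ℝ) : ℂ)))
        (Complex.exp (Complex.I * ((a * t : ℝ) : ℂ)) * (Complex.I * a)) t := by
      intro t
      have h1 : HasDerivAt (fun t : ℝ => Complex.I * ((a * t : ℝ) : ℂ)) (Complex.I * a) t := by
        have := (((hasDerivAt_id t).const_mul a).ofReal_comp).const_mul Complex.I
        simpa using this
      exact h1.cexp
    have hBd : ∀ t : ℝ, HasDerivAt (fun t : ℝ => ((lineCutoff (t / R) : ℝ) : ℂ))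
        ((deriv lineCutoff (t / R) / R : ℝ) : ℂ) t := by
      intro t
      have h1 : HasDerivAt lineCutoff (deriv lineCutoff (t / R)) (t / R) :=
        ((lineCutoff.contDiff (n := 1)).differentiable one_ne_zero _).hasDerivAt
      have h2 := (h1.comp t ((hasDerivAt_id t).div_const R)).ofReal_comp
      simpa [div_eq_mul_inv] using h2
    have hBc : Continuous (deriv lineCutoff) :=
      lineCutoff.contDiff.continuous_deriv (n := 1) le_rfl
    have e := intervalIntegral.integral_mul_deriv_eq_deriv_mul (a := 0) (b := 2 * R)
      (fun t _ => hed t) (fun t _ => hBd t)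
      (Continuous.intervalIntegrable (by fun_prop) _ _)
      (Continuous.intervalIntegrable (by fun_prop) _ _)
    have hb1 : lineCutoff (2 * R / R) = 0 :=
      lineCutoff_of_ge (by rw [mul_div_assoc, div_self hR.ne']; norm_num)
    have hb0 : lineCutoff (0 / R) = 1 := lineCutoff_of_le (by simp)
    rw [hb1, hb0] at e
    have e1 := intervalIntegral.norm_integral_le_of_norm_le_const (a := 0) (b := 2 * R) (C := M / R)
      (f := fun t : ℝ => Complex.exp (Complex.I * ((a * t : ℝ) : ℂ)) *
        ((deriv lineCutoff (t / R) / R : ℝ) : ℂ)) fun t _ => by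
        rw [norm_mul, Complex.norm_exp, Complex.norm_real, norm_div, Real.norm_of_nonneg hR.le]
        simpa using div_le_div_of_nonneg_right (hM (t / R)) hR.le
    rw [sub_zero, abs_of_pos (by linarith : 0 < 2 * R),
      show M / R * (2 * R) = 2 * M by field_simp] at e1
    have e2 : (Complex.I * a) * ∫ t in (0 : ℝ)..(2 * R), Complex.exp (Complex.I * ((a * t : ℝ) : ℂ)) *
        ((lineCutoff (t / R) : ℝ) : ℂ) = -1 - ∫ t in (0 : ℝ)..(2 * R),
          Complex.exp (Complex.I * ((a * t : ℝ) : ℂ)) * ((deriv lineCutoff (t / R) / R : ℝ) : ℂ) := by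
      rw [e, ← intervalIntegral.integral_const_mul]
      simp only [mul_zero, Complex.ofReal_zero, Complex.ofReal_one, Complex.exp_zero, mul_one, zero_sub]
      rw [show ∀ A : ℂ, (-1 : ℂ) - (-1 - A) = A from fun A => by ring]
      exact intervalIntegral.integral_congr fun t _ => by ring
    have e3 := congrArg norm e2
    rw [norm_mul, norm_mul, Complex.norm_I, one_mul, Complex.norm_real, Real.norm_eq_abs] at e3
    rw [e3]
    refine (norm_sub_le _ _).trans ?_
    rw [norm_neg, norm_one]
    linarith
  -- The sine is a combination of the exponentials of `±iρt`. Integrating by parts against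
  -- `e^{i(λ±ρ)t}` gains `1/|λ±ρ|`, and `|λ + ρ| ≥ |λ - ρ|`.
  have hS2 : |ρ - lam| * ‖S‖ ≤ 1 + 2 * M := by
    set A : ℝ → ℂ := fun a => ∫ t in (0 : ℝ)..(2 * R),
      Complex.exp (Complex.I * ((a * t : ℝ) : ℂ)) * ((lineCutoff (t / R) : ℝ) : ℂ) with hA
    have hAi : ∀ a : ℝ, IntervalIntegrable (fun t : ℝ => Complex.exp (Complex.I * ((a * t : ℝ) : ℂ)) *
        ((lineCutoff (t / R) : ℝ) : ℂ)) volume 0 (2 * R) := by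
      intro a
      have := lineCutoff.continuous
      exact Continuous.intervalIntegrable (by fun_prop) _ _
    have e1 : S = (A (lam - ρ) - A (lam + ρ)) * (Complex.I / 2) := by
      simp only [hA, hS]
      rw [← intervalIntegral.integral_sub (hAi _) (hAi _), ← intervalIntegral.integral_mul_const]
      refine intervalIntegral.integral_congr fun t _ => ?_
      simp only [hκ]
      rw [Complex.sin, ← sub_mul]
      have e1 : Complex.exp (Complex.I * (((lam - ρ) * t : ℝ) : ℂ)) =
          Complex.exp (-((ρ * t : ℝ) : ℂ) * Complex.I) * Complex.exp (Complex.I * lam * t) := by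
        rw [← Complex.exp_add]; congr 1; push_cast; ring
      have e2 : Complex.exp (Complex.I * (((lam + ρ) * t : ℝ) : ℂ)) =
          Complex.exp (((ρ * t : ℝ) : ℂ) * Complex.I) * Complex.exp (Complex.I * lam * t) := by
        rw [← Complex.exp_add]; congr 1; push_cast; ring
      rw [e1, e2]; ring
    have e2 : ‖S‖ ≤ (‖A (lam - ρ)‖ + ‖A (lam + ρ)‖) / 2 := by
      rw [e1, norm_mul, norm_div, Complex.norm_I, Complex.norm_ofNat, mul_one_div]
      exact div_le_div_of_nonneg_right (norm_sub_le _ _) zero_le_two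
    have e3 : |ρ - lam| * ‖A (lam - ρ)‖ ≤ 1 + 2 * M := by
      rw [abs_sub_comm]; exact hexp _
    have e4 : |ρ - lam| * ‖A (lam + ρ)‖ ≤ 1 + 2 * M := by
      refine (mul_le_mul_of_nonneg_right ?_ (norm_nonneg _)).trans (hexp (lam + ρ))
      rw [abs_of_pos (by linarith : 0 < lam + ρ), abs_le]
      constructor <;> linarith
    nlinarith [mul_le_mul_of_nonneg_left e2 (abs_nonneg (ρ - lam))]
  rw [h3, ← div_eq_mul_inv, le_div_iff₀ (by positivity)]
  have e1 : (4 * Real.pi * ‖S‖) ^ 2 ≤ (8 * Real.pi * R) ^ 2 := by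
    refine pow_le_pow_left₀ (by positivity) ?_ 2
    nlinarith [Real.pi_pos]
  have e2 : (4 * Real.pi * (|ρ - lam| * ‖S‖)) ^ 2 ≤ (4 * Real.pi * (1 + 2 * M)) ^ 2 := by
    refine pow_le_pow_left₀ (by positivity) ?_ 2
    gcongr
  have e3 : (4 * Real.pi * (|ρ - lam| * ‖S‖)) ^ 2 = (4 * Real.pi * ‖S‖) ^ 2 * (ρ - lam) ^ 2 := by
    rw [← sq_abs (ρ - lam)]; ring
  rw [e3] at e2
  nlinarith [mul_le_mul_of_nonneg_left e2 (sq_nonneg R)]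

/-! ### Mean squares of outgoing waves in balls -/

/-- The convolution `∫ k(x - y) g(y) dy` of a kernel with a density. -/
def kernelConv (k g : E3 → ℂ) (x : E3) : ℂ := ∫ y, k (x - y) * g y

theorem kernelConv_eq_convolution (k g : E3 → ℂ) :
    kernelConv k g = MeasureTheory.convolution k g (ContinuousLinearMap.mul ℂ ℂ) volume := by
  funext x
  rw [MeasureTheory.convolution_eq_swap]
  rfl

theorem fourier_kernelConv {k g : E3 → ℂ} (hk : Integrable k) (hg : Integrable g) (ξ : E3) :
    𝓕 (kernelConv k g) ξ = 𝓕 k ξ * 𝓕 g ξ := by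
  rw [kernelConv_eq_convolution]
  exact Real.fourier_mul_convolution_eq hk hg ξ

theorem integrable_kernelConv {k g : E3 → ℂ} (hk : Integrable k) (hg : Integrable g) :
    Integrable (kernelConv k g) := by
  rw [kernelConv_eq_convolution]
  exact hk.integrable_convolution _ hg

theorem eLpNorm_two_sq {α : Type*} [MeasurableSpace α] {μ : Measure α} (f : α → ℂ) :
    eLpNorm f 2 μ ^ 2 = ∫⁻ x, ‖f x‖ₑ ^ 2 ∂μ := by
  have := eLpNorm_nnreal_pow_eq_lintegral (μ := μ) (f := f) (p := 2) two_ne_zero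
  simpa using this

theorem memLp_two_of_integrable_of_bound {f : E3 → ℂ} (hf : Integrable f) {B : ℝ}
    (hB : ∀ x, ‖f x‖ ≤ B) : MemLp f 2 := by
  rw [memLp_two_iff_integrable_sq_norm hf.1]
  refine (hf.norm.const_mul B).mono' (hf.1.norm.pow 2) (.of_forall fun x => ?_)
  rw [Real.norm_of_nonneg (by positivity), sq]
  exact mul_le_mul_of_nonneg_right (hB x) (norm_nonneg _)

theorem norm_kernelConv_le {k g : E3 → ℂ} (hk : Integrable k) {B : ℝ} (hB : ∀ x, ‖g x‖ ≤ B)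
    (x : E3) : ‖kernelConv k g x‖ ≤ (∫ y, ‖k y‖) * B := by
  have h1 : Integrable fun y => k (x - y) := hk.comp_sub_left x
  calc ‖kernelConv k g x‖ ≤ ∫ y, ‖k (x - y)‖ * B := by
        refine norm_integral_le_of_norm_le (h1.norm.mul_const B) (.of_forall fun y => ?_)
        rw [norm_mul]
        exact mul_le_mul_of_nonneg_left (hB y) (norm_nonneg _)
    _ = _ := by
        rw [integral_mul_const, integral_sub_left_eq_self (fun y => ‖k y‖)]

theorem memLp_kernelConv {k g : E3 → ℂ} (hk : Integrable k) (hg : Integrable g) {B : ℝ}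
    (hB : ∀ x, ‖g x‖ ≤ B) : MemLp (kernelConv k g) 2 :=
  memLp_two_of_integrable_of_bound (integrable_kernelConv hk hg) (norm_kernelConv_le hk hB)

theorem lintegral_kernelConv_sq {k g : E3 → ℂ} (hk : Integrable k) (hg : Integrable g) {B : ℝ}
    (hB : ∀ x, ‖g x‖ ≤ B) :
    ∫⁻ x, ‖kernelConv k g x‖ₑ ^ 2 = ∫⁻ ξ, ‖𝓕 k ξ‖ₑ ^ 2 * ‖𝓕 g ξ‖ₑ ^ 2 := by
  rw [← eLpNorm_two_sq, ← eLpNorm_fourier_eq (integrable_kernelConv hk hg)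
    (memLp_kernelConv hk hg hB), eLpNorm_two_sq]
  simp only [fourier_kernelConv hk hg, enorm_mul, mul_pow]

theorem enorm_sq_eq_ofReal (z : ℂ) : ‖z‖ₑ ^ 2 = ENNReal.ofReal (‖z‖ ^ 2) := by
  rw [← ofReal_norm, ENNReal.ofReal_pow (norm_nonneg _)]

/-- A Fourier transform concentrated at scale `1/Y` near a point of the sphere of radius `λ/2π` has
mean square of order `Y⁻²` on every sphere around the origin. -/
theorem exists_lintegral_sphere_fourier_le {lam : ℝ} (hlam : 0 < lam) :
    ∃ C : ℝ, 0 ≤ C ∧ ∀ (w : S2) (G : E3 → ℂ) (A Y r : ℝ), 0 < Y → 0 < r →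
      (∀ ξ, ‖G ξ‖ ≤ A * ((1 + Y * ‖ξ - (lam / (2 * Real.pi)) • (w : E3)‖) ^ 2)⁻¹) →
      ∫⁻ σ : S2, ‖G (r • (σ : E3))‖ₑ ^ 2 ∂sphereMeasure ≤
        ENNReal.ofReal (C * (A ^ 2 * (Y ^ 2)⁻¹)) := by
  obtain ⟨C, hC0, hC⟩ := exists_lintegral_cap_le
  set a : ℝ := lam / (2 * Real.pi) with ha
  have ha0 : 0 < a := by positivity
  refine ⟨C * ((a / 2) ^ 2)⁻¹, by positivity, fun w G A Y r hY hr hG => ?_⟩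
  have hw : ‖(w : E3)‖ = 1 := by simp
  have hpt : ∀ σ : S2, ‖G (r • (σ : E3))‖ₑ ^ 2 ≤ ENNReal.ofReal (A ^ 2) *
      ENNReal.ofReal (((1 + ((Y * (a / 2)) * ‖(σ : E3) - w‖) ^ 2) ^ 2)⁻¹) := by
    intro σ
    have hσ : ‖(σ : E3)‖ = 1 := by simp
    rw [enorm_sq_eq_ofReal, ← ENNReal.ofReal_mul (sq_nonneg A)]
    refine ENNReal.ofReal_le_ofReal ?_
    set d : ℝ := ‖r • (σ : E3) - a • (w : E3)‖ with hd
    have hd0 : 0 ≤ d := norm_nonneg _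
    -- Moving `rσ` radially to the sphere of radius `a` at most doubles its distance to `a w`.
    have h1 : a * ‖(σ : E3) - w‖ ≤ 2 * d := by
      have e1 : a • ((σ : E3) - w) = (a - r) • (σ : E3) + (r • (σ : E3) - a • (w : E3)) := by module
      have e2 : a * ‖(σ : E3) - w‖ = ‖a • ((σ : E3) - w)‖ := by
        rw [norm_smul, Real.norm_of_nonneg ha0.le]
      have e3 : |a - r| ≤ d := by
        have := abs_norm_sub_norm_le (r • (σ : E3)) (a • (w : E3))
        rw [norm_smul, norm_smul, hσ, hw, Real.norm_of_nonneg ha0.le, Real.norm_of_nonneg hr.le,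
          mul_one, mul_one, abs_sub_comm] at this
        exact this
      have e4 := norm_add_le ((a - r) • (σ : E3)) (r • (σ : E3) - a • (w : E3))
      rw [norm_smul, hσ, mul_one, Real.norm_eq_abs] at e4
      rw [e2, e1]; linarith
    have h2 : 1 + ((Y * (a / 2)) * ‖(σ : E3) - w‖) ^ 2 ≤ (1 + Y * d) ^ 2 := by
      have e1 : (Y * (a / 2)) * ‖(σ : E3) - w‖ ≤ Y * d := by
        rw [mul_assoc]; exact mul_le_mul_of_nonneg_left (by linarith) hY.le
      have e2 : ((Y * (a / 2)) * ‖(σ : E3) - w‖) ^ 2 ≤ (Y * d) ^ 2 :=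
        pow_le_pow_left₀ (by positivity) e1 2
      have e3 : 0 ≤ Y * d := by positivity
      nlinarith
    calc ‖G (r • (σ : E3))‖ ^ 2 ≤ (A * ((1 + Y * d) ^ 2)⁻¹) ^ 2 :=
          pow_le_pow_left₀ (norm_nonneg _) (hG _) 2
      _ = A ^ 2 * (((1 + Y * d) ^ 2) ^ 2)⁻¹ := by rw [mul_pow, inv_pow]
      _ ≤ _ := by
          refine mul_le_mul_of_nonneg_left ?_ (sq_nonneg A)
          exact inv_anti₀ (by positivity) (pow_le_pow_left₀ (by positivity) h2 2)
  calc _ ≤ ∫⁻ σ : S2, ENNReal.ofReal (A ^ 2) *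
      ENNReal.ofReal (((1 + ((Y * (a / 2)) * ‖(σ : E3) - w‖) ^ 2) ^ 2)⁻¹) ∂sphereMeasure :=
        lintegral_mono hpt
    _ = ENNReal.ofReal (A ^ 2) * ∫⁻ σ : S2,
      ENNReal.ofReal (((1 + ((Y * (a / 2)) * ‖(σ : E3) - w‖) ^ 2) ^ 2)⁻¹) ∂sphereMeasure :=
        lintegral_const_mul' _ _ ENNReal.ofReal_ne_top
    _ ≤ ENNReal.ofReal (A ^ 2) * ENNReal.ofReal (C * ((Y * (a / 2)) ^ 2)⁻¹) :=
        mul_le_mul_right (hC w _ (by positivity)) _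
    _ = _ := by
        rw [← ENNReal.ofReal_mul (sq_nonneg A), mul_pow, mul_inv]
        congr 1; ring

/-- Integration over frequencies against the profile of the transform of a truncated wave costs a
factor `1/R`. -/
theorem integral_lorentzian {R : ℝ} (hR : 0 < R) (lam : ℝ) :
    Integrable (fun r : ℝ => (1 + (2 * R * (2 * Real.pi * r - lam)) ^ 2)⁻¹) ∧
    ∫ r : ℝ, (1 + (2 * R * (2 * Real.pi * r - lam)) ^ 2)⁻¹ = (4 * R)⁻¹ := by
  set c : ℝ := 4 * Real.pi * R with hc
  have hc0 : 0 < c := by positivity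
  have e : (fun r : ℝ => (1 + (2 * R * (2 * Real.pi * r - lam)) ^ 2)⁻¹) =
      fun r => (fun t : ℝ => (fun x : ℝ => (1 + x ^ 2)⁻¹) (c * t)) (r - lam / (2 * Real.pi)) := by
    funext r
    simp only [hc]
    congr 3
    field_simp
    ring
  rw [e]
  constructor
  · exact (integrable_inv_one_add_sq.comp_mul_left' hc0.ne').comp_sub_right _
  · rw [integral_sub_right_eq_self (fun t : ℝ => (fun x : ℝ => (1 + x ^ 2)⁻¹) (c * t)),
      Measure.integral_comp_mul_left (fun x : ℝ => (1 + x ^ 2)⁻¹), integral_univ_inv_one_add_sq, abs_of_pos (by positivity), hc]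
    simp only [smul_eq_mul]
    field_simp

/-- The mean square over balls of an outgoing wave, whose source has a Fourier transform concentrated
at scale `1/Y` near one point of the sphere of radius `λ/2π`. The truncation of the kernel is
harmless in the ball, and Plancherel's theorem reduces the estimate to the Fourier side. -/
theorem exists_lintegral_ball_kernelConv_le {lam : ℝ} (hlam : 0 < lam) :
    ∃ C : ℝ, 0 ≤ C ∧ ∀ (w : S2) (g : E3 → ℂ) (A R Y : ℝ), 0 < R → 0 < Y →
      Continuous g → (∀ y, R < ‖y‖ → g y = 0) →
      (∀ ξ, ‖𝓕 g ξ‖ ≤ A * ((1 + Y * ‖ξ - (lam / (2 * Real.pi)) • (w : E3)‖) ^ 2)⁻¹) →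
      ∫⁻ x in Metric.ball 0 R, ‖kernelConv (sphericalKernel lam) g x‖ₑ ^ 2 ≤
        ENNReal.ofReal (C * (A ^ 2 * R * (Y ^ 2)⁻¹)) := by
  obtain ⟨C₁, hC₁0, hC₁⟩ := exists_norm_fourier_truncatedKernel_le
  obtain ⟨C₂, hC₂0, hC₂⟩ := exists_lintegral_sphere_fourier_le hlam
  refine ⟨C₁ * C₂ / (4 * Real.pi ^ 2), by positivity, fun w g A R Y hR hY hgc hgs hgF => ?_⟩
  have hgcs : HasCompactSupport g := by
    refine HasCompactSupport.intro (isCompact_closedBall (0 : E3) R) fun y hy => hgs y ?_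
    simpa using hy
  have hgi : Integrable g := hgc.integrable_of_hasCompactSupport hgcs
  obtain ⟨B, hB⟩ := hgc.bounded_above_of_compact_support hgcs
  have h2R : 0 < 2 * R := by linarith
  set T := truncatedKernel lam (2 * R) with hT
  have hTi : Integrable T := integrable_truncatedKernel lam h2R
  have hTc : Continuous (𝓕 T) := continuous_fourier_of_integrable hTi
  have hGc : Continuous (𝓕 g) := continuous_fourier_of_integrable hgi
  -- For `x` and `y` in the ball of radius `R`, `|x - y| ≤ 2R`: the truncation at distance `2R` is
  -- invisible.
  have h1 : ∀ x ∈ Metric.ball (0 : E3) R,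
      ‖kernelConv (sphericalKernel lam) g x‖ₑ ^ 2 = ‖kernelConv T g x‖ₑ ^ 2 := by
    intro x hx
    rw [mem_ball_zero_iff] at hx
    congr 2
    refine integral_congr_ae (.of_forall fun y => ?_)
    simp only
    by_cases hy : R < ‖y‖
    · rw [hgs y hy, mul_zero, mul_zero]
    · rw [hT, truncatedKernel_eq lam h2R]
      exact (norm_sub_le _ _).trans (by linarith [not_lt.1 hy])
  have hφm : Measurable fun p : S2 × ℝ => ENNReal.ofReal (p.2 ^ 2) *
      (‖𝓕 T (p.2 • (p.1 : E3))‖ₑ ^ 2 * ‖𝓕 g (p.2 • (p.1 : E3))‖ₑ ^ 2) := by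
    have h0 : Continuous fun p : S2 × ℝ => p.2 • (p.1 : E3) := by fun_prop
    have h1 := (hTc.comp h0).measurable
    have h2 := (hGc.comp h0).measurable
    exact (measurable_snd.pow_const 2).ennreal_ofReal.mul
      ((h1.enorm.pow_const 2).mul (h2.enorm.pow_const 2))
  obtain ⟨hLi, hLv⟩ := integral_lorentzian hR lam
  calc _ = ∫⁻ x in Metric.ball 0 R, ‖kernelConv T g x‖ₑ ^ 2 :=
        setLIntegral_congr_fun measurableSet_ball h1
    _ ≤ ∫⁻ x, ‖kernelConv T g x‖ₑ ^ 2 := setLIntegral_le_lintegral _ _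
    _ = ∫⁻ ξ, ‖𝓕 T ξ‖ₑ ^ 2 * ‖𝓕 g ξ‖ₑ ^ 2 := lintegral_kernelConv_sq hTi hgi hB
    _ = ∫⁻ σ : S2, ∫⁻ r in Set.Ioi (0 : ℝ), ENNReal.ofReal (r ^ 2) *
          (‖𝓕 T (r • (σ : E3))‖ₑ ^ 2 * ‖𝓕 g (r • (σ : E3))‖ₑ ^ 2) ∂volume ∂sphereMeasure :=
        lintegral_polar (by
          exact (hTc.measurable.enorm.pow_const 2).mul (hGc.measurable.enorm.pow_const 2))
    _ = ∫⁻ r in Set.Ioi (0 : ℝ), ∫⁻ σ : S2, ENNReal.ofReal (r ^ 2) *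
          (‖𝓕 T (r • (σ : E3))‖ₑ ^ 2 * ‖𝓕 g (r • (σ : E3))‖ₑ ^ 2) ∂sphereMeasure ∂volume :=
        lintegral_lintegral_swap hφm.aemeasurable
    _ ≤ ∫⁻ r in Set.Ioi (0 : ℝ), ENNReal.ofReal (C₁ * (2 * R) ^ 2 / (4 * Real.pi ^ 2) *
          (1 + (2 * R * (2 * Real.pi * r - lam)) ^ 2)⁻¹) *
          ENNReal.ofReal (C₂ * (A ^ 2 * (Y ^ 2)⁻¹)) := by
        refine setLIntegral_mono' measurableSet_Ioi fun r hr => ?_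
        have hr0 : 0 < r := hr
        have h2 : ∀ σ : S2, ENNReal.ofReal (r ^ 2) *
            (‖𝓕 T (r • (σ : E3))‖ₑ ^ 2 * ‖𝓕 g (r • (σ : E3))‖ₑ ^ 2) ≤
            ENNReal.ofReal (C₁ * (2 * R) ^ 2 / (4 * Real.pi ^ 2) *
            (1 + (2 * R * (2 * Real.pi * r - lam)) ^ 2)⁻¹) * ‖𝓕 g (r • (σ : E3))‖ₑ ^ 2 := by
          intro σ
          rw [← mul_assoc]
          refine mul_le_mul_left ?_ _
          rw [enorm_sq_eq_ofReal, ← ENNReal.ofReal_mul (sq_nonneg r)]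
          refine ENNReal.ofReal_le_ofReal ?_
          have h3 := hC₁ lam hlam (2 * R) h2R (r • (σ : E3))
          rw [norm_smul, Real.norm_of_nonneg hr0.le, show ‖(σ : E3)‖ = 1 by simp, mul_one, mul_pow,
            mul_pow, mul_pow] at h3
          rw [div_mul_eq_mul_div, le_div_iff₀ (by positivity)]
          calc _ = (2 ^ 2 * Real.pi ^ 2 * r ^ 2) * ‖𝓕 T (r • (σ : E3))‖ ^ 2 := by ring
            _ ≤ _ := by
              refine le_trans (le_of_eq ?_) h3
              ring
        refine (lintegral_mono h2).trans ?_
        rw [lintegral_const_mul' _ _ ENNReal.ofReal_ne_top]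
        exact mul_le_mul_right (hC₂ w (𝓕 g) A Y r hY hr0 hgF) _
    _ ≤ ∫⁻ r : ℝ, ENNReal.ofReal (C₁ * (2 * R) ^ 2 / (4 * Real.pi ^ 2) *
          (1 + (2 * R * (2 * Real.pi * r - lam)) ^ 2)⁻¹) *
          ENNReal.ofReal (C₂ * (A ^ 2 * (Y ^ 2)⁻¹)) := setLIntegral_le_lintegral _ _
    _ = ENNReal.ofReal (C₁ * C₂ / (4 * Real.pi ^ 2) * (A ^ 2 * R * (Y ^ 2)⁻¹)) := by
        rw [lintegral_mul_const' _ _ ENNReal.ofReal_ne_top,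
          ← ofReal_integral_eq_lintegral_ofReal (hLi.const_mul _)
            (.of_forall fun r => by positivity), integral_const_mul, hLv,
          ← ENNReal.ofReal_mul (by positivity)]
        congr 1
        field_simp
        ring

/-! ### The radial equation of a spherical wave -/

/-- The spherical wave as a function of the squared distance: `e^{iλ√t}/√t`. -/
def waveProfile (lam t : ℝ) : ℂ :=
  Complex.exp (Complex.I * lam * (√t : ℂ)) / (√t : ℂ)

/-- The derivative of `waveProfile`. -/
def waveProfile₁ (lam t : ℝ) : ℂ :=
  Complex.exp (Complex.I * lam * (√t : ℂ)) * (Complex.I * lam * (√t : ℂ) - 1) / (2 * (√t : ℂ) ^ 3)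

/-- The second derivative of `waveProfile`, written so as to display the equation
`4tψ'' + 6ψ' + λ²ψ = 0` which expresses the Helmholtz equation. -/
def waveProfile₂ (lam t : ℝ) : ℂ :=
  -(6 * waveProfile₁ lam t + lam ^ 2 * waveProfile lam t) / (4 * t)

theorem sphericalKernel_eq_waveProfile (lam : ℝ) (x : E3) :
    sphericalKernel lam x = waveProfile lam (‖x‖ ^ 2) := by
  rw [waveProfile, Real.sqrt_sq (norm_nonneg x), sphericalKernel]

theorem hasDerivAt_ofReal_sqrt {t : ℝ} (ht : 0 < t) :
    HasDerivAt (fun t : ℝ => (√t : ℂ)) (1 / (2 * (√t : ℂ))) t := by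
  have := (Real.hasDerivAt_sqrt ht.ne').ofReal_comp
  simpa using this

theorem hasDerivAt_exp_sqrt (lam : ℝ) {t : ℝ} (ht : 0 < t) :
    HasDerivAt (fun t : ℝ => Complex.exp (Complex.I * lam * (√t : ℂ)))
      (Complex.exp (Complex.I * lam * (√t : ℂ)) * (Complex.I * lam * (1 / (2 * (√t : ℂ))))) t :=
  ((hasDerivAt_ofReal_sqrt ht).const_mul (Complex.I * (lam : ℂ))).cexp

theorem hasDerivAt_waveProfile (lam : ℝ) {t : ℝ} (ht : 0 < t) :
    HasDerivAt (waveProfile lam) (waveProfile₁ lam t) t := by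
  have hs : (√t : ℂ) ≠ 0 := by exact_mod_cast (Real.sqrt_pos.2 ht).ne'
  have h := (hasDerivAt_exp_sqrt lam ht).div (hasDerivAt_ofReal_sqrt ht) hs
  have e : (Complex.exp (Complex.I * lam * (√t : ℂ)) * (Complex.I * lam * (1 / (2 * (√t : ℂ)))) *
      (√t : ℂ) - Complex.exp (Complex.I * lam * (√t : ℂ)) * (1 / (2 * (√t : ℂ)))) / (√t : ℂ) ^ 2 =
      waveProfile₁ lam t := by
    rw [waveProfile₁]; field_simp
  rw [← e]
  exact h

theorem hasDerivAt_waveProfile₁ (lam : ℝ) {t : ℝ} (ht : 0 < t) :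
    HasDerivAt (waveProfile₁ lam) (waveProfile₂ lam t) t := by
  have hs : (√t : ℂ) ≠ 0 := by exact_mod_cast (Real.sqrt_pos.2 ht).ne'
  have hst : (t : ℂ) = (√t : ℂ) ^ 2 := by
    rw [← Complex.ofReal_pow, Real.sq_sqrt ht.le]
  have h1 := ((hasDerivAt_ofReal_sqrt ht).const_mul (Complex.I * (lam : ℂ))).sub_const 1
  have h2 := ((hasDerivAt_ofReal_sqrt ht).pow 3).const_mul (2 : ℂ)
  have h := ((hasDerivAt_exp_sqrt lam ht).mul h1).div h2 (mul_ne_zero two_ne_zero (pow_ne_zero 3 hs))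
  refine h.congr_deriv ?_
  simp only [Pi.mul_apply, Pi.pow_apply]
  rw [waveProfile₂, waveProfile₁, waveProfile, hst]
  generalize (√t : ℂ) = s at hs
  generalize Complex.exp (Complex.I * lam * s) = E
  have hI := Complex.I_sq
  field_simp
  linear_combination (4 * E * lam ^ 2 * s ^ 4) * hI

theorem norm_waveProfile₁_le {lam d : ℝ} (hlam : 0 < lam) (hd : 1 / 2 ≤ d) :
    ‖waveProfile₁ lam (d ^ 2)‖ ≤ (lam + 2) / (2 * d ^ 2) := by
  have hd0 : 0 < d := by linarith
  rw [waveProfile₁, Real.sqrt_sq hd0.le, norm_div, norm_mul, Complex.norm_exp, norm_mul, norm_pow,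
    Complex.norm_real, Real.norm_of_nonneg hd0.le]
  have e1 : ‖Complex.I * lam * d - 1‖ ≤ lam * d + 1 := by
    refine (norm_sub_le _ _).trans ?_
    simp [abs_of_pos hlam, abs_of_pos hd0]
  have e2 : (Complex.I * lam * d).re = 0 := by simp
  rw [e2, Real.exp_zero, one_mul, Complex.norm_ofNat, div_le_div_iff₀ (by positivity) (by positivity)]
  have : ‖Complex.I * lam * d - 1‖ ≤ (lam + 2) * d := by linarith
  calc _ ≤ (lam + 2) * d * (2 * d ^ 2) := by gcongr
    _ = _ := by ring

theorem norm_waveProfile₂_le {lam d : ℝ} (hlam : 0 < lam) (hd : 1 / 2 ≤ d) :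
    ‖waveProfile₂ lam (d ^ 2)‖ ≤ (6 * (lam + 2) + lam ^ 2) / (4 * d ^ 3) := by
  have hd0 : 0 < d := by linarith
  have h1 := norm_waveProfile₁_le hlam hd
  have h0 : ‖waveProfile lam (d ^ 2)‖ = 1 / d := by
    rw [waveProfile, Real.sqrt_sq hd0.le, norm_div, Complex.norm_exp, Complex.norm_real,
      Real.norm_of_nonneg hd0.le]
    simp
  have h2 : ‖waveProfile₁ lam (d ^ 2)‖ ≤ (lam + 2) / d := by
    refine h1.trans ?_
    rw [div_le_div_iff₀ (by positivity) hd0]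
    nlinarith [mul_pos (by linarith : 0 < lam + 2) hd0]
  rw [waveProfile₂, norm_div, norm_neg]
  have e1 : ‖(4 * ((d ^ 2 : ℝ) : ℂ))‖ = 4 * d ^ 2 := by
    rw [norm_mul, Complex.norm_real, Real.norm_of_nonneg (by positivity)]; simp
  rw [e1]
  have e2 : ‖6 * waveProfile₁ lam (d ^ 2) + lam ^ 2 * waveProfile lam (d ^ 2)‖ ≤
      (6 * (lam + 2) + lam ^ 2) / d := by
    refine (norm_add_le _ _).trans ?_
    rw [norm_mul, norm_mul, norm_pow, Complex.norm_real, h0, Real.norm_of_nonneg hlam.le,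
      Complex.norm_ofNat]
    rw [add_div, mul_div_assoc, mul_one_div]
    gcongr
  calc _ ≤ (6 * (lam + 2) + lam ^ 2) / d / (4 * d ^ 2) := by gcongr
    _ = _ := by field_simp

/-- The spherical wave with source `y`, at the point at distance `s` from the origin in a direction
`θ` with `a = ⟨θ, y⟩` and `b = |y|²`, divided by `e^{iλs}/s`. -/
def radialWave (lam a b s : ℝ) : ℂ :=
  s * Complex.exp (-Complex.I * lam * s) * waveProfile lam (s ^ 2 - 2 * a * s + b)

/-- The derivative of `radialWave` in `s`. -/
def radialWave₁ (lam a b s : ℝ) : ℂ :=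
  Complex.exp (-Complex.I * lam * s) * ((1 - Complex.I * lam * s) *
    waveProfile lam (s ^ 2 - 2 * a * s + b) +
    2 * s * (s - a) * waveProfile₁ lam (s ^ 2 - 2 * a * s + b))

/-- The value of `k'' + 2iλk'` for `k = radialWave`. By the Helmholtz equation it equals
`-s⁻¹ e^{-iλs}` times the spherical Laplacian of the wave. -/
def radialSource (lam a b s : ℝ) : ℂ :=
  Complex.exp (-Complex.I * lam * s) * (-4 * a * waveProfile₁ lam (s ^ 2 - 2 * a * s + b) -
    4 * s * (b - a ^ 2) * waveProfile₂ lam (s ^ 2 - 2 * a * s + b))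

theorem hasDerivAt_exp_neg (lam s : ℝ) :
    HasDerivAt (fun s : ℝ => Complex.exp (-Complex.I * lam * (s : ℂ)))
      (Complex.exp (-Complex.I * lam * s) * (-Complex.I * lam)) s := by
  have h1 : HasDerivAt (fun s : ℝ => -Complex.I * lam * (s : ℂ)) (-Complex.I * lam) s := by
    simpa using (Complex.ofRealCLM.hasDerivAt (x := s)).const_mul (-Complex.I * (lam : ℂ))
  exact h1.cexp

theorem hasDerivAt_comp_sq_dist {f : ℝ → ℂ} {f' : ℂ} {a b s : ℝ}
    (h : HasDerivAt f f' (s ^ 2 - 2 * a * s + b)) :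
    HasDerivAt (fun s : ℝ => f (s ^ 2 - 2 * a * s + b)) ((2 * (s - a) : ℂ) * f') s := by
  have h1 : HasDerivAt (fun s : ℝ => s ^ 2 - 2 * a * s + b) (2 * (s - a)) s := by
    have := (((hasDerivAt_id s).pow 2).sub ((hasDerivAt_id s).const_mul (2 * a))).add_const b
    refine this.congr_deriv ?_
    simp only [id]; push_cast; ring
  have h2 := h.scomp s h1
  refine h2.congr_deriv ?_
  rw [Complex.real_smul]; push_cast; ring

theorem hasDerivAt_radialWave (lam : ℝ) {a b s : ℝ} (h : 0 < s ^ 2 - 2 * a * s + b) :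
    HasDerivAt (radialWave lam a b) (radialWave₁ lam a b s) s := by
  have h1 := ((Complex.ofRealCLM.hasDerivAt (x := s)).mul (hasDerivAt_exp_neg lam s)).mul
    (hasDerivAt_comp_sq_dist (hasDerivAt_waveProfile lam h))
  refine h1.congr_deriv ?_
  simp only [radialWave₁, Pi.mul_apply, Complex.ofRealCLM_apply, Complex.ofReal_one]
  ring

theorem hasDerivAt_radialWave₁ (lam : ℝ) {a b s : ℝ} (h : 0 < s ^ 2 - 2 * a * s + b) :
    HasDerivAt (radialWave₁ lam a b)
      (radialSource lam a b s - 2 * Complex.I * lam * radialWave₁ lam a b s) s := by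
  have hid : HasDerivAt (fun s : ℝ => (s : ℂ)) 1 s := by
    simpa using (hasDerivAt_id s).ofReal_comp
  have h1 := (hasDerivAt_exp_neg lam s).mul
    ((((hid.const_mul (Complex.I * (lam : ℂ))).const_sub 1).mul
      (hasDerivAt_comp_sq_dist (hasDerivAt_waveProfile lam h))).add
     (((hid.const_mul 2).mul (hid.sub_const (a : ℂ))).mul
      (hasDerivAt_comp_sq_dist (hasDerivAt_waveProfile₁ lam h))))
  refine h1.congr_deriv ?_
  simp only [radialWave₁, radialSource, Pi.mul_apply, Pi.add_apply]
  have ht : ((s ^ 2 - 2 * a * s + b : ℝ) : ℂ) ≠ 0 := by exact_mod_cast h.ne'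
  have hode : 4 * ((s ^ 2 - 2 * a * s + b : ℝ) : ℂ) * waveProfile₂ lam (s ^ 2 - 2 * a * s + b) =
      -(6 * waveProfile₁ lam (s ^ 2 - 2 * a * s + b) +
        lam ^ 2 * waveProfile lam (s ^ 2 - 2 * a * s + b)) := by
    rw [waveProfile₂, mul_div_cancel₀ _ (mul_ne_zero (by norm_num) ht)]
  generalize waveProfile₂ lam (s ^ 2 - 2 * a * s + b) = p2 at *
  generalize waveProfile₁ lam (s ^ 2 - 2 * a * s + b) = p1 at *
  generalize waveProfile lam (s ^ 2 - 2 * a * s + b) = p0 at *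
  generalize Complex.exp (-Complex.I * lam * s) = E
  have hI := Complex.I_sq
  push_cast at hode
  linear_combination (E * s) * hode + (-E * lam ^ 2 * s * p0) * hI

theorem norm_radialSource_le {lam a b β s : ℝ} (hlam : 0 < lam) (ha : |a| ≤ β) (hab : a ^ 2 ≤ b)
    (hb : b ≤ β ^ 2) (hs : 1 ≤ s) (hβ : 2 * β ≤ s) :
    ‖radialSource lam a b s‖ ≤ (8 * β * (lam + 2) + 8 * β ^ 2 * (6 * (lam + 2) + lam ^ 2)) / s ^ 2 := by
  have hβ0 : 0 ≤ β := (abs_nonneg a).trans ha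
  have ht : (s / 2) ^ 2 ≤ s ^ 2 - 2 * a * s + b := by
    have h1 := (abs_le.1 ha).2
    nlinarith [sq_nonneg (s - a), mul_nonneg hβ0 hβ0]
  set d := √(s ^ 2 - 2 * a * s + b) with hd
  have hd2 : s ^ 2 - 2 * a * s + b = d ^ 2 := by rw [hd, Real.sq_sqrt]; nlinarith
  have hds : s / 2 ≤ d := Real.le_sqrt_of_sq_le ht
  have hd0 : 0 < d := by linarith
  rw [radialSource, hd2, norm_mul, Complex.norm_exp]
  have e0 : (-Complex.I * lam * s).re = 0 := by simp
  rw [e0, Real.exp_zero, one_mul]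
  refine (norm_sub_le _ _).trans ?_
  have h1 := norm_waveProfile₁_le hlam (by linarith : 1 / 2 ≤ d)
  have h2 := norm_waveProfile₂_le hlam (by linarith : 1 / 2 ≤ d)
  have n1 : ‖(-4 * a : ℂ)‖ ≤ 4 * β := by
    rw [neg_mul, norm_neg, norm_mul, Complex.norm_real, Complex.norm_ofNat, Real.norm_eq_abs]
    exact mul_le_mul_of_nonneg_left ha (by norm_num)
  have n2 : ‖(4 * s * (b - a ^ 2) : ℂ)‖ ≤ 4 * s * β ^ 2 := by
    have : (4 * s * (b - a ^ 2) : ℂ) = ((4 * s * (b - a ^ 2) : ℝ) : ℂ) := by push_cast; ring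
    rw [this, Complex.norm_real, Real.norm_of_nonneg
      (mul_nonneg (by linarith) (by linarith))]
    exact mul_le_mul_of_nonneg_left (by nlinarith [sq_nonneg a]) (by linarith)
  rw [norm_mul (-4 * a : ℂ), norm_mul (4 * s * (b - a ^ 2) : ℂ), add_div]
  refine add_le_add ?_ ?_
  · calc _ ≤ 4 * β * ((lam + 2) / (2 * d ^ 2)) := by gcongr
      _ ≤ 4 * β * ((lam + 2) / (2 * (s / 2) ^ 2)) := by gcongr
      _ = _ := by field_simp; ring
  · calc _ ≤ 4 * s * β ^ 2 * ((6 * (lam + 2) + lam ^ 2) / (4 * d ^ 3)) := by gcongr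
      _ ≤ 4 * s * β ^ 2 * ((6 * (lam + 2) + lam ^ 2) / (4 * (s / 2) ^ 3)) := by gcongr
      _ = _ := by field_simp; ring

theorem sq_dist_pos {a b β s : ℝ} (ha : |a| ≤ β) (hab : a ^ 2 ≤ b) (hs : 1 ≤ s) (hβ : 2 * β ≤ s) :
    0 < s ^ 2 - 2 * a * s + b := by
  have h1 := (abs_le.1 ha).2
  have h2 : 0 < s - a := by
    have := (abs_nonneg a).trans ha
    linarith
  nlinarith [mul_pos h2 h2]

theorem tendsto_dist_div (a b : ℝ) :
    Tendsto (fun s : ℝ => √(s ^ 2 - 2 * a * s + b) / s) atTop (𝓝 1) := by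
  have h0 : Tendsto (fun s : ℝ => s⁻¹) atTop (𝓝 0) := tendsto_inv_atTop_zero
  have h1 : Tendsto (fun s : ℝ => √(1 - 2 * a * s⁻¹ + b * (s⁻¹ * s⁻¹))) atTop (𝓝 1) := by
    have := ((tendsto_const_nhds (x := (1 : ℝ))).sub (h0.const_mul (2 * a))).add
      ((h0.mul h0).const_mul b)
    simpa using this.sqrt
  refine h1.congr' ?_
  filter_upwards [eventually_gt_atTop 0] with s hs
  rw [show 1 - 2 * a * s⁻¹ + b * (s⁻¹ * s⁻¹) = (s ^ 2 - 2 * a * s + b) / s ^ 2 by field_simp,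
    Real.sqrt_div' _ (sq_nonneg s), Real.sqrt_sq hs.le]

theorem tendsto_dist_sub {a b β : ℝ} (ha : |a| ≤ β) (hab : a ^ 2 ≤ b) :
    Tendsto (fun s : ℝ => √(s ^ 2 - 2 * a * s + b) - s) atTop (𝓝 (-a)) := by
  have h0 : Tendsto (fun s : ℝ => s⁻¹) atTop (𝓝 0) := tendsto_inv_atTop_zero
  have h1 : Tendsto (fun s : ℝ => (b * s⁻¹ - 2 * a) / (√(s ^ 2 - 2 * a * s + b) / s + 1)) atTop
      (𝓝 ((b * 0 - 2 * a) / (1 + 1))) :=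
    ((h0.const_mul b).sub_const (2 * a)).div ((tendsto_dist_div a b).add_const 1) (by norm_num)
  have e : (b * 0 - 2 * a) / (1 + 1) = -a := by ring
  rw [e] at h1
  refine h1.congr' ?_
  filter_upwards [eventually_ge_atTop 1, eventually_ge_atTop (2 * β)] with s hs hβ
  have hp := sq_dist_pos ha hab hs hβ
  have hd := Real.sqrt_pos.2 hp
  have hd2 := Real.sq_sqrt hp.le
  generalize √(s ^ 2 - 2 * a * s + b) = d at hd hd2
  have hs0 : 0 < s := by linarith
  field_simp
  linear_combination -hd2

theorem tendsto_exp_dist (lam : ℝ) {a b β : ℝ} (ha : |a| ≤ β) (hab : a ^ 2 ≤ b) :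
    Tendsto (fun s : ℝ => Complex.exp (Complex.I * lam *
      ((√(s ^ 2 - 2 * a * s + b) - s : ℝ) : ℂ))) atTop (𝓝 (Complex.exp (-Complex.I * lam * a))) := by
  have h1 := ((Complex.continuous_ofReal.tendsto _).comp (tendsto_dist_sub ha hab)).const_mul
    (Complex.I * (lam : ℂ))
  have h2 := (Complex.continuous_exp.tendsto _).comp h1
  have e : Complex.I * lam * ((-a : ℝ) : ℂ) = -Complex.I * lam * a := by push_cast; ring
  rw [e] at h2
  exact h2

theorem tendsto_div_dist (a b : ℝ) :
    Tendsto (fun s : ℝ => ((s / √(s ^ 2 - 2 * a * s + b) : ℝ) : ℂ)) atTop (𝓝 1) := by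
  have h := (tendsto_dist_div a b).inv₀ one_ne_zero
  simp only [inv_div, inv_one] at h
  have h' := (Complex.continuous_ofReal.tendsto _).comp h
  rw [Complex.ofReal_one] at h'
  exact h'

theorem tendsto_radialWave (lam : ℝ) {a b β : ℝ} (ha : |a| ≤ β) (hab : a ^ 2 ≤ b) :
    Tendsto (radialWave lam a b) atTop (𝓝 (Complex.exp (-Complex.I * lam * a))) := by
  have h := (tendsto_div_dist a b).mul (tendsto_exp_dist lam ha hab)
  rw [one_mul] at h
  refine h.congr fun s => ?_
  rw [radialWave, waveProfile]
  have e : Complex.exp (Complex.I * lam * ((√(s ^ 2 - 2 * a * s + b) - s : ℝ) : ℂ)) =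
      Complex.exp (-Complex.I * lam * s) *
        Complex.exp (Complex.I * lam * (√(s ^ 2 - 2 * a * s + b) : ℂ)) := by
    rw [← Complex.exp_add]; congr 1; push_cast; ring
  rw [e]; push_cast; ring

theorem tendsto_radialWave₁ (lam : ℝ) {a b β : ℝ} (ha : |a| ≤ β) (hab : a ^ 2 ≤ b) :
    Tendsto (radialWave₁ lam a b) atTop (𝓝 0) := by
  have hu := tendsto_div_dist a b
  have hv : Tendsto (fun s : ℝ => ((1 / √(s ^ 2 - 2 * a * s + b) : ℝ) : ℂ)) atTop (𝓝 0) := by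
    have h0 : Tendsto (fun s : ℝ => ((s⁻¹ : ℝ) : ℂ)) atTop (𝓝 0) := by
      have h' := (Complex.continuous_ofReal.tendsto _).comp (tendsto_inv_atTop_zero (𝕜 := ℝ))
      rw [Complex.ofReal_zero] at h'
      exact h'
    have h1 := hu.mul h0
    rw [mul_zero] at h1
    refine h1.congr' ?_
    filter_upwards [eventually_gt_atTop 0] with s hs
    rw [← Complex.ofReal_mul]
    congr 1
    field_simp
  have hua := hu.sub (hv.const_mul (a : ℂ))
  have h := (tendsto_exp_dist lam ha hab).mul
    (((hv.sub (hu.const_mul (Complex.I * (lam : ℂ)))).add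
      ((hu.mul hua).const_mul (Complex.I * (lam : ℂ)))).sub ((hu.mul hua).mul hv))
  have e0 : Complex.exp (-Complex.I * lam * a) * (0 - Complex.I * lam * 1 +
      Complex.I * lam * (1 * (1 - a * 0)) - 1 * (1 - a * 0) * 0) = 0 := by ring
  rw [e0] at h
  refine h.congr' ?_
  filter_upwards [eventually_ge_atTop 1, eventually_ge_atTop (2 * β)] with s hs hβ
  have hp := sq_dist_pos ha hab hs hβ
  have hd := Real.sqrt_pos.2 hp
  rw [radialWave₁, waveProfile, waveProfile₁]
  have e : Complex.exp (Complex.I * lam * ((√(s ^ 2 - 2 * a * s + b) - s : ℝ) : ℂ)) =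
      Complex.exp (-Complex.I * lam * s) *
        Complex.exp (Complex.I * lam * (√(s ^ 2 - 2 * a * s + b) : ℂ)) := by
    rw [← Complex.exp_add]; congr 1; push_cast; ring
  rw [e]
  generalize √(s ^ 2 - 2 * a * s + b) = d at hd
  have hd' : (d : ℂ) ≠ 0 := by exact_mod_cast hd.ne'
  push_cast
  field_simp
  ring

/-- The deviation of a spherical wave from its far field. Variation of constants for
`k'' + 2iλk' = q` gives it as an integral of the source over the exterior of the sphere. -/
theorem radialWave_sub_eq {lam a b β r : ℝ} (hlam : 0 < lam) (ha : |a| ≤ β) (hab : a ^ 2 ≤ b)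
    (hb : b ≤ β ^ 2) (hr : 1 ≤ r) (hβ : 2 * β ≤ r) :
    IntegrableOn (fun s : ℝ => (Complex.exp (2 * Complex.I * lam * (s - r)) - 1) *
      radialSource lam a b s) (Set.Ioi r) ∧
    ∫ s in Set.Ioi r, (Complex.exp (2 * Complex.I * lam * (s - r)) - 1) * radialSource lam a b s =
      2 * Complex.I * lam * (radialWave lam a b r - Complex.exp (-Complex.I * lam * a)) := by
  set E : ℝ → ℂ := fun s => Complex.exp (2 * Complex.I * lam * (s - r)) with hE
  have hEn : ∀ s, ‖E s‖ = 1 := by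
    intro s
    have : 2 * Complex.I * lam * ((s : ℂ) - r) = ((2 * lam * (s - r) : ℝ) : ℂ) * Complex.I := by
      push_cast; ring
    rw [hE]; simp only
    rw [this, Complex.norm_exp_ofReal_mul_I]
  have hEd : ∀ s : ℝ, HasDerivAt E (E s * (2 * Complex.I * lam)) s := by
    intro s
    have hid : HasDerivAt (fun s : ℝ => (s : ℂ)) 1 s := by
      simpa using (hasDerivAt_id s).ofReal_comp
    have h1 := ((hid.sub_const (r : ℂ)).const_mul (2 * Complex.I * (lam : ℂ))).cexp
    rwa [mul_one] at h1
  have hpos : ∀ s, r ≤ s → 0 < s ^ 2 - 2 * a * s + b := fun s hs =>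
    sq_dist_pos ha hab (hr.trans hs) (hβ.trans hs)
  -- `P' = (E - 1) k'' + E' k' - 2iλ k' = (E - 1) (k'' + 2iλ k')`. At `s = r` the first term of
  -- `P` vanishes, and at infinity `k' → 0` while `k` tends to its far field value.
  set P : ℝ → ℂ := fun s => (E s - 1) * radialWave₁ lam a b s -
    2 * Complex.I * lam * radialWave lam a b s with hP
  have hPd : ∀ s, r ≤ s → HasDerivAt P ((E s - 1) * radialSource lam a b s) s := by
    intro s hs
    have h1 := (((hEd s).sub_const 1).mul (hasDerivAt_radialWave₁ lam (hpos s hs))).sub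
      ((hasDerivAt_radialWave lam (hpos s hs)).const_mul (2 * Complex.I * (lam : ℂ)))
    refine h1.congr_deriv ?_
    ring
  have hE1 : ∀ s, ‖E s - 1‖ ≤ 2 := fun s =>
    (norm_sub_le _ _).trans (by rw [hEn, norm_one]; norm_num)
  have hPlim : Tendsto P atTop (𝓝 (-(2 * Complex.I * lam * Complex.exp (-Complex.I * lam * a)))) := by
    have h1 : Tendsto (fun s => (E s - 1) * radialWave₁ lam a b s) atTop (𝓝 0) := by
      have := (tendsto_radialWave₁ lam ha hab).norm.const_mul 2
      rw [norm_zero, mul_zero] at this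
      refine squeeze_zero_norm (fun s => ?_) this
      rw [norm_mul]
      exact mul_le_mul_of_nonneg_right (hE1 s) (norm_nonneg _)
    have h2 := h1.sub ((tendsto_radialWave lam ha hab).const_mul (2 * Complex.I * (lam : ℂ)))
    rwa [zero_sub] at h2
  have hcont : ContinuousOn (fun s => (E s - 1) * radialSource lam a b s) (Set.Ioi r) := by
    have hpoly : Continuous fun s : ℝ => s ^ 2 - 2 * a * s + b := by fun_prop
    have hmaps : Set.MapsTo (fun s : ℝ => s ^ 2 - 2 * a * s + b) (Set.Ioi r) (Set.Ioi 0) :=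
      fun s hs => hpos s (le_of_lt hs)
    have h0 : ContinuousOn (waveProfile lam) (Set.Ioi 0) := fun t ht =>
      (hasDerivAt_waveProfile lam ht).continuousAt.continuousWithinAt
    have h1 : ContinuousOn (waveProfile₁ lam) (Set.Ioi 0) := fun t ht =>
      (hasDerivAt_waveProfile₁ lam ht).continuousAt.continuousWithinAt
    have h2 : ContinuousOn (waveProfile₂ lam) (Set.Ioi 0) := by
      unfold waveProfile₂
      refine ContinuousOn.div ?_ (by fun_prop) fun t ht => ?_
      · exact ((h1.const_smul (6 : ℂ)).add (h0.const_smul ((lam : ℂ) ^ 2))).neg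
      · have : (t : ℂ) ≠ 0 := by exact_mod_cast (Set.mem_Ioi.1 ht).ne'
        exact mul_ne_zero (by norm_num) this
    have h1' := h1.comp hpoly.continuousOn hmaps
    have h2' := h2.comp hpoly.continuousOn hmaps
    have hEc : Continuous E := continuous_iff_continuousAt.2 fun s => (hEd s).continuousAt
    simp only [radialSource]
    refine ((hEc.sub continuous_const).continuousOn).mul (ContinuousOn.mul (by fun_prop) ?_)
    refine ContinuousOn.sub ?_ ?_
    · exact ContinuousOn.mul (by fun_prop) h1'
    · exact ContinuousOn.mul (by fun_prop) h2'
  have hint : IntegrableOn (fun s => (E s - 1) * radialSource lam a b s) (Set.Ioi r) := by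
    have hr0 : 0 < r := by linarith
    have h1 : IntegrableOn (fun s : ℝ => s ^ (-2 : ℝ)) (Set.Ioi r) :=
      integrableOn_Ioi_rpow_of_lt (by norm_num) hr0
    refine (h1.const_mul (2 * (8 * β * (lam + 2) + 8 * β ^ 2 * (6 * (lam + 2) + lam ^ 2)))).mono'
      (hcont.aestronglyMeasurable measurableSet_Ioi) ?_
    filter_upwards [ae_restrict_mem measurableSet_Ioi] with s hs
    have hs' : r < s := hs
    have hs0 : 0 < s := by linarith
    have h2 := norm_radialSource_le hlam ha hab hb (by linarith : 1 ≤ s) (by linarith)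
    rw [norm_mul, Real.rpow_neg hs0.le, Real.rpow_two, mul_assoc, ← div_eq_mul_inv]
    exact mul_le_mul (hE1 s) h2 (norm_nonneg _) zero_le_two
  refine ⟨hint, ?_⟩
  rw [integral_Ioi_of_hasDerivAt_of_tendsto (hPd r le_rfl).continuousAt.continuousWithinAt
    (fun s hs => hPd s (le_of_lt hs)) hint hPlim]
  simp only [hP, hE, sub_self, mul_zero, Complex.exp_zero, zero_mul, zero_sub]
  ring

/-! ### Rotation fields and the spherical Laplacian -/

/-- The vector field generating the rotations in the coordinate plane of indices `j` and `k`. -/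
def rotField (j k : Fin 3) : E3 →L[ℝ] E3 :=
  (EuclideanSpace.proj j : E3 →L[ℝ] ℝ).smulRight (EuclideanSpace.single k (1 : ℝ)) -
    (EuclideanSpace.proj k : E3 →L[ℝ] ℝ).smulRight (EuclideanSpace.single j (1 : ℝ))

theorem rotField_apply (j k : Fin 3) (y : E3) : rotField j k y =
    y j • EuclideanSpace.single k (1 : ℝ) - y k • EuclideanSpace.single j (1 : ℝ) := rfl

theorem inner_rotField (j k : Fin 3) (x y : E3) :
    inner ℝ x (rotField j k y) = y j * x k - y k * x j := by
  rw [rotField_apply, inner_sub_right, inner_smul_right, inner_smul_right,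
    EuclideanSpace.inner_single_right, EuclideanSpace.inner_single_right]
  simp

theorem inner_rotField_self (j k : Fin 3) (y : E3) : inner ℝ y (rotField j k y) = 0 := by
  rw [inner_rotField]; ring

/-- The derivative of `f` along the rotations in a coordinate plane. -/
def rotDeriv (j k : Fin 3) (f : E3 → ℂ) (y : E3) : ℂ := fderiv ℝ f y (rotField j k y)

/-- The Laplace operator of the spheres around the origin, as the sum of the squares of the three
rotation fields. -/
def sphericalLaplacian (f : E3 → ℂ) (y : E3) : ℂ :=
  rotDeriv 0 1 (rotDeriv 0 1 f) y + rotDeriv 1 2 (rotDeriv 1 2 f) y +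
    rotDeriv 2 0 (rotDeriv 2 0 f) y

theorem contDiff_rotDeriv {f : E3 → ℂ} (hf : ContDiff ℝ ∞ f) (j k : Fin 3) :
    ContDiff ℝ ∞ (rotDeriv j k f) := by
  have h := hf.fderiv_right (m := ∞) (by simp)
  exact h.clm_apply (rotField j k).contDiff

theorem rotDeriv_eq_zero {f : E3 → ℂ} {c : ℝ} (hf : ∀ y, c < ‖y‖ → f y = 0) (j k : Fin 3) {y : E3}
    (hy : c < ‖y‖) : rotDeriv j k f y = 0 := by
  have h : f =ᶠ[𝓝 y] fun _ => 0 := by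
    filter_upwards [(continuous_norm.continuousAt (x := y)).eventually_const_lt hy] with z hz
      using hf z hz
  rw [rotDeriv, h.fderiv_eq]
  simp

theorem hasCompactSupport_rotDeriv {f : E3 → ℂ} (hf : HasCompactSupport f) (j k : Fin 3) :
    HasCompactSupport (rotDeriv j k f) := by
  obtain ⟨c, hc⟩ := hf.isCompact.isBounded.subset_closedBall 0
  refine HasCompactSupport.intro (isCompact_closedBall (0 : E3) c) fun y hy =>
    rotDeriv_eq_zero (c := c) (fun z hz => ?_) j k (by simpa using hy)
  exact image_eq_zero_of_notMem_tsupport fun h => by simpa using (hc h).trans_lt hz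

theorem rotDeriv_add {f g : E3 → ℂ} (hf : Differentiable ℝ f) (hg : Differentiable ℝ g)
    (j k : Fin 3) : rotDeriv j k (fun y => f y + g y) = fun y => rotDeriv j k f y + rotDeriv j k g y := by
  funext y
  rw [rotDeriv, fderiv_fun_add (hf y) (hg y)]
  rfl

theorem rotDeriv_mul {f g : E3 → ℂ} (hf : Differentiable ℝ f) (hg : Differentiable ℝ g)
    (j k : Fin 3) : rotDeriv j k (fun y => f y * g y) =
      fun y => rotDeriv j k f y * g y + f y * rotDeriv j k g y := by
  funext y
  rw [rotDeriv, fderiv_fun_mul (hf y) (hg y)]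
  simp only [rotDeriv, _root_.add_apply, FunLike.coe_smul, Pi.smul_apply, smul_eq_mul]
  ring

theorem rotDeriv_const_mul {f : E3 → ℂ} (hf : Differentiable ℝ f) (c : ℂ) (j k : Fin 3) :
    rotDeriv j k (fun y => c * f y) = fun y => c * rotDeriv j k f y := by
  funext y
  rw [rotDeriv, fderiv_const_mul (hf y)]
  rfl

theorem integral_coord_mul_fderiv_eq_zero {Φ : E3 → ℂ} (hΦ : ContDiff ℝ ∞ Φ)
    (hc : HasCompactSupport Φ) {j k : Fin 3} (hjk : j ≠ k) :
    Integrable (fun y => ((y j : ℝ) : ℂ) * fderiv ℝ Φ y (EuclideanSpace.single k (1 : ℝ))) ∧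
    ∫ y, ((y j : ℝ) : ℂ) * fderiv ℝ Φ y (EuclideanSpace.single k (1 : ℝ)) = 0 := by
  set L : E3 →L[ℝ] ℂ := Complex.ofRealCLM.comp (EuclideanSpace.proj j) with hL
  have hLa : ∀ y : E3, L y = ((y j : ℝ) : ℂ) := fun y => rfl
  have hd : Continuous fun y => fderiv ℝ Φ y (EuclideanSpace.single k (1 : ℝ)) :=
    (hΦ.continuous_fderiv (by simp)).clm_apply continuous_const
  have hdc : HasCompactSupport fun y => fderiv ℝ Φ y (EuclideanSpace.single k (1 : ℝ)) :=
    hc.fderiv_apply ℝ _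
  have h0 : ∀ y, fderiv ℝ L y (EuclideanSpace.single k (1 : ℝ)) = 0 := by
    intro y
    rw [ContinuousLinearMap.fderiv, hLa]
    simp [hjk]
  have hi : Integrable (fun y => L y * fderiv ℝ Φ y (EuclideanSpace.single k (1 : ℝ))) :=
    (L.continuous.mul hd).integrable_of_hasCompactSupport hdc.mul_left
  have h := integral_mul_fderiv_eq_neg_fderiv_mul_of_integrable (μ := (volume : Measure E3))
    (f := L) (g := Φ) (v := EuclideanSpace.single k (1 : ℝ)) 
    (by simp only [h0, zero_mul]; exact integrable_zero _ _ _) hi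
    ((L.continuous.mul hΦ.continuous).integrable_of_hasCompactSupport hc.mul_left)
    (fun x _ => L.differentiableAt) (fun x _ => (hΦ.differentiable (by simp)) x)
  simp only [h0, zero_mul, integral_zero, neg_zero] at h
  exact ⟨hi, h⟩

theorem integral_rotDeriv_eq_zero {Φ : E3 → ℂ} (hΦ : ContDiff ℝ ∞ Φ) (hc : HasCompactSupport Φ)
    {j k : Fin 3} (hjk : j ≠ k) : ∫ y, rotDeriv j k Φ y = 0 := by
  obtain ⟨i1, h1⟩ := integral_coord_mul_fderiv_eq_zero hΦ hc hjk
  obtain ⟨i2, h2⟩ := integral_coord_mul_fderiv_eq_zero hΦ hc hjk.symm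
  have e : rotDeriv j k Φ = fun y =>
      ((y j : ℝ) : ℂ) * fderiv ℝ Φ y (EuclideanSpace.single k (1 : ℝ)) -
      ((y k : ℝ) : ℂ) * fderiv ℝ Φ y (EuclideanSpace.single j (1 : ℝ)) := by
    funext y
    rw [rotDeriv, rotField_apply, map_sub, map_smul, map_smul, Complex.real_smul, Complex.real_smul]
  rw [e, integral_sub i1 i2, h1, h2, sub_zero]

theorem integral_rotDeriv_mul {f g : E3 → ℂ} (hf : ContDiff ℝ ∞ f) (hg : ContDiff ℝ ∞ g)
    (hc : HasCompactSupport g) {j k : Fin 3} (hjk : j ≠ k) :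
    ∫ y, rotDeriv j k f y * g y = -∫ y, f y * rotDeriv j k g y := by
  have h := integral_rotDeriv_eq_zero (hf.mul hg) hc.mul_left hjk
  have hgc : HasCompactSupport (rotDeriv j k g) :=
    hasCompactSupport_rotDeriv hc j k
  rw [rotDeriv_mul (hf.differentiable (by simp)) (hg.differentiable (by simp)),
    integral_add] at h
  · exact eq_neg_of_add_eq_zero_left h
  · exact ((contDiff_rotDeriv hf j k).continuous.mul hg.continuous).integrable_of_hasCompactSupport
      hc.mul_left
  · exact (hf.continuous.mul (contDiff_rotDeriv hg j k).continuous).integrable_of_hasCompactSupport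
      hgc.mul_left

theorem integral_rotDeriv_rotDeriv_mul {f g : E3 → ℂ} (hf : ContDiff ℝ ∞ f) (hg : ContDiff ℝ ∞ g)
    (hc : HasCompactSupport g) {j k : Fin 3} (hjk : j ≠ k) :
    ∫ y, rotDeriv j k (rotDeriv j k f) y * g y = ∫ y, f y * rotDeriv j k (rotDeriv j k g) y := by
  have hgc := hasCompactSupport_rotDeriv hc j k
  rw [integral_rotDeriv_mul (contDiff_rotDeriv hf j k) hg hc hjk,
    integral_rotDeriv_mul hf (contDiff_rotDeriv hg j k) hgc hjk, neg_neg]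

theorem hasFDerivAt_comp_dist_sq {p : ℝ → ℂ} (hp : Differentiable ℝ p) (x y v : E3) :
    DifferentiableAt ℝ (fun y => p (‖x - y‖ ^ 2)) y ∧
    fderiv ℝ (fun y => p (‖x - y‖ ^ 2)) y v = -(2 * deriv p (‖x - y‖ ^ 2) * (inner ℝ (x - y) v : ℝ)) := by
  have h1 : HasFDerivAt (fun y : E3 => x - y) (-ContinuousLinearMap.id ℝ E3) y :=
    (hasFDerivAt_id y).const_sub x
  have h2 := ((hp (‖x - y‖ ^ 2)).hasDerivAt.hasFDerivAt).comp y h1.norm_sq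
  refine ⟨h2.differentiableAt, ?_⟩
  have h3 : fderiv ℝ (fun y => p (‖x - y‖ ^ 2)) y = _ := h2.fderiv
  rw [h3, inner_sub_left]
  simp
  ring

theorem rotDeriv_comp_dist_sq {p : ℝ → ℂ} (hp : Differentiable ℝ p) (x : E3) (j k : Fin 3) :
    rotDeriv j k (fun y => p (‖x - y‖ ^ 2)) =
      fun y => deriv p (‖x - y‖ ^ 2) * ((-2 * inner ℝ x (rotField j k y) : ℝ) : ℂ) := by
  funext y
  rw [rotDeriv, (hasFDerivAt_comp_dist_sq hp x y _).2, inner_sub_left, inner_rotField_self, sub_zero]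
  push_cast; ring

theorem rotDeriv_rotDeriv_comp_dist_sq {p : ℝ → ℂ} (hp : ContDiff ℝ ∞ p) (x y : E3) (j k : Fin 3) :
    rotDeriv j k (rotDeriv j k (fun y => p (‖x - y‖ ^ 2))) y =
      4 * deriv (deriv p) (‖x - y‖ ^ 2) * (inner ℝ x (rotField j k y) : ℝ) ^ 2 -
      2 * deriv p (‖x - y‖ ^ 2) * (inner ℝ x (rotField j k (rotField j k y)) : ℝ) := by
  have hp0 : Differentiable ℝ p := hp.differentiable (by simp)
  have hp1 : Differentiable ℝ (deriv p) := by
    have : ContDiff ℝ ∞ (deriv p) := (contDiff_infty_iff_deriv.1 hp).2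
    exact this.differentiable (by simp)
  set L : E3 →L[ℝ] ℂ := Complex.ofRealCLM.comp ((-2 : ℝ) • (innerSL ℝ x).comp (rotField j k)) with hL
  have hLa : ∀ y : E3, L y = ((-2 * inner ℝ x (rotField j k y) : ℝ) : ℂ) := fun y => rfl
  have e : rotDeriv j k (fun y => p (‖x - y‖ ^ 2)) = fun y => deriv p (‖x - y‖ ^ 2) * L y := by
    rw [rotDeriv_comp_dist_sq hp0]; rfl
  rw [e, rotDeriv_mul (fun y => (hasFDerivAt_comp_dist_sq hp1 x y 0).1) L.differentiable,
    rotDeriv_comp_dist_sq hp1]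
  simp only
  rw [rotDeriv, ContinuousLinearMap.fderiv, hLa, hLa]
  push_cast; ring

theorem sphericalLaplacian_comp_dist_sq {p : ℝ → ℂ} (hp : ContDiff ℝ ∞ p) (x y : E3) :
    sphericalLaplacian (fun y => p (‖x - y‖ ^ 2)) y =
      4 * deriv (deriv p) (‖x - y‖ ^ 2) * ((‖x‖ ^ 2 * ‖y‖ ^ 2 - inner ℝ x y ^ 2 : ℝ) : ℂ) +
      4 * deriv p (‖x - y‖ ^ 2) * (inner ℝ x y : ℝ) := by
  rw [sphericalLaplacian, rotDeriv_rotDeriv_comp_dist_sq hp, rotDeriv_rotDeriv_comp_dist_sq hp,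
    rotDeriv_rotDeriv_comp_dist_sq hp]
  generalize deriv (deriv p) (‖x - y‖ ^ 2) = p2
  generalize deriv p (‖x - y‖ ^ 2) = p1
  have e1 : ‖x‖ ^ 2 = x 0 ^ 2 + x 1 ^ 2 + x 2 ^ 2 := by
    rw [EuclideanSpace.real_norm_sq_eq, Fin.sum_univ_three]
  have e2 : ‖y‖ ^ 2 = y 0 ^ 2 + y 1 ^ 2 + y 2 ^ 2 := by
    rw [EuclideanSpace.real_norm_sq_eq, Fin.sum_univ_three]
  have e3 : inner ℝ x y = x 0 * y 0 + x 1 * y 1 + x 2 * y 2 := by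
    rw [PiLp.inner_apply, Fin.sum_univ_three]; simp; ring
  rw [e1, e2, e3]
  simp only [inner_rotField]
  simp [rotField_apply]
  ring

/-- The spherical Laplacian is symmetric, because the rotation fields are divergence free. -/
theorem integral_sphericalLaplacian_mul {f g : E3 → ℂ} (hf : ContDiff ℝ ∞ f) (hg : ContDiff ℝ ∞ g)
    (hc : HasCompactSupport g) :
    ∫ y, sphericalLaplacian f y * g y = ∫ y, f y * sphericalLaplacian g y := by
  have i1 : ∀ j k, Integrable fun y => rotDeriv j k (rotDeriv j k f) y * g y := fun j k =>
    ((contDiff_rotDeriv (contDiff_rotDeriv hf j k) j k).continuous.mul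
      hg.continuous).integrable_of_hasCompactSupport hc.mul_left
  have i2 : ∀ j k, Integrable fun y => f y * rotDeriv j k (rotDeriv j k g) y := fun j k =>
    (hf.continuous.mul (contDiff_rotDeriv (contDiff_rotDeriv hg j k) j k).continuous
      ).integrable_of_hasCompactSupport 
      (hasCompactSupport_rotDeriv (hasCompactSupport_rotDeriv hc j k) j k).mul_left
  simp only [sphericalLaplacian, add_mul, mul_add]
  have h3 : ∀ F₁ F₂ F₃ : E3 → ℂ, Integrable F₁ → Integrable F₂ → Integrable F₃ →
      ∫ y, (F₁ y + F₂ y + F₃ y) = (∫ y, F₁ y) + (∫ y, F₂ y) + ∫ y, F₃ y := by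
    intro F₁ F₂ F₃ h₁ h₂ h₃
    rw [integral_add (f := fun y => F₁ y + F₂ y) (h₁.add h₂) h₃, integral_add h₁ h₂]
  rw [h3 _ _ _ (i1 _ _) (i1 _ _) (i1 _ _), h3 _ _ _ (i2 _ _) (i2 _ _) (i2 _ _),
    integral_rotDeriv_rotDeriv_mul hf hg hc (by decide),
    integral_rotDeriv_rotDeriv_mul hf hg hc (by decide),
    integral_rotDeriv_rotDeriv_mul hf hg hc (by decide)]

theorem sphericalLaplacian_eq_zero {f : E3 → ℂ} {c : ℝ} (hf : ∀ y, c < ‖y‖ → f y = 0) {y : E3}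
    (hy : c < ‖y‖) : sphericalLaplacian f y = 0 := by
  have h : ∀ j k, rotDeriv j k (rotDeriv j k f) y = 0 := fun j k =>
    rotDeriv_eq_zero (fun z hz => rotDeriv_eq_zero hf j k hz) j k hy
  rw [sphericalLaplacian, h, h, h]; simp

theorem contDiff_sphericalLaplacian {f : E3 → ℂ} (hf : ContDiff ℝ ∞ f) :
    ContDiff ℝ ∞ (sphericalLaplacian f) := by
  have h : ∀ j k, ContDiff ℝ ∞ (rotDeriv j k (rotDeriv j k f)) := fun j k =>
    contDiff_rotDeriv (contDiff_rotDeriv hf j k) j k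
  exact ((h 0 1).add (h 1 2)).add (h 2 0)

theorem contDiffAt_waveProfile (lam : ℝ) {t : ℝ} (ht : 0 < t) :
    ContDiffAt ℝ ∞ (waveProfile lam) t := by
  have h1 : ContDiffAt ℝ ∞ (fun t : ℝ => (√t : ℂ)) t :=
    Complex.ofRealCLM.contDiff.contDiffAt.comp t (Real.contDiffAt_sqrt ht.ne')
  have hs : (√t : ℂ) ≠ 0 := by exact_mod_cast (Real.sqrt_pos.2 ht).ne'
  have h2 : ContDiffAt ℝ ∞ (fun t : ℝ => Complex.exp (Complex.I * lam * (√t : ℂ))) t :=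
    (contDiffAt_const.mul h1).cexp
  have h3 := h2.mul (h1.inv hs)
  refine h3.congr_of_eventuallyEq (.of_forall fun u => ?_)
  simp [waveProfile, div_eq_mul_inv]

/-- The function `waveProfile` may be modified near zero so as to be smooth on the line. -/
theorem exists_contDiff_eq_waveProfile (lam : ℝ) {δ : ℝ} (hδ : 0 < δ) :
    ∃ p : ℝ → ℂ, ContDiff ℝ ∞ p ∧ ∀ t, δ ≤ t → p t = waveProfile lam t ∧
      deriv p t = waveProfile₁ lam t ∧ deriv (deriv p) t = waveProfile₂ lam t := by
  set p : ℝ → ℂ := fun t => ((Real.smoothTransition (4 / δ * t - 1) : ℝ) : ℂ) * waveProfile lam t with hp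
  have hp0 : ∀ t, δ / 2 < t → p t = waveProfile lam t := by
    intro t ht
    simp only [hp]
    rw [Real.smoothTransition.one_of_one_le]
    · simp
    · rw [div_mul_eq_mul_div, le_sub_iff_add_le, le_div_iff₀ hδ]; linarith
  have hp1 : ∀ t, δ / 2 < t → deriv p t = waveProfile₁ lam t := by
    intro t ht
    have h : p =ᶠ[𝓝 t] waveProfile lam := by
      filter_upwards [eventually_gt_nhds ht] with u hu using hp0 u hu
    rw [h.deriv_eq]
    exact (hasDerivAt_waveProfile lam (by linarith)).deriv
  refine ⟨p, contDiff_iff_contDiffAt.2 fun t => ?_, fun t ht => ⟨hp0 t (by linarith),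
    hp1 t (by linarith), ?_⟩⟩
  · rcases lt_or_ge t (δ / 4) with ht | ht
    · have h : p =ᶠ[𝓝 t] fun _ => 0 := by
        filter_upwards [eventually_lt_nhds ht] with u hu
        simp only [hp]
        rw [Real.smoothTransition.zero_of_nonpos]
        · simp
        · rw [div_mul_eq_mul_div, sub_nonpos, div_le_one hδ]; linarith
      exact contDiffAt_const.congr_of_eventuallyEq h
    · have h1 : ContDiff ℝ ∞ fun t : ℝ => Real.smoothTransition (4 / δ * t - 1) :=
        Real.smoothTransition.contDiff.comp (by fun_prop)
      exact (Complex.ofRealCLM.contDiff.comp h1).contDiffAt.mul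
        (contDiffAt_waveProfile lam (by linarith))
  · have h : deriv p =ᶠ[𝓝 t] waveProfile₁ lam := by
      filter_upwards [eventually_gt_nhds (by linarith : δ / 2 < t)] with u hu using hp1 u hu
    rw [h.deriv_eq]
    exact (hasDerivAt_waveProfile₁ lam (by linarith)).deriv

/-- The spherical Laplacian of an outgoing wave is the outgoing wave of the spherical Laplacian of the
source, since the rotations commute with the kernel. -/
theorem integral_waveProfile_sphericalLaplacian (lam : ℝ) {g : E3 → ℂ} (hg : ContDiff ℝ ∞ g) {β : ℝ}
    (hβ : ∀ y, β < ‖y‖ → g y = 0) {x : E3} (hx : β < ‖x‖) :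
    ∫ y, (4 * waveProfile₂ lam (‖x - y‖ ^ 2) * ((‖x‖ ^ 2 * ‖y‖ ^ 2 - inner ℝ x y ^ 2 : ℝ) : ℂ) +
      4 * waveProfile₁ lam (‖x - y‖ ^ 2) * (inner ℝ x y : ℝ)) * g y =
    kernelConv (sphericalKernel lam) (sphericalLaplacian g) x := by
  obtain ⟨p, hp, hpe⟩ := exists_contDiff_eq_waveProfile lam (δ := (‖x‖ - β) ^ 2)
    (pow_pos (by linarith) 2)
  have hδ : ∀ y : E3, ‖y‖ ≤ β → (‖x‖ - β) ^ 2 ≤ ‖x - y‖ ^ 2 := by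
    intro y hy
    refine pow_le_pow_left₀ (by linarith) ?_ 2
    have := norm_sub_norm_le x y
    linarith
  have hc : HasCompactSupport g := HasCompactSupport.intro (isCompact_closedBall (0 : E3) β)
    fun y hy => hβ y (by simpa using hy)
  have hf : ContDiff ℝ ∞ fun y : E3 => p (‖x - y‖ ^ 2) :=
    hp.comp ((contDiff_const.sub contDiff_id).norm_sq ℝ)
  have h := integral_sphericalLaplacian_mul hf hg hc
  rw [kernelConv]
  refine (integral_congr_ae (.of_forall fun y => ?_)).trans (h.trans
    (integral_congr_ae (.of_forall fun y => ?_)))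
  · by_cases hy : β < ‖y‖
    · rw [hβ y hy, mul_zero, mul_zero]
    · obtain ⟨-, h1, h2⟩ := hpe _ (hδ y (not_lt.1 hy))
      rw [sphericalLaplacian_comp_dist_sq hp, h1, h2]
  · simp only
    by_cases hy : β < ‖y‖
    · rw [sphericalLaplacian_eq_zero hβ hy, mul_zero, mul_zero]
    · obtain ⟨h0, -, -⟩ := hpe _ (hδ y (not_lt.1 hy))
      rw [h0, sphericalKernel_eq_waveProfile]

/-! ### Hardy's inequality and weighted integrals -/

theorem lintegral_Ioi_rpow {a c : ℝ} (ha : a < -1) (hc : 0 < c) :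
    ∫⁻ t in Set.Ioi c, ENNReal.ofReal (t ^ a) = ENNReal.ofReal (-c ^ (a + 1) / (a + 1)) := by
  rw [← integral_Ioi_rpow_of_lt ha hc, ofReal_integral_eq_lintegral_ofReal
    (integrableOn_Ioi_rpow_of_lt ha hc)]
  filter_upwards [ae_restrict_mem measurableSet_Ioi] with t ht
  exact Real.rpow_nonneg (hc.trans ht).le _

theorem lintegral_Ioo_rpow_neg_half_le {s : ℝ} (hs : 0 < s) :
    ∫⁻ r in Set.Ioo 0 s, ENNReal.ofReal (r ^ (-1 / 2 : ℝ)) ≤ ENNReal.ofReal (2 * s ^ (1 / 2 : ℝ)) := by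
  have h1 : ∫ r in (0 : ℝ)..s, r ^ (-1 / 2 : ℝ) = 2 * s ^ (1 / 2 : ℝ) := by
    rw [integral_rpow (Or.inl (by norm_num))]
    norm_num
    ring
  have h2 : IntegrableOn (fun r : ℝ => r ^ (-1 / 2 : ℝ)) (Set.Ioc 0 s) :=
    (intervalIntegrable_iff_integrableOn_Ioc_of_le hs.le).1
      (intervalIntegral.intervalIntegrable_rpow' (by norm_num))
  rw [intervalIntegral.integral_of_le hs.le] at h1
  rw [← h1, ofReal_integral_eq_lintegral_ofReal h2]
  · exact lintegral_mono_set Set.Ioo_subset_Ioc_self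
  · filter_upwards [ae_restrict_mem measurableSet_Ioc] with t ht
    exact Real.rpow_nonneg ht.1.le _

theorem sq_lintegral_mul_le {α : Type*} [MeasurableSpace α] {μ : Measure α} {f g : α → ENNReal}
    (hf : AEMeasurable f μ) (hg : AEMeasurable g μ) :
    (∫⁻ x, f x * g x ∂μ) ^ 2 ≤ (∫⁻ x, f x ^ 2 ∂μ) * ∫⁻ x, g x ^ 2 ∂μ := by
  have h := ENNReal.lintegral_mul_le_Lp_mul_Lq μ Real.HolderConjugate.two_two hf hg
  simp only [ENNReal.rpow_two, Pi.mul_apply] at h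
  have h2 := pow_le_pow_left₀ zero_le h 2
  rw [mul_pow, ← ENNReal.rpow_natCast, ← ENNReal.rpow_natCast, ← ENNReal.rpow_natCast,
    ← ENNReal.rpow_mul, ← ENNReal.rpow_mul] at h2
  rw [← ENNReal.rpow_natCast]
  simpa using h2

/-- Hardy's inequality for the averaging operator `F ↦ ∫_r^∞ F(s) ds/s`. -/
theorem lintegral_sq_lintegral_Ioi_le {F : ℝ → ENNReal} (hF : Measurable F) {R : ℝ} (hR : 0 < R) :
    ∫⁻ r in Set.Ioi R, (∫⁻ s in Set.Ioi r, ENNReal.ofReal s⁻¹ * F s) ^ 2 ≤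
      4 * ∫⁻ s in Set.Ioi R, F s ^ 2 := by
  have h1 : ∀ r ∈ Set.Ioi R, (∫⁻ s in Set.Ioi r, ENNReal.ofReal s⁻¹ * F s) ^ 2 ≤
      ENNReal.ofReal (2 * r ^ (-1 / 2 : ℝ)) *
        ∫⁻ s in Set.Ioi r, ENNReal.ofReal (s ^ (-1 / 2 : ℝ)) * F s ^ 2 := by
    intro r hr
    have hr0 : 0 < r := hR.trans hr
    -- Cauchy-Schwarz, with the factor `s⁻¹` split as `s^{-3/4} s^{-1/4}`.
    have e1 : ∫⁻ s in Set.Ioi r, ENNReal.ofReal s⁻¹ * F s =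
        ∫⁻ s in Set.Ioi r, ENNReal.ofReal (s ^ (-3 / 4 : ℝ)) *
          (ENNReal.ofReal (s ^ (-1 / 4 : ℝ)) * F s) := by
      refine setLIntegral_congr_fun measurableSet_Ioi fun s hs => ?_
      have hs0 : 0 < s := hr0.trans hs
      rw [← mul_assoc, ← ENNReal.ofReal_mul (by positivity), ← Real.rpow_add hs0,
        ← Real.rpow_neg_one]
      norm_num
    rw [e1]
    refine (sq_lintegral_mul_le (by fun_prop) (by fun_prop)).trans (le_of_eq ?_)
    congr 1
    · have e2 : ∀ s ∈ Set.Ioi r, ENNReal.ofReal (s ^ (-3 / 4 : ℝ)) ^ 2 =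
          ENNReal.ofReal (s ^ (-3 / 2 : ℝ)) := by
        intro s hs
        have hs0 : 0 < s := hr0.trans hs
        rw [← ENNReal.ofReal_pow (by positivity), ← Real.rpow_natCast, ← Real.rpow_mul hs0.le]
        norm_num
      rw [setLIntegral_congr_fun measurableSet_Ioi e2, lintegral_Ioi_rpow (by norm_num) hr0]
      congr 1
      norm_num
      ring
    · refine setLIntegral_congr_fun measurableSet_Ioi fun s hs => ?_
      have hs0 : 0 < s := hr0.trans hs
      rw [mul_pow, ← ENNReal.ofReal_pow (by positivity), ← Real.rpow_natCast, ← Real.rpow_mul hs0.le]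
      norm_num
  set H : ℝ → ENNReal := fun s => ENNReal.ofReal (s ^ (-1 / 2 : ℝ)) * F s ^ 2 with hH
  have hHm : Measurable H := by fun_prop
  have e3 : ∀ r : ℝ, ENNReal.ofReal (2 * r ^ (-1 / 2 : ℝ)) * ∫⁻ s in Set.Ioi r, H s =
      ∫⁻ s, {p : ℝ × ℝ | p.1 < p.2}.indicator
        (fun p => ENNReal.ofReal (2 * p.1 ^ (-1 / 2 : ℝ)) * H p.2) (r, s) := by
    intro r
    rw [← lintegral_const_mul _ hHm, ← lintegral_indicator measurableSet_Ioi]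
    rfl
  have hm2 : Measurable ({p : ℝ × ℝ | p.1 < p.2}.indicator
        (fun p => ENNReal.ofReal (2 * p.1 ^ (-1 / 2 : ℝ)) * H p.2)) := by
    refine Measurable.indicator ?_ (measurableSet_lt measurable_fst measurable_snd)
    exact Measurable.mul (by fun_prop) (hHm.comp measurable_snd)
  calc _ ≤ ∫⁻ r in Set.Ioi R, ∫⁻ s, {p : ℝ × ℝ | p.1 < p.2}.indicator
        (fun p => ENNReal.ofReal (2 * p.1 ^ (-1 / 2 : ℝ)) * H p.2) (r, s) := by
        refine setLIntegral_mono' measurableSet_Ioi fun r hr => ?_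
        rw [← e3]; exact h1 r hr
    _ = ∫⁻ s, ∫⁻ r in Set.Ioi R, {p : ℝ × ℝ | p.1 < p.2}.indicator
        (fun p => ENNReal.ofReal (2 * p.1 ^ (-1 / 2 : ℝ)) * H p.2) (r, s) :=
        lintegral_lintegral_swap hm2.aemeasurable
    _ ≤ ∫⁻ s, (Set.Ioi R).indicator (fun s => 4 * F s ^ 2) s := by
        refine lintegral_mono fun s => ?_
        by_cases hs : R < s
        · have hs0 : 0 < s := hR.trans hs
          rw [Set.indicator_of_mem (by exact hs)]
          calc _ ≤ ∫⁻ r in Set.Ioi R, (Set.Ioo 0 s).indicator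
                (fun r => ENNReal.ofReal (2 * r ^ (-1 / 2 : ℝ)) * H s) r := by
                refine setLIntegral_mono' measurableSet_Ioi fun r hr => ?_
                by_cases hrs : r < s
                · rw [Set.indicator_of_mem (by exact hrs),
                    Set.indicator_of_mem (Set.mem_Ioo.2 ⟨hR.trans hr, hrs⟩)]
                · rw [Set.indicator_of_notMem (by exact hrs)]
                  exact zero_le
            _ ≤ ∫⁻ r, (Set.Ioo 0 s).indicator
                (fun r => ENNReal.ofReal (2 * r ^ (-1 / 2 : ℝ)) * H s) r :=
                setLIntegral_le_lintegral _ _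
            _ = (∫⁻ r in Set.Ioo 0 s, ENNReal.ofReal (2 * r ^ (-1 / 2 : ℝ))) * H s := by
                rw [lintegral_indicator measurableSet_Ioo, lintegral_mul_const _ (by fun_prop)]
            _ ≤ (2 * ENNReal.ofReal (2 * s ^ (1 / 2 : ℝ))) * H s := by
                refine mul_le_mul_left ?_ _
                have : ∀ r : ℝ, ENNReal.ofReal (2 * r ^ (-1 / 2 : ℝ)) =
                    2 * ENNReal.ofReal (r ^ (-1 / 2 : ℝ)) := by
                  intro r
                  rw [ENNReal.ofReal_mul zero_le_two]; simp
                simp only [this]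
                rw [lintegral_const_mul _ (by fun_prop)]
                exact mul_le_mul_right (lintegral_Ioo_rpow_neg_half_le hs0) _
            _ = 4 * F s ^ 2 := by
                rw [hH]
                simp only
                rw [← mul_assoc, mul_assoc 2, ← ENNReal.ofReal_mul (by positivity), mul_assoc 2 (s ^ _),
                  ← Real.rpow_add hs0]
                norm_num
        · rw [Set.indicator_of_notMem (by exact hs)]
          refine le_of_eq ?_
          rw [setLIntegral_congr_fun (g := fun _ => 0) measurableSet_Ioi]
          · simp
          · intro r hr
            refine Set.indicator_of_notMem (fun h => hs ?_) _
            exact lt_trans (Set.mem_Ioi.1 hr) h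
    _ = 4 * ∫⁻ s in Set.Ioi R, F s ^ 2 := by
        rw [lintegral_indicator measurableSet_Ioi, lintegral_const_mul _ (by fun_prop)]

/-- A density whose mass in balls grows linearly is integrable at infinity against `|x|⁻²`. -/
theorem lintegral_inv_norm_sq_mul_le {H : E3 → ENNReal} (hH : Measurable H) {M R : ℝ} (hM : 0 ≤ M)
    (hR : 0 < R) (h : ∀ t, R ≤ t → ∫⁻ x in Metric.ball 0 t, H x ≤ ENNReal.ofReal (M * t)) :
    ∫⁻ x in {x : E3 | R < ‖x‖}, ENNReal.ofReal (‖x‖ ^ 2)⁻¹ * H x ≤ ENNReal.ofReal (2 * M / R) := by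
  have hS : MeasurableSet {x : E3 | R < ‖x‖} := measurableSet_lt measurable_const measurable_norm
  -- `|x|⁻² = ∫ 2 t⁻³ dt` over `t > |x|`, after which the integrals are exchanged.
  have h1 : ∀ x ∈ {x : E3 | R < ‖x‖}, ENNReal.ofReal (‖x‖ ^ 2)⁻¹ * H x =
      ∫⁻ t in Set.Ioi R, {p : E3 × ℝ | ‖p.1‖ < p.2}.indicator
        (fun p => ENNReal.ofReal (2 * p.2 ^ (-3 : ℝ)) * H p.1) (x, t) := by
    intro x hx
    have hx0 : 0 < ‖x‖ := hR.trans hx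
    have e1 : ∀ t : ℝ, {p : E3 × ℝ | ‖p.1‖ < p.2}.indicator
        (fun p => ENNReal.ofReal (2 * p.2 ^ (-3 : ℝ)) * H p.1) (x, t) =
        (Set.Ioi ‖x‖).indicator (fun t => ENNReal.ofReal (2 * t ^ (-3 : ℝ)) * H x) t := fun t => rfl
    simp only [e1]
    rw [lintegral_indicator measurableSet_Ioi, Measure.restrict_restrict measurableSet_Ioi,
      Set.inter_eq_left.2 (Set.Ioi_subset_Ioi (le_of_lt hx)), lintegral_mul_const _ (by fun_prop)]
    congr 1
    simp only [ENNReal.ofReal_mul zero_le_two]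
    rw [lintegral_const_mul _ (by fun_prop), lintegral_Ioi_rpow (by norm_num) hx0,
      ← ENNReal.ofReal_mul zero_le_two]
    congr 1
    norm_num
    ring
  have hm2 : Measurable ({p : E3 × ℝ | ‖p.1‖ < p.2}.indicator
        (fun p => ENNReal.ofReal (2 * p.2 ^ (-3 : ℝ)) * H p.1)) := by
    refine Measurable.indicator ?_ (measurableSet_lt (measurable_norm.comp measurable_fst) measurable_snd)
    exact Measurable.mul (by fun_prop) (hH.comp measurable_fst)
  rw [setLIntegral_congr_fun hS h1, lintegral_lintegral_swap
    (f := fun x t => {p : E3 × ℝ | ‖p.1‖ < p.2}.indicator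
      (fun p => ENNReal.ofReal (2 * p.2 ^ (-3 : ℝ)) * H p.1) (x, t)) hm2.aemeasurable]
  calc _ ≤ ∫⁻ t in Set.Ioi R, ENNReal.ofReal (2 * M) * ENNReal.ofReal (t ^ (-2 : ℝ)) := by
        refine setLIntegral_mono' measurableSet_Ioi fun t ht => ?_
        have ht0 : 0 < t := hR.trans ht
        have e1 : ∀ x : E3, {p : E3 × ℝ | ‖p.1‖ < p.2}.indicator
            (fun p => ENNReal.ofReal (2 * p.2 ^ (-3 : ℝ)) * H p.1) (x, t) =
            (Metric.ball (0 : E3) t).indicator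
              (fun x => ENNReal.ofReal (2 * t ^ (-3 : ℝ)) * H x) x := by
          intro x
          by_cases hx : ‖x‖ < t
          · rw [Set.indicator_of_mem (by exact hx), Set.indicator_of_mem (by simpa using hx)]
          · rw [Set.indicator_of_notMem (by exact hx), Set.indicator_of_notMem (by simpa using hx)]
        refine (setLIntegral_le_lintegral _ _).trans ?_
        simp only [e1]
        rw [lintegral_indicator measurableSet_ball, lintegral_const_mul _ hH]
        refine (mul_le_mul_right (h t (le_of_lt ht)) _).trans (le_of_eq ?_)
        rw [← ENNReal.ofReal_mul (by positivity), ← ENNReal.ofReal_mul (by positivity)]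
        congr 1
        have : t ^ (-2 : ℝ) = t ^ (-3 : ℝ) * t := by
          rw [show (-2 : ℝ) = -3 + 1 by norm_num, Real.rpow_add_one ht0.ne']
        rw [this]; ring
    _ = _ := by
        rw [lintegral_const_mul _ (by fun_prop), lintegral_Ioi_rpow (by norm_num) hR,
          ← ENNReal.ofReal_mul (by positivity)]
        congr 1
        norm_num
        rw [Real.rpow_neg_one]
        field_simp

theorem measurable_kernelConv {k g : E3 → ℂ} (hk : Measurable k) (hg : Measurable g) :
    Measurable (kernelConv k g) := by
  have h : StronglyMeasurable fun p : E3 × E3 => k (p.1 - p.2) * g p.2 :=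
    (Measurable.mul (hk.comp (measurable_fst.sub measurable_snd))
      (hg.comp measurable_snd)).stronglyMeasurable
  exact h.integral_prod_right.measurable

/-! ### Wave packets -/

theorem contDiff_planeWave (lam : ℝ) (w : E3) : ContDiff ℝ ∞ (planeWave lam w) := by
  have h : ContDiff ℝ ∞ fun x : E3 => ((lam * inner ℝ x w : ℝ) : ℂ) :=
    Complex.ofRealCLM.contDiff.comp (contDiff_const.mul (contDiff_id.inner ℝ contDiff_const))
  exact (contDiff_const.mul h).cexp

theorem norm_planeWave (lam : ℝ) (w x : E3) : ‖planeWave lam w x‖ = 1 := by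
  rw [planeWave, mul_comm, Complex.norm_exp_ofReal_mul_I]

/-- The wave of length scale `Y` with profile `U` which oscillates like a plane wave. -/
def wavePacket (lam : ℝ) (w : E3) (U : E3 → ℂ) (Y : ℝ) (y : E3) : ℂ :=
  U (Y⁻¹ • y) * planeWave lam w y

/-- The logarithmic derivative of a plane wave along a rotation field. -/
def phaseField (lam : ℝ) (w : E3) (j k : Fin 3) : E3 →L[ℝ] ℂ :=
  (Complex.I * (lam : ℂ)) • (Complex.ofRealCLM.comp ((innerSL ℝ w).comp (rotField j k)))

theorem rotDeriv_planeWave (lam : ℝ) (w : E3) (j k : Fin 3) (y : E3) :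
    rotDeriv j k (planeWave lam w) y = phaseField lam w j k y * planeWave lam w y := by
  set L : E3 →L[ℝ] ℂ := (Complex.I * (lam : ℂ)) • (Complex.ofRealCLM.comp (innerSL ℝ w)) with hL
  have hp : planeWave lam w = fun y => Complex.exp (L y) := by
    funext y
    simp [planeWave, hL, real_inner_comm, mul_assoc]
  have h := (L.hasFDerivAt (x := y)).cexp
  rw [rotDeriv, hp, h.fderiv]
  simp [phaseField, hL]
  ring

theorem rotDeriv_comp_smul {U : E3 → ℂ} (hU : Differentiable ℝ U) (j k : Fin 3) (a : ℝ) (y : E3) :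
    rotDeriv j k (fun y => U (a • y)) y = rotDeriv j k U (a • y) := by
  have h1 : HasFDerivAt (fun y : E3 => a • y) (a • ContinuousLinearMap.id ℝ E3) y :=
    (hasFDerivAt_id y).const_smul a
  have h2 := (hU (a • y)).hasFDerivAt.comp y h1
  have h3 : fderiv ℝ (fun y => U (a • y)) y = _ := h2.fderiv
  rw [rotDeriv, h3, rotDeriv]
  simp

theorem rotDeriv_wavePacket (lam : ℝ) (w : E3) {U : E3 → ℂ} (hU : ContDiff ℝ ∞ U) (j k : Fin 3)
    {Y : ℝ} (hY : 0 < Y) : rotDeriv j k (wavePacket lam w U Y) =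
      wavePacket lam w (fun y => rotDeriv j k U y + Y * (phaseField lam w j k y * U y)) Y := by
  have hUd : Differentiable ℝ U := hU.differentiable (by simp)
  have hUs : Differentiable ℝ fun y : E3 => U (Y⁻¹ • y) :=
    hUd.comp (differentiable_id.const_smul Y⁻¹)
  have hpd : Differentiable ℝ (planeWave lam w) := (contDiff_planeWave lam w).differentiable (by simp)
  funext y
  have h := congrFun (rotDeriv_mul hUs hpd j k) y
  have e : (fun y => U (Y⁻¹ • y) * planeWave lam w y) = wavePacket lam w U Y := rfl
  rw [e] at h
  rw [h, rotDeriv_comp_smul hUd, rotDeriv_planeWave, wavePacket, map_smul, Complex.real_smul]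
  have hYc : (Y : ℂ) ≠ 0 := by exact_mod_cast hY.ne'
  push_cast
  field_simp

/-- The spherical Laplacian of a wave packet is a combination of wave packets, quadratic in `Y`. -/
theorem exists_sphericalLaplacian_wavePacket (lam : ℝ) (w : E3) {U : E3 → ℂ} {c : ℝ}
    (hU : ContDiff ℝ ∞ U) (hc : ∀ y, c < ‖y‖ → U y = 0) :
    ∃ U₀ U₁ U₂ : E3 → ℂ, (ContDiff ℝ ∞ U₀ ∧ ContDiff ℝ ∞ U₁ ∧ ContDiff ℝ ∞ U₂) ∧
      (∀ y, c < ‖y‖ → U₀ y = 0 ∧ U₁ y = 0 ∧ U₂ y = 0) ∧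
      ∀ Y : ℝ, 0 < Y → sphericalLaplacian (wavePacket lam w U Y) =
        wavePacket lam w (fun y => U₀ y + Y * U₁ y + Y ^ 2 * U₂ y) Y := by
  set ℓ := phaseField lam w with hℓ
  set A : Fin 3 → Fin 3 → E3 → ℂ := fun j k => rotDeriv j k (rotDeriv j k U) with hA
  set B : Fin 3 → Fin 3 → E3 → ℂ := fun j k y => rotDeriv j k (fun y => ℓ j k y * U y) y +
    ℓ j k y * rotDeriv j k U y with hB
  set D : Fin 3 → Fin 3 → E3 → ℂ := fun j k y => ℓ j k y * (ℓ j k y * U y) with hD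
  have hℓU : ∀ j k, ContDiff ℝ ∞ fun y => ℓ j k y * U y := fun j k => (ℓ j k).contDiff.mul hU
  have hℓU0 : ∀ j k y, c < ‖y‖ → ℓ j k y * U y = 0 := fun j k y hy => by rw [hc y hy, mul_zero]
  have hAc : ∀ j k, ContDiff ℝ ∞ (A j k) := fun j k =>
    contDiff_rotDeriv (contDiff_rotDeriv hU j k) j k
  have hBc : ∀ j k, ContDiff ℝ ∞ (B j k) := fun j k =>
    (contDiff_rotDeriv (hℓU j k) j k).add ((ℓ j k).contDiff.mul (contDiff_rotDeriv hU j k))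
  have hDc : ∀ j k, ContDiff ℝ ∞ (D j k) := fun j k => (ℓ j k).contDiff.mul (hℓU j k)
  have hA0 : ∀ j k y, c < ‖y‖ → A j k y = 0 := fun j k y hy =>
    rotDeriv_eq_zero (fun z hz => rotDeriv_eq_zero hc j k hz) j k hy
  have hB0 : ∀ j k y, c < ‖y‖ → B j k y = 0 := fun j k y hy => by
    simp only [hB]
    rw [rotDeriv_eq_zero (hℓU0 j k) j k hy, rotDeriv_eq_zero hc j k hy, mul_zero, add_zero]
  have hD0 : ∀ j k y, c < ‖y‖ → D j k y = 0 := fun j k y hy => by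
    simp only [hD]; rw [hc y hy, mul_zero, mul_zero]
  have hstep : ∀ (Y : ℝ), 0 < Y → ∀ j k, rotDeriv j k (rotDeriv j k (wavePacket lam w U Y)) =
      wavePacket lam w (fun y => A j k y + Y * B j k y + Y ^ 2 * D j k y) Y := by
    intro Y hY j k
    have h1 : ContDiff ℝ ∞ fun y => rotDeriv j k U y + Y * (ℓ j k y * U y) :=
      (contDiff_rotDeriv hU j k).add (contDiff_const.mul (hℓU j k))
    rw [rotDeriv_wavePacket lam w hU j k hY, rotDeriv_wavePacket lam w h1 j k hY]
    congr 1
    funext y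
    rw [rotDeriv_add ((contDiff_rotDeriv hU j k).differentiable (by simp))
      ((contDiff_const.mul (hℓU j k)).differentiable (by simp)),
      rotDeriv_const_mul ((hℓU j k).differentiable (by simp))]
    simp only [hA, hB, hD]
    ring
  refine ⟨fun y => A 0 1 y + A 1 2 y + A 2 0 y, fun y => B 0 1 y + B 1 2 y + B 2 0 y,
    fun y => D 0 1 y + D 1 2 y + D 2 0 y,
    ⟨((hAc _ _).add (hAc _ _)).add (hAc _ _), ((hBc _ _).add (hBc _ _)).add (hBc _ _),
      ((hDc _ _).add (hDc _ _)).add (hDc _ _)⟩, fun y hy => ?_, fun Y hY => ?_⟩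
  · simp only [hA0 _ _ y hy, hB0 _ _ y hy, hD0 _ _ y hy, add_zero, and_self]
  · funext y
    rw [sphericalLaplacian, hstep Y hY, hstep Y hY, hstep Y hY]
    simp only [wavePacket]
    ring

theorem contDiff_wavePacket (lam : ℝ) (w : E3) {U : E3 → ℂ} (hU : ContDiff ℝ ∞ U) (Y : ℝ) :
    ContDiff ℝ ∞ (wavePacket lam w U Y) :=
  (hU.comp (contDiff_const_smul Y⁻¹)).mul (contDiff_planeWave lam w)

theorem wavePacket_eq_zero (lam : ℝ) (w : E3) {U : E3 → ℂ} {c : ℝ} (hc : ∀ y, c < ‖y‖ → U y = 0)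
    {Y : ℝ} (hY : 0 < Y) {y : E3} (hy : c * Y < ‖y‖) : wavePacket lam w U Y y = 0 := by
  rw [wavePacket, hc, zero_mul]
  rw [norm_smul, norm_inv, Real.norm_of_nonneg hY.le, inv_mul_eq_div, lt_div_iff₀ hY]
  exact hy

theorem fourier_wavePacket (lam : ℝ) (w : E3) (U : E3 → ℂ) {Y : ℝ} (hY : 0 < Y) (ξ : E3) :
    𝓕 (wavePacket lam w U Y) ξ =
      (Y ^ 3 : ℝ) * 𝓕 U (Y • (ξ - (lam / (2 * Real.pi)) • w)) := by
  rw [Real.fourier_eq', Real.fourier_eq']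
  have h := Measure.integral_comp_inv_smul_of_nonneg (volume : Measure E3)
    (fun y => Complex.exp (((-2 * Real.pi * inner ℝ y (Y • (ξ - (lam / (2 * Real.pi)) • w)) : ℝ) : ℂ) *
      Complex.I) • U y) (R := Y) hY.le
  rw [finrank_euclideanSpace, Fintype.card_fin, Complex.real_smul] at h
  rw [← h]
  refine integral_congr_ae (.of_forall fun y => ?_)
  simp only [smul_eq_mul, wavePacket, planeWave]
  rw [mul_comm (U _), ← mul_assoc, ← Complex.exp_add]
  congr 2
  rw [inner_smul_left, inner_smul_right, inner_sub_right, inner_smul_right]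
  have hYc : (Y : ℂ) ≠ 0 := by exact_mod_cast hY.ne'
  have hpi : (Real.pi : ℂ) ≠ 0 := by exact_mod_cast Real.pi_ne_zero
  simp only [RCLike.conj_to_real]
  push_cast
  field_simp
  ring

theorem exists_norm_fourier_wavePacket_le (lam : ℝ) (w : E3) {U : E3 → ℂ} (hU : ContDiff ℝ ∞ U)
    {c : ℝ} (hc : ∀ y, c < ‖y‖ → U y = 0) : ∃ D : ℝ, 0 ≤ D ∧ ∀ Y : ℝ, 0 < Y → ∀ ξ,
      ‖𝓕 (wavePacket lam w U Y) ξ‖ ≤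
        D * Y ^ 3 * ((1 + Y * ‖ξ - (lam / (2 * Real.pi)) • w‖) ^ 2)⁻¹ := by
  have hcs : HasCompactSupport U := HasCompactSupport.intro (isCompact_closedBall (0 : E3) c)
    fun y hy => hc y (by simpa using hy)
  obtain ⟨D, hD0, hD⟩ := schwartz_pointwise_bound (𝓕 (hcs.toSchwartzMap hU)) 2
  refine ⟨D, hD0, fun Y hY ξ => ?_⟩
  have h := hD (Y • (ξ - (lam / (2 * Real.pi)) • w))
  rw [SchwartzMap.fourier_coe, norm_smul, Real.norm_of_nonneg hY.le] at h
  rw [fourier_wavePacket lam w U hY, norm_mul, Complex.norm_real, Real.norm_of_nonneg (by positivity)]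
  calc _ ≤ Y ^ 3 * (D * ((1 + Y * ‖ξ - (lam / (2 * Real.pi)) • w‖) ^ 2)⁻¹) :=
        mul_le_mul_of_nonneg_left h (by positivity)
    _ = _ := by ring

/-! ### Deviation of a wave from its far field -/

/-- The far field `|x|⁻¹ e^{iλ|x|} ∫ e^{-iλ y·x/|x|} g(y) dy` of the outgoing wave with source `g`. -/
def farField (lam : ℝ) (g : E3 → ℂ) (x : E3) : ℂ :=
  sphericalKernel lam x * 𝓕 g ((lam / (2 * Real.pi)) • (‖x‖⁻¹ • x))

/-- The difference between an outgoing wave and its far field. -/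
def waveRemainder (lam : ℝ) (g : E3 → ℂ) (x : E3) : ℂ :=
  kernelConv (sphericalKernel lam) g x - farField lam g x

theorem norm_smul_sub_sq {θ : E3} (hθ : ‖θ‖ = 1) (s : ℝ) (y : E3) :
    ‖s • θ - y‖ ^ 2 = s ^ 2 - 2 * inner ℝ θ y * s + ‖y‖ ^ 2 := by
  rw [norm_sub_sq_real, norm_smul, hθ, mul_one, inner_smul_left, Real.norm_eq_abs, sq_abs]
  simp only [RCLike.conj_to_real]
  ring

theorem measurable_waveProfile (lam : ℝ) : Measurable (waveProfile lam) := by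
  unfold waveProfile; fun_prop

theorem measurable_waveProfile₁ (lam : ℝ) : Measurable (waveProfile₁ lam) := by
  unfold waveProfile₁; fun_prop

theorem measurable_waveProfile₂ (lam : ℝ) : Measurable (waveProfile₂ lam) := by
  have h0 := measurable_waveProfile lam
  have h1 := measurable_waveProfile₁ lam
  unfold waveProfile₂; fun_prop

/-- Integrating the source of the radial equation against a density gives the outgoing wave
of the spherical Laplacian of this density. -/
theorem integral_mul_radialSource (lam : ℝ) {g : E3 → ℂ} (hg : ContDiff ℝ ∞ g) {β : ℝ}
    (hβ : ∀ y, β < ‖y‖ → g y = 0) {θ : E3} (hθ : ‖θ‖ = 1) {s : ℝ} (hs0 : 0 < s) (hs : β < s) :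
    ∫ y, g y * radialSource lam (inner ℝ θ y) (‖y‖ ^ 2) s =
      -(s : ℂ)⁻¹ * Complex.exp (-Complex.I * lam * s) *
        kernelConv (sphericalKernel lam) (sphericalLaplacian g) (s • θ) := by
  have hn : ‖s • θ‖ = s := by rw [norm_smul, hθ, mul_one, Real.norm_of_nonneg hs0.le]
  rw [← integral_waveProfile_sphericalLaplacian lam hg hβ (by rwa [hn]), ← integral_const_mul]
  refine integral_congr_ae (.of_forall fun y => ?_)
  simp only
  rw [norm_smul_sub_sq hθ, hn, inner_smul_left, radialSource]
  have hsc : (s : ℂ) ≠ 0 := by exact_mod_cast hs0.ne'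
  simp only [RCLike.conj_to_real]
  push_cast
  field_simp
  ring

theorem integral_mul_radialWave {lam : ℝ} {g : E3 → ℂ} (hg : Integrable g) {β : ℝ}
    (hβ : ∀ y, β < ‖y‖ → g y = 0) {θ : E3} (hθ : ‖θ‖ = 1) {r : ℝ} (hr0 : 0 < r) (hr : β < r) :
    ∫ y, g y * (radialWave lam (inner ℝ θ y) (‖y‖ ^ 2) r -
        Complex.exp (-Complex.I * lam * (inner ℝ θ y : ℝ))) =
      r * Complex.exp (-Complex.I * lam * r) * waveRemainder lam g (r • θ) := by
  have hn : ‖r • θ‖ = r := by rw [norm_smul, hθ, mul_one, Real.norm_of_nonneg hr0.le]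
  have hrc : (r : ℂ) ≠ 0 := by exact_mod_cast hr0.ne'
  have i1 : Integrable fun y => sphericalKernel lam (r • θ - y) * g y := by
    refine (hg.norm.const_mul (r - β)⁻¹).mono' ?_ (.of_forall fun y => ?_)
    · exact ((measurable_sphericalKernel lam).comp (measurable_const.sub measurable_id)
        ).aestronglyMeasurable.mul hg.1
    · rw [norm_mul]
      by_cases hy : β < ‖y‖
      · rw [hβ y hy]; simp
      · refine mul_le_mul_of_nonneg_right ?_ (norm_nonneg _)
        rw [norm_sphericalKernel]
        have h1 : r - β ≤ ‖r • θ - y‖ := by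
          have := norm_sub_norm_le (r • θ) y
          rw [hn] at this
          linarith
        simpa using inv_anti₀ (by linarith) h1
  have i2 : Integrable fun y => Complex.exp (-Complex.I * lam * (inner ℝ θ y : ℝ)) * g y := by
    refine hg.bdd_mul (c := 1) ?_ (.of_forall fun y => ?_)
    · have : Continuous fun y : E3 => Complex.exp (-Complex.I * lam * (inner ℝ θ y : ℝ)) := by
        fun_prop
      exact this.aestronglyMeasurable
    · have : -Complex.I * lam * (inner ℝ θ y : ℝ) = -Complex.I * ((lam * inner ℝ θ y : ℝ) : ℂ) := by
        push_cast; ring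
      rw [this]
      exact (norm_exp_neg_I_mul _).le
  have e1 : ∫ y, Complex.exp (-Complex.I * lam * (inner ℝ θ y : ℝ)) * g y =
      𝓕 g ((lam / (2 * Real.pi)) • θ) := by
    rw [Real.fourier_eq']
    refine integral_congr_ae (.of_forall fun y => ?_)
    simp only [smul_eq_mul]
    congr 2
    rw [inner_smul_right, real_inner_comm]
    have hpi : (Real.pi : ℂ) ≠ 0 := by exact_mod_cast Real.pi_ne_zero
    push_cast
    field_simp
  have e2 : waveRemainder lam g (r • θ) = kernelConv (sphericalKernel lam) g (r • θ) -
      Complex.exp (Complex.I * lam * r) / r * 𝓕 g ((lam / (2 * Real.pi)) • θ) := by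
    rw [waveRemainder, farField, hn, smul_smul r⁻¹ r, inv_mul_cancel₀ hr0.ne', one_smul, sphericalKernel, hn]
  have e3 : ∀ y, g y * (radialWave lam (inner ℝ θ y) (‖y‖ ^ 2) r -
      Complex.exp (-Complex.I * lam * (inner ℝ θ y : ℝ))) =
      r * Complex.exp (-Complex.I * lam * r) * (sphericalKernel lam (r • θ - y) * g y) -
      Complex.exp (-Complex.I * lam * (inner ℝ θ y : ℝ)) * g y := by
    intro y
    rw [radialWave, sphericalKernel_eq_waveProfile, norm_smul_sub_sq hθ]
    ring
  simp only [e3]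
  rw [integral_sub (i1.const_mul _) i2, integral_const_mul, e1, e2, kernelConv]
  have hE : Complex.exp (-Complex.I * lam * r) * Complex.exp (Complex.I * lam * r) = 1 := by
    rw [← Complex.exp_add]
    simp
  have e4 : (r : ℂ) * Complex.exp (-Complex.I * lam * r) * (Complex.exp (Complex.I * lam * r) / r *
      𝓕 g ((lam / (2 * Real.pi)) • θ)) = 𝓕 g ((lam / (2 * Real.pi)) • θ) := by
    calc _ = (Complex.exp (-Complex.I * lam * r) * Complex.exp (Complex.I * lam * r)) *
          𝓕 g ((lam / (2 * Real.pi)) • θ) := by field_simp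
      _ = _ := by rw [hE, one_mul]
  rw [mul_sub, e4]

/-- Far from its source, an outgoing wave differs from its far field by an average over the exterior
of the outgoing wave generated by the spherical Laplacian of the source. -/
theorem enorm_waveRemainder_le {lam : ℝ} (hlam : 0 < lam) {g : E3 → ℂ} (hg : ContDiff ℝ ∞ g) {β : ℝ}
    (hβ : ∀ y, β < ‖y‖ → g y = 0) {θ : E3} (hθ : ‖θ‖ = 1) {r : ℝ} (hr : 1 ≤ r)
    (hr2 : 2 * β ≤ r) : ‖waveRemainder lam g (r • θ)‖ₑ ≤ ENNReal.ofReal (lam * r)⁻¹ *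
      ∫⁻ s in Set.Ioi r, ENNReal.ofReal s⁻¹ *
        ‖kernelConv (sphericalKernel lam) (sphericalLaplacian g) (s • θ)‖ₑ := by
  have hr0 : 0 < r := by linarith
  have hβr : β < r := by linarith
  have hcs : HasCompactSupport g := HasCompactSupport.intro (isCompact_closedBall (0 : E3) β)
    fun y hy => hβ y (by simpa using hy)
  have hgi : Integrable g := hg.continuous.integrable_of_hasCompactSupport hcs
  set E : ℝ → ℂ := fun s => Complex.exp (2 * Complex.I * lam * (s - r)) - 1 with hE
  have hEn : ∀ s, ‖E s‖ ≤ 2 := by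
    intro s
    have : 2 * Complex.I * lam * ((s : ℂ) - r) = ((2 * lam * (s - r) : ℝ) : ℂ) * Complex.I := by
      push_cast; ring
    rw [hE]; simp only
    rw [this]
    refine (norm_sub_le _ _).trans ?_
    rw [Complex.norm_exp_ofReal_mul_I, norm_one]; norm_num
  have hab : ∀ y, inner ℝ θ y ^ 2 ≤ ‖y‖ ^ 2 := by
    intro y
    have := abs_real_inner_le_norm θ y
    rw [hθ, one_mul] at this
    exact sq_le_sq.2 (by rwa [abs_norm])
  have hin : ∀ y, ‖y‖ ≤ β → |inner ℝ θ y| ≤ β := fun y hy => by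
    have := abs_real_inner_le_norm θ y
    rw [hθ, one_mul] at this
    exact this.trans hy
  set M : ℝ := 8 * β * (lam + 2) + 8 * β ^ 2 * (6 * (lam + 2) + lam ^ 2) with hM
  set q : E3 → ℝ → ℂ := fun y s => radialSource lam (inner ℝ θ y) (‖y‖ ^ 2) s with hq
  have hqm : Measurable fun p : E3 × ℝ => g p.1 * (E p.2 * q p.1 p.2) := by
    have h1 := measurable_waveProfile₁ lam
    have h2 := measurable_waveProfile₂ lam
    have h3 := hg.continuous.measurable
    simp only [hq, hE, radialSource]
    fun_prop
  have hint : Integrable (fun p : E3 × ℝ => g p.1 * (E p.2 * q p.1 p.2))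
      ((volume : Measure E3).prod (volume.restrict (Set.Ioi r))) := by
    have h1 : IntegrableOn (fun s : ℝ => s ^ (-2 : ℝ)) (Set.Ioi r) :=
      integrableOn_Ioi_rpow_of_lt (by norm_num) hr0
    refine (hgi.norm.mul_prod (h1.const_mul (2 * M))).mono' hqm.aestronglyMeasurable ?_
    have h2 : ∀ᵐ p ∂((volume : Measure E3).prod (volume.restrict (Set.Ioi r))), r < p.2 :=
      Measure.quasiMeasurePreserving_snd.ae (ae_restrict_mem measurableSet_Ioi)
    filter_upwards [h2] with p hp
    have hp0 : 0 < p.2 := hr0.trans hp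
    rw [norm_mul]
    by_cases hy : β < ‖p.1‖
    · rw [hβ _ hy]; simp
    · refine mul_le_mul_of_nonneg_left ?_ (norm_nonneg _)
      have h3 := norm_radialSource_le hlam (hin p.1 (not_lt.1 hy)) (hab p.1)
        (pow_le_pow_left₀ (norm_nonneg _) (not_lt.1 hy) 2) (by linarith : 1 ≤ p.2) (by linarith)
      rw [norm_mul, Real.rpow_neg hp0.le, Real.rpow_two, mul_assoc, ← div_eq_mul_inv]
      exact mul_le_mul (hEn _) h3 (norm_nonneg _) zero_le_two
  -- Integration of the identity of `radialWave_sub_eq` against `g`, with Fubini on the right-hand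
  -- side.
  have key : 2 * Complex.I * lam * (r * Complex.exp (-Complex.I * lam * r) *
      waveRemainder lam g (r • θ)) = ∫ s in Set.Ioi r, E s * (-(s : ℂ)⁻¹ *
        Complex.exp (-Complex.I * lam * s) *
        kernelConv (sphericalKernel lam) (sphericalLaplacian g) (s • θ)) := by
    rw [← integral_mul_radialWave hgi hβ hθ hr0 hβr, ← integral_const_mul]
    calc _ = ∫ y, ∫ s in Set.Ioi r, g y * (E s * q y s) := by
          refine integral_congr_ae (.of_forall fun y => ?_)
          simp only
          rw [integral_const_mul]
          by_cases hy : β < ‖y‖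
          · rw [hβ _ hy]; simp
          · rw [(radialWave_sub_eq hlam (hin y (not_lt.1 hy)) (hab y)
              (pow_le_pow_left₀ (norm_nonneg _) (not_lt.1 hy) 2) hr hr2).2]
            ring
      _ = ∫ s in Set.Ioi r, ∫ y, g y * (E s * q y s) := integral_integral_swap hint
      _ = _ := by
          refine setIntegral_congr_fun measurableSet_Ioi fun s hs => ?_
          have hs' : r < s := hs
          rw [← integral_mul_radialSource lam hg hβ hθ (hr0.trans hs') (hβr.trans hs'),
            ← integral_const_mul]
          refine integral_congr_ae (.of_forall fun y => ?_)
          simp only [hq]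
          ring
  have hn1 : ∀ s : ℝ, ‖Complex.exp (-Complex.I * lam * s)‖ = 1 := by
    intro s
    rw [Complex.norm_exp]; simp
  have h1 : ENNReal.ofReal (2 * (lam * r)) * ‖waveRemainder lam g (r • θ)‖ₑ ≤
      2 * ∫⁻ s in Set.Ioi r, ENNReal.ofReal s⁻¹ *
        ‖kernelConv (sphericalKernel lam) (sphericalLaplacian g) (s • θ)‖ₑ := by
    have h2 : ENNReal.ofReal (2 * (lam * r)) * ‖waveRemainder lam g (r • θ)‖ₑ =
        ‖2 * Complex.I * lam * (r * Complex.exp (-Complex.I * lam * r) *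
          waveRemainder lam g (r • θ))‖ₑ := by
      rw [← ofReal_norm, ← ofReal_norm, ← ENNReal.ofReal_mul (by positivity)]
      congr 1
      simp only [norm_mul, hn1, Complex.norm_I, Complex.norm_real, Real.norm_of_nonneg hr0.le,
        Real.norm_of_nonneg hlam.le, Complex.norm_ofNat]
      ring
    rw [h2, key, ← lintegral_const_mul' _ _ (by norm_num)]
    refine (enorm_integral_le_lintegral_enorm _).trans ?_
    refine setLIntegral_mono' measurableSet_Ioi fun s hs => ?_
    have hs0 : 0 < s := hr0.trans hs
    rw [enorm_mul, enorm_mul]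
    refine mul_le_mul' ?_ (mul_le_mul' (le_of_eq ?_) le_rfl)
    · rw [← ofReal_norm]
      exact (ENNReal.ofReal_le_ofReal (hEn s)).trans (by simp)
    · rw [← ofReal_norm]
      congr 1
      rw [norm_mul, hn1, norm_neg, norm_inv, Complex.norm_real, Real.norm_of_nonneg hs0.le, mul_one]
  have hc : ENNReal.ofReal (lam * r)⁻¹ = 2 * ENNReal.ofReal (2 * (lam * r))⁻¹ := by
    rw [show (2 : ENNReal) = ENNReal.ofReal 2 by simp, ← ENNReal.ofReal_mul zero_le_two]
    congr 1
    field_simp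
  have h0 : ENNReal.ofReal (2 * (lam * r))⁻¹ * ENNReal.ofReal (2 * (lam * r)) = 1 := by
    rw [← ENNReal.ofReal_mul (by positivity), inv_mul_cancel₀ (by positivity), ENNReal.ofReal_one]
  calc ‖waveRemainder lam g (r • θ)‖ₑ = ENNReal.ofReal (2 * (lam * r))⁻¹ *
        (ENNReal.ofReal (2 * (lam * r)) * ‖waveRemainder lam g (r • θ)‖ₑ) := by
        rw [← mul_assoc, h0, one_mul]
    _ ≤ _ := by
        rw [hc, mul_comm (2 : ENNReal) (ENNReal.ofReal _), mul_assoc]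
        exact mul_le_mul_right h1 _

/-! ### The remainder of a wave packet -/

theorem fourier_add_of_integrable {f g : E3 → ℂ} (hf : Integrable f) (hg : Integrable g) (ξ : E3) :
    𝓕 (fun x => f x + g x) ξ = 𝓕 f ξ + 𝓕 g ξ :=
  congrFun (VectorFourier.fourierIntegral_add (μ := volume) (L := innerₗ E3) Real.continuous_fourierChar
    continuous_inner hf hg) ξ

theorem fourier_const_mul (f : E3 → ℂ) (c : ℂ) (ξ : E3) :
    𝓕 (fun x => c * f x) ξ = c * 𝓕 f ξ :=
  congrFun (VectorFourier.fourierIntegral_const_smul Real.fourierChar volume (innerₗ E3) f c) ξ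

theorem lintegral_polar_indicator {f : E3 → ENNReal} (hf : Measurable f) {s : Set ℝ}
    (hs : MeasurableSet s) : ∫⁻ x in {x : E3 | ‖x‖ ∈ s}, f x = ∫⁻ σ : S2, ∫⁻ r in s ∩ Set.Ioi 0,
      ENNReal.ofReal (r ^ 2) * f (r • (σ : E3)) ∂volume ∂sphereMeasure := by
  have hS : MeasurableSet {x : E3 | ‖x‖ ∈ s} := measurable_norm hs
  rw [← lintegral_indicator hS, lintegral_polar (hf.indicator hS)]
  refine lintegral_congr fun σ => ?_
  rw [← Measure.restrict_restrict hs, ← lintegral_indicator hs]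
  refine setLIntegral_congr_fun measurableSet_Ioi fun r hr => ?_
  have hr0 : 0 < r := hr
  have hn : ‖r • (σ : E3)‖ = r := by
    rw [norm_smul, Real.norm_of_nonneg hr0.le]; simp
  by_cases h : r ∈ s
  · rw [Set.indicator_of_mem h, Set.indicator_of_mem (by rw [Set.mem_ofPred_eq, hn]; exact h)]
  · rw [Set.indicator_of_notMem h, Set.indicator_of_notMem (by rw [Set.mem_ofPred_eq, hn]; exact h),
      mul_zero]

theorem lintegral_polar_exterior {f : E3 → ENNReal} (hf : Measurable f) {R : ℝ} (hR : 0 ≤ R) :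
    ∫⁻ x in {x : E3 | R < ‖x‖}, f x = ∫⁻ σ : S2, ∫⁻ r in Set.Ioi R,
      ENNReal.ofReal (r ^ 2) * f (r • (σ : E3)) ∂volume ∂sphereMeasure := by
  have h := lintegral_polar_indicator hf (s := Set.Ioi R) measurableSet_Ioi
  rwa [Set.inter_eq_left.2 (Set.Ioi_subset_Ioi hR)] at h

theorem lintegral_polar_ball {f : E3 → ENNReal} (hf : Measurable f) (R : ℝ) :
    ∫⁻ x in Metric.ball (0 : E3) R, f x = ∫⁻ σ : S2, ∫⁻ r in Set.Ioo 0 R,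
      ENNReal.ofReal (r ^ 2) * f (r • (σ : E3)) ∂volume ∂sphereMeasure := by
  have h := lintegral_polar_indicator hf (s := Set.Iio R) measurableSet_Iio
  rw [Set.Iio_inter_Ioi] at h
  have e : Metric.ball (0 : E3) R = {x : E3 | ‖x‖ ∈ Set.Iio R} := by
    ext x; simp
  rwa [e]

theorem measurable_farField (lam : ℝ) {g : E3 → ℂ} (hg : Integrable g) :
    Measurable (farField lam g) := by
  have h1 := measurable_sphericalKernel lam
  have h2 := (continuous_fourier_of_integrable hg).measurable
  unfold farField
  exact h1.mul (h2.comp (by fun_prop))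

theorem measurable_waveRemainder (lam : ℝ) {g : E3 → ℂ} (hg : Integrable g) (hgm : Measurable g) :
    Measurable (waveRemainder lam g) :=
  (measurable_kernelConv (measurable_sphericalKernel _) hgm).sub (measurable_farField lam hg)

theorem enorm_add_sq_le (a b : ℂ) : ‖a - b‖ₑ ^ 2 ≤ 2 * ‖a‖ₑ ^ 2 + 2 * ‖b‖ₑ ^ 2 := by
  rw [enorm_sq_eq_ofReal, enorm_sq_eq_ofReal, enorm_sq_eq_ofReal,
    show (2 : ENNReal) = ENNReal.ofReal 2 by simp, ← ENNReal.ofReal_mul zero_le_two,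
    ← ENNReal.ofReal_mul zero_le_two, ← ENNReal.ofReal_add (by positivity) (by positivity)]
  refine ENNReal.ofReal_le_ofReal ?_
  have h := norm_sub_le a b
  have h2 := pow_le_pow_left₀ (norm_nonneg _) h 2
  nlinarith [sq_nonneg (‖a‖ - ‖b‖)]

theorem lintegral_ball_farField_sq {lam : ℝ} {g : E3 → ℂ} (hg : Integrable g) (R : ℝ) :
    ∫⁻ x in Metric.ball (0 : E3) R, ‖farField lam g x‖ₑ ^ 2 = ENNReal.ofReal R *
      ∫⁻ σ : S2, ‖𝓕 g ((lam / (2 * Real.pi)) • (σ : E3))‖ₑ ^ 2 ∂sphereMeasure := by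
  rw [lintegral_polar_ball ((measurable_farField lam hg).enorm.pow_const 2),
    ← lintegral_const_mul' _ _ ENNReal.ofReal_ne_top]
  refine lintegral_congr fun σ => ?_
  have h1 : ∀ r ∈ Set.Ioo 0 R, ENNReal.ofReal (r ^ 2) * ‖farField lam g (r • (σ : E3))‖ₑ ^ 2 =
      ‖𝓕 g ((lam / (2 * Real.pi)) • (σ : E3))‖ₑ ^ 2 := by
    intro r hr
    have hr0 : 0 < r := hr.1
    have hn : ‖r • (σ : E3)‖ = r := by
      rw [norm_smul, Real.norm_of_nonneg hr0.le]; simp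
    rw [farField, enorm_mul, mul_pow, hn, smul_smul r⁻¹ r, inv_mul_cancel₀ hr0.ne', one_smul,
      enorm_sq_eq_ofReal (sphericalKernel _ _), norm_sphericalKernel, hn, ← mul_assoc,
      ← ENNReal.ofReal_mul (sq_nonneg r)]
    have e : r ^ 2 * (Real.exp (-(lam : ℂ).im * r) / r) ^ 2 = 1 := by
      rw [Complex.ofReal_im, neg_zero, zero_mul, Real.exp_zero]; field_simp
    rw [e, ENNReal.ofReal_one, one_mul]
  rw [setLIntegral_congr_fun measurableSet_Ioo h1, setLIntegral_const, Real.volume_Ioo, sub_zero, mul_comm]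

/-- The mean square of the remainder in the exterior region, by Hardy's inequality. -/
theorem lintegral_exterior_waveRemainder_le {lam : ℝ} (hlam : 0 < lam) {g : E3 → ℂ}
    (hg : ContDiff ℝ ∞ g) {β : ℝ} (hβ : ∀ y, β < ‖y‖ → g y = 0) {R : ℝ} (hR : 1 ≤ R)
    (hR2 : 2 * β ≤ R) : ∫⁻ x in {x : E3 | R < ‖x‖}, ‖waveRemainder lam g x‖ₑ ^ 2 ≤
      ENNReal.ofReal (4 * (lam ^ 2)⁻¹) * ∫⁻ x in {x : E3 | R < ‖x‖}, ENNReal.ofReal (‖x‖ ^ 2)⁻¹ *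
        ‖kernelConv (sphericalKernel lam) (sphericalLaplacian g) x‖ₑ ^ 2 := by
  have hR0 : 0 < R := by linarith
  have hcs : HasCompactSupport g := HasCompactSupport.intro (isCompact_closedBall (0 : E3) β)
    fun y hy => hβ y (by simpa using hy)
  have hgi : Integrable g := hg.continuous.integrable_of_hasCompactSupport hcs
  set v := kernelConv (sphericalKernel lam) (sphericalLaplacian g) with hv
  have hvm : Measurable v := measurable_kernelConv (measurable_sphericalKernel _)
    (contDiff_sphericalLaplacian hg).continuous.measurable
  rw [lintegral_polar_exterior ((measurable_waveRemainder lam hgi hg.continuous.measurable).enorm.pow_const 2)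
    hR0.le, lintegral_polar_exterior (by fun_prop) hR0.le,
    ← lintegral_const_mul' _ _ ENNReal.ofReal_ne_top]
  refine lintegral_mono fun σ => ?_
  have hσ : ‖(σ : E3)‖ = 1 := by simp
  set F : ℝ → ENNReal := fun s => ‖v (s • (σ : E3))‖ₑ with hF
  have hFm : Measurable F := by
    simp only [hF]
    exact (hvm.comp (by fun_prop)).enorm
  have h1 : ∀ r ∈ Set.Ioi R, ENNReal.ofReal (r ^ 2) * ‖waveRemainder lam g (r • (σ : E3))‖ₑ ^ 2 ≤
      ENNReal.ofReal (lam ^ 2)⁻¹ * (∫⁻ s in Set.Ioi r, ENNReal.ofReal s⁻¹ * F s) ^ 2 := by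
    intro r hr
    have hr' : R < r := hr
    have hr0 : 0 < r := hR0.trans hr
    have h2 := pow_le_pow_left₀ zero_le (enorm_waveRemainder_le hlam hg hβ hσ
      (by linarith : 1 ≤ r) (by linarith)) 2
    refine (mul_le_mul_right h2 _).trans (le_of_eq ?_)
    rw [mul_pow, ← mul_assoc, ← ENNReal.ofReal_pow (by positivity), ← ENNReal.ofReal_mul (by positivity)]
    congr 2
    field_simp
  have h2 : ∀ r ∈ Set.Ioi R, ENNReal.ofReal (r ^ 2) * (ENNReal.ofReal (‖r • (σ : E3)‖ ^ 2)⁻¹ *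
      ‖v (r • (σ : E3))‖ₑ ^ 2) = F r ^ 2 := by
    intro r hr
    have hr0 : 0 < r := hR0.trans hr
    rw [norm_smul, Real.norm_of_nonneg hr0.le, hσ, mul_one, ← mul_assoc,
      ← ENNReal.ofReal_mul (by positivity), mul_inv_cancel₀ (by positivity), ENNReal.ofReal_one, one_mul]
  calc _ ≤ ∫⁻ r in Set.Ioi R, ENNReal.ofReal (lam ^ 2)⁻¹ *
        (∫⁻ s in Set.Ioi r, ENNReal.ofReal s⁻¹ * F s) ^ 2 := setLIntegral_mono' measurableSet_Ioi h1
    _ = ENNReal.ofReal (lam ^ 2)⁻¹ * ∫⁻ r in Set.Ioi R,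
        (∫⁻ s in Set.Ioi r, ENNReal.ofReal s⁻¹ * F s) ^ 2 :=
        lintegral_const_mul' _ _ ENNReal.ofReal_ne_top
    _ ≤ ENNReal.ofReal (lam ^ 2)⁻¹ * (4 * ∫⁻ s in Set.Ioi R, F s ^ 2) :=
        mul_le_mul_right (lintegral_sq_lintegral_Ioi_le hFm hR0) _
    _ = _ := by
        rw [setLIntegral_congr_fun measurableSet_Ioi h2, ENNReal.ofReal_mul (by norm_num), mul_comm
          (ENNReal.ofReal 4), mul_assoc]
        simp

/-- The remainder of a wave packet of scale `Y` has norm of order `Y³` in `L²`. The regions inside and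
outside the sphere of radius of order `Y²` contribute equally. -/
theorem exists_lintegral_waveRemainder_wavePacket_le {lam : ℝ} (hlam : 0 < lam) (w : S2) {U : E3 → ℂ}
    (hU : ContDiff ℝ ∞ U) {c : ℝ} (hc1 : 1 ≤ c) (hc : ∀ y, c < ‖y‖ → U y = 0) :
    ∃ C : ℝ, 0 ≤ C ∧ ∀ Y : ℝ, 1 ≤ Y →
      ∫⁻ x, ‖waveRemainder lam (wavePacket lam w U Y) x‖ₑ ^ 2 ≤ ENNReal.ofReal (C * Y ^ 6) := by
  obtain ⟨C₁, hC₁0, hC₁⟩ := exists_lintegral_ball_kernelConv_le hlam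
  obtain ⟨C₂, hC₂0, hC₂⟩ := exists_lintegral_sphere_fourier_le hlam
  obtain ⟨U₀, U₁, U₂, ⟨h0, h1, h2⟩, hcU, hΛ⟩ := exists_sphericalLaplacian_wavePacket lam w hU hc
  obtain ⟨D, hD0, hD⟩ := exists_norm_fourier_wavePacket_le lam w hU hc
  obtain ⟨D₀, hD₀0, hD₀⟩ := exists_norm_fourier_wavePacket_le lam w h0 fun y hy => (hcU y hy).1
  obtain ⟨D₁, hD₁0, hD₁⟩ := exists_norm_fourier_wavePacket_le lam w h1 fun y hy => (hcU y hy).2.1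
  obtain ⟨D₂, hD₂0, hD₂⟩ := exists_norm_fourier_wavePacket_le lam w h2 fun y hy => (hcU y hy).2.2
  set D' : ℝ := D₀ + D₁ + D₂ with hD'
  refine ⟨(2 * C₁ + 2 * C₂) * D ^ 2 * (4 * c) + 4 * (lam ^ 2)⁻¹ * (C₁ * D' ^ 2 / c), by positivity,
    fun Y hY => ?_⟩
  have hY0 : 0 < Y := by linarith
  have hYY : Y ≤ Y ^ 2 := by nlinarith
  set g := wavePacket lam w U Y with hg
  have hgs : ContDiff ℝ ∞ g := contDiff_wavePacket lam w hU Y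
  have hg0 : ∀ y, c * Y < ‖y‖ → g y = 0 := fun y hy => wavePacket_eq_zero lam w hc hY0 hy
  have hint : ∀ V : E3 → ℂ, ContDiff ℝ ∞ V → (∀ y, c < ‖y‖ → V y = 0) →
      Integrable (wavePacket lam w V Y) := by
    intro V hV hV0
    refine (contDiff_wavePacket lam w hV Y).continuous.integrable_of_hasCompactSupport ?_
    exact HasCompactSupport.intro (isCompact_closedBall (0 : E3) (c * Y))
      fun y hy => wavePacket_eq_zero lam w hV0 hY0 (by simpa using hy)
  have hgi : Integrable g := hint U hU hc
  set Λ := sphericalLaplacian g with hΛg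
  have hΛs : Continuous Λ := (contDiff_sphericalLaplacian hgs).continuous
  have hΛ0 : ∀ y, c * Y < ‖y‖ → Λ y = 0 := fun y hy => sphericalLaplacian_eq_zero hg0 hy
  -- The transforms of the three wave packets are of size `Y³` near the frequency `λw`, and their
  -- coefficients are at most `Y²`.
  have hΛF : ∀ ξ, ‖𝓕 Λ ξ‖ ≤ D' * Y ^ 5 *
      ((1 + Y * ‖ξ - (lam / (2 * Real.pi)) • (w : E3)‖) ^ 2)⁻¹ := by
    intro ξ
    have e : Λ = fun y => (wavePacket lam w U₀ Y y + (Y : ℂ) * wavePacket lam w U₁ Y y) +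
        (Y : ℂ) ^ 2 * wavePacket lam w U₂ Y y := by
      rw [hΛg, hg, hΛ Y hY0]
      funext y
      simp only [wavePacket]; ring
    have i0 := hint U₀ h0 fun y hy => (hcU y hy).1
    have i1 := hint U₁ h1 fun y hy => (hcU y hy).2.1
    have i2 := hint U₂ h2 fun y hy => (hcU y hy).2.2
    have i01 : Integrable fun y => wavePacket lam w U₀ Y y + (Y : ℂ) * wavePacket lam w U₁ Y y :=
      i0.add (i1.const_mul _)
    rw [e, fourier_add_of_integrable i01 (i2.const_mul _),
      fourier_add_of_integrable i0 (i1.const_mul _), fourier_const_mul, fourier_const_mul]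
    refine (norm_add₃_le).trans ?_
    rw [norm_mul, norm_mul, norm_pow, Complex.norm_real, Real.norm_of_nonneg hY0.le]
    set B : ℝ := ((1 + Y * ‖ξ - (lam / (2 * Real.pi)) • (w : E3)‖) ^ 2)⁻¹ with hB
    have hB0 : 0 ≤ B := by positivity
    have b0 : ‖𝓕 (wavePacket lam w U₀ Y) ξ‖ ≤ D₀ * Y ^ 5 * B := by
      refine (hD₀ Y hY0 ξ).trans ?_
      have : Y ^ 3 ≤ Y ^ 5 := pow_le_pow_right₀ hY (by norm_num)
      gcongr
    have b1 : Y * ‖𝓕 (wavePacket lam w U₁ Y) ξ‖ ≤ D₁ * Y ^ 5 * B := by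
      refine (mul_le_mul_of_nonneg_left (hD₁ Y hY0 ξ) hY0.le).trans ?_
      have : Y ^ 4 ≤ Y ^ 5 := pow_le_pow_right₀ hY (by norm_num)
      calc _ = D₁ * Y ^ 4 * B := by ring
        _ ≤ _ := by gcongr
    have b2 : Y ^ 2 * ‖𝓕 (wavePacket lam w U₂ Y) ξ‖ ≤ D₂ * Y ^ 5 * B := by
      refine (mul_le_mul_of_nonneg_left (hD₂ Y hY0 ξ) (sq_nonneg Y)).trans (le_of_eq ?_)
      ring
    calc _ ≤ D₀ * Y ^ 5 * B + D₁ * Y ^ 5 * B + D₂ * Y ^ 5 * B := add_le_add (add_le_add b0 b1) b2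
      _ = _ := by rw [hD']; ring
  -- The near part contributes `(Y³)² R Y⁻² = Y⁴ R` and the far part `(Y⁵)² Y⁻² R⁻¹ = Y⁸ R⁻¹`,
  -- which balance for `R` of order `Y²`.
  set R : ℝ := 2 * c * Y ^ 2 with hR
  have hR1 : 1 ≤ R := by nlinarith
  have hR0 : 0 < R := by linarith
  have hcR : 2 * (c * Y) ≤ R := by nlinarith
  have hrm : Measurable fun x => ‖waveRemainder lam g x‖ₑ ^ 2 :=
    (measurable_waveRemainder lam hgi hgs.continuous.measurable).enorm.pow_const 2
  -- Near the origin, the wave and its far field are estimated separately.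
  have hnear : ∫⁻ x in Metric.ball (0 : E3) (2 * R), ‖waveRemainder lam g x‖ₑ ^ 2 ≤
      ENNReal.ofReal ((2 * C₁ + 2 * C₂) * D ^ 2 * (4 * c) * Y ^ 6) := by
    have n1 := hC₁ w g (D * Y ^ 3) (2 * R) Y (by linarith) hY0 hgs.continuous
      (fun y hy => hg0 y (by linarith)) (hD Y hY0)
    have n2 : ∫⁻ x in Metric.ball (0 : E3) (2 * R), ‖farField lam g x‖ₑ ^ 2 ≤
        ENNReal.ofReal (2 * R * (C₂ * ((D * Y ^ 3) ^ 2 * (Y ^ 2)⁻¹))) := by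
      rw [lintegral_ball_farField_sq hgi, ENNReal.ofReal_mul (p := 2 * R) (by linarith)]
      exact mul_le_mul_right (hC₂ w (𝓕 g) (D * Y ^ 3) Y _ hY0 (by positivity) (hD Y hY0)) _
    have hfm := (measurable_farField lam hgi).enorm.pow_const 2
    have hkm : Measurable fun x => ‖kernelConv (sphericalKernel lam) g x‖ₑ ^ 2 :=
      (measurable_kernelConv (measurable_sphericalKernel lam) hgs.continuous.measurable).enorm.pow_const 2
    calc _ ≤ ∫⁻ x in Metric.ball (0 : E3) (2 * R), (2 * ‖kernelConv (sphericalKernel lam) g x‖ₑ ^ 2 +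
          2 * ‖farField lam g x‖ₑ ^ 2) := lintegral_mono fun x => enorm_add_sq_le _ _
      _ = 2 * (∫⁻ x in Metric.ball (0 : E3) (2 * R), ‖kernelConv (sphericalKernel lam) g x‖ₑ ^ 2) +
          2 * ∫⁻ x in Metric.ball (0 : E3) (2 * R), ‖farField lam g x‖ₑ ^ 2 := by
          rw [lintegral_add_left (hkm.const_mul _), lintegral_const_mul _ hkm, lintegral_const_mul _ hfm]
      _ ≤ 2 * ENNReal.ofReal (C₁ * ((D * Y ^ 3) ^ 2 * (2 * R) * (Y ^ 2)⁻¹)) +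
          2 * ENNReal.ofReal (2 * R * (C₂ * ((D * Y ^ 3) ^ 2 * (Y ^ 2)⁻¹))) :=
          add_le_add (mul_le_mul_right n1 _) (mul_le_mul_right n2 _)
      _ = _ := by
          rw [show (2 : ENNReal) = ENNReal.ofReal 2 by simp, ← ENNReal.ofReal_mul zero_le_two,
            ← ENNReal.ofReal_mul zero_le_two, ← ENNReal.ofReal_add (by positivity) (by positivity)]
          congr 1
          rw [hR]
          field_simp
          ring
  -- Far away, the remainder is controlled by the wave with source `Λ`, whose mass in balls grows
  -- linearly.
  have hfar : ∫⁻ x in {x : E3 | R < ‖x‖}, ‖waveRemainder lam g x‖ₑ ^ 2 ≤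
      ENNReal.ofReal (4 * (lam ^ 2)⁻¹ * (C₁ * D' ^ 2 / c) * Y ^ 6) := by
    refine (lintegral_exterior_waveRemainder_le hlam hgs hg0 hR1 hcR).trans ?_
    have f1 := lintegral_inv_norm_sq_mul_le (H := fun x => ‖kernelConv (sphericalKernel lam) Λ x‖ₑ ^ 2)
      (M := C₁ * ((D' * Y ^ 5) ^ 2 * (Y ^ 2)⁻¹)) (R := R)
      ((measurable_kernelConv (measurable_sphericalKernel lam) hΛs.measurable).enorm.pow_const 2)
      (by positivity) hR0 (fun t ht => by
        have := hC₁ w Λ (D' * Y ^ 5) t Y (by linarith) hY0 hΛs (fun y hy => hΛ0 y (by nlinarith)) hΛF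
        refine this.trans (le_of_eq ?_)
        congr 1; ring)
    refine (mul_le_mul_right f1 _).trans (le_of_eq ?_)
    rw [← ENNReal.ofReal_mul (by positivity)]
    congr 1
    rw [hR]
    field_simp
  calc _ ≤ ∫⁻ x in Metric.ball (0 : E3) (2 * R) ∪ {x : E3 | R < ‖x‖}, ‖waveRemainder lam g x‖ₑ ^ 2 := by
        rw [← setLIntegral_univ]
        refine lintegral_mono_set fun x _ => ?_
        rcases lt_or_ge R ‖x‖ with hx | hx
        · exact Or.inr hx
        · refine Or.inl ?_
          rw [mem_ball_zero_iff]; linarith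
    _ ≤ _ := lintegral_union_le _ _ _
    _ ≤ _ := add_le_add hnear hfar
    _ = _ := by
        rw [← ENNReal.ofReal_add (by positivity) (by positivity)]
        congr 1; ring

/-! ### Square integrability of the remainder -/

/-- The spherical wave is the sum of an integrable and of a bounded kernel. -/
theorem exists_sphericalKernel_split (lam : ℝ) : ∃ k₁ k₂ : E3 → ℂ, Measurable k₁ ∧ Measurable k₂ ∧
    Integrable k₁ ∧ (∀ x, ‖k₂ x‖ ≤ 1) ∧ ∀ x, sphericalKernel lam x = k₁ x + k₂ x := by
  have hS : MeasurableSet {x : E3 | ‖x‖ < 1} := measurableSet_lt measurable_norm measurable_const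
  have hm := measurable_sphericalKernel (lam : ℂ)
  have hn : ∀ x, ‖sphericalKernel lam x‖ = ‖x‖⁻¹ := by
    intro x
    rw [norm_sphericalKernel, Complex.ofReal_im, neg_zero, zero_mul, Real.exp_zero, one_div]
  refine ⟨{x : E3 | ‖x‖ < 1}.indicator (sphericalKernel lam),
    {x : E3 | ‖x‖ < 1}ᶜ.indicator (sphericalKernel lam), hm.indicator hS, hm.indicator hS.compl,
    ?_, fun x => ?_, fun x => ?_⟩
  · have h := integrable_indicator_inv_norm_pow (k := 1) (by norm_num) 1
    refine h.mono' (hm.indicator hS).aestronglyMeasurable (.of_forall fun x => ?_)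
    by_cases hx : ‖x‖ < 1
    · rw [Set.indicator_of_mem (by exact hx), Set.indicator_of_mem (by exact hx), hn, pow_one]
    · rw [Set.indicator_of_notMem (by exact hx), Set.indicator_of_notMem (by exact hx), norm_zero]
  · by_cases hx : ‖x‖ < 1
    · rw [Set.indicator_of_notMem (by simpa using hx)]; simp
    · rw [Set.indicator_of_mem (by simpa using hx), hn]
      exact inv_le_one_of_one_le₀ (not_lt.1 hx)
  · exact (congrFun (Set.indicator_self_add_compl _ _) x).symm

theorem integrable_sphericalKernel_sub_mul (lam : ℝ) {g : E3 → ℂ} (hg : Integrable g) {B : ℝ}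
    (hB : ∀ x, ‖g x‖ ≤ B) (x : E3) : Integrable fun y => sphericalKernel lam (x - y) * g y := by
  obtain ⟨k₁, k₂, -, h2, h3, h4, h5⟩ := exists_sphericalKernel_split lam
  have i1 : Integrable fun y => k₁ (x - y) * g y :=
    (h3.comp_sub_left x).mul_bdd (c := B) hg.1 (.of_forall hB)
  have i2 : Integrable fun y => k₂ (x - y) * g y :=
    hg.bdd_mul (c := 1) (h2.comp (measurable_const.sub measurable_id)).aestronglyMeasurable
      (.of_forall fun y => h4 _)
  refine (i1.add i2).congr (.of_forall fun y => ?_)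
  simp only [Pi.add_apply, h5]; ring

/-- Termwise integration of a dyadic decomposition against an integrable function. -/
theorem hasSum_integral_dyadic_of_integrable {m : ℝ} (hm : 3 < m) {F : E3 → ℂ} {U : 𝓢(E3, ℂ)}
    (hF : ∀ x, HasSum
      (fun j : ℕ => (((dyadicRatio m / 8) ^ j : ℝ) : ℂ) * U (((2 : ℝ) ^ j)⁻¹ • x)) (F x))
    {b : E3 → ℂ} (hb : Integrable b) :
    HasSum (fun j : ℕ => (((dyadicRatio m / 8) ^ j : ℝ) : ℂ) *
      ∫ x, b x * U (((2 : ℝ) ^ j)⁻¹ • x)) (∫ x, b x * F x) := by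
  have hq := dyadicRatio_pos m
  have hq1 := dyadicRatio_lt_one hm
  obtain ⟨D, hD0, hD⟩ := schwartz_pointwise_bound U 0
  simp only [pow_zero, inv_one, mul_one] at hD
  have hint : ∀ j : ℕ, Integrable (fun x : E3 => b x * U (((2 : ℝ) ^ j)⁻¹ • x)) := fun j =>
    hb.mul_bdd (c := D) (U.continuous.comp (continuous_const_smul _)).aestronglyMeasurable
      (.of_forall fun x => hD _)
  have hint2 : ∀ j : ℕ, Integrable (fun x : E3 =>
      (((dyadicRatio m / 8) ^ j : ℝ) : ℂ) * (b x * U (((2 : ℝ) ^ j)⁻¹ • x))) := fun j =>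
    (hint j).const_mul _
  have hnorm : ∀ j : ℕ, ∫ x : E3, ‖(((dyadicRatio m / 8) ^ j : ℝ) : ℂ) *
      (b x * U (((2 : ℝ) ^ j)⁻¹ • x))‖ ≤ (D * ∫ x, ‖b x‖) * (dyadicRatio m / 8) ^ j := by
    intro j
    rw [mul_comm, ← integral_const_mul, ← integral_const_mul]
    refine integral_mono (hint2 j).norm ((hb.norm.const_mul _).const_mul _) fun x => ?_
    simp only [norm_mul, Complex.norm_real, Real.norm_of_nonneg (by positivity :
      0 ≤ (dyadicRatio m / 8) ^ j)]
    rw [mul_comm ‖b x‖]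
    gcongr
    exact hD _
  have h := hasSum_integral_of_summable_integral_norm hint2
    (Summable.of_nonneg_of_le (fun j => integral_nonneg fun x => norm_nonneg _) hnorm
      ((summable_geometric_of_lt_one (by positivity) (by linarith)).mul_left _))
  have e2 : ∀ x : E3, b x * F x = ∑' j : ℕ,
      (((dyadicRatio m / 8) ^ j : ℝ) : ℂ) * (b x * U (((2 : ℝ) ^ j)⁻¹ • x)) := fun x => by
    rw [← (hF x).tsum_eq, ← tsum_mul_left]
    congr 1; funext j; ring
  simp only [e2]
  simp only [integral_const_mul] at h
  exact h

/-- The remainder of a modulated source as an integral against the sum of an integrable and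
of a bounded function. -/
theorem exists_waveRemainder_eq_integral (lam : ℝ) (w x : E3) : ∃ b₁ b₂ : E3 → ℂ, Integrable b₁ ∧
    AEStronglyMeasurable b₂ ∧ (∃ B, ∀ y, ‖b₂ y‖ ≤ B) ∧ ∀ F : E3 → ℂ, Integrable F →
      (∃ B, ∀ y, ‖F y‖ ≤ B) → waveRemainder lam (fun y => F y * planeWave lam w y) x =
        (∫ y, b₁ y * F y) + ∫ y, b₂ y * F y := by
  obtain ⟨k₁, k₂, h1, h2, h3, h4, h5⟩ := exists_sphericalKernel_split lam
  set pw := planeWave lam w with hpw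
  have hpwc : Continuous pw := (contDiff_planeWave lam w).continuous
  set ξ : E3 := (lam / (2 * Real.pi)) • (‖x‖⁻¹ • x) with hξ
  set e : E3 → ℂ := fun y => Complex.exp (((-2 * Real.pi * inner ℝ y ξ : ℝ) : ℂ) * Complex.I) with he
  have hec : Continuous e := by fun_prop
  have hen : ∀ y, ‖e y‖ = 1 := fun y => by rw [he]; exact Complex.norm_exp_ofReal_mul_I _
  set b₂ : E3 → ℂ := fun y => (k₂ (x - y) - sphericalKernel lam x * e y) * pw y with hb₂
  have hb₂n : ∀ y, ‖b₂ y‖ ≤ 1 + ‖sphericalKernel lam x‖ := by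
    intro y
    rw [hb₂]; simp only
    rw [norm_mul, hpw, norm_planeWave, mul_one]
    refine (norm_sub_le _ _).trans ?_
    rw [norm_mul, hen, mul_one]
    exact add_le_add (h4 _) le_rfl
  have hb₂m : AEStronglyMeasurable b₂ := by
    have h2' : Measurable fun y => k₂ (x - y) := h2.comp (measurable_const.sub measurable_id)
    exact ((h2'.sub (measurable_const.mul hec.measurable)).mul hpwc.measurable).aestronglyMeasurable
  have hb₁ : Integrable fun y => k₁ (x - y) * pw y :=
    (h3.comp_sub_left x).mul_bdd (c := 1) hpwc.aestronglyMeasurable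
      (.of_forall fun y => (norm_planeWave lam w y).le)
  refine ⟨fun y => k₁ (x - y) * pw y, b₂, hb₁, hb₂m, ⟨_, hb₂n⟩, fun F hF ⟨B, hB⟩ => ?_⟩
  have hFp : Integrable fun y => F y * pw y :=
    hF.mul_bdd (c := 1) hpwc.aestronglyMeasurable (.of_forall fun y => (norm_planeWave lam w y).le)
  have i1 : Integrable fun y => (k₁ (x - y) * pw y) * F y :=
    hb₁.mul_bdd (c := B) hF.1 (.of_forall hB)
  have i2 : Integrable fun y => b₂ y * F y := hF.bdd_mul (c := _) hb₂m (.of_forall hb₂n)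
  have i3 := integrable_sphericalKernel_sub_mul lam hFp (B := B) (fun y => by
    rw [norm_mul, hpw, norm_planeWave, mul_one]; exact hB y) x
  have i4 : Integrable fun y => e y * (F y * pw y) :=
    hFp.bdd_mul (c := 1) hec.aestronglyMeasurable (.of_forall fun y => (hen y).le)
  rw [← integral_add i1 i2, waveRemainder, farField, kernelConv, Real.fourier_eq']
  simp only [smul_eq_mul]
  rw [← integral_const_mul, ← integral_sub i3 (i4.const_mul _)]
  refine integral_congr_ae (.of_forall fun y => ?_)
  simp only [hb₂, h5]
  ring

/-- The scattered wave generated by the potential differs from its far field by a function in `L²`. -/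
theorem memLp_waveRemainder {m : ℝ} (hm : 3 < m) {V v : E3 → ℝ} (hV : ContDiff ℝ ∞ V)
    (hhom : ∀ x : E3, 1 < ‖x‖ → V x = ‖x‖ ^ (-m) * v (‖x‖⁻¹ • x)) {lam : ℝ} (hlam : 0 < lam) (w : S2) :
    MemLp (waveRemainder lam fun x => (V x : ℂ) * planeWave lam w x) 2 := by
  obtain ⟨W, U, hWc, hUc, hsum⟩ := exists_dyadic_decomposition hV hhom
  have hq := dyadicRatio_pos m
  have hsupp : ∀ T : 𝓢(E3, ℂ), HasCompactSupport T →
      ∃ c : ℝ, 1 ≤ c ∧ ∀ y, c < ‖y‖ → T y = 0 := by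
    intro T hT
    obtain ⟨c, hc⟩ := hT.isCompact.isBounded.subset_closedBall 0
    refine ⟨max c 1, le_max_right _ _, fun y hy => ?_⟩
    exact image_eq_zero_of_notMem_tsupport fun h => by
      have := hc h
      rw [mem_closedBall_zero_iff] at this
      exact absurd (this.trans (le_max_left c 1)) (not_le.2 hy)
  obtain ⟨cW, hcW1, hcW⟩ := hsupp W hWc
  obtain ⟨cU, hcU1, hcU⟩ := hsupp U hUc
  obtain ⟨CW, hCW0, hCW⟩ := exists_lintegral_waveRemainder_wavePacket_le hlam w (W.smooth ⊤) hcW1 hcW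
  obtain ⟨CU, hCU0, hCU⟩ := exists_lintegral_waveRemainder_wavePacket_le hlam w (U.smooth ⊤) hcU1 hcU
  have hVi : Integrable (fun x => (V x : ℂ)) := (integrable_potential hm hV.continuous hhom).ofReal
  obtain ⟨CV, hCV0, hCV⟩ := exists_potential_bound (by linarith) hV.continuous hhom
  have hVb : ∀ x, ‖(V x : ℂ)‖ ≤ CV := by
    intro x
    rw [Complex.norm_real, Real.norm_eq_abs]
    refine (hCV x).trans (mul_le_of_le_one_right hCV0 ?_)
    exact Real.rpow_le_one_of_one_le_of_nonpos (by linarith [norm_nonneg x]) (by linarith)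
  have hbd : ∀ T : 𝓢(E3, ℂ), ∃ D : ℝ, ∀ x, ‖T x‖ ≤ D := by
    intro T
    obtain ⟨D, -, hD⟩ := schwartz_pointwise_bound T 0
    exact ⟨D, fun x => by simpa using hD x⟩
  have hUi : ∀ j : ℕ, Integrable (fun x : E3 => U (((2 : ℝ) ^ j)⁻¹ • x)) := fun j =>
    U.integrable.comp_smul (by positivity)
  set f : ℕ → E3 → ℂ := fun j x => (((dyadicRatio m / 8) ^ j : ℝ) : ℂ) *
    waveRemainder lam (wavePacket lam w U (2 ^ j)) x with hf
  have hpi : ∀ (T : 𝓢(E3, ℂ)) {Y : ℝ}, 0 < Y → Measurable (waveRemainder lam (wavePacket lam w T Y)) := by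
    intro T Y hY
    have hc : Continuous (wavePacket lam w T Y) := (contDiff_wavePacket lam w (T.smooth ⊤) Y).continuous
    refine measurable_waveRemainder lam ?_ hc.measurable
    exact (T.integrable.comp_smul (inv_ne_zero hY.ne')).mul_bdd (c := 1)
      (contDiff_planeWave lam w).continuous.aestronglyMeasurable
      (.of_forall fun y => (norm_planeWave lam w y).le)
  have hnorm : ∀ {F : E3 → ℂ} {b : ℝ}, 0 ≤ b → ∫⁻ x, ‖F x‖ₑ ^ 2 ≤ ENNReal.ofReal (b ^ 2) →
      eLpNorm F 2 volume ≤ ENNReal.ofReal b := by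
    intro F b hb h
    rw [← eLpNorm_two_sq, ENNReal.ofReal_pow hb] at h
    exact (ENNReal.pow_le_pow_left_iff two_ne_zero).1 h
  have hW : MemLp (waveRemainder lam (wavePacket lam w W 1)) 2 := by
    refine ⟨(hpi W one_pos).aestronglyMeasurable, ?_⟩
    refine (hnorm (Real.sqrt_nonneg CW) ?_).trans_lt ENNReal.ofReal_lt_top
    rw [Real.sq_sqrt hCW0]
    simpa using hCW 1 le_rfl
  -- The remainder of the sum is the sum of the remainders.
  have hF : ∀ x, HasSum (fun j => f j x) (waveRemainder lam
      (fun x => ((V x : ℂ) - W x) * planeWave lam w x) x) := by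
    intro x
    obtain ⟨b₁, b₂, h1, h2, ⟨B, h3⟩, h4⟩ := exists_waveRemainder_eq_integral lam w x
    obtain ⟨DU, hDU⟩ := hbd U
    obtain ⟨DW, hDW⟩ := hbd W
    have hs := (hasSum_integral_dyadic_of_integrable hm hsum h1).add (hasSum_integral_dyadic hm hsum h2 h3)
    have hFi : Integrable fun y => (V y : ℂ) - W y := hVi.sub W.integrable
    rw [← h4 _ hFi ⟨CV + DW, fun y => (norm_sub_le _ _).trans
      (add_le_add (hVb y) (hDW y))⟩] at hs
    have e : ∀ j, f j x = (((dyadicRatio m / 8) ^ j : ℝ) : ℂ) *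
        ((∫ y, b₁ y * U (((2 : ℝ) ^ j)⁻¹ • y)) + ∫ y, b₂ y * U (((2 : ℝ) ^ j)⁻¹ • y)) := fun j => by
      rw [← h4 _ (hUi j) ⟨DU, fun y => hDU _⟩]
      rfl
    simp only [e, mul_add]
    exact hs
  -- The `L²` norm of the `j`-th term is at most a multiple of `(q/8)^j (2^j)³ = q^j`.
  have hsumL : MemLp (waveRemainder lam (fun x => ((V x : ℂ) - W x) * planeWave lam w x)) 2 := by
    refine memLp_of_hasSum (f := f) (a := fun j => √CU * dyadicRatio m ^ j) (by norm_num)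
      (fun j => ((hpi U (by positivity)).const_mul _).aestronglyMeasurable) (.of_forall hF)
      (fun j => by positivity)
      ((summable_geometric_of_lt_one hq.le (dyadicRatio_lt_one hm)).mul_left _) fun j => ?_
    refine hnorm (by positivity) ?_
    simp only [hf, enorm_mul, mul_pow]
    rw [lintegral_const_mul' _ _ (by simp), enorm_sq_eq_ofReal, Complex.norm_real,
      Real.norm_of_nonneg (by positivity), Real.sq_sqrt hCU0]
    refine (mul_le_mul_right (hCU (2 ^ j) (one_le_pow₀ (by norm_num))) _).trans (le_of_eq ?_)
    rw [← ENNReal.ofReal_mul (by positivity)]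
    congr 1
    have : ((dyadicRatio m / 8) ^ j) * ((2 : ℝ) ^ j) ^ 3 = dyadicRatio m ^ j := by
      rw [div_pow, ← pow_mul, mul_comm j 3, pow_mul]; norm_num
    rw [← this]; ring
  refine (hW.add hsumL).congr_norm (measurable_waveRemainder lam ?_ ?_).aestronglyMeasurable
    (.of_forall fun x => ?_)
  · exact hVi.mul_bdd (c := 1) (contDiff_planeWave lam w).continuous.aestronglyMeasurable
      (.of_forall fun y => (norm_planeWave lam w y).le)
  · exact ((Complex.continuous_ofReal.comp hV.continuous).mul
      (contDiff_planeWave lam w).continuous).measurable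
  · obtain ⟨b₁, b₂, h1, h2, ⟨B, h3⟩, h4⟩ := exists_waveRemainder_eq_integral lam w x
    obtain ⟨DW, hDW⟩ := hbd W
    have hFi : Integrable fun y => (V y : ℂ) - W y := hVi.sub W.integrable
    have hFb : ∀ y, ‖(V y : ℂ) - W y‖ ≤ CV + DW := fun y =>
      (norm_sub_le _ _).trans (add_le_add (hVb y) (hDW y))
    have i : ∀ {F : E3 → ℂ} {D : ℝ}, Integrable F → (∀ y, ‖F y‖ ≤ D) →
        Integrable (fun y => b₁ y * F y) ∧ Integrable (fun y => b₂ y * F y) := fun hF hD =>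
      ⟨h1.mul_bdd (c := _) hF.1 (.of_forall hD), hF.bdd_mul (c := _) h2 (.of_forall h3)⟩
    have eW : waveRemainder lam (wavePacket lam w W 1) x = (∫ y, b₁ y * W y) + ∫ y, b₂ y * W y := by
      rw [← h4 _ W.integrable ⟨DW, hDW⟩]
      congr 1
      funext y
      rw [wavePacket, inv_one, one_smul]
    rw [Pi.add_apply, eW, h4 _ hFi ⟨_, hFb⟩, h4 _ hVi ⟨_, hVb⟩]
    congr 1
    have e3 : ∀ b : E3 → ℂ, Integrable (fun y => b y * W y) →
        Integrable (fun y => b y * ((V y : ℂ) - W y)) →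
        (∫ y, b y * W y) + ∫ y, b y * ((V y : ℂ) - W y) = ∫ y, b y * (V y : ℂ) := by
      intro b hb1 hb2
      rw [← integral_add hb1 hb2]
      congr 1; funext y; ring
    rw [← e3 b₁ (i W.integrable hDW).1 (i hFi hFb).1, ← e3 b₂ (i W.integrable hDW).2 (i hFi hFb).2]
    ring

/-! ### Fourier multipliers on `L²` and the free resolvent -/

open Classical in
/-- The Fourier multiplier with symbol `p`, on those `G ∈ L²` for which `p Ĝ ∈ L²` (and zero
on the others). The symbol is a function of the frequency in the normalization `e^{-2πi x·ξ}`. -/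
def symbolMultiplier (p : E3 → ℂ) (G : L2R3) : L2R3 :=
  if h : MemLp (fun ξ => p ξ * (𝓕 G : L2R3) ξ) 2 volume then 𝓕⁻ (h.toLp _ : L2R3) else 0

theorem memLp_symbol_mul {p : E3 → ℂ} (hp : Measurable p) {C : ℝ} (hC : ∀ ξ, ‖p ξ‖ ≤ C)
    (f : L2R3) : MemLp (fun ξ => p ξ * f ξ) 2 volume :=
  (Lp.memLp f).of_le_mul (c := C)
    (hp.aestronglyMeasurable.mul (Lp.aestronglyMeasurable f))
    (.of_forall fun ξ => by
      rw [norm_mul]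
      exact mul_le_mul_of_nonneg_right (hC ξ) (norm_nonneg _))

theorem fourier_symbolMultiplier {p : E3 → ℂ} (hp : Measurable p) {C : ℝ} (hC : ∀ ξ, ‖p ξ‖ ≤ C)
    (G : L2R3) :
    ((𝓕 (symbolMultiplier p G) : L2R3) : E3 → ℂ) =ᵐ[volume] fun ξ => p ξ * (𝓕 G : L2R3) ξ := by
  have h := memLp_symbol_mul hp hC (𝓕 G)
  rw [symbolMultiplier, dif_pos h, FourierTransform.fourier_fourierInv_eq]
  exact h.coeFn_toLp

theorem eq_of_fourier_ae_eq {u v : L2R3}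
    (h : ((𝓕 u : L2R3) : E3 → ℂ) =ᵐ[volume] ((𝓕 v : L2R3) : E3 → ℂ)) : u = v :=
  (Lp.fourierTransformₗᵢ E3 ℂ).injective (Lp.ext h)

theorem fourier_add_ae_eq (u v : L2R3) : ((𝓕 (u + v) : L2R3) : E3 → ℂ) =ᵐ[volume]
    fun ξ => (𝓕 u : L2R3) ξ + (𝓕 v : L2R3) ξ := by
  rw [FourierTransform.fourier_add]
  exact Lp.coeFn_add _ _

theorem fourier_smul_ae_eq (c : ℂ) (u : L2R3) : ((𝓕 (c • u) : L2R3) : E3 → ℂ) =ᵐ[volume]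
    fun ξ => c * (𝓕 u : L2R3) ξ := by
  rw [FourierTransform.fourier_smul]
  exact Lp.coeFn_smul _ _

theorem fourier_sub_ae_eq (u v : L2R3) : ((𝓕 (u - v) : L2R3) : E3 → ℂ) =ᵐ[volume]
    fun ξ => (𝓕 u : L2R3) ξ - (𝓕 v : L2R3) ξ := by
  have e : u - v = u + (-1 : ℂ) • v := by simp [sub_eq_add_neg]
  rw [e]
  filter_upwards [fourier_add_ae_eq u ((-1 : ℂ) • v), fourier_smul_ae_eq (-1) v] with ξ h1 h2
  rw [h1, h2]
  ring

theorem tendsto_norm_Lp_of_tendsto_lintegral {ι : Type*} {l : Filter ι} {f : ι → L2R3}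
    (h : Tendsto (fun i => ∫⁻ x, ‖f i x‖ₑ ^ 2) l (𝓝 0)) : Tendsto (fun i => ‖f i‖) l (𝓝 0) := by
  have e : ∀ i, ‖f i‖ = Real.sqrt (∫⁻ x, ‖f i x‖ₑ ^ 2).toReal := fun i => by
    rw [← eLpNorm_two_sq, ENNReal.toReal_pow, Real.sqrt_sq ENNReal.toReal_nonneg, Lp.norm_def]
  simp only [e]
  have h1 := (ENNReal.tendsto_toReal ENNReal.zero_ne_top).comp h
  have h2 := (Real.continuous_sqrt.tendsto _).comp h1
  rw [ENNReal.toReal_zero, Real.sqrt_zero] at h2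
  exact h2

/-- Bounded symbols converging almost everywhere give strongly convergent multipliers. -/
theorem tendsto_symbolMultiplier {p : ℝ → E3 → ℂ} {p₀ : E3 → ℂ} {C : ℝ}
    (hp : ∀ μ, Measurable (p μ)) (hp₀ : Measurable p₀) (hC : ∀ μ, 0 < μ → ∀ ξ, ‖p μ ξ‖ ≤ C)
    (hC₀ : ∀ ξ, ‖p₀ ξ‖ ≤ C)
    (h : ∀ᵐ ξ, Tendsto (fun μ => p μ ξ) (𝓝[>] 0) (𝓝 (p₀ ξ))) (G : L2R3) :
    Tendsto (fun μ => ‖symbolMultiplier (p μ) G - symbolMultiplier p₀ G‖) (𝓝[>] 0) (𝓝 0) := by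
  set f : E3 → ℂ := ((𝓕 G : L2R3) : E3 → ℂ) with hf
  have hfm : Measurable f := (Lp.stronglyMeasurable _).measurable
  have e : ∀ μ, ‖symbolMultiplier (p μ) G - symbolMultiplier p₀ G‖ =
      ‖(𝓕 (symbolMultiplier (p μ) G - symbolMultiplier p₀ G) : L2R3)‖ := fun μ =>
    (Lp.norm_fourier_eq _).symm
  simp only [e]
  refine tendsto_norm_Lp_of_tendsto_lintegral ?_
  have e2 : (fun μ => ∫⁻ ξ, ‖(p μ ξ - p₀ ξ) * f ξ‖ₑ ^ 2) =ᶠ[𝓝[>] 0]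
      fun μ => ∫⁻ ξ, ‖(𝓕 (symbolMultiplier (p μ) G - symbolMultiplier p₀ G) : L2R3) ξ‖ₑ ^ 2 := by
    filter_upwards [self_mem_nhdsWithin] with μ hμ
    refine lintegral_congr_ae ?_
    filter_upwards [fourier_sub_ae_eq (symbolMultiplier (p μ) G) (symbolMultiplier p₀ G),
      fourier_symbolMultiplier (hp μ) (hC μ hμ) G, fourier_symbolMultiplier hp₀ hC₀ G]
      with ξ h1 h2 h3
    rw [h1, h2, h3, sub_mul]
  refine Tendsto.congr' e2 ?_
  have hC0 : 0 ≤ C := (norm_nonneg _).trans (hC₀ 0)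
  have h0 : (0 : ENNReal) = ∫⁻ _ : E3, 0 := by simp
  rw [h0]
  refine tendsto_lintegral_filter_of_dominated_convergence
    (fun ξ => ‖((2 * C : ℝ) : ℂ) * f ξ‖ₑ ^ 2) ?_ ?_ ?_ ?_
  · exact .of_forall fun μ => ((((hp μ).sub hp₀).mul hfm).enorm).pow_const 2
  · filter_upwards [self_mem_nhdsWithin] with μ hμ
    refine .of_forall fun ξ => ?_
    gcongr ?_ ^ 2
    rw [enorm_le_iff_norm_le, norm_mul, norm_mul, Complex.norm_real,
      Real.norm_of_nonneg (by positivity)]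
    refine mul_le_mul_of_nonneg_right ((norm_sub_le _ _).trans ?_) (norm_nonneg _)
    linarith [hC μ hμ ξ, hC₀ ξ]
  · rw [← eLpNorm_two_sq]
    exact ENNReal.pow_ne_top ((Lp.memLp (𝓕 G : L2R3)).const_mul _).2.ne
  · filter_upwards [h] with ξ hξ
    have h1 : Tendsto (fun μ => (p μ ξ - p₀ ξ) * f ξ) (𝓝[>] 0) (𝓝 ((p₀ ξ - p₀ ξ) * f ξ)) :=
      (hξ.sub_const _).mul_const _
    rw [sub_self, zero_mul] at h1
    have h2 := (ENNReal.continuous_pow 2).tendsto _ |>.comp h1.enorm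
    rw [enorm_zero, zero_pow two_ne_zero] at h2
    exact h2

/-- The symbol of `(H₀ - z)⁻¹`. -/
def resolventSymbol (z : ℂ) (ξ : E3) : ℂ := (((2 * Real.pi * ‖ξ‖ : ℝ) : ℂ) - z)⁻¹

theorem measurable_resolventSymbol (z : ℂ) : Measurable (resolventSymbol z) := by
  unfold resolventSymbol
  fun_prop

theorem resolvent_denominator_ne_zero {z : ℂ} (hz : z.im ≠ 0) (r : ℝ) : (r : ℂ) - z ≠ 0 := by
  intro h
  apply hz
  simpa using (congrArg Complex.im h).symm

theorem norm_resolventSymbol_le {z : ℂ} (hz : 0 < z.im) (ξ : E3) :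
    ‖resolventSymbol z ξ‖ ≤ z.im⁻¹ := by
  rw [resolventSymbol, norm_inv]
  refine inv_anti₀ hz ?_
  have := Complex.abs_im_le_norm (((2 * Real.pi * ‖ξ‖ : ℝ) : ℂ) - z)
  simp only [Complex.sub_im, Complex.ofReal_im, zero_sub, abs_neg, abs_of_pos hz] at this
  exact this

/-- The free resolvent exists in the upper half-plane, and is a Fourier multiplier. -/
theorem isFreeResolvent_symbolMultiplier {z : ℂ} (hz : 0 < z.im) (G : L2R3) :
    IsFreeResolvent z G (symbolMultiplier (resolventSymbol z) G) := by
  set u := symbolMultiplier (resolventSymbol z) G with hu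
  filter_upwards [fourier_add_ae_eq G (z • u), fourier_smul_ae_eq z u,
    fourier_symbolMultiplier (measurable_resolventSymbol z) (norm_resolventSymbol_le hz) G]
    with ξ h1 h2 h3
  have h0 := resolvent_denominator_ne_zero hz.ne' (2 * Real.pi * ‖ξ‖)
  rw [h1, h2, ← hu] at *
  rw [h3, resolventSymbol]
  field_simp
  ring

theorem eq_symbolMultiplier_of_isFreeResolvent {z : ℂ} (hz : 0 < z.im) {G u : L2R3}
    (h : IsFreeResolvent z G u) : u = symbolMultiplier (resolventSymbol z) G := by
  refine eq_of_fourier_ae_eq ?_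
  filter_upwards [h, fourier_add_ae_eq G (z • u), fourier_smul_ae_eq z u,
    fourier_symbolMultiplier (measurable_resolventSymbol z) (norm_resolventSymbol_le hz) G]
    with ξ h0 h1 h2 h3
  have hd := resolvent_denominator_ne_zero hz.ne' (2 * Real.pi * ‖ξ‖)
  rw [h1, h2] at h0
  rw [h3, resolventSymbol, eq_inv_mul_iff_mul_eq₀ hd]
  linear_combination -h0

/-- Multiplication of an `L²` function by a function of temperate growth. -/
theorem smulLeftCLM_toTemperedDistribution {p : E3 → ℂ} (hp : p.HasTemperateGrowth) {f h : L2R3}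
    (hh : (h : E3 → ℂ) =ᵐ[volume] fun x => p x * f x) :
    TemperedDistribution.smulLeftCLM ℂ p (Lp.toTemperedDistribution f) =
      Lp.toTemperedDistribution h := by
  ext φ
  rw [TemperedDistribution.smulLeftCLM_apply_apply, Lp.toTemperedDistribution_apply,
    Lp.toTemperedDistribution_apply]
  refine integral_congr_ae ?_
  filter_upwards [hh] with x hx
  rw [hx, SchwartzMap.smulLeftCLM_apply_apply hp]
  simp only [smul_eq_mul]
  ring

theorem fourierMultiplierCLM_toTemperedDistribution {p : E3 → ℂ} (hp : p.HasTemperateGrowth)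
    {f h : L2R3} (hh : ((𝓕 h : L2R3) : E3 → ℂ) =ᵐ[volume] fun ξ => p ξ * (𝓕 f : L2R3) ξ) :
    TemperedDistribution.fourierMultiplierCLM ℂ p (Lp.toTemperedDistribution f) =
      Lp.toTemperedDistribution h := by
  rw [TemperedDistribution.fourierMultiplierCLM_apply, Lp.fourier_toTemperedDistribution_eq,
    smulLeftCLM_toTemperedDistribution hp hh, Lp.fourierInv_toTemperedDistribution_eq,
    FourierTransform.fourierInv_fourier_eq]

/-- Convergence in `L²` implies convergence of the distributions on every test function. -/
theorem tendsto_toTemperedDistribution_apply {ι : Type*} {l : Filter ι} {f : ι → L2R3}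
    {f₀ : L2R3} (h : Tendsto (fun i => ‖f i - f₀‖) l (𝓝 0)) (φ : 𝓢(E3, ℂ)) :
    Tendsto (fun i => (Lp.toTemperedDistribution (f i) : 𝓢'(E3, ℂ)) φ) l
      (𝓝 ((Lp.toTemperedDistribution f₀ : 𝓢'(E3, ℂ)) φ)) := by
  have h1 : Tendsto f l (𝓝 f₀) := tendsto_iff_norm_sub_tendsto_zero.2 h
  have h2 := (PointwiseConvergenceCLM.evalCLM (RingHom.id ℂ) ℂ φ).continuous.comp
    (Lp.toTemperedDistributionCLM ℂ (volume : Measure E3) 2).continuous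
  exact (h2.tendsto f₀).comp h1

/-! ### Weighted estimates for outgoing waves -/

theorem measurable_japaneseWeight (s : ℝ) : Measurable (japaneseWeight s) := by
  unfold japaneseWeight
  fun_prop

theorem japaneseWeight_mul (s t : ℝ) (x : E3) :
    japaneseWeight s x * japaneseWeight t x = japaneseWeight (s + t) x := by
  rw [japaneseWeight, japaneseWeight, japaneseWeight, ← Complex.ofReal_mul,
    ← Real.rpow_add (by positivity), add_div]

theorem norm_japaneseWeight (s : ℝ) (x : E3) :
    ‖japaneseWeight s x‖ = (1 + ‖x‖ ^ 2) ^ (s / 2) := by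
  rw [japaneseWeight, Complex.norm_real, Real.norm_of_nonneg (by positivity)]

theorem norm_japaneseWeight_le_one {s : ℝ} (hs : 0 ≤ s) (x : E3) : ‖japaneseWeight (-s) x‖ ≤ 1 := by
  rw [norm_japaneseWeight]
  exact Real.rpow_le_one_of_one_le_of_nonpos (by nlinarith [norm_nonneg x]) (by linarith)

theorem norm_japaneseWeight_sq_le {s : ℝ} (hs : 0 ≤ s) (x : E3) :
    ‖japaneseWeight (-s) x‖ ^ 2 ≤ 2 ^ s * (1 + ‖x‖) ^ (-(2 * s)) := by
  rw [norm_japaneseWeight, ← Real.rpow_natCast, ← Real.rpow_mul (by positivity)]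
  have h1 : (1 + ‖x‖) ^ 2 / 2 ≤ 1 + ‖x‖ ^ 2 := by nlinarith [sq_nonneg (1 - ‖x‖)]
  have h2 : (1 + ‖x‖ ^ 2) ^ (-s) ≤ ((1 + ‖x‖) ^ 2 / 2) ^ (-s) :=
    Real.rpow_le_rpow_of_nonpos (by positivity) h1 (by linarith)
  have e1 : -s / 2 * ((2 : ℕ) : ℝ) = -s := by push_cast; ring
  rw [e1]
  refine h2.trans (le_of_eq ?_)
  rw [Real.div_rpow (by positivity) (by norm_num), ← Real.rpow_natCast, ← Real.rpow_mul (by positivity),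
    Real.rpow_neg (by norm_num : (0 : ℝ) ≤ 2), div_inv_eq_mul, mul_comm]
  congr 2
  push_cast; ring

/-- The kernel `|x - y|⁻²` is integrable in `x` against the weight `⟨x⟩^{-2s}`, `s > 1/2`,
uniformly in `y`. -/
theorem exists_lintegral_weight_inv_norm_sq_le {s : ℝ} (hs : 1 / 2 < s) : ∃ K : ℝ, ∀ y : E3,
    ∫⁻ x : E3, ‖japaneseWeight (-s) x‖ₑ ^ 2 * ‖((‖x - y‖⁻¹ : ℝ) : ℂ)‖ₑ ^ 2 ≤ ENNReal.ofReal K := by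
  set q : E3 → ℝ := fun x => (Set.Iio 1).indicator (fun r : ℝ => (r ^ 2)⁻¹) ‖x‖ with hq
  set r : E3 → ℝ := fun x => 2 ^ s * 4 * (1 + ‖x‖) ^ (-(2 * s + 2)) with hr
  have hqi : Integrable q := integrable_indicator_inv_norm_pow le_rfl 1
  have hri : Integrable r := (integrable_one_add_norm (by simp; linarith)).const_mul _
  have hq0 : ∀ x, 0 ≤ q x := fun x => Set.indicator_nonneg (fun r _ => by positivity) _
  have hr0 : ∀ x, 0 ≤ r x := fun x => by positivity
  refine ⟨(∫ x, q x) + (∫ x, r x) + ∫ x, r x, fun y => ?_⟩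
  have hqy : Integrable fun x => q (x - y) := hqi.comp_sub_right y
  have hry : Integrable fun x => r (x - y) := hri.comp_sub_right y
  have hpt : ∀ x, ‖japaneseWeight (-s) x‖ ^ 2 * ‖x - y‖⁻¹ ^ 2 ≤ q (x - y) + r (x - y) + r x := by
    intro x
    -- Close to `y` the singularity is integrable and the weight is bounded; elsewhere both
    -- factors decay.
    by_cases h : ‖x - y‖ < 1
    · have e : q (x - y) = ‖x - y‖⁻¹ ^ 2 := by
        rw [hq]
        simp only
        rw [Set.indicator_of_mem (by exact h), inv_pow]
      have h1 : ‖japaneseWeight (-s) x‖ ^ 2 ≤ 1 :=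
        pow_le_one₀ (norm_nonneg _) (norm_japaneseWeight_le_one (by linarith) x)
      have h2 := mul_le_mul_of_nonneg_right h1 (sq_nonneg ‖x - y‖⁻¹)
      rw [one_mul] at h2
      linarith [hr0 x, hr0 (x - y)]
    · rw [not_lt] at h
      have h1 := norm_japaneseWeight_sq_le (by linarith : 0 ≤ s) x
      have h2 : ‖x - y‖⁻¹ ^ 2 ≤ 4 * (1 + ‖x - y‖) ^ (-2 : ℝ) := by
        rw [Real.rpow_neg (by positivity), Real.rpow_two, inv_pow, ← div_eq_mul_inv,
          inv_le_comm₀ (by positivity) (by positivity), inv_div, div_le_iff₀ (by norm_num)]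
        nlinarith
      have h3 := mul_le_mul h1 h2 (by positivity) (by positivity)
      -- The product of the two decays is at most the total decay in the smaller of the two
      -- distances.
      have h4 : (1 + ‖x‖) ^ (-(2 * s)) * (1 + ‖x - y‖) ^ (-2 : ℝ) ≤
          (1 + ‖x - y‖) ^ (-(2 * s + 2)) + (1 + ‖x‖) ^ (-(2 * s + 2)) := by
        rcases le_total ‖x‖ ‖x - y‖ with h5 | h5
        · have : (1 + ‖x - y‖) ^ (-2 : ℝ) ≤ (1 + ‖x‖) ^ (-2 : ℝ) :=
            Real.rpow_le_rpow_of_nonpos (by positivity) (by linarith) (by norm_num)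
          calc _ ≤ (1 + ‖x‖) ^ (-(2 * s)) * (1 + ‖x‖) ^ (-2 : ℝ) := by gcongr
            _ = (1 + ‖x‖) ^ (-(2 * s + 2)) := by
              rw [← Real.rpow_add (by positivity)]; congr 1; ring
            _ ≤ _ := le_add_of_nonneg_left (by positivity)
        · have : (1 + ‖x‖) ^ (-(2 * s)) ≤ (1 + ‖x - y‖) ^ (-(2 * s)) :=
            Real.rpow_le_rpow_of_nonpos (by positivity) (by linarith) (by linarith)
          calc _ ≤ (1 + ‖x - y‖) ^ (-(2 * s)) * (1 + ‖x - y‖) ^ (-2 : ℝ) := by gcongr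
            _ = (1 + ‖x - y‖) ^ (-(2 * s + 2)) := by
              rw [← Real.rpow_add (by positivity)]; congr 1; ring
            _ ≤ _ := le_add_of_nonneg_right (by positivity)
      have h6 := mul_le_mul_of_nonneg_left h4 (by positivity : (0 : ℝ) ≤ 2 ^ s * 4)
      have h7 := hq0 (x - y)
      simp only [hr]
      linarith
  have e : ∀ x, ‖japaneseWeight (-s) x‖ₑ ^ 2 * ‖((‖x - y‖⁻¹ : ℝ) : ℂ)‖ₑ ^ 2 =
      ENNReal.ofReal (‖japaneseWeight (-s) x‖ ^ 2 * ‖x - y‖⁻¹ ^ 2) := by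
    intro x
    rw [enorm_sq_eq_ofReal, enorm_sq_eq_ofReal, ← ENNReal.ofReal_mul (by positivity),
      Complex.norm_real, Real.norm_of_nonneg (by positivity)]
  simp only [e]
  calc _ ≤ ∫⁻ x, ENNReal.ofReal (q (x - y) + r (x - y) + r x) :=
        lintegral_mono fun x => ENNReal.ofReal_le_ofReal (hpt x)
    _ = ENNReal.ofReal (∫ x, (q (x - y) + r (x - y) + r x)) :=
        (ofReal_integral_eq_lintegral_ofReal ((hqy.add hry).add hri)
          (.of_forall fun x => add_nonneg (add_nonneg (hq0 _) (hr0 _)) (hr0 _))).symm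
    _ = _ := by
        have i1 : Integrable fun x => q (x - y) + r (x - y) := hqy.add hry
        rw [integral_add i1 hri, integral_add hqy hry, integral_sub_right_eq_self q,
          integral_sub_right_eq_self r]

/-- The weighted mean square of `k * g` is controlled by that of `|k|² * |g|`. -/
theorem lintegral_weight_kernelConv_sq_le {W k g : E3 → ℂ} (hW : Measurable W) (hk : Measurable k)
    (hg : Measurable g) :
    ∫⁻ x, ‖W x * kernelConv k g x‖ₑ ^ 2 ≤ (∫⁻ y, ‖g y‖ₑ) *
      ∫⁻ p : E3 × E3, ‖W p.1‖ₑ ^ 2 * ‖k (p.1 - p.2)‖ₑ ^ 2 * ‖g p.2‖ₑ := by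
  have hmeas : Measurable fun p : E3 × E3 => ‖W p.1‖ₑ ^ 2 * ‖k (p.1 - p.2)‖ₑ ^ 2 * ‖g p.2‖ₑ := by
    fun_prop
  have hgh : ∀ y, ‖g y‖ₑ ^ (1 / 2 : ℝ) * ‖g y‖ₑ ^ (1 / 2 : ℝ) = ‖g y‖ₑ := fun y => by
    rw [← ENNReal.rpow_add_of_nonneg _ _ (by norm_num) (by norm_num)]
    norm_num
  rw [Measure.volume_eq_prod, lintegral_prod _ hmeas.aemeasurable, ← lintegral_const_mul _
    hmeas.lintegral_prod_right']
  refine lintegral_mono fun x => ?_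
  -- Cauchy-Schwarz with respect to the measure `|g| dy`.
  have h1 : ‖kernelConv k g x‖ₑ ≤ ∫⁻ y, (‖k (x - y)‖ₑ * ‖g y‖ₑ ^ (1 / 2 : ℝ)) * ‖g y‖ₑ ^ (1 / 2 : ℝ) := by
    refine (enorm_integral_le_lintegral_enorm _).trans (le_of_eq ?_)
    refine lintegral_congr fun y => ?_
    rw [enorm_mul, mul_assoc, hgh]
  have h2 := sq_lintegral_mul_le (μ := (volume : Measure E3))
    (f := fun y => ‖k (x - y)‖ₑ * ‖g y‖ₑ ^ (1 / 2 : ℝ)) (g := fun y => ‖g y‖ₑ ^ (1 / 2 : ℝ))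
    (by fun_prop) (by fun_prop)
  have e1 : ∀ y, (‖k (x - y)‖ₑ * ‖g y‖ₑ ^ (1 / 2 : ℝ)) ^ 2 = ‖k (x - y)‖ₑ ^ 2 * ‖g y‖ₑ := fun y => by
    rw [mul_pow, sq (‖g y‖ₑ ^ (1 / 2 : ℝ)), hgh]
  have e2 : ∀ y, (‖g y‖ₑ ^ (1 / 2 : ℝ)) ^ 2 = ‖g y‖ₑ := fun y => by rw [sq, hgh]
  simp only [e1, e2] at h2
  have e3 : ∫⁻ y, ‖W x‖ₑ ^ 2 * ‖k (x - y)‖ₑ ^ 2 * ‖g y‖ₑ =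
      ‖W x‖ₑ ^ 2 * ∫⁻ y, ‖k (x - y)‖ₑ ^ 2 * ‖g y‖ₑ := by
    rw [← lintegral_const_mul _ (by fun_prop)]
    simp only [mul_assoc]
  simp only
  rw [e3, enorm_mul, mul_pow]
  calc _ ≤ ‖W x‖ₑ ^ 2 * ((∫⁻ y, ‖k (x - y)‖ₑ ^ 2 * ‖g y‖ₑ) * ∫⁻ y, ‖g y‖ₑ) := by
        gcongr
        exact (pow_le_pow_left₀ zero_le h1 2).trans h2
    _ = _ := by ring

/-- The majorant in the dominated convergence of weighted mean squares of waves. -/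
theorem lintegral_weight_inv_norm_sq_lt_top {s : ℝ} (hs : 1 / 2 < s) {g : E3 → ℂ}
    (hg : Measurable g) (hgi : Integrable g) :
    ∫⁻ p : E3 × E3, ‖japaneseWeight (-s) p.1‖ₑ ^ 2 * ‖((‖p.1 - p.2‖⁻¹ : ℝ) : ℂ)‖ₑ ^ 2 * ‖g p.2‖ₑ
      < ⊤ := by
  obtain ⟨K, hK⟩ := exists_lintegral_weight_inv_norm_sq_le hs
  have hW := measurable_japaneseWeight (-s)
  have hmeas : Measurable fun p : E3 × E3 =>
      ‖japaneseWeight (-s) p.1‖ₑ ^ 2 * ‖((‖p.1 - p.2‖⁻¹ : ℝ) : ℂ)‖ₑ ^ 2 * ‖g p.2‖ₑ := by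
    fun_prop
  rw [Measure.volume_eq_prod, lintegral_prod_symm _ hmeas.aemeasurable]
  calc _ ≤ ∫⁻ y, ENNReal.ofReal K * ‖g y‖ₑ := by
        refine lintegral_mono fun y => ?_
        simp only
        rw [lintegral_mul_const _ (by fun_prop)]
        gcongr
        exact hK y
    _ < ⊤ := by
        rw [lintegral_const_mul _ hg.enorm]
        exact ENNReal.mul_lt_top ENNReal.ofReal_lt_top hgi.2

/-- Outgoing waves are in the weighted space of every weight `⟨x⟩^{-s}`, `s > 1/2`. -/
theorem memLp_weight_kernelConv {s : ℝ} (hs : 1 / 2 < s) {k g : E3 → ℂ} (hk : Measurable k) {C : ℝ}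
    (hC : ∀ x, ‖k x‖ ≤ C * ‖x‖⁻¹) (hg : Measurable g) (hgi : Integrable g) :
    MemLp (fun x => japaneseWeight (-s) x * kernelConv k g x) 2 := by
  have hW := measurable_japaneseWeight (-s)
  refine ⟨(hW.mul (measurable_kernelConv hk hg)).aestronglyMeasurable, ?_⟩
  refine (ENNReal.pow_lt_top_iff.1 (?_ : _ ^ 2 < ⊤)).resolve_right two_ne_zero
  rw [eLpNorm_two_sq]
  refine (lintegral_weight_kernelConv_sq_le hW hk hg).trans_lt (ENNReal.mul_lt_top hgi.2 ?_)
  have h := lintegral_weight_inv_norm_sq_lt_top hs hg hgi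
  calc _ ≤ ∫⁻ p : E3 × E3, ENNReal.ofReal C ^ 2 * (‖japaneseWeight (-s) p.1‖ₑ ^ 2 *
          ‖((‖p.1 - p.2‖⁻¹ : ℝ) : ℂ)‖ₑ ^ 2 * ‖g p.2‖ₑ) := by
        refine lintegral_mono fun p => ?_
        have : ‖k (p.1 - p.2)‖ₑ ≤ ENNReal.ofReal C * ‖((‖p.1 - p.2‖⁻¹ : ℝ) : ℂ)‖ₑ := by
          rw [← ofReal_norm, ← ofReal_norm, Complex.norm_real, Real.norm_of_nonneg (by positivity),
            ← ENNReal.ofReal_mul' (by positivity)]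
          exact ENNReal.ofReal_le_ofReal (hC _)
        calc _ ≤ ‖japaneseWeight (-s) p.1‖ₑ ^ 2 *
              (ENNReal.ofReal C * ‖((‖p.1 - p.2‖⁻¹ : ℝ) : ℂ)‖ₑ) ^ 2 * ‖g p.2‖ₑ := by gcongr
          _ = _ := by ring
    _ < ⊤ := by
        rw [lintegral_const_mul' _ _ (by finiteness)]
        exact ENNReal.mul_lt_top (by finiteness) h

/-- Convergence of outgoing waves in the weighted spaces, from pointwise convergence of the
kernels. -/
theorem tendsto_lintegral_weight_kernelConv {s : ℝ} (hs : 1 / 2 < s) {k : ℝ → E3 → ℂ} {g : E3 → ℂ}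
    (hk : ∀ μ, Measurable (k μ)) {C : ℝ} (hC : ∀ᶠ μ in 𝓝[>] 0, ∀ x, ‖k μ x‖ ≤ C * ‖x‖⁻¹)
    (hlim : ∀ x, Tendsto (fun μ => k μ x) (𝓝[>] 0) (𝓝 0)) (hg : Measurable g) (hgi : Integrable g) :
    Tendsto (fun μ => ∫⁻ x, ‖japaneseWeight (-s) x * kernelConv (k μ) g x‖ₑ ^ 2) (𝓝[>] 0) (𝓝 0) := by
  have hW := measurable_japaneseWeight (-s)
  have hfin := lintegral_weight_inv_norm_sq_lt_top hs hg hgi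
  have hmain : Tendsto (fun μ => ∫⁻ p : E3 × E3,
      ‖japaneseWeight (-s) p.1‖ₑ ^ 2 * ‖k μ (p.1 - p.2)‖ₑ ^ 2 * ‖g p.2‖ₑ) (𝓝[>] 0)
      (𝓝 (∫⁻ _ : E3 × E3, 0)) := by
    refine tendsto_lintegral_filter_of_dominated_convergence
      (fun p : E3 × E3 => ENNReal.ofReal C ^ 2 * (‖japaneseWeight (-s) p.1‖ₑ ^ 2 *
          ‖((‖p.1 - p.2‖⁻¹ : ℝ) : ℂ)‖ₑ ^ 2 * ‖g p.2‖ₑ)) ?_ ?_ ?_ ?_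
    · refine .of_forall fun μ => ?_
      have := hk μ
      fun_prop
    · filter_upwards [hC] with μ hμ
      refine .of_forall fun p => ?_
      have : ‖k μ (p.1 - p.2)‖ₑ ≤ ENNReal.ofReal C * ‖((‖p.1 - p.2‖⁻¹ : ℝ) : ℂ)‖ₑ := by
        rw [← ofReal_norm, ← ofReal_norm, Complex.norm_real, Real.norm_of_nonneg (by positivity),
          ← ENNReal.ofReal_mul' (by positivity)]
        exact ENNReal.ofReal_le_ofReal (hμ _)
      calc _ ≤ ‖japaneseWeight (-s) p.1‖ₑ ^ 2 *
            (ENNReal.ofReal C * ‖((‖p.1 - p.2‖⁻¹ : ℝ) : ℂ)‖ₑ) ^ 2 * ‖g p.2‖ₑ := by gcongr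
        _ = _ := by ring
    · rw [lintegral_const_mul' _ _ (by finiteness)]
      exact (ENNReal.mul_lt_top (by finiteness) hfin).ne
    · refine .of_forall fun p => ?_
      have h1 := (ENNReal.continuous_pow 2).tendsto _ |>.comp (hlim (p.1 - p.2)).enorm
      rw [enorm_zero, zero_pow two_ne_zero] at h1
      have h2 := ENNReal.Tendsto.const_mul (a := ‖japaneseWeight (-s) p.1‖ₑ ^ 2) h1
        (.inr (by finiteness))
      have h3 := ENNReal.Tendsto.mul_const (b := ‖g p.2‖ₑ) h2 (.inr (by finiteness))
      rw [mul_zero, zero_mul] at h3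
      exact h3
  rw [lintegral_zero] at hmain
  have h1 := ENNReal.Tendsto.const_mul (a := ∫⁻ y, ‖g y‖ₑ) hmain (.inr hgi.2.ne)
  rw [mul_zero] at h1
  exact tendsto_of_tendsto_of_tendsto_of_le_of_le tendsto_const_nhds h1 (fun _ => zero_le)
    fun μ => lintegral_weight_kernelConv_sq_le hW (hk μ) hg

/-! ### The resolvent near the real axis -/

theorem norm_resolventSymbol_neg_le {z : ℂ} (hz : 0 < z.re) (ξ : E3) :
    ‖resolventSymbol (-z) ξ‖ ≤ z.re⁻¹ := by
  rw [resolventSymbol, norm_inv, sub_neg_eq_add]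
  refine inv_anti₀ hz ?_
  have h := Complex.re_le_norm (((2 * Real.pi * ‖ξ‖ : ℝ) : ℂ) + z)
  simp only [Complex.add_re, Complex.ofReal_re] at h
  have : 0 ≤ 2 * Real.pi * ‖ξ‖ := by positivity
  linarith

/-- The resolvent of `(-Δ)^{1/2}` is `z/2π` times the convolution with the spherical wave of
frequency `z` (the resolvent of `-Δ` at `z²`), plus the resolvent at `-z`. -/
theorem symbolMultiplier_resolventSymbol_ae_eq {z : ℂ} (hz : 0 < z.im) (hz' : 0 < z.re) {g : E3 → ℂ}
    (hg : Integrable g) {B : ℝ} (hB : ∀ x, ‖g x‖ ≤ B) (hg2 : MemLp g 2) :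
    (symbolMultiplier (resolventSymbol z) (hg2.toLp g) : E3 → ℂ) =ᵐ[volume] fun x =>
      z / (2 * Real.pi) * kernelConv (sphericalKernel z) g x +
        symbolMultiplier (resolventSymbol (-z)) (hg2.toLp g) x := by
  have hk := integrable_sphericalKernel hz
  have hv := memLp_kernelConv hk hg hB
  set v : L2R3 := hv.toLp _ with hvdef
  set G : L2R3 := hg2.toLp g with hG
  set q := symbolMultiplier (resolventSymbol (-z)) G with hq
  have key : symbolMultiplier (resolventSymbol z) G = (z / (2 * Real.pi)) • v + q := by
    refine eq_of_fourier_ae_eq ?_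
    filter_upwards [fourier_add_ae_eq ((z / (2 * Real.pi)) • v) q,
      fourier_smul_ae_eq (z / (2 * Real.pi)) v,
      fourier_symbolMultiplier (measurable_resolventSymbol z) (norm_resolventSymbol_le hz) G,
      fourier_symbolMultiplier (measurable_resolventSymbol (-z)) (norm_resolventSymbol_neg_le hz') G,
      fourier_toLp_ae_eq (integrable_kernelConv hk hg) hv, fourier_toLp_ae_eq hg hg2]
      with ξ h1 h2 h3 h4 h5 h6
    have hd := resolvent_denominator_ne_zero hz.ne' (2 * Real.pi * ‖ξ‖)
    have hd' := resolvent_denominator_ne_zero (z := -z) (by simpa using hz.ne') (2 * Real.pi * ‖ξ‖)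
    rw [sub_neg_eq_add] at hd'
    rw [h1, h2, h3, hq, h4, hvdef, h5, fourier_kernelConv hk hg, fourier_sphericalKernel hz, hG, h6,
      resolventSymbol, resolventSymbol, sub_neg_eq_add]
    generalize ((2 * Real.pi * ‖ξ‖ : ℝ) : ℂ) = ρ at hd hd' ⊢
    have e : ρ ^ 2 - z ^ 2 = (ρ - z) * (ρ + z) := by ring
    have hpi : (Real.pi : ℂ) ≠ 0 := by exact_mod_cast Real.pi_ne_zero
    rw [e]
    field_simp
    ring
  rw [key]
  filter_upwards [Lp.coeFn_add ((z / (2 * Real.pi)) • v) q, Lp.coeFn_smul (z / (2 * Real.pi)) v,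
    hv.coeFn_toLp] with x h1 h2 h3
  rw [h1, Pi.add_apply, h2, Pi.smul_apply, h3, smul_eq_mul]

theorem abs_sqrt_one_add_sq_sub_le (a b : ℝ) :
    |(1 + a ^ 2) ^ (1 / 2 : ℝ) - (1 + b ^ 2) ^ (1 / 2 : ℝ)| ≤ |a - b| := by
  rw [← Real.sqrt_eq_rpow, ← Real.sqrt_eq_rpow, ← sq_le_sq]
  have h1 := Real.sq_sqrt (by positivity : 0 ≤ 1 + a ^ 2)
  have h2 := Real.sq_sqrt (by positivity : 0 ≤ 1 + b ^ 2)
  have h3 : 1 + a * b ≤ √(1 + a ^ 2) * √(1 + b ^ 2) := by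
    rw [← Real.sqrt_mul (by positivity)]
    exact Real.le_sqrt_of_sq_le (by nlinarith [sq_nonneg (a - b)])
  nlinarith

/-- The symbol of `(⟨D⟩ - ⟨λ⟩) (H₀ - z)⁻¹`, which stays bounded as `z → λ`. -/
def regularizedSymbol (lam : ℝ) (z : ℂ) (ξ : E3) : ℂ :=
  (japaneseSymbol 1 ξ - (((1 + lam ^ 2) ^ (1 / 2 : ℝ) : ℝ) : ℂ)) * resolventSymbol z ξ

theorem measurable_regularizedSymbol (lam : ℝ) (z : ℂ) : Measurable (regularizedSymbol lam z) := by
  have := measurable_resolventSymbol z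
  unfold regularizedSymbol japaneseSymbol
  fun_prop

/-- This is `|⟨ρ⟩ - ⟨λ⟩| ≤ |ρ - λ| ≤ |ρ - z|` for `Re z = λ`. -/
theorem norm_regularizedSymbol_le {lam : ℝ} {z : ℂ} (hz : z.re = lam) (ξ : E3) :
    ‖regularizedSymbol lam z ξ‖ ≤ 1 := by
  have hn : ‖(2 * Real.pi) • ξ‖ = 2 * Real.pi * ‖ξ‖ := by
    rw [norm_smul, Real.norm_of_nonneg (by positivity)]
  rw [regularizedSymbol, japaneseSymbol, hn, resolventSymbol, norm_mul, norm_inv,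
    ← Complex.ofReal_sub, Complex.norm_real, Real.norm_eq_abs]
  refine mul_inv_le_one_of_le₀ ((abs_sqrt_one_add_sq_sub_le _ _).trans ?_) (norm_nonneg _)
  have := Complex.abs_re_le_norm (((2 * Real.pi * ‖ξ‖ : ℝ) : ℂ) - z)
  rwa [Complex.sub_re, Complex.ofReal_re, hz] at this

theorem tendsto_add_mul_I (lam : ℝ) :
    Tendsto (fun μ : ℝ => (lam : ℂ) + (μ : ℂ) * Complex.I) (𝓝[>] 0) (𝓝 (lam : ℂ)) := by
  have h : Continuous fun μ : ℝ => (lam : ℂ) + (μ : ℂ) * Complex.I := by fun_prop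
  have h1 := (h.tendsto 0).mono_left (nhdsWithin_le_nhds (s := Set.Ioi 0))
  simpa using h1

theorem ae_tendsto_regularizedSymbol {lam : ℝ} : ∀ᵐ ξ : E3,
    Tendsto (fun μ : ℝ => regularizedSymbol lam ((lam : ℂ) + (μ : ℂ) * Complex.I) ξ) (𝓝[>] 0)
      (𝓝 (regularizedSymbol lam lam ξ)) := by
  -- The limit fails only on the sphere `2π|ξ| = λ`, where the value of the symbol at `z = λ` is a
  -- junk value.
  have h0 : volume (Metric.sphere (0 : E3) (lam / (2 * Real.pi))) = 0 :=
    Measure.addHaar_sphere _ _ _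
  filter_upwards [measure_eq_zero_iff_ae_notMem.1 h0] with ξ hξ
  have hd : ((2 * Real.pi * ‖ξ‖ : ℝ) : ℂ) - lam ≠ 0 := by
    rw [← Complex.ofReal_sub, Complex.ofReal_ne_zero]
    intro h
    apply hξ
    rw [mem_sphere_zero_iff_norm, eq_div_iff (by positivity)]
    linarith
  exact (((tendsto_add_mul_I lam).const_sub _).inv₀ hd).const_mul _

theorem ae_tendsto_resolventSymbol_neg {lam : ℝ} (hlam : 0 < lam) : ∀ᵐ ξ : E3,
    Tendsto (fun μ : ℝ => resolventSymbol (-((lam : ℂ) + (μ : ℂ) * Complex.I)) ξ) (𝓝[>] 0)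
      (𝓝 (resolventSymbol (-lam) ξ)) := by
  refine .of_forall fun ξ => ?_
  refine ((tendsto_add_mul_I lam).neg.const_sub _).inv₀ ?_
  rw [sub_neg_eq_add, ← Complex.ofReal_add, Complex.ofReal_ne_zero]
  positivity

/-- `⟨D⟩ R₀(z) G = ⟨λ⟩ R₀(z) G + (⟨D⟩ - ⟨λ⟩) R₀(z) G`, where the second term is regular. -/
theorem fourierMultiplierCLM_resolvent {lam : ℝ} {z : ℂ} (hz : 0 < z.im) (hre : z.re = lam) (G : L2R3) :
    TemperedDistribution.fourierMultiplierCLM ℂ (japaneseSymbol 1)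
        (Lp.toTemperedDistribution (symbolMultiplier (resolventSymbol z) G)) =
      (((1 + lam ^ 2) ^ (1 / 2 : ℝ) : ℝ) : ℂ) •
        Lp.toTemperedDistribution (symbolMultiplier (resolventSymbol z) G) +
      Lp.toTemperedDistribution (symbolMultiplier (regularizedSymbol lam z) G) := by
  set c : ℂ := (((1 + lam ^ 2) ^ (1 / 2 : ℝ) : ℝ) : ℂ) with hc
  set u := symbolMultiplier (resolventSymbol z) G with hu
  set P := symbolMultiplier (regularizedSymbol lam z) G with hP
  have h : TemperedDistribution.fourierMultiplierCLM ℂ (japaneseSymbol 1)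
      (Lp.toTemperedDistribution u) = Lp.toTemperedDistribution (c • u + P) := by
    refine fourierMultiplierCLM_toTemperedDistribution (japaneseSymbol_hasTemperateGrowth 1) ?_
    filter_upwards [fourier_add_ae_eq (c • u) P, fourier_smul_ae_eq c u,
      fourier_symbolMultiplier (measurable_resolventSymbol z) (norm_resolventSymbol_le hz) G,
      fourier_symbolMultiplier (measurable_regularizedSymbol lam z) (norm_regularizedSymbol_le hre) G]
      with ξ h1 h2 h3 h4
    rw [h1, h2, hu, h3, hP, h4, regularizedSymbol]
    ring
  rw [h]
  have := (Lp.toTemperedDistributionCLM ℂ (volume : Measure E3) 2).map_add (c • u) P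
  rw [map_smul] at this
  exact this

/-- Multiplication by `⟨x⟩^{-s}` on `L²`. -/
def weightMul (s : ℝ) (hs : 0 ≤ s) (f : L2R3) : L2R3 :=
  (memLp_symbol_mul (measurable_japaneseWeight (-s)) (norm_japaneseWeight_le_one hs) f).toLp _

theorem coeFn_weightMul {s : ℝ} (hs : 0 ≤ s) (f : L2R3) :
    (weightMul s hs f : E3 → ℂ) =ᵐ[volume] fun x => japaneseWeight (-s) x * f x :=
  MemLp.coeFn_toLp _

theorem norm_weightMul_le {s : ℝ} (hs : 0 ≤ s) (f : L2R3) : ‖weightMul s hs f‖ ≤ ‖f‖ := by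
  refine Lp.norm_le_norm_of_ae_le ?_
  filter_upwards [coeFn_weightMul hs f] with x hx
  rw [hx, norm_mul]
  exact mul_le_of_le_one_left (norm_nonneg _) (norm_japaneseWeight_le_one hs x)

theorem smulLeftCLM_weightMul {s : ℝ} (hs : 0 ≤ s) (f : L2R3) :
    TemperedDistribution.smulLeftCLM ℂ (japaneseWeight (-s)) (Lp.toTemperedDistribution f) =
      Lp.toTemperedDistribution (weightMul s hs f) :=
  smulLeftCLM_toTemperedDistribution (japaneseWeight_hasTemperateGrowth _) (coeFn_weightMul hs f)

theorem isRepresentedBy_toTemperedDistribution (f : L2R3) :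
    IsRepresentedBy (Lp.toTemperedDistribution f) f := fun φ =>
  ⟨(φ.memLp 2).integrable_mul (Lp.memLp f), by
    rw [Lp.toTemperedDistribution_apply]; rfl⟩

theorem IsRepresentedBy.sub {T S : 𝓢'(E3, ℂ)} {F H : E3 → ℂ} (hT : IsRepresentedBy T F)
    (hS : IsRepresentedBy S H) : IsRepresentedBy (T - S) fun x => F x - H x := fun φ => by
  have e : (fun x => φ x * (F x - H x)) = fun x => φ x * F x - φ x * H x := by
    funext x; ring
  rw [e]
  refine ⟨(hT φ).1.sub (hS φ).1, ?_⟩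
  rw [integral_sub (hT φ).1 (hS φ).1, ← (hT φ).2, ← (hS φ).2]
  rfl

theorem IsRepresentedBy.congr {T : 𝓢'(E3, ℂ)} {F H : E3 → ℂ} (hT : IsRepresentedBy T F)
    (h : F =ᵐ[volume] H) : IsRepresentedBy T H := fun φ => by
  have e : (fun x => φ x * F x) =ᵐ[volume] fun x => φ x * H x := by
    filter_upwards [h] with x hx
    rw [hx]
  exact ⟨(hT φ).1.congr e, (hT φ).2.trans (integral_congr_ae e)⟩

/-- Multiplying a distribution given by a function with a weight that makes it square integrable. -/
theorem IsRepresentedBy.smulLeftCLM_eq {T : 𝓢'(E3, ℂ)} {F : E3 → ℂ} (hT : IsRepresentedBy T F)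
    {p : E3 → ℂ} (hp : p.HasTemperateGrowth) (h : MemLp (fun x => p x * F x) 2) :
    TemperedDistribution.smulLeftCLM ℂ p T = Lp.toTemperedDistribution (h.toLp _) := by
  ext φ
  rw [TemperedDistribution.smulLeftCLM_apply_apply, (hT _).2, Lp.toTemperedDistribution_apply]
  refine integral_congr_ae ?_
  filter_upwards [h.coeFn_toLp] with x hx
  rw [hx, SchwartzMap.smulLeftCLM_apply_apply hp]
  simp only [smul_eq_mul]
  ring

/-- A function which is square integrable against the weight `⟨x⟩⁻¹` is a tempered distribution. -/
theorem exists_isRepresentedBy_of_weight {F : E3 → ℂ}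
    (h : MemLp (fun x => japaneseWeight (-1) x * F x) 2) :
    ∃ T : 𝓢'(E3, ℂ), IsRepresentedBy T F := by
  refine ⟨TemperedDistribution.smulLeftCLM ℂ (japaneseWeight 1)
    (Lp.toTemperedDistribution (h.toLp _)), fun φ => ?_⟩
  have hw := japaneseWeight_hasTemperateGrowth 1
  set ψ : 𝓢(E3, ℂ) := SchwartzMap.smulLeftCLM ℂ (japaneseWeight 1) φ with hψ
  have e : (fun x => ψ x * (h.toLp _) x) =ᵐ[volume] fun x => φ x * F x := by
    filter_upwards [h.coeFn_toLp] with x hx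
    have h1 := japaneseWeight_mul 1 (-1) x
    have h2 : japaneseWeight 0 x = 1 := by simp [japaneseWeight]
    rw [add_neg_cancel, h2] at h1
    rw [hx, hψ, SchwartzMap.smulLeftCLM_apply_apply hw, smul_eq_mul]
    linear_combination (φ x * F x) * h1
  refine ⟨((ψ.memLp 2).integrable_mul (Lp.memLp (h.toLp _))).congr e, ?_⟩
  rw [TemperedDistribution.smulLeftCLM_apply_apply, Lp.toTemperedDistribution_apply]
  exact integral_congr_ae e

/-! ### The limiting absorption principle -/

/-- The difference of the convolution kernels of `R₀(λ + iμ)` and `R₀(λ + i0)`, up to terms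
which are regular at `μ = 0`. -/
def kernelDifference (lam μ : ℝ) (x : E3) : ℂ :=
  ((lam : ℂ) + (μ : ℂ) * Complex.I) / (2 * Real.pi) *
      sphericalKernel ((lam : ℂ) + (μ : ℂ) * Complex.I) x -
    (lam : ℂ) / (2 * Real.pi) * sphericalKernel lam x

theorem measurable_kernelDifference (lam μ : ℝ) : Measurable (kernelDifference lam μ) :=
  ((measurable_sphericalKernel _).const_mul _).sub ((measurable_sphericalKernel _).const_mul _)

theorem norm_sphericalKernel_le {z : ℂ} (hz : 0 ≤ z.im) (x : E3) : ‖sphericalKernel z x‖ ≤ ‖x‖⁻¹ := by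
  rw [norm_sphericalKernel, div_eq_mul_inv]
  refine mul_le_of_le_one_left (by positivity) (Real.exp_le_one_iff.2 ?_)
  have := mul_nonneg hz (norm_nonneg x)
  linarith

theorem norm_kernelDifference_le {lam μ : ℝ} (hlam : 0 < lam) (hμ : 0 < μ) (x : E3) :
    ‖kernelDifference lam μ x‖ ≤ (2 * lam + μ) * ‖x‖⁻¹ := by
  have hz : ‖(lam : ℂ) + (μ : ℂ) * Complex.I‖ ≤ lam + μ := by
    refine (norm_add_le _ _).trans ?_
    rw [norm_mul, Complex.norm_I, mul_one, Complex.norm_real, Complex.norm_real,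
      Real.norm_of_nonneg hlam.le, Real.norm_of_nonneg hμ.le]
  have hpi : ‖(2 * Real.pi : ℂ)‖ = 2 * Real.pi := by
    rw [norm_mul, Complex.norm_ofNat, Complex.norm_real, Real.norm_of_nonneg Real.pi_pos.le]
  have hdiv : ∀ a : ℂ, ‖a / (2 * Real.pi)‖ ≤ ‖a‖ := fun a => by
    rw [norm_div, hpi]
    exact div_le_self (norm_nonneg _) (by linarith [Real.pi_gt_three])
  have h1 := norm_sphericalKernel_le (z := (lam : ℂ) + (μ : ℂ) * Complex.I) (by simpa using hμ.le) x
  have h2 := norm_sphericalKernel_le (z := (lam : ℂ)) (by simp) x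
  have h3 := hdiv (lam : ℂ)
  rw [Complex.norm_real, Real.norm_of_nonneg hlam.le] at h3
  refine (norm_sub_le _ _).trans ?_
  rw [norm_mul, norm_mul]
  calc _ ≤ (lam + μ) * ‖x‖⁻¹ + lam * ‖x‖⁻¹ :=
        add_le_add (mul_le_mul ((hdiv _).trans hz) h1 (norm_nonneg _) (by positivity))
          (mul_le_mul h3 h2 (norm_nonneg _) hlam.le)
    _ = _ := by ring

theorem tendsto_kernelDifference (lam : ℝ) (x : E3) :
    Tendsto (fun μ => kernelDifference lam μ x) (𝓝[>] 0) (𝓝 0) := by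
  have h : Continuous fun μ : ℝ => kernelDifference lam μ x := by
    unfold kernelDifference sphericalKernel
    fun_prop
  have h1 := (h.tendsto 0).mono_left (nhdsWithin_le_nhds (s := Set.Ioi 0))
  simpa [kernelDifference] using h1

theorem kernelConv_kernelDifference {lam μ : ℝ} (hμ : 0 < μ) {g : E3 → ℂ}
    (hgi : Integrable g) {B : ℝ} (hB : ∀ x, ‖g x‖ ≤ B) (x : E3) :
    kernelConv (kernelDifference lam μ) g x =
      ((lam : ℂ) + (μ : ℂ) * Complex.I) / (2 * Real.pi) *
        kernelConv (sphericalKernel ((lam : ℂ) + (μ : ℂ) * Complex.I)) g x -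
      (lam : ℂ) / (2 * Real.pi) * kernelConv (sphericalKernel lam) g x := by
  set z : ℂ := (lam : ℂ) + (μ : ℂ) * Complex.I with hz
  have hzi : 0 < z.im := by simpa [hz] using hμ
  have i1 : Integrable fun y => z / (2 * Real.pi) * (sphericalKernel z (x - y) * g y) :=
    (((integrable_sphericalKernel hzi).comp_sub_left x).mul_bdd (c := B) hgi.1
      (.of_forall hB)).const_mul _
  have i2 : Integrable fun y => (lam : ℂ) / (2 * Real.pi) * (sphericalKernel lam (x - y) * g y) :=
    (integrable_sphericalKernel_sub_mul lam hgi hB x).const_mul _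
  rw [kernelConv, kernelConv, kernelConv, ← integral_const_mul, ← integral_const_mul,
    ← integral_sub i1 i2]
  refine integral_congr_ae (.of_forall fun y => ?_)
  simp only [kernelDifference, ← hz]
  ring

/-- The boundary value `R₀(λ + i0) g` as a function. -/
def outgoingWave (lam : ℝ) (g : E3 → ℂ) (G : L2R3) (x : E3) : ℂ :=
  (lam : ℂ) / (2 * Real.pi) * kernelConv (sphericalKernel lam) g x +
    symbolMultiplier (resolventSymbol (-lam)) G x

theorem memLp_weight_outgoingWave {s : ℝ} (hs : 1 / 2 < s) {lam : ℝ} {g : E3 → ℂ}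
    (hg : Measurable g) (hgi : Integrable g) (G : L2R3) :
    MemLp (fun x => japaneseWeight (-s) x * outgoingWave lam g G x) 2 := by
  have h1 := memLp_weight_kernelConv hs (measurable_sphericalKernel lam) (C := 1)
    (fun x => by
      rw [one_mul]
      exact norm_sphericalKernel_le (by simp) x) hg hgi
  have h2 := memLp_symbol_mul (measurable_japaneseWeight (-s))
    (norm_japaneseWeight_le_one (by linarith : 0 ≤ s)) (symbolMultiplier (resolventSymbol (-lam)) G)
  refine ((h1.const_mul ((lam : ℂ) / (2 * Real.pi))).add h2).ae_eq (.of_forall fun x => ?_)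
  simp only [Pi.add_apply, outgoingWave]
  ring

/-- `R₀(λ + iμ) g` converges to the outgoing wave in the weighted spaces of weight `⟨x⟩^{-s}`. -/
theorem exists_tendsto_weight_resolvent_sub {s : ℝ} (hs : 1 / 2 < s) {lam : ℝ} (hlam : 0 < lam)
    {g : E3 → ℂ} (hg : Measurable g) (hgi : Integrable g) {B : ℝ} (hB : ∀ x, ‖g x‖ ≤ B)
    (hg2 : MemLp g 2) {T : 𝓢'(E3, ℂ)} (hT : IsRepresentedBy T (outgoingWave lam g (hg2.toLp g))) :
    ∃ d : ℝ → L2R3, (∀ μ : ℝ, 0 < μ → TemperedDistribution.smulLeftCLM ℂ (japaneseWeight (-s))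
        (Lp.toTemperedDistribution (symbolMultiplier
          (resolventSymbol ((lam : ℂ) + (μ : ℂ) * Complex.I)) (hg2.toLp g)) - T) =
        Lp.toTemperedDistribution (d μ)) ∧
      Tendsto (fun μ => ‖d μ‖) (𝓝[>] 0) (𝓝 0) := by
  have hs0 : 0 ≤ s := by linarith
  set G : L2R3 := hg2.toLp g with hG
  set z : ℝ → ℂ := fun μ => (lam : ℂ) + (μ : ℂ) * Complex.I with hz
  have hzi : ∀ μ, 0 < μ → 0 < (z μ).im := fun μ hμ => by simpa [hz] using hμ
  have hzr : ∀ μ, (z μ).re = lam := fun μ => by simp [hz]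
  have hmem : ∀ μ : ℝ, 0 < μ →
      MemLp (fun x => japaneseWeight (-s) x * kernelConv (kernelDifference lam μ) g x) 2 :=
    fun μ hμ => memLp_weight_kernelConv hs (measurable_kernelDifference lam μ)
      (norm_kernelDifference_le hlam hμ) hg hgi
  classical
  set d₁ : ℝ → L2R3 := fun μ => if h : 0 < μ then (hmem μ h).toLp _ else 0 with hd₁
  set r : ℝ → L2R3 := fun μ => symbolMultiplier (resolventSymbol (-z μ)) G -
    symbolMultiplier (resolventSymbol (-lam)) G with hr
  have hd₁e : ∀ μ, 0 < μ → (d₁ μ : E3 → ℂ) =ᵐ[volume]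
      fun x => japaneseWeight (-s) x * kernelConv (kernelDifference lam μ) g x := fun μ hμ => by
    simp only [hd₁, dif_pos hμ]
    exact (hmem μ hμ).coeFn_toLp
  refine ⟨fun μ => d₁ μ + weightMul s hs0 (r μ), fun μ hμ => ?_, ?_⟩
  · have h1 := (isRepresentedBy_toTemperedDistribution
      (symbolMultiplier (resolventSymbol (z μ)) G)).sub hT
    have h2 : (fun x => symbolMultiplier (resolventSymbol (z μ)) G x - outgoingWave lam g G x)
        =ᵐ[volume] fun x => kernelConv (kernelDifference lam μ) g x + r μ x := by
      filter_upwards [symbolMultiplier_resolventSymbol_ae_eq (hzi μ hμ) (by rwa [hzr]) hgi hB hg2,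
        Lp.coeFn_sub (symbolMultiplier (resolventSymbol (-z μ)) G)
          (symbolMultiplier (resolventSymbol (-lam)) G)] with x h3 h4
      rw [h3, hr, h4, Pi.sub_apply, kernelConv_kernelDifference hμ hgi hB, outgoingWave]
      ring
    have h3 := h1.congr h2
    have h4 : (fun x => japaneseWeight (-s) x * (kernelConv (kernelDifference lam μ) g x + r μ x))
        =ᵐ[volume] (d₁ μ + weightMul s hs0 (r μ) : L2R3) := by
      filter_upwards [Lp.coeFn_add (d₁ μ) (weightMul s hs0 (r μ)), hd₁e μ hμ,
        coeFn_weightMul hs0 (r μ)] with x h5 h6 h7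
      rw [h5, Pi.add_apply, h6, h7, mul_add]
    have h5 := (Lp.memLp (d₁ μ + weightMul s hs0 (r μ))).ae_eq h4.symm
    rw [h3.smulLeftCLM_eq (japaneseWeight_hasTemperateGrowth (-s)) h5]
    congr 1
    exact Lp.ext (h5.coeFn_toLp.trans h4)
  · have t1 : Tendsto (fun μ => ‖d₁ μ‖) (𝓝[>] 0) (𝓝 0) := by
      refine tendsto_norm_Lp_of_tendsto_lintegral ?_
      have h1 := tendsto_lintegral_weight_kernelConv hs (measurable_kernelDifference lam)
        (C := 2 * lam + 1) ?_ (tendsto_kernelDifference lam) hg hgi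
      · refine h1.congr' ?_
        filter_upwards [self_mem_nhdsWithin] with μ hμ
        refine lintegral_congr_ae ?_
        filter_upwards [hd₁e μ hμ] with x hx
        rw [hx]
      · filter_upwards [Ioo_mem_nhdsGT (zero_lt_one (α := ℝ))] with μ hμ x
        refine (norm_kernelDifference_le hlam hμ.1 x).trans ?_
        exact mul_le_mul_of_nonneg_right (by linarith [hμ.2]) (by positivity)
    have t2 : Tendsto (fun μ => ‖r μ‖) (𝓝[>] 0) (𝓝 0) :=
      tendsto_symbolMultiplier (p := fun μ => resolventSymbol (-z μ)) (C := lam⁻¹)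
        (fun μ => measurable_resolventSymbol _) (measurable_resolventSymbol _)
        (fun μ _ ξ => by
          have := norm_resolventSymbol_neg_le (z := z μ) (by rwa [hzr]) ξ
          rwa [hzr] at this)
        (fun ξ => norm_resolventSymbol_neg_le (z := lam) (by simpa using hlam) ξ)
        (ae_tendsto_resolventSymbol_neg hlam) G
    have t3 := t1.add t2
    rw [add_zero] at t3
    refine squeeze_zero (fun μ => norm_nonneg _) (fun μ => ?_) t3
    exact (norm_add_le _ _).trans (by gcongr; exact norm_weightMul_le hs0 _)

theorem smulLeftCLM_japaneseWeight_cancel (s : ℝ) (T : 𝓢'(E3, ℂ)) :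
    TemperedDistribution.smulLeftCLM ℂ (japaneseWeight s)
      (TemperedDistribution.smulLeftCLM ℂ (japaneseWeight (-s)) T) = T := by
  rw [TemperedDistribution.smulLeftCLM_smulLeftCLM_apply (japaneseWeight_hasTemperateGrowth _)
    (japaneseWeight_hasTemperateGrowth _)]
  have e : japaneseWeight (-s) * japaneseWeight s = fun _ : E3 => (1 : ℂ) := by
    funext x
    rw [Pi.mul_apply, japaneseWeight_mul]
    simp [japaneseWeight]
  rw [e, TemperedDistribution.smulLeftCLM_const, one_smul]

theorem fourierMultiplierCLM_japaneseSymbol_cancel (k : ℝ) (T : 𝓢'(E3, ℂ)) :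
    TemperedDistribution.fourierMultiplierCLM ℂ (japaneseSymbol (-k))
      (TemperedDistribution.fourierMultiplierCLM ℂ (japaneseSymbol k) T) = T := by
  rw [TemperedDistribution.fourierMultiplierCLM_fourierMultiplierCLM_apply
    (japaneseSymbol_hasTemperateGrowth _) (japaneseSymbol_hasTemperateGrowth _)]
  have e : japaneseSymbol k * japaneseSymbol (-k) = fun _ : E3 => (1 : ℂ) := by
    funext x
    have h1 := japaneseWeight_mul k (-k) ((2 * Real.pi) • x)
    rw [Pi.mul_apply]
    refine h1.trans ?_
    simp [japaneseWeight]
  rw [e, TemperedDistribution.fourierMultiplierCLM_const]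
  simp

/-- Distributions converging in a weighted `L²` space converge on every test function. -/
theorem tendsto_apply_of_weight {T : ℝ → 𝓢'(E3, ℂ)} {T₀ : 𝓢'(E3, ℂ)} {s : ℝ} {d : ℝ → L2R3}
    (h : ∀ μ, 0 < μ → TemperedDistribution.smulLeftCLM ℂ (japaneseWeight (-s)) (T μ - T₀) =
      Lp.toTemperedDistribution (d μ)) (hd : Tendsto (fun μ => ‖d μ‖) (𝓝[>] 0) (𝓝 0)) (φ : 𝓢(E3, ℂ)) :
    Tendsto (fun μ => T μ φ) (𝓝[>] 0) (𝓝 (T₀ φ)) := by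
  set ψ := SchwartzMap.smulLeftCLM ℂ (japaneseWeight s) φ with hψ
  have h1 := tendsto_toTemperedDistribution_apply (f := d) (f₀ := 0) (by simpa using hd) ψ
  have h0 : (Lp.toTemperedDistribution (0 : L2R3) : 𝓢'(E3, ℂ)) ψ = 0 := by
    have := (Lp.toTemperedDistributionCLM ℂ (volume : Measure E3) 2).map_zero
    rw [Lp.toTemperedDistributionCLM_apply] at this
    rw [this]
    rfl
  rw [h0] at h1
  have h2 : Tendsto (fun μ => T μ φ - T₀ φ) (𝓝[>] 0) (𝓝 0) := by
    refine h1.congr' ?_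
    filter_upwards [self_mem_nhdsWithin] with μ hμ
    have h3 := congrArg (fun S : 𝓢'(E3, ℂ) =>
      TemperedDistribution.smulLeftCLM ℂ (japaneseWeight s) S φ) (h μ hμ)
    simp only [smulLeftCLM_japaneseWeight_cancel] at h3
    rw [TemperedDistribution.smulLeftCLM_apply_apply] at h3
    exact h3.symm
  simpa using h2.add_const (T₀ φ)

theorem toTemperedDistribution_add (f g : L2R3) :
    (Lp.toTemperedDistribution (f + g) : 𝓢'(E3, ℂ)) =
      Lp.toTemperedDistribution f + Lp.toTemperedDistribution g :=
  (Lp.toTemperedDistributionCLM ℂ (volume : Measure E3) 2).map_add f g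

theorem toTemperedDistribution_smul (c : ℂ) (f : L2R3) :
    (Lp.toTemperedDistribution (c • f) : 𝓢'(E3, ℂ)) = c • Lp.toTemperedDistribution f :=
  (Lp.toTemperedDistributionCLM ℂ (volume : Measure E3) 2).map_smul c f

theorem toTemperedDistribution_sub (f g : L2R3) :
    (Lp.toTemperedDistribution (f - g) : 𝓢'(E3, ℂ)) =
      Lp.toTemperedDistribution f - Lp.toTemperedDistribution g :=
  (Lp.toTemperedDistributionCLM ℂ (volume : Measure E3) 2).map_sub f g

/-- The limiting absorption principle: the outgoing wave is the outgoing resolvent applied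
to the density. -/
theorem isOutgoingResolvent_outgoingWave {lam : ℝ} (hlam : 0 < lam) {g : E3 → ℂ} (hg : Measurable g)
    (hgi : Integrable g) {B : ℝ} (hB : ∀ x, ‖g x‖ ≤ B) (hg2 : MemLp g 2) {T : 𝓢'(E3, ℂ)}
    (hT : IsRepresentedBy T (outgoingWave lam g (hg2.toLp g))) : IsOutgoingResolvent lam g T := by
  set G : L2R3 := hg2.toLp g with hG
  set z : ℝ → ℂ := fun μ => (lam : ℂ) + (μ : ℂ) * Complex.I with hz
  have hzi : ∀ μ, 0 < μ → 0 < (z μ).im := fun μ hμ => by simpa [hz] using hμ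
  have hzr : ∀ μ, (z μ).re = lam := fun μ => by simp [hz]
  set c : ℂ := (((1 + lam ^ 2) ^ (1 / 2 : ℝ) : ℝ) : ℂ) with hc
  set u : ℝ → L2R3 := fun μ => symbolMultiplier (resolventSymbol (z μ)) G with hu
  set P : ℝ → L2R3 := fun μ => symbolMultiplier (regularizedSymbol lam (z μ)) G with hP
  set P₀ : L2R3 := symbolMultiplier (regularizedSymbol lam lam) G with hP₀
  set D := TemperedDistribution.fourierMultiplierCLM (E := E3) ℂ (japaneseSymbol 1) with hD
  have tP : Tendsto (fun μ => ‖P μ - P₀‖) (𝓝[>] 0) (𝓝 0) :=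
    tendsto_symbolMultiplier (p := fun μ => regularizedSymbol lam (z μ)) (C := 1)
      (fun μ => measurable_regularizedSymbol _ _) (measurable_regularizedSymbol _ _)
      (fun μ _ ξ => norm_regularizedSymbol_le (hzr μ) ξ)
      (fun ξ => norm_regularizedSymbol_le (Complex.ofReal_re lam) ξ) ae_tendsto_regularizedSymbol G
  have hDu : ∀ μ, 0 < μ → D (Lp.toTemperedDistribution (u μ)) =
      c • Lp.toTemperedDistribution (u μ) + Lp.toTemperedDistribution (P μ) := fun μ hμ =>
    fourierMultiplierCLM_resolvent (hzi μ hμ) (hzr μ) G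
  -- the operator identity passes to the limit in the sense of distributions
  have hDT : D T = c • T + Lp.toTemperedDistribution P₀ := by
    obtain ⟨d, hd, td⟩ := exists_tendsto_weight_resolvent_sub (s := 1) (by norm_num) hlam hg hgi hB
      hg2 hT
    have hw := fun φ => tendsto_apply_of_weight hd td φ
    ext φ
    have l1 : Tendsto (fun μ => D (Lp.toTemperedDistribution (u μ)) φ) (𝓝[>] 0) (𝓝 (D T φ)) := by
      simp only [hD, TemperedDistribution.fourierMultiplierCLM_apply_apply]
      exact hw _
    have l2 := ((hw φ).const_mul c).add (tendsto_toTemperedDistribution_apply tP φ)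
    refine tendsto_nhds_unique l1 (l2.congr' ?_)
    filter_upwards [self_mem_nhdsWithin] with μ hμ
    rw [hDu μ hμ]
    rfl
  refine ⟨G, hg2.coeFn_toLp, u, fun μ hμ => isFreeResolvent_symbolMultiplier (hzi μ hμ) G,
    fun s hs => ?_⟩
  have hs0 : 0 ≤ s := by linarith
  obtain ⟨d, hd, td⟩ := exists_tendsto_weight_resolvent_sub hs hlam hg hgi hB hg2 hT
  refine ⟨fun μ => c • d μ + weightMul s hs0 (P μ - P₀), fun μ hμ => ?_, ?_⟩
  · have h1 : D (Lp.toTemperedDistribution (u μ) - T) =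
        c • (Lp.toTemperedDistribution (u μ) - T) + Lp.toTemperedDistribution (P μ - P₀) := by
      rw [map_sub, hDu μ hμ, hDT, toTemperedDistribution_sub, smul_sub]
      abel
    rw [IsWeightedSobolevRep, h1, map_add, map_smul, hd μ hμ, smulLeftCLM_weightMul hs0,
      toTemperedDistribution_add, toTemperedDistribution_smul]
  · have t3 := (td.const_mul ‖c‖).add tP
    rw [mul_zero, add_zero] at t3
    refine squeeze_zero (fun μ => norm_nonneg _) (fun μ => ?_) t3
    refine (norm_add_le _ _).trans ?_
    rw [norm_smul]
    exact add_le_add le_rfl (norm_weightMul_le hs0 _)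

/-- The outgoing resolvent is well defined. -/
theorem IsOutgoingResolvent.unique {lam : ℝ} {g : E3 → ℂ} {T T' : 𝓢'(E3, ℂ)}
    (h : IsOutgoingResolvent lam g T) (h' : IsOutgoingResolvent lam g T') : T = T' := by
  obtain ⟨G, hG, u, hu, hlim⟩ := h
  obtain ⟨G', hG', u', hu', hlim'⟩ := h'
  obtain rfl : G = G' := Lp.ext (hG.trans hG'.symm)
  have huu : ∀ μ, 0 < μ → u μ = u' μ := fun μ hμ => by
    have hz : 0 < ((lam : ℂ) + (μ : ℂ) * Complex.I).im := by simpa using hμ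
    rw [eq_symbolMultiplier_of_isFreeResolvent hz (hu μ hμ),
      eq_symbolMultiplier_of_isFreeResolvent hz (hu' μ hμ)]
  obtain ⟨d, hd, td⟩ := hlim 1 (by norm_num)
  obtain ⟨d', hd', td'⟩ := hlim' 1 (by norm_num)
  set D := TemperedDistribution.fourierMultiplierCLM (E := E3) ℂ (japaneseSymbol 1) with hD
  -- Both are limits of the same family, as is seen by testing against Schwartz functions; `⟨D⟩`
  -- is then inverted.
  have key : D T = D T' := by
    ext φ
    have l1 := tendsto_apply_of_weight (T := fun μ => D (Lp.toTemperedDistribution (u μ))) (T₀ := D T)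
      (fun μ hμ => by rw [← map_sub]; exact hd μ hμ) td φ
    have l2 := tendsto_apply_of_weight (T := fun μ => D (Lp.toTemperedDistribution (u' μ)))
      (T₀ := D T') (fun μ hμ => by rw [← map_sub]; exact hd' μ hμ) td' φ
    refine tendsto_nhds_unique l1 (l2.congr' ?_)
    filter_upwards [self_mem_nhdsWithin] with μ hμ
    rw [huu μ hμ]
  rw [← fourierMultiplierCLM_japaneseSymbol_cancel 1 T, ← hD, key, hD,
    fourierMultiplierCLM_japaneseSymbol_cancel]

/-- The leading amplitude is the far field amplitude of the wave generated by `V` and a plane wave. -/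
theorem farField_planeWave (V : E3 → ℝ) (lam : ℝ) (w x : E3) :
    (lam : ℂ) / (2 * Real.pi) * farField lam (fun y => (V y : ℂ) * planeWave lam w y) x =
      ((‖x‖⁻¹ : ℝ) : ℂ) * Complex.exp (Complex.I * ((lam * ‖x‖ : ℝ) : ℂ)) *
        leadingAmplitude V lam (‖x‖⁻¹ • x) w := by
  have h : 𝓕 (fun y => (V y : ℂ) * planeWave lam w y) ((lam / (2 * Real.pi)) • (‖x‖⁻¹ • x)) =
      potentialFourier V (lam • (‖x‖⁻¹ • x - w)) := by
    rw [Real.fourier_eq', potentialFourier]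
    refine integral_congr_ae (.of_forall fun y => ?_)
    simp only [planeWave, smul_eq_mul]
    rw [mul_comm (V y : ℂ), ← mul_assoc, ← Complex.exp_add]
    congr 2
    simp only [inner_smul_right, inner_sub_right]
    have hpi : (Real.pi : ℂ) ≠ 0 := by exact_mod_cast Real.pi_ne_zero
    push_cast
    field_simp
    ring
  rw [farField, h, leadingAmplitude, sphericalKernel]
  push_cast
  rw [mul_assoc Complex.I]
  ring

/-- Existence, uniqueness and asymptotics of the outgoing wave generated by a plane wave. -/
theorem exists_outgoingResolvent_asymptotics {m : ℝ} (hm : 3 < m) {V v : E3 → ℝ}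
    (hV : ContDiff ℝ ∞ V) (hhom : ∀ x : E3, 1 < ‖x‖ → V x = ‖x‖ ^ (-m) * v (‖x‖⁻¹ • x)) {lam : ℝ}
    (hlam : 0 < lam) (w : S2) :
    ∃ w₀ : 𝓢'(E3, ℂ),
      IsOutgoingResolvent lam (fun x => (V x : ℂ) * planeWave lam w x) w₀ ∧
      (∀ w₀' : 𝓢'(E3, ℂ),
        IsOutgoingResolvent lam (fun x => (V x : ℂ) * planeWave lam w x) w₀' → w₀' = w₀) ∧
      ∃ h : E3 → ℂ, MemLp h 2 volume ∧
        IsRepresentedBy w₀ (fun x =>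
          ((‖x‖⁻¹ : ℝ) : ℂ) * Complex.exp (Complex.I * ((lam * ‖x‖ : ℝ) : ℂ)) *
            leadingAmplitude V lam (‖x‖⁻¹ • x) w + h x) := by
  set g : E3 → ℂ := fun x => (V x : ℂ) * planeWave lam w x with hgdef
  obtain ⟨C, hC0, hC⟩ := exists_potential_bound (by linarith) hV.continuous hhom
  have hgc : Continuous g :=
    (Complex.continuous_ofReal.comp hV.continuous).mul (contDiff_planeWave lam w).continuous
  have hgn : ∀ x, ‖g x‖ = ‖V x‖ := fun x => by
    rw [hgdef]
    simp only
    rw [norm_mul, norm_planeWave, mul_one, Complex.norm_real]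
  have hgi : Integrable g := (integrable_potential hm hV.continuous hhom).norm.mono'
    hgc.aestronglyMeasurable (.of_forall fun x => (hgn x).le)
  have hgB : ∀ x, ‖g x‖ ≤ C := fun x => by
    rw [hgn]
    refine (hC x).trans (mul_le_of_le_one_right hC0 ?_)
    exact Real.rpow_le_one_of_one_le_of_nonpos (by linarith [norm_nonneg x]) (by linarith)
  have hg2 := memLp_two_of_integrable_of_bound hgi hgB
  set G : L2R3 := hg2.toLp g with hG
  obtain ⟨T, hT⟩ := exists_isRepresentedBy_of_weight
    (memLp_weight_outgoingWave (s := 1) (by norm_num) (lam := lam) hgc.measurable hgi G)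
  have hres := isOutgoingResolvent_outgoingWave hlam hgc.measurable hgi hgB hg2 hT
  refine ⟨T, hres, fun T' hT' => hT'.unique hres,
    fun x => (lam : ℂ) / (2 * Real.pi) * waveRemainder lam g x +
      symbolMultiplier (resolventSymbol (-lam)) G x,
    ((memLp_waveRemainder hm hV hhom hlam w).const_mul _).add (Lp.memLp _),
    hT.congr (.of_forall fun x => ?_)⟩
  simp only
  rw [← farField_planeWave, outgoingWave, waveRemainder]
  ring

/-! ### Properties of the leading amplitude -/

theorem lemma3p1 (m : ℝ) (hm : 3 < m) (V₀ v₀ : E3 → ℝ) (hV₀ : ContDiff ℝ ∞ V₀)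
    (hhom : ∀ x : E3, 1 < ‖x‖ → V₀ x = ‖x‖ ^ (-m) * v₀ (‖x‖⁻¹ • x)) :
    -- the asymptotics of `w₀ = R₀⁺(λ)(V₀ Φ₀)`
    (∀ lam : ℝ, 0 < lam → ∀ w : S2,
      ∃ w₀ : 𝓢'(E3, ℂ),
        IsOutgoingResolvent lam (fun x => (V₀ x : ℂ) * planeWave lam w x) w₀ ∧
        (∀ w₀' : 𝓢'(E3, ℂ),
          IsOutgoingResolvent lam (fun x => (V₀ x : ℂ) * planeWave lam w x) w₀' → w₀' = w₀) ∧
        ∃ h : E3 → ℂ, MemLp h 2 volume ∧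
          IsRepresentedBy w₀ (fun x =>
            ((‖x‖⁻¹ : ℝ) : ℂ) * Complex.exp (Complex.I * ((lam * ‖x‖ : ℝ) : ℂ)) *
              leadingAmplitude V₀ lam (‖x‖⁻¹ • x) w + h x)) ∧
    -- smoothness of `f₀` away from `θ = w`
    ContMDiffOn (𝓘(ℝ, ℝ).prod ((𝓡 2).prod (𝓡 2))) 𝓘(ℝ, ℂ) ∞
      (fun p : ℝ × S2 × S2 => leadingAmplitude V₀ p.1 p.2.1 p.2.2)
      {p : ℝ × S2 × S2 | 0 < p.1 ∧ p.2.1 ≠ p.2.2} ∧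
    -- Sobolev regularity of `f₀` in `w`
    (∀ lam : ℝ, 0 < lam → ∀ θ : S2, ∀ κ : ℝ, κ < m - 2 →
      MemSobolevSphere κ (fun w : S2 => leadingAmplitude V₀ lam θ w)) ∧
    (∀ lam : ℝ, 0 < lam → ∀ θ : S2,
      (∃ x : E3, inner ℝ x (θ : E3) = 0 ∧ 1 < ‖x‖ ∧ xrayTransform V₀ x θ ≠ 0) →
      ¬ MemSobolevSphere (m - 2) (fun w : S2 => leadingAmplitude V₀ lam θ w)) := by
  refine ⟨?_, contMDiffOn_leadingAmplitude fun η hη =>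
      contDiffAt_fourier_potential hm hV₀ hhom hη,
    fun lam hlam θ κ hκ => memSobolevSphere_leadingAmplitude hm hV₀ hhom hlam θ hκ, ?_⟩
  · exact fun lam hlam w => exists_outgoingResolvent_asymptotics hm hV₀ hhom hlam w
  · exact fun lam hlam θ hx => not_memSobolevSphere_leadingAmplitude hm hV₀ hhom hlam θ hx

end
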